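/- **Setting.** Let $0<s<1$ and $\beta(\theta)=|\cos\frac\theta2|\,|\sin\frac\theta2|^{-1-2s}$ for $|\theta|\le\frac\pi4$. The Kac collision operator is $$K(F,G)(v)=\int_{|\theta|\le\pi/4}\beta(\theta)\int_{\mathbb R}\big(F(v_*')G(v')-F(v_*)G(v)\big)\,dv_*\,d\theta,\quad v'=v\cos\theta-v_*\sin\theta,\ \ v_*'=v\sin\theta+v_*\cos\theta,$$ where the $\theta$-integral is a finite part, i.e. the integrand is replaced by its even part in $\theta$; on non-smooth $F,G$ the operator is defined by duality against test functions $\psi\in C_c^\infty(\mathbb R)$: $$\langle K(F,G),\psi\rangle=\int_{|\theta|\le\pi/4}\beta(\theta)\iint F(v_*)G(v)\Big[\tfrac12\psi(v\cos\theta+v_*\sin\theta)+\tfrac12\psi(v\cos\theta-v_*\sin\theta)-\psi(v)\Big]dv_*\,dv\,d\theta .$$ Let $\mu(v)=(2\pi)^{-1/2}e^{-v^2/2}$, $\Gamma(f,g)=\mu^{-1/2}K(\mu^{1/2}f,\mu^{1/2}g)$ and $\mathcal Kg=-\mu^{-1/2}K(\mu,\mu^{1/2}g)-\mu^{-1/2}K(\mu^{1/2}g,\mu)$.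 Let $\mathcal H=-\partial_v^2+\frac{v^2}4$; its eigenfunctions are the Hermite functions $e_n$, with eigenvalues $n+\frac12$, and $\mathcal H^{r}=\sum_{n\ge0}(n+\frac12)^{r}(\cdot,e_n)e_n$. Fix smooth $\varphi,\chi:\mathbb R\to[0,1]$ with $\varphi$ supported in $\{\frac34\le|\xi|\le\frac83\}$, $\chi$ supported in $\{|\xi|\le\frac43\}$ and $\chi(\xi)+\sum_{q\ge0}\varphi(2^{-q}\xi)=1$ for all $\xi$. Put $\Delta_{-1}=\chi(D_x)$ and $\Delta_q=\varphi(2^{-q}D_x)$ for $q\ge0$. For $T>0$ and $\varrho\in\{2,\infty\}$ let $$\|u\|_{\widetilde L^2_v(B^{1/2}_{2,1})}=\sum_{q\ge-1}2^{q/2}\|\Delta_qu\|_{L^2_vL^2_x},\qquad \|u\|_{\widetilde L^{\varrho}_T\widetilde L^2_v(B^{1/2}_{2,1})}=\sum_{q\ge-1}2^{q/2}\|\Delta_qu\|_{L^{\varrho}([0,T];L^2_vL^2_x)},$$ and let $\widetilde L^2_v(B^{1/2}_{2,1})$ and $\widetilde L^{\varrho}_T\widetilde L^2_v(B^{1/2}_{2,1})$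 be the spaces of complex-valued $u(x,v)$, respectively $u(t,x,v)$ with $0\le t\le T$, for which these norms are finite. **Theorem.** There exist constants $\varepsilon_0>0$ and $c_0>1$, depending only on $s$ and $(\varphi,\chi)$, such that for all $T>0$, all $g_0\in\widetilde L^2_v(B^{1/2}_{2,1})$ and all $f\in\widetilde L^\infty_T\widetilde L^2_v(B^{1/2}_{2,1})$ with $\|f\|_{\widetilde L^\infty_T\widetilde L^2_v(B^{1/2}_{2,1})}\le\varepsilon_0$, the Cauchy problem $$\partial_tg+v\,\partial_xg+\mathcal Kg=\Gamma(f,g),\qquad g|_{t=0}=g_0,$$ admits a weak solution $g\in L^\infty([0,T];L^2(\mathbb R^2_{x,v}))$, that is, $$-\int_0^T\!\!\iint g\,(\partial_th+v\partial_xh)\,dv\,dx\,dt-\iint g_0\,h|_{t=0}\,dv\,dx+\int_0^T\!\!\int\langle\mathcal Kg,h\rangle_v\,dx\,dt=\int_0^T\!\!\int\langle\Gamma(f,g),h\rangle_v\,dx\,dt$$ for every $h\in C_c^\infty(\mathbb R^3)$ supported in $\{t<T\}$, where $\langle\cdot,\cdot\rangle_v$ is the duality in $v$ given above. Moreover $g\in\widetilde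 L^\infty_T\widetilde L^2_v(B^{1/2}_{2,1})$, $\mathcal H^{s/2}g\in\widetilde L^2_T\widetilde L^2_v(B^{1/2}_{2,1})$, and $$\|g\|_{\widetilde L^\infty_T\widetilde L^2_v(B^{1/2}_{2,1})}+\|\mathcal H^{s/2}g\|_{\widetilde L^2_T\widetilde L^2_v(B^{1/2}_{2,1})}\le c_0e^T\|g_0\|_{\widetilde L^2_v(B^{1/2}_{2,1})}.$$ -/

import Mathlib

open MeasureTheory Set
open scoped ENNReal ContDiff

noncomputable section

namespace Kac

/-! ### Littlewood-Paley blocks in the position variable -/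

/-- A Littlewood-Paley couple `(φ, χ)` on the line: smooth `[0, 1]`-valued functions, `χ` supported
in the ball of radius `4/3`, `φ` supported in the shell `3/4 ≤ |ξ| ≤ 8/3`, and
`χ(ξ) + ∑_{q ≥ 0} φ(2^{-q} ξ) = 1` for every `ξ` (for each `ξ` only finitely many terms of the sum
are nonzero). -/
structure LPCouple where
  φ : ℝ → ℝ
  χ : ℝ → ℝ
  smooth_φ : ContDiff ℝ ∞ φ
  smooth_χ : ContDiff ℝ ∞ χ
  φ_mem : ∀ ξ, φ ξ ∈ Icc (0 : ℝ) 1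
  χ_mem : ∀ ξ, χ ξ ∈ Icc (0 : ℝ) 1
  supp_φ : ∀ ξ, φ ξ ≠ 0 → 3 / 4 ≤ |ξ| ∧ |ξ| ≤ 8 / 3
  supp_χ : ∀ ξ, χ ξ ≠ 0 → |ξ| ≤ 4 / 3
  unit : ∀ ξ, χ ξ + ∑' q : ℕ, φ (ξ / 2 ^ q) = 1

/-- The symbol of the dyadic block `Δ_q` with `q = n - 1 ≥ -1`:
`χ` for `q = -1` and `φ(2^{-q} ·)` for `q ≥ 0`. -/
def LPCouple.symbol (P : LPCouple) : ℕ → ℝ → ℝ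
  | 0 => P.χ
  | n + 1 => fun ξ => P.φ (ξ / 2 ^ n)

/-- The convolution kernel of `Δ_{n-1}`, i.e. the inverse Fourier transform
`(2π)⁻¹ ∫ e^{i x ξ} m(ξ) dξ` of its symbol `m`. It is a Schwartz function. -/
def LPCouple.kernel (P : LPCouple) (n : ℕ) (x : ℝ) : ℂ :=
  (2 * Real.pi : ℂ)⁻¹ * ∫ ξ : ℝ, Complex.exp (Complex.I * x * ξ) * (P.symbol n ξ : ℂ)

/-- The dyadic block `Δ_{n-1} u = m(D) u = m^∨ ⋆ u` of a function `u ∈ L^p(ℝ)`. -/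
def LPCouple.block (P : LPCouple) (n : ℕ) (u : ℝ → ℂ) (x : ℝ) : ℂ :=
  ∫ y : ℝ, P.kernel n (x - y) * u y

/-! ### Mixed Lebesgue spaces and Chemin-Lerner spaces

Functions of time, position and velocity are functions of `(t, x, v) : ℝ × ℝ × ℝ`, considered for
`0 ≤ t ≤ T`; initial data are functions of `(x, v) : ℝ × ℝ`. All norms take values in `[0, ∞]`. -/

/-- Lebesgue measure on `[0, T] × ℝ_x × ℝ_v`. -/
def slab (T : ℝ) : Measure (ℝ × ℝ × ℝ) :=
  volume.restrict (Icc 0 T ×ˢ univ)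

/-- The norm of `L^{p₂}_v L^{p₃}_x`. -/
def normVX (p₂ p₃ : ℝ≥0∞) (u : ℝ × ℝ → ℂ) : ℝ≥0∞ :=
  eLpNorm (fun v : ℝ => eLpNorm (fun x : ℝ => u (x, v)) p₃ volume) p₂ volume

/-- The norm of `L^{p₁}_T L^{p₂}_v L^{p₃}_x`. -/
def normTVX (T : ℝ) (p₁ p₂ p₃ : ℝ≥0∞) (u : ℝ × ℝ × ℝ → ℂ) : ℝ≥0∞ :=
  eLpNorm (fun t : ℝ => normVX p₂ p₃ (fun z => u (t, z))) p₁ (volume.restrict (Icc 0 T))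

/-- `u ∈ L^{p₂}_v L^{p₃}_x`. -/
def MemVX (p₂ p₃ : ℝ≥0∞) (u : ℝ × ℝ → ℂ) : Prop :=
  AEStronglyMeasurable u volume ∧ normVX p₂ p₃ u < ⊤

/-- `u ∈ L^{p₁}_T L^{p₂}_v L^{p₃}_x`. For `p₂ = p₃ = 2` this is `L^{p₁}([0, T]; L²(ℝ²_{x,v}))`. -/
def MemTVX (T : ℝ) (p₁ p₂ p₃ : ℝ≥0∞) (u : ℝ × ℝ × ℝ → ℂ) : Prop :=
  AEStronglyMeasurable u (slab T) ∧ normTVX T p₁ p₂ p₃ u < ⊤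

/-- The norm `∑_{q ≥ -1} 2^{qσ} ‖Δ_q u‖_{L^ϱ_v L^p_x}` of `L̃^ϱ_v(B^σ_{p,1})`;
`Δ_q` acts on the variable `x`. -/
def besovNormV (P : LPCouple) (ϱ : ℝ≥0∞) (σ : ℝ) (p : ℝ≥0∞) (u : ℝ × ℝ → ℂ) : ℝ≥0∞ :=
  ∑' n : ℕ, (2 : ℝ≥0∞) ^ (((n : ℝ) - 1) * σ) *
    normVX ϱ p (fun z => P.block n (fun y => u (y, z.2)) z.1)

/-- The norm `∑_{q ≥ -1} 2^{qσ} ‖Δ_q u‖_{L^{ϱ₁}_T L^{ϱ₂}_v L^p_x}` of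
`L̃^{ϱ₁}_T L̃^{ϱ₂}_v(B^σ_{p,1})`; `Δ_q` acts on the variable `x`. -/
def besovNormTV (P : LPCouple) (T : ℝ) (ϱ₁ ϱ₂ : ℝ≥0∞) (σ : ℝ) (p : ℝ≥0∞)
    (u : ℝ × ℝ × ℝ → ℂ) : ℝ≥0∞ :=
  ∑' n : ℕ, (2 : ℝ≥0∞) ^ (((n : ℝ) - 1) * σ) *
    normTVX T ϱ₁ ϱ₂ p (fun z => P.block n (fun y => u (z.1, y, z.2.2)) z.2.1)

/-- `u ∈ L̃²_v(B^{1/2}_{2,1})`. Since `‖u‖_{L²_v L²_x} ≤ ∑_q ‖Δ_q u‖_{L²_v L²_x}`, every tempered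
distribution of finite norm is a function in `L²_v L²_x`, so nothing is lost by asking for such a
function from the start. -/
def MemBesovV (P : LPCouple) (u : ℝ × ℝ → ℂ) : Prop :=
  MemVX 2 2 u ∧ besovNormV P 2 (1 / 2) 2 u < ⊤

/-- `u ∈ L̃^ϱ_T L̃²_v(B^{1/2}_{2,1})`. As above, every tempered distribution of finite norm is a
function in `L^ϱ_T L²_v L²_x`. -/
def MemBesovTV (P : LPCouple) (T : ℝ) (ϱ : ℝ≥0∞) (u : ℝ × ℝ × ℝ → ℂ) : Prop :=
  MemTVX T ϱ 2 2 u ∧ besovNormTV P T ϱ 2 (1 / 2) 2 u < ⊤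

/-! ### Hermite functions and powers of the harmonic oscillator -/

/-- The normalized Maxwellian `μ(v) = (2π)^{-1/2} e^{-v²/2}`. -/
def maxwellian (v : ℝ) : ℝ :=
  (Real.sqrt (2 * Real.pi))⁻¹ * Real.exp (-v ^ 2 / 2)

/-- The Hermite function `e_n = (n!)^{-1/2} (v/2 - d/dv)^n μ^{1/2} = (n!)^{-1/2} He_n μ^{1/2}`,
where `He_n` is the probabilists' Hermite polynomial. These functions are an orthonormal basis of
`L²(ℝ)`, and `(-d²/dv² + v²/4) e_n = (n + 1/2) e_n`. -/
def hermiteFun (n : ℕ) (v : ℝ) : ℝ :=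
  (Real.sqrt (n.factorial : ℝ))⁻¹ * Polynomial.aeval v (Polynomial.hermite n) *
    Real.sqrt (maxwellian v)

/-- `h = ℋ^r g` on `[0, T] × ℝ_x × ℝ_v`, where `ℋ = -∂_v² + v²/4` and
`ℋ^r = ∑_n (n + 1/2)^r ℙ_n`: for almost every `(t, x)`, every Hermite coefficient of
`h(t, x, ·)` is `(n + 1/2)^r` times that of `g(t, x, ·)`. For square integrable `g` and `h` this
determines `h` almost everywhere, by completeness of the Hermite functions. -/
def IsOscillatorPower (T r : ℝ) (g h : ℝ × ℝ × ℝ → ℂ) : Prop :=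
  ∀ᵐ z : ℝ × ℝ ∂(volume.restrict (Icc 0 T ×ˢ univ)), ∀ n : ℕ,
    ∫ v : ℝ, h (z.1, z.2, v) * (hermiteFun n v : ℂ) =
      (((n : ℝ) + 1 / 2) ^ r : ℝ) * ∫ v : ℝ, g (z.1, z.2, v) * (hermiteFun n v : ℂ)

/-! ### The Kac collision operator -/

/-- The cross section `β(θ) = |cos(θ/2)| / |sin(θ/2)|^{1+2s}`, used for `|θ| ≤ π/4`. -/
def crossSection (s θ : ℝ) : ℝ :=
  |Real.cos (θ / 2)| / |Real.sin (θ / 2)| ^ (1 + 2 * s)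

/-- The action `∫ K(F, G)(v) ψ(v) dv` of the Kac collision operator
`K(F, G)(v) = ∫_{|θ| ≤ π/4} β(θ) ∫ (F(v_*') G(v') - F(v_*) G(v)) dv_* dθ`
on a test function `ψ ∈ C_c^∞(ℝ)`. The rotation `(v, v_*) ↦ (v', v_*')` preserves the measure
`dv dv_*`, which moves it to `ψ` with `θ` replaced by `-θ`:
`∫ β(θ) ∫∫ F(v_*) G(v) (ψ(v cos θ + v_* sin θ) - ψ(v)) dv_* dv dθ`.
The integral over `θ` is a finite part, that is, the integrand is replaced by its even part in `θ`,
which is `O(θ²)` at the origin; the resulting integral converges absolutely as soon as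
`(1 + v_*²) F(v_*)` and `(1 + |v|) G(v)` are integrable. -/
def kacPairing (s : ℝ) (F G ψ : ℝ → ℂ) : ℂ :=
  ∫ θ in Icc (-(Real.pi / 4)) (Real.pi / 4), (crossSection s θ : ℂ) *
    ∫ v : ℝ, ∫ w : ℝ, F w * G v *
      ((ψ (v * Real.cos θ + w * Real.sin θ) + ψ (v * Real.cos θ - w * Real.sin θ)) / 2 - ψ v)

/-- Multiplication by `μ^{1/2}`. -/
def mulSqrtMu (f : ℝ → ℂ) (v : ℝ) : ℂ := (Real.sqrt (maxwellian v) : ℂ) * f v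

/-- Multiplication by `μ^{-1/2}`. -/
def divSqrtMu (f : ℝ → ℂ) (v : ℝ) : ℂ := (Real.sqrt (maxwellian v) : ℂ)⁻¹ * f v

/-- The action of `Γ(f, g) = μ^{-1/2} K(μ^{1/2} f, μ^{1/2} g)` on a test function `ψ ∈ C_c^∞(ℝ)`.
It converges absolutely for all `f, g ∈ L²(ℝ)`. -/
def gammaPairing (s : ℝ) (f g ψ : ℝ → ℂ) : ℂ :=
  kacPairing s (mulSqrtMu f) (mulSqrtMu g) (divSqrtMu ψ)

/-- The action on a test function `ψ ∈ C_c^∞(ℝ)` of the linearized operator `𝒦 g = 𝒦₁ g + 𝒦₂ g`,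
`𝒦₁ g = -μ^{-1/2} K(μ, μ^{1/2} g)`, `𝒦₂ g = -μ^{-1/2} K(μ^{1/2} g, μ)`. -/
def linKacPairing (s : ℝ) (g ψ : ℝ → ℂ) : ℂ :=
  -kacPairing s (fun v => (maxwellian v : ℂ)) (mulSqrtMu g) (divSqrtMu ψ)
    - kacPairing s (mulSqrtMu g) (fun v => (maxwellian v : ℂ)) (divSqrtMu ψ)

/-! ### Weak solutions -/

/-- Test functions: `C^∞` on `ℝ³`, with compact support contained in `{t < T}`. -/
def IsTest (T : ℝ) (h : ℝ × ℝ × ℝ → ℂ) : Prop :=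
  ContDiff ℝ ∞ h ∧ HasCompactSupport h ∧ tsupport h ⊆ {z | z.1 < T}

/-- `g` is a weak solution on `[0, T]` of `∂_t g + v ∂_x g + 𝒦 g = Γ(f, g)`, `g|_{t=0} = g₀`:
the equation, integrated over `[0, T] × ℝ²` against any test function `h` vanishing near `t = T`,
holds after moving `∂_t` and `v ∂_x` to `h`, with the term at `t = 0` given by `g₀`. -/
def IsWeakSolution (s T : ℝ) (f : ℝ × ℝ × ℝ → ℂ) (g₀ : ℝ × ℝ → ℂ) (g : ℝ × ℝ × ℝ → ℂ) : Prop :=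
  ∀ h : ℝ × ℝ × ℝ → ℂ, IsTest T h →
    -(∫ t in Icc 0 T, ∫ x : ℝ, ∫ v : ℝ, g (t, x, v) *
          (deriv (fun τ : ℝ => h (τ, x, v)) t + (v : ℂ) * deriv (fun y : ℝ => h (t, y, v)) x))
      - (∫ x : ℝ, ∫ v : ℝ, g₀ (x, v) * h (0, x, v))
      + (∫ t in Icc 0 T, ∫ x : ℝ,
          linKacPairing s (fun v => g (t, x, v)) (fun v => h (t, x, v)))
    = ∫ t in Icc 0 T, ∫ x : ℝ,
        gammaPairing s (fun v => f (t, x, v)) (fun v => g (t, x, v)) (fun v => h (t, x, v))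

end Kac

end

/-! The unknown enters the equation linearly, so existence comes from duality: an a priori estimate
for the adjoint problem, followed by Hahn-Banach. No approximating equation has to be solved.

Velocity. In the Hermite basis everything is explicit. Rotation invariance of the Gaussian gives
`gaussExp_He_comp_mul_He_comp`, hence Γ(e_k, e_l) = α_{k,l} e_{k+l}, and the linearized operator is
diagonal with eigenvalues λ_n (`hasSum_gammaPairing`, `hasSum_linKacPairing`). For k ≥ 1 the angular
factor in α_{k,l} is at most the square root of a binomial probability with parameter sin²θ. Moments
of the binomial law together with ∫ β min(1, aθ²) ≲ a^s bound the sums of α² over k + l = n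
(`sum_alpha_two`, `sum_alpha_one`), and Cauchy-Schwarz gives |⟨Γ(f,g),h⟩| ≲ ‖f‖ ‖ℋ^{s/2}g‖
‖ℋ^{s/2}h‖. In the other direction 1 + λ_n ≥ (n + 1/2)^s / 600 (`wt_le_one_add_lam`). The added 1 is
paid for by writing g = e^t w, which is where e^T comes from.

Adjoint estimate. The weak form `adjForm` of 1 + ∂_t + v∂_x + 𝒦 - Γ(f,·) puts every unbounded
operator on the smooth test function h, so for fixed h it is continuous in g ∈ L². The non-smooth
choice g = 1_{t ≥ t₀} conj(Δ_qΔ_q h) is therefore allowed and produces the energy identity for Δ_q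
h, backwards from T, where h vanishes. Transport drops out because v∂_x is skew and commutes with
Δ_q. The trilinear term is split into frequency blocks: a paraproduct argument (`sum_paraWeight_le`)
bounds it by the B^{1/2}_{2,1} norm of f times norms of the form sup_q 2^{-q/2}‖Δ_q ·‖, and
smallness of f absorbs it. If the adjoint operator maps h to a + ℋ^{s/2}c, the outcome is
`IsNice.eLpNorm_blkX_le_of_adjForm`: sup_q 2^{-q/2}‖Δ_q h(t)‖ is at most 100 times the sum of the
analogous sup norms of a (in L¹_T) and of c (in L²_T).

Existence. The functional (a, c) ↦ ∫ g₀ h(0) is thus well defined and bounded; Hahn-Banach extends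
it and Riesz represents it by a pair (w, w'). Data with c = 0 give the equation for w; the datum h =
0, a = -ℋ^{s/2}c gives w' = ℋ^{s/2}w (`exists_dual_solution`). The bound by a sup over q turns into
a bound on a sum over q when the functional is tested on sums of near-optimal blocks
(`tsum_rt_mul_normT_le`), with L^∞_T recovered from L¹_T and L²_T from itself. -/

namespace Kac

open FourierTransform SchwartzMap
open scoped ComplexConjugate

/-! ### The Fourier transform of square integrable functions on the line -/

/-- The Fourier transform of a square integrable function, as a function. -/
noncomputable def ft (u : ℝ → ℂ) : ℝ → ℂ :=
  open Classical in if h : MemLp u 2 volume then ⇑(𝓕 (h.toLp u) : Lp ℂ 2 (volume : Measure ℝ)) else 0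

/-- The inverse Fourier integral. -/
noncomputable def ift (G : ℝ → ℂ) (x : ℝ) : ℂ :=
  ∫ η : ℝ, Complex.exp (2 * Real.pi * x * η * Complex.I) * G η

theorem ft_eq {u : ℝ → ℂ} (h : MemLp u 2 volume) :
    ft u = ⇑(𝓕 (h.toLp u) : Lp ℂ 2 (volume : Measure ℝ)) := by
  simp [ft, h]

theorem memLp_ft (u : ℝ → ℂ) : MemLp (ft u) 2 volume := by
  unfold ft
  split_ifs with h
  · exact Lp.memLp _
  · exact MemLp.zero

theorem eLpNorm_ft {u : ℝ → ℂ} (h : MemLp u 2 volume) :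
    eLpNorm (ft u) 2 volume = eLpNorm u 2 volume := by
  rw [ft_eq h, ← ENNReal.toReal_eq_toReal_iff' (Lp.eLpNorm_ne_top _) h.2.ne, ← Lp.norm_def,
    Lp.norm_fourier_eq, Lp.norm_toLp]

theorem ft_sub {u w : ℝ → ℂ} (hu : MemLp u 2 volume) (hw : MemLp w 2 volume) :
    ft (fun x => u x - w x) =ᵐ[volume] fun η => ft u η - ft w η := by
  have h1 : ft (fun x => u x - w x) = ⇑(𝓕 ((hu.sub hw).toLp (u - w)) : Lp ℂ 2 (volume : Measure ℝ)) :=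
    ft_eq (hu.sub hw)
  rw [h1, ft_eq hu, ft_eq hw, MemLp.toLp_sub hu hw]
  have h2 : (𝓕 (hu.toLp u - hw.toLp w) : Lp ℂ 2 (volume : Measure ℝ)) = 𝓕 (hu.toLp u) - 𝓕 (hw.toLp w) :=
    map_sub (Lp.fourierTransformₗᵢ ℝ ℂ) _ _
  rw [h2]
  exact Lp.coeFn_sub _ _

theorem integral_conj_mul_ft {u w : ℝ → ℂ} (hu : MemLp u 2 volume) (hw : MemLp w 2 volume) :
    ∫ η, conj (ft u η) * ft w η = ∫ x, conj (u x) * w x := by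
  have h := Lp.inner_fourier_eq (hu.toLp u) (hw.toLp w)
  rw [L2.inner_def, L2.inner_def] at h
  rw [ft_eq hu, ft_eq hw]
  calc _ = ∫ a, inner ℂ ((𝓕 (hu.toLp u) : Lp ℂ 2 (volume : Measure ℝ)) a)
        ((𝓕 (hw.toLp w) : Lp ℂ 2 (volume : Measure ℝ)) a) := by
        congr 1; ext a; simp [RCLike.inner_apply, mul_comm]
    _ = _ := h
    _ = _ := by
      apply integral_congr_ae
      filter_upwards [hu.coeFn_toLp, hw.coeFn_toLp] with a h1 h2
      simp [RCLike.inner_apply, mul_comm, h1, h2]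

theorem ft_schwartz (f : 𝓢(ℝ, ℂ)) : ft f =ᵐ[volume] 𝓕 (f : ℝ → ℂ) := by
  have h1 : ft f = ⇑(𝓕 ((f.memLp 2 volume).toLp f) : Lp ℂ 2 (volume : Measure ℝ)) := ft_eq (f.memLp 2 volume)
  have h2 : (f.memLp 2 volume).toLp f = f.toLp 2 volume := rfl
  rw [h1, h2, SchwartzMap.toLp_fourier_eq, ← SchwartzMap.fourier_coe]
  exact SchwartzMap.coeFn_toLp _ _ _

theorem norm_expI (x η : ℝ) : ‖Complex.exp (2 * Real.pi * x * η * Complex.I)‖ = 1 := by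
  have : (2 * Real.pi * x * η * Complex.I : ℂ) = ((2 * Real.pi * x * η : ℝ) : ℂ) * Complex.I := by
    push_cast; ring
  rw [this, Complex.norm_exp_ofReal_mul_I]

theorem conj_expI (x η : ℝ) : conj (Complex.exp (2 * Real.pi * x * η * Complex.I)) =
    Complex.exp (-(2 * Real.pi * x * η * Complex.I)) := by
  rw [← Complex.exp_conj]; simp [map_ofNat]

theorem continuous_expI : Continuous fun p : ℝ × ℝ =>
    Complex.exp (2 * Real.pi * p.1 * p.2 * Complex.I) := by fun_prop

theorem continuous_ift {G : ℝ → ℂ} (hG : Integrable G) : Continuous (ift G) := by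
  refine continuous_of_dominated (bound := fun η => ‖G η‖) ?_ ?_ hG.norm ?_
  · intro x
    exact (Continuous.aestronglyMeasurable (by fun_prop)).mul hG.1
  · intro x
    exact Filter.Eventually.of_forall fun η => by rw [norm_mul, norm_expI, one_mul]
  · exact Filter.Eventually.of_forall fun η => by fun_prop

theorem norm_ift_le {G : ℝ → ℂ} (x : ℝ) : ‖ift G x‖ ≤ ∫ η, ‖G η‖ := by
  refine (norm_integral_le_integral_norm _).trans (le_of_eq ?_)
  congr 1; ext η; rw [norm_mul, norm_expI, one_mul]

theorem fourier_eq_ift_neg (f : ℝ → ℂ) (η : ℝ) : 𝓕 f η = ift f (-η) := by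
  rw [Real.fourier_real_eq_integral_exp_smul, ift]
  congr 1; ext x
  rw [smul_eq_mul]; congr 2; push_cast; ring

theorem fourierInv_eq_ift (f : ℝ → ℂ) (x : ℝ) : 𝓕⁻ f x = ift f x := by
  rw [Real.fourierInv_eq_fourier_neg, fourier_eq_ift_neg, neg_neg]

/-- Fubini: the exponential has modulus one and is symmetric in the two variables. -/
theorem integral_mul_ift {G g : ℝ → ℂ} (hG : Integrable G) (hg : Integrable g) :
    ∫ x, g x * ift G x = ∫ η, ift g η * G η := by
  have hint : Integrable (Function.uncurry fun x η : ℝ =>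
      Complex.exp (2 * Real.pi * x * η * Complex.I) * (g x * G η)) (volume.prod volume) := by
    refine (hg.mul_prod hG).bdd_mul (c := 1) continuous_expI.aestronglyMeasurable ?_
    exact Filter.Eventually.of_forall fun p => (norm_expI p.1 p.2).le
  calc ∫ x, g x * ift G x
      = ∫ x : ℝ, ∫ η : ℝ, Complex.exp (2 * Real.pi * x * η * Complex.I) * (g x * G η) := by
        congr 1; ext x; rw [ift, ← integral_const_mul]; congr 1; ext η; ring
    _ = ∫ η : ℝ, ∫ x : ℝ, Complex.exp (2 * Real.pi * x * η * Complex.I) * (g x * G η) :=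
        integral_integral_swap hint
    _ = _ := by
        congr 1; ext η; rw [ift, ← integral_mul_const]; congr 1; ext x; ring_nf

/-- The inverse Fourier integral of an `L¹ ∩ L²` function is its `L²` inverse Fourier transform. -/
theorem ift_ae_eq {G : ℝ → ℂ} (hG : Integrable G) (hG2 : MemLp G 2 volume) :
    ift G =ᵐ[volume] ⇑(𝓕⁻ (hG2.toLp G) : Lp ℂ 2 (volume : Measure ℝ)) := by
  set W : Lp ℂ 2 (volume : Measure ℝ) := 𝓕⁻ (hG2.toLp G) with hW
  have hFW : 𝓕 W = hG2.toLp G := by rw [hW]; exact FourierTransform.fourier_fourierInv_eq _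
  -- Both functions are locally integrable, so testing against real test functions suffices. There
  -- Fubini moves the Fourier integral to the test function and Plancherel moves it back.
  refine ae_eq_of_integral_contDiff_smul_eq (continuous_ift hG).locallyIntegrable
    ((Lp.memLp W).locallyIntegrable (by norm_num)) ?_
  intro g hg hgs
  let gs : 𝓢(ℝ, ℂ) := (hgs.comp_left (g := ((↑) : ℝ → ℂ)) Complex.ofReal_zero).toSchwartzMap
    (Complex.ofRealCLM.contDiff.comp hg)
  have hgs_apply : ∀ x, gs x = (g x : ℂ) := fun x => rfl
  have hgi : Integrable (fun x => (g x : ℂ)) := gs.integrable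
  have h1 := Lp.inner_fourier_eq (gs.toLp 2 volume) W
  rw [hFW, SchwartzMap.toLp_fourier_eq, L2.inner_def, L2.inner_def] at h1
  calc ∫ x, g x • ift G x = ∫ x, (g x : ℂ) * ift G x := by simp
    _ = ∫ η, ift (fun x => (g x : ℂ)) η * G η := integral_mul_ift hG hgi
    _ = ∫ a, inner ℂ ((𝓕 gs).toLp 2 volume a) (hG2.toLp G a) := by
        apply integral_congr_ae
        filter_upwards [hG2.coeFn_toLp, (𝓕 gs).coeFn_toLp 2 volume] with a h2 h3
        rw [h2, h3, RCLike.inner_apply, mul_comm, SchwartzMap.fourier_coe, fourier_eq_ift_neg]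
        congr 1
        rw [ift, ift, ← integral_conj]
        congr 1; ext x
        rw [map_mul, conj_expI, hgs_apply, Complex.conj_ofReal]
        congr 2; push_cast; ring
    _ = _ := h1
    _ = ∫ x, g x • W x := by
        apply integral_congr_ae
        filter_upwards [gs.coeFn_toLp 2 volume] with a h3
        rw [h3, RCLike.inner_apply, hgs_apply, Complex.conj_ofReal, mul_comm, Complex.real_smul]

theorem memLp_ift {G : ℝ → ℂ} (hG : Integrable G) (hG2 : MemLp G 2 volume) :
    MemLp (ift G) 2 volume :=
  (Lp.memLp _).ae_eq (ift_ae_eq hG hG2).symm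

theorem ft_ift {G : ℝ → ℂ} (hG : Integrable G) (hG2 : MemLp G 2 volume) :
    ft (ift G) =ᵐ[volume] G := by
  have h := memLp_ift hG hG2
  rw [ft_eq h]
  have h2 : h.toLp (ift G) = 𝓕⁻ (hG2.toLp G) := by
    apply Lp.ext
    exact h.coeFn_toLp.trans (ift_ae_eq hG hG2)
  rw [h2, FourierTransform.fourier_fourierInv_eq]
  exact hG2.coeFn_toLp

/-! ### Symbols of the dyadic blocks -/

namespace LPCouple

variable (P : LPCouple)

/-- The couple reflected in the frequency variable. -/
def reflect : LPCouple where
  φ ξ := P.φ (-ξ)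
  χ ξ := P.χ (-ξ)
  smooth_φ := P.smooth_φ.comp contDiff_neg
  smooth_χ := P.smooth_χ.comp contDiff_neg
  φ_mem ξ := P.φ_mem _
  χ_mem ξ := P.χ_mem _
  supp_φ ξ h := by simpa using P.supp_φ _ h
  supp_χ ξ h := by simpa using P.supp_χ _ h
  unit ξ := by simpa [neg_div] using P.unit (-ξ)

theorem reflect_symbol (n : ℕ) (ξ : ℝ) : P.reflect.symbol n ξ = P.symbol n (-ξ) := by
  cases n <;> simp [symbol, reflect, neg_div]

theorem reflect_reflect : P.reflect.reflect = P := by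
  simp [reflect]

theorem symbol_mem (n : ℕ) (ξ : ℝ) : P.symbol n ξ ∈ Icc (0 : ℝ) 1 := by
  cases n
  · exact P.χ_mem _
  · exact P.φ_mem _

theorem contDiff_symbol (n : ℕ) : ContDiff ℝ ∞ (P.symbol n) := by
  cases n with
  | zero => exact P.smooth_χ
  | succ n => exact P.smooth_φ.comp (contDiff_id.div_const _)

theorem abs_le_of_symbol_ne_zero {n : ℕ} {ξ : ℝ} (h : P.symbol n ξ ≠ 0) :
    |ξ| ≤ 4 / 3 * 2 ^ n := by
  cases n with
  | zero => simpa using P.supp_χ ξ h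
  | succ n =>
    have := (P.supp_φ _ h).2
    rw [abs_div, abs_of_pos (by positivity : (0 : ℝ) < 2 ^ n), div_le_iff₀ (by positivity)] at this
    rw [pow_succ]; linarith

theorem le_abs_of_symbol_ne_zero {n : ℕ} {ξ : ℝ} (hn : n ≠ 0) (h : P.symbol n ξ ≠ 0) :
    3 / 8 * 2 ^ n ≤ |ξ| := by
  cases n with
  | zero => exact absurd rfl hn
  | succ n =>
    have := (P.supp_φ _ h).1
    rw [abs_div, abs_of_pos (by positivity : (0 : ℝ) < 2 ^ n), le_div_iff₀ (by positivity)] at this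
    rw [pow_succ]; linarith

/-- The first symbol lives in |ξ| ≤ (4/3)2^n and the second in |ξ| ≥ (3/8)2^m ≥ (3/2)2^n. Indices
are shifted: n stands for the block q = n - 1. -/
theorem symbol_mul_symbol {n m : ℕ} (h : n + 2 ≤ m) (ξ : ℝ) :
    P.symbol n ξ * P.symbol m ξ = 0 := by
  by_contra hne
  obtain ⟨h1, h2⟩ := mul_ne_zero_iff.1 hne
  have h3 := P.abs_le_of_symbol_ne_zero h1
  have h4 := P.le_abs_of_symbol_ne_zero (by omega) h2
  have h5 : (2 : ℝ) ^ (n + 2) ≤ 2 ^ m := pow_le_pow_right₀ (by norm_num) h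
  have h6 : (0 : ℝ) < 2 ^ n := by positivity
  rw [pow_add] at h5
  linarith

theorem hasSum_symbol (ξ : ℝ) : HasSum (fun n => P.symbol n ξ) 1 := by
  -- An infinite sum equal to a prescribed value carries information only once summability is known,
  -- because the sum of a non-summable family is 0 by convention.
  have hs : Summable fun q : ℕ => P.φ (ξ / 2 ^ q) := by
    obtain ⟨R, hR⟩ := pow_unbounded_of_one_lt (4 / 3 * |ξ|) (by norm_num : (1 : ℝ) < 2)
    refine summable_of_ne_finset_zero (s := Finset.range R) fun q hq => ?_
    by_contra hne
    have := P.le_abs_of_symbol_ne_zero (n := q + 1) (by omega) hne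
    have h5 : (2 : ℝ) ^ R ≤ 2 ^ q := pow_le_pow_right₀ (by norm_num) (by simpa using hq)
    rw [pow_succ] at this
    linarith
  have h2 : HasSum (fun n => P.symbol (n + 1) ξ) (1 - P.χ ξ) := by
    rw [← P.unit ξ, add_sub_cancel_left]; exact hs.hasSum
  rw [hasSum_nat_add_iff' (f := fun n => P.symbol n ξ) 1 |>.symm]
  simpa [symbol] using h2

theorem sum_symbol_mem (N : ℕ) (ξ : ℝ) :
    ∑ n ∈ Finset.range N, P.symbol n ξ ∈ Icc (0 : ℝ) 1 :=
  ⟨Finset.sum_nonneg fun n _ => (P.symbol_mem n ξ).1,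
    sum_le_hasSum _ (fun n _ => (P.symbol_mem n ξ).1) (P.hasSum_symbol ξ)⟩

theorem sum_symbol_eq_one {N : ℕ} (hN : N ≠ 0) {ξ : ℝ} (h : |ξ| < 3 / 8 * 2 ^ N) :
    ∑ n ∈ Finset.range N, P.symbol n ξ = 1 := by
  refine (hasSum_sum_of_ne_finset_zero fun n hn => ?_).unique (P.hasSum_symbol ξ)
  by_contra hne
  have hn' : N ≤ n := by simpa using hn
  have := P.le_abs_of_symbol_ne_zero (by omega) hne
  have h5 : (2 : ℝ) ^ N ≤ 2 ^ n := pow_le_pow_right₀ (by norm_num) hn'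
  linarith

/-- The Fourier multiplier of `Δ_{n-1}` in the normalization of Mathlib, as a Schwartz function. -/
noncomputable def mult (n : ℕ) : 𝓢(ℝ, ℂ) :=
  HasCompactSupport.toSchwartzMap (f := fun η : ℝ => (P.symbol n (2 * Real.pi * η) : ℂ))
    (by
      refine HasCompactSupport.intro (K := Icc (-(4 / 3 * 2 ^ n)) (4 / 3 * 2 ^ n)) isCompact_Icc ?_
      intro η hη
      by_contra hne
      have h1 := P.abs_le_of_symbol_ne_zero (Complex.ofReal_ne_zero.1 hne)
      rw [abs_mul, abs_of_pos Real.two_pi_pos] at h1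
      have h3 : (1 : ℝ) ≤ 2 * Real.pi := by linarith [Real.pi_gt_three]
      have h2 : |η| ≤ 4 / 3 * 2 ^ n := by nlinarith [abs_nonneg η]
      exact hη (abs_le.1 h2))
    (Complex.ofRealCLM.contDiff.comp
      ((P.contDiff_symbol n).comp (contDiff_const.mul contDiff_id)))

theorem mult_apply (n : ℕ) (η : ℝ) : P.mult n η = (P.symbol n (2 * Real.pi * η) : ℂ) := rfl

theorem norm_mult_le (n : ℕ) (η : ℝ) : ‖P.mult n η‖ ≤ 1 := by
  rw [mult_apply, Complex.norm_real, Real.norm_of_nonneg (P.symbol_mem _ _).1]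
  exact (P.symbol_mem _ _).2

theorem conj_mult (n : ℕ) (η : ℝ) : conj (P.mult n η) = P.mult n η := by
  rw [mult_apply, Complex.conj_ofReal]

theorem kernel_eq_ift (n : ℕ) (x : ℝ) : P.kernel n x = ift (P.mult n) x := by
  have h := Measure.integral_comp_mul_left
    (fun ξ : ℝ => Complex.exp (Complex.I * x * ξ) * (P.symbol n ξ : ℂ)) (2 * Real.pi)
  rw [kernel, ift]
  have h2 : (2 * Real.pi : ℂ)⁻¹ * ∫ ξ : ℝ, Complex.exp (Complex.I * x * ξ) * (P.symbol n ξ : ℂ) =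
      |(2 * Real.pi)⁻¹| • ∫ ξ : ℝ, Complex.exp (Complex.I * x * ξ) * (P.symbol n ξ : ℂ) := by
    rw [abs_of_pos (by positivity), Complex.real_smul]; push_cast; rfl
  rw [h2, ← h]
  congr 1; ext η
  rw [mult_apply]; congr 2; push_cast; ring

theorem kernel_eq_fourierInv (n : ℕ) : P.kernel n = ⇑(𝓕⁻ (P.mult n) : 𝓢(ℝ, ℂ)) := by
  ext x; rw [kernel_eq_ift, SchwartzMap.fourierInv_coe, fourierInv_eq_ift]

theorem integrable_kernel (n : ℕ) : Integrable (P.kernel n) := by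
  rw [kernel_eq_fourierInv]; exact SchwartzMap.integrable (𝓕⁻ (P.mult n) : 𝓢(ℝ, ℂ))

theorem continuous_kernel (n : ℕ) : Continuous (P.kernel n) := by
  rw [kernel_eq_fourierInv]; exact SchwartzMap.continuous (𝓕⁻ (P.mult n) : 𝓢(ℝ, ℂ))

theorem memLp_kernel (n : ℕ) : MemLp (P.kernel n) 2 volume := by
  rw [kernel_eq_fourierInv]; exact SchwartzMap.memLp (𝓕⁻ (P.mult n) : 𝓢(ℝ, ℂ)) _ _

theorem reflect_mult (n : ℕ) (η : ℝ) : P.reflect.mult n η = P.mult n (-η) := by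
  rw [mult_apply, mult_apply, reflect_symbol]; congr 2; ring

theorem conj_kernel (n : ℕ) (x : ℝ) : conj (P.kernel n x) = P.kernel n (-x) := by
  rw [kernel_eq_ift, kernel_eq_ift, ift, ift, ← integral_conj]
  congr 1; ext η
  rw [map_mul, conj_expI, conj_mult]; congr 2; push_cast; ring

theorem kernel_reflect (n : ℕ) (x : ℝ) : P.reflect.kernel n x = P.kernel n (-x) := by
  rw [kernel_eq_ift, kernel_eq_ift, ift, ift,
    ← integral_neg_eq_self (fun η : ℝ => Complex.exp (2 * Real.pi * (-x : ℝ) * η * Complex.I) *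
      P.mult n η)]
  congr 1; ext η
  rw [reflect_mult]; congr 2; push_cast; ring

theorem ft_kernel (n : ℕ) (η : ℝ) : ift (P.kernel n) (-η) = P.mult n η := by
  have h1 : 𝓕 (P.kernel n) η = ift (P.kernel n) (-η) := fourier_eq_ift_neg _ _
  rw [← h1, kernel_eq_fourierInv, ← SchwartzMap.fourier_coe,
    FourierTransform.fourier_fourierInv_eq]

end LPCouple

end Kac

/-! ### Littlewood-Paley blocks on L² of the line. -/

namespace Kac

open FourierTransform SchwartzMap
open scoped ComplexConjugate

theorem memLp_conj {α : Type*} [MeasurableSpace α] {ν : Measure α} {p : ℝ≥0∞} {u : α → ℂ}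
    (hu : MemLp u p ν) : MemLp (fun x => conj (u x)) p ν :=
  hu.of_le (Complex.continuous_conj.comp_aestronglyMeasurable hu.1)
    (Filter.Eventually.of_forall fun x => by simp)

theorem eLpNorm_conj {α : Type*} [MeasurableSpace α] {ν : Measure α} {p : ℝ≥0∞} (u : α → ℂ) :
    eLpNorm (fun x => conj (u x)) p ν = eLpNorm u p ν :=
  eLpNorm_congr_norm_ae (Filter.Eventually.of_forall fun x => by simp)

theorem integrable_mul_of_memLp {α : Type*} [MeasurableSpace α] {ν : Measure α} {u w : α → ℂ}
    (hu : MemLp u 2 ν) (hw : MemLp w 2 ν) : Integrable (fun x => u x * w x) ν :=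
  MemLp.integrable_mul hu hw

theorem enorm_integral_mul_le {α : Type*} [MeasurableSpace α] {ν : Measure α} {u w : α → ℂ}
    (hu : AEStronglyMeasurable u ν) (hw : AEStronglyMeasurable w ν) :
    ‖∫ x, u x * w x ∂ν‖ₑ ≤ eLpNorm u 2 ν * eLpNorm w 2 ν := by
  refine (enorm_integral_le_lintegral_enorm _).trans ?_
  have h := ENNReal.lintegral_mul_le_Lp_mul_Lq ν Real.HolderConjugate.two_two hu.enorm hw.enorm
  rw [eLpNorm_eq_lintegral_rpow_enorm_toReal (by norm_num) (by norm_num),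
    eLpNorm_eq_lintegral_rpow_enorm_toReal (by norm_num) (by norm_num)]
  simpa [enorm_mul] using h

theorem memLp_two_of_bound {f g : ℝ → ℂ} {C : ℝ} (hf : AEStronglyMeasurable f volume)
    (hb : ∀ x, ‖f x‖ ≤ C) (hg : MemLp g 2 volume) : MemLp (fun x => f x * g x) 2 volume := by
  refine (hg.const_mul (C : ℂ)).of_le (hf.mul hg.1) (Filter.Eventually.of_forall fun x => ?_)
  rw [norm_mul, norm_mul]
  gcongr
  exact (hb x).trans (by rw [Complex.norm_real]; exact le_abs_self C)

namespace LPCouple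

variable (P : LPCouple)

theorem memLp_mult_mul (n : ℕ) {G : ℝ → ℂ} (hG : MemLp G 2 volume) :
    MemLp (fun η => P.mult n η * G η) 2 volume :=
  memLp_two_of_bound (P.mult n).continuous.aestronglyMeasurable (P.norm_mult_le n) hG

theorem integrable_mult_mul (n : ℕ) {G : ℝ → ℂ} (hG : MemLp G 2 volume) :
    Integrable (fun η => P.mult n η * G η) :=
  integrable_mul_of_memLp ((P.mult n).memLp 2) hG

theorem memLp_kernel_sub (n : ℕ) (x : ℝ) : MemLp (fun y => P.kernel n (x - y)) 2 volume :=
  (P.memLp_kernel n).comp_measurePreserving (Measure.measurePreserving_sub_left volume x)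

theorem integrable_kernel_mul (n : ℕ) {u : ℝ → ℂ} (hu : MemLp u 2 volume) (x : ℝ) :
    Integrable fun y => P.kernel n (x - y) * u y :=
  integrable_mul_of_memLp (P.memLp_kernel_sub n x) hu

/-- Plancherel against the translated kernel, whose transform is `mult` times a character. The
identity holds at every point and not just almost everywhere, since a block is a genuine convolution
integral. -/
theorem block_eq_ift (n : ℕ) {u : ℝ → ℂ} (hu : MemLp u 2 volume) :
    P.block n u = ift (fun η => P.mult n η * ft u η) := by
  ext x
  set G : ℝ → ℂ := fun η => P.mult n η * Complex.exp (2 * Real.pi * (-x : ℝ) * η * Complex.I)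
    with hG
  have hGc : Continuous G := (P.mult n).continuous.mul (by fun_prop)
  have hGn : ∀ η, ‖G η‖ = ‖P.mult n η‖ := fun η => by rw [hG]; simp only; rw [norm_mul, norm_expI,
    mul_one]
  have hG1 : Integrable G := (P.mult n).integrable.mono hGc.aestronglyMeasurable
    (Filter.Eventually.of_forall fun η => (hGn η).le)
  have hG2 : MemLp G 2 volume := ((P.mult n).memLp 2).of_le hGc.aestronglyMeasurable
    (Filter.Eventually.of_forall fun η => (hGn η).le)
  have hψ : ∀ y, ift G y = conj (P.kernel n (x - y)) := fun y => by
    rw [conj_kernel, neg_sub, kernel_eq_ift, ift, ift]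
    congr 1; ext η
    rw [hG]; simp only
    rw [mul_comm (P.mult n η), ← mul_assoc, ← Complex.exp_add]
    congr 2; push_cast; ring
  have h1 := integral_conj_mul_ft (memLp_ift hG1 hG2) hu
  calc P.block n u x = ∫ y, conj (ift G y) * u y := by
        rw [block]; congr 1; ext y; rw [hψ, Complex.conj_conj]
    _ = _ := h1.symm
    _ = _ := by
      apply integral_congr_ae
      filter_upwards [ft_ift hG1 hG2] with η hη
      rw [hη, hG]; simp only
      rw [map_mul, conj_mult, conj_expI]
      have : -(2 * Real.pi * ((-x : ℝ) : ℂ) * η * Complex.I) = 2 * Real.pi * x * η * Complex.I := by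
        push_cast; ring
      rw [this]; ring

theorem memLp_block (n : ℕ) {u : ℝ → ℂ} (hu : MemLp u 2 volume) : MemLp (P.block n u) 2 volume := by
  rw [block_eq_ift P n hu]
  exact memLp_ift (P.integrable_mult_mul n (memLp_ft u)) (P.memLp_mult_mul n (memLp_ft u))

theorem ft_block (n : ℕ) {u : ℝ → ℂ} (hu : MemLp u 2 volume) :
    ft (P.block n u) =ᵐ[volume] fun η => P.mult n η * ft u η := by
  rw [block_eq_ift P n hu]
  exact ft_ift (P.integrable_mult_mul n (memLp_ft u)) (P.memLp_mult_mul n (memLp_ft u))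

theorem norm_block_le (n : ℕ) {u : ℝ → ℂ} (hu : MemLp u 2 volume) :
    ∃ C, ∀ x, ‖P.block n u x‖ ≤ C := by
  rw [block_eq_ift P n hu]; exact ⟨_, norm_ift_le⟩

theorem eLpNorm_block_le (n : ℕ) {u : ℝ → ℂ} (hu : MemLp u 2 volume) :
    eLpNorm (P.block n u) 2 volume ≤ eLpNorm u 2 volume := by
  rw [← eLpNorm_ft hu, ← eLpNorm_ft (P.memLp_block n hu), eLpNorm_congr_ae (P.ft_block n hu)]
  refine eLpNorm_mono fun η => ?_
  rw [norm_mul]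
  exact mul_le_of_le_one_left (norm_nonneg _) (P.norm_mult_le n η)

theorem block_congr (n : ℕ) {u w : ℝ → ℂ} (h : u =ᵐ[volume] w) : P.block n u = P.block n w := by
  ext x
  exact integral_congr_ae (h.mono fun y hy => by simp only [hy])

theorem block_add (n : ℕ) {u w : ℝ → ℂ} (hu : MemLp u 2 volume) (hw : MemLp w 2 volume) (x : ℝ) :
    P.block n (fun y => u y + w y) x = P.block n u x + P.block n w x := by
  simp only [block]
  rw [← integral_add (P.integrable_kernel_mul n hu x) (P.integrable_kernel_mul n hw x)]
  congr 1; ext y; ring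

theorem block_const_mul (n : ℕ) (c : ℂ) (u : ℝ → ℂ) (x : ℝ) :
    P.block n (fun y => c * u y) x = c * P.block n u x := by
  simp only [block]
  rw [← integral_const_mul]
  congr 1; ext y; ring

theorem conj_block (n : ℕ) (u : ℝ → ℂ) (x : ℝ) :
    conj (P.block n u x) = P.reflect.block n (fun y => conj (u y)) x := by
  rw [block, block, ← integral_conj]
  congr 1; ext y
  rw [map_mul, conj_kernel, kernel_reflect]

theorem integral_conj_block_mul (n : ℕ) {u w : ℝ → ℂ} (hu : MemLp u 2 volume)
    (hw : MemLp w 2 volume) :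
    ∫ x, conj (P.block n u x) * w x = ∫ x, conj (u x) * P.block n w x := by
  rw [← integral_conj_mul_ft (P.memLp_block n hu) hw,
    ← integral_conj_mul_ft hu (P.memLp_block n hw)]
  apply integral_congr_ae
  filter_upwards [P.ft_block n hu, P.ft_block n hw] with η h1 h2
  rw [h1, h2, map_mul, conj_mult]; ring

/-- Transposing in a pairing without conjugation replaces the multiplier m(ξ) by m(-ξ). The symbols
are not assumed even, hence the reflected couple, which will always act on test functions. -/
theorem integral_block_mul (n : ℕ) {u w : ℝ → ℂ} (hu : MemLp u 2 volume) (hw : MemLp w 2 volume) :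
    ∫ x, P.block n u x * w x = ∫ x, u x * P.reflect.block n w x := by
  have h := P.reflect.integral_conj_block_mul n (memLp_conj hu) hw
  simpa [conj_block, reflect_reflect] using h

theorem volume_support_mult (n : ℕ) : volume (Function.support (P.mult n)) ≤ 2 ^ n := by
  have h : Function.support (P.mult n) ⊆ Icc (-(2 ^ n / 2)) (2 ^ n / 2 : ℝ) := by
    intro η hη
    have h1 := P.abs_le_of_symbol_ne_zero (Complex.ofReal_ne_zero.1 hη)
    rw [abs_mul, abs_of_pos Real.two_pi_pos] at h1
    have h4 := mul_le_mul_of_nonneg_right Real.pi_gt_three.le (abs_nonneg η)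
    have h2 : |η| ≤ 2 ^ n / 2 := by
      have : (0 : ℝ) < 2 ^ n := by positivity
      linarith
    exact abs_le.1 h2
  refine (measure_mono h).trans ?_
  rw [Real.volume_Icc]
  have : (2 ^ n / 2 - -(2 ^ n / 2) : ℝ) = 2 ^ n := by ring
  rw [this, ENNReal.ofReal_pow (by norm_num)]; simp

/-- Bernstein's inequality. -/
theorem enorm_block_le (n : ℕ) {u : ℝ → ℂ} (hu : MemLp u 2 volume) (x : ℝ) :
    ‖P.block n u x‖ₑ ≤ (2 : ℝ≥0∞) ^ ((n : ℝ) / 2) * eLpNorm (P.block n u) 2 volume := by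
  set G : ℝ → ℂ := fun η => P.mult n η * ft u η with hG
  have hG2 : MemLp G 2 volume := P.memLp_mult_mul n (memLp_ft u)
  have hsupp : Function.support G ⊆ Function.support (P.mult n) := fun η hη => left_ne_zero_of_mul hη
  have hms : MeasurableSet (Function.support (P.mult n)) :=
    (P.mult n).continuous.isOpen_support.measurableSet
  have e1 : ‖P.block n u x‖ₑ ≤ eLpNorm G 1 volume := by
    rw [P.block_eq_ift n hu, eLpNorm_one_eq_lintegral_enorm]
    refine (enorm_integral_le_lintegral_enorm _).trans (le_of_eq ?_)
    congr 1; ext η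
    rw [enorm_mul]
    have : ‖Complex.exp (2 * Real.pi * x * η * Complex.I)‖ₑ = 1 := by
      rw [← ofReal_norm, norm_expI, ENNReal.ofReal_one]
    rw [this, one_mul]
  have e2 : eLpNorm G 2 volume = eLpNorm (P.block n u) 2 volume := by
    rw [← eLpNorm_ft (P.memLp_block n hu), eLpNorm_congr_ae (P.ft_block n hu)]
  have e3 : eLpNorm G 1 volume = eLpNorm G 1 (volume.restrict (Function.support (P.mult n))) := by
    rw [← eLpNorm_indicator_eq_eLpNorm_restrict hms, indicator_eq_self.2 hsupp]
  -- Cauchy-Schwarz on the frequency support, whose measure is at most 2^n.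
  have e4 := eLpNorm_le_eLpNorm_mul_rpow_measure_univ (μ := volume.restrict (Function.support
    (P.mult n))) (p := 1) (q := 2) (by norm_num) (hG2.1.restrict)
  rw [Measure.restrict_apply_univ] at e4
  refine e1.trans (e3.le.trans (e4.trans ?_))
  rw [mul_comm]
  gcongr
  · have : (1 / (1 : ℝ≥0∞).toReal - 1 / (2 : ℝ≥0∞).toReal) = 1 / 2 := by norm_num
    rw [this]
    refine (ENNReal.rpow_le_rpow (P.volume_support_mult n) (by norm_num)).trans (le_of_eq ?_)
    rw [← ENNReal.rpow_natCast, ← ENNReal.rpow_mul]; congr 1; ring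
  · exact (eLpNorm_mono_measure _ Measure.restrict_le_self).trans e2.le

theorem mult_mul_mult {n m : ℕ} (h : n + 2 ≤ m ∨ m + 2 ≤ n) (η : ℝ) :
    P.mult n η * P.mult m η = 0 := by
  rw [mult_apply, mult_apply, ← Complex.ofReal_mul]
  rcases h with h | h
  · rw [P.symbol_mul_symbol h, Complex.ofReal_zero]
  · rw [mul_comm, P.symbol_mul_symbol h, Complex.ofReal_zero]

theorem block_block_eq_ift (n m : ℕ) {u : ℝ → ℂ} (hu : MemLp u 2 volume) :
    P.block n (P.block m u) = ift (fun η => P.mult n η * P.mult m η * ft u η) := by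
  rw [P.block_eq_ift n (P.memLp_block m hu)]
  ext x
  apply integral_congr_ae
  filter_upwards [P.ft_block m hu] with η h
  rw [h, mul_assoc (P.mult n η)]

theorem block_block_eq_zero {n m : ℕ} (h : n + 2 ≤ m ∨ m + 2 ≤ n) {u : ℝ → ℂ}
    (hu : MemLp u 2 volume) (x : ℝ) : P.block n (P.block m u) x = 0 := by
  rw [P.block_block_eq_ift n m hu, ift]
  simp [P.mult_mul_mult h]

/-- The low frequency cut-off `∑_{n < N} Δ_{n-1}`. -/
noncomputable def lowPass (N : ℕ) (u : ℝ → ℂ) (x : ℝ) : ℂ := ∑ n ∈ Finset.range N, P.block n u x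

theorem sum_block_eq_ift (s : Finset ℕ) {u : ℝ → ℂ} (hu : MemLp u 2 volume) (x : ℝ) :
    ∑ n ∈ s, P.block n u x = ift (fun η => (∑ n ∈ s, P.mult n η) * ft u η) x := by
  simp only [P.block_eq_ift _ hu, ift]
  rw [← integral_finsetSum]
  · congr 1; ext η; rw [Finset.sum_mul, Finset.mul_sum]
  · intro n _
    exact (P.integrable_mult_mul n (memLp_ft u)).bdd_mul (c := 1)
      (Continuous.aestronglyMeasurable (by fun_prop))
      (Filter.Eventually.of_forall fun η => (norm_expI _ _).le)

theorem memLp_lowPass (N : ℕ) {u : ℝ → ℂ} (hu : MemLp u 2 volume) :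
    MemLp (P.lowPass N u) 2 volume :=
  memLp_finsetSum _ fun n _ => P.memLp_block n hu

theorem ft_lowPass (N : ℕ) {u : ℝ → ℂ} (hu : MemLp u 2 volume) :
    ft (P.lowPass N u) =ᵐ[volume] fun η => (∑ n ∈ Finset.range N, P.mult n η) * ft u η := by
  have h : P.lowPass N u = ift (fun η => (∑ n ∈ Finset.range N, P.mult n η) * ft u η) := by
    ext x; exact P.sum_block_eq_ift _ hu x
  rw [h]
  refine ft_ift ?_ ?_ <;> simp only [Finset.sum_mul]
  · exact integrable_finsetSum _ fun n _ => P.integrable_mult_mul n (memLp_ft u)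
  · exact memLp_finsetSum _ fun n _ => P.memLp_mult_mul n (memLp_ft u)

theorem sum_mult (N : ℕ) (η : ℝ) : ∑ n ∈ Finset.range N, P.mult n η =
    ((∑ n ∈ Finset.range N, P.symbol n (2 * Real.pi * η) : ℝ) : ℂ) := by
  simp [mult_apply]

theorem norm_one_sub_sum_mult_le (N : ℕ) (η : ℝ) :
    ‖1 - ∑ n ∈ Finset.range N, P.mult n η‖ ≤ 1 := by
  have h := P.sum_symbol_mem N (2 * Real.pi * η)
  rw [sum_mult, ← Complex.ofReal_one, ← Complex.ofReal_sub, Complex.norm_real, Real.norm_eq_abs,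
    abs_le]
  constructor <;> linarith [h.1, h.2]

theorem ft_sub_lowPass (N : ℕ) {u : ℝ → ℂ} (hu : MemLp u 2 volume) :
    ft (fun x => u x - P.lowPass N u x) =ᵐ[volume]
      fun η => (1 - ∑ n ∈ Finset.range N, P.mult n η) * ft u η := by
  filter_upwards [ft_sub hu (P.memLp_lowPass N hu), P.ft_lowPass N hu] with η h1 h2
  rw [h1, h2]; ring

/-- Dominated convergence on the Fourier side: the error multiplier lies in [0, 1] and vanishes from
some N on at each frequency. -/
theorem tendsto_lowPass {u : ℝ → ℂ} (hu : MemLp u 2 volume) :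
    Filter.Tendsto (fun N => eLpNorm (fun x => u x - P.lowPass N u x) 2 volume)
      Filter.atTop (nhds 0) := by
  have h1 : ∀ N, eLpNorm (fun x => u x - P.lowPass N u x) 2 volume =
      (∫⁻ η, ‖(1 - ∑ n ∈ Finset.range N, P.mult n η) * ft u η‖ₑ ^ (2 : ℝ)) ^ (1 / 2 : ℝ) := by
    intro N
    have hm : MemLp (fun x => u x - P.lowPass N u x) 2 volume := hu.sub (P.memLp_lowPass N hu)
    rw [← eLpNorm_ft hm, eLpNorm_congr_ae (P.ft_sub_lowPass N hu),
      eLpNorm_eq_lintegral_rpow_enorm_toReal (by norm_num) (by norm_num)]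
    simp
  simp only [h1]
  have h0 : (0 : ℝ≥0∞) = 0 ^ (1 / 2 : ℝ) := by rw [ENNReal.zero_rpow_of_pos (by norm_num)]
  rw [h0]
  refine Filter.Tendsto.ennrpow_const _ ?_
  have h2 : ∫⁻ η, ‖ft u η‖ₑ ^ (2 : ℝ) ≠ ⊤ := by
    have := lintegral_rpow_enorm_lt_top_of_eLpNorm_lt_top (p := 2) (by norm_num) (by norm_num)
      (memLp_ft u).2
    simpa using this.ne
  have h3 := tendsto_lintegral_of_dominated_convergence' (μ := volume)
    (F := fun N η => ‖(1 - ∑ n ∈ Finset.range N, P.mult n η) * ft u η‖ₑ ^ (2 : ℝ))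
    (f := fun _ => 0) (fun η => ‖ft u η‖ₑ ^ (2 : ℝ)) ?_ ?_ h2 ?_
  · simpa using h3
  · intro N
    refine (AEStronglyMeasurable.enorm ?_).pow_const _
    refine AEStronglyMeasurable.mul (Continuous.aestronglyMeasurable ?_) (memLp_ft u).1
    exact continuous_const.sub (continuous_finsetSum _ fun n _ => (P.mult n).continuous)
  · intro N
    refine Filter.Eventually.of_forall fun η => ?_
    simp only
    gcongr
    rw [enorm_le_iff_norm_le, norm_mul]
    exact mul_le_of_le_one_left (norm_nonneg _) (P.norm_one_sub_sum_mult_le N η)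
  · refine Filter.Eventually.of_forall fun η => ?_
    refine tendsto_const_nhds.congr' ?_
    obtain ⟨R, hR⟩ := pow_unbounded_of_one_lt (8 / 3 * |2 * Real.pi * η|)
      (by norm_num : (1 : ℝ) < 2)
    filter_upwards [Filter.eventually_ge_atTop (R + 1)] with N hN
    rw [sum_mult, P.sum_symbol_eq_one (by omega)]
    · simp
    · have h5 : (2 : ℝ) ^ R ≤ 2 ^ N := pow_le_pow_right₀ (by norm_num) (by omega)
      linarith

end LPCouple

/-- The Fourier transform of the derivative of a Schwartz function. -/
theorem ft_deriv (f : 𝓢(ℝ, ℂ)) :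
    ft (deriv f) =ᵐ[volume] fun η => (2 * Real.pi * η * Complex.I : ℂ) * ft f η := by
  have h1 : (SchwartzMap.derivCLM ℂ ℂ f : ℝ → ℂ) = deriv f := by
    ext x; simp
  rw [← h1]
  filter_upwards [ft_schwartz (SchwartzMap.derivCLM ℂ ℂ f), ft_schwartz f] with η h2 h3
  rw [h2, h3, h1, Real.fourier_deriv f.integrable f.differentiable]
  · simp only [smul_eq_mul]; ring
  · rw [← h1]; exact SchwartzMap.integrable _

namespace LPCouple

variable (P : LPCouple)

/-- The error multiplier vanishes for |2πη| < (3/8)2^N; elsewhere it is at most 1 ≤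
(8/3)2^{-N}|2πη|, and 8/3 ≤ 3. The explicit rate later lets the number of blocks tend to infinity.
-/
theorem eLpNorm_sub_lowPass_le {N : ℕ} (hN : N ≠ 0) (f : 𝓢(ℝ, ℂ)) :
    eLpNorm (fun x => f x - P.lowPass N f x) 2 volume ≤
      ENNReal.ofReal (3 / 2 ^ N) * eLpNorm (deriv f) 2 volume := by
  have hf : MemLp f 2 volume := f.memLp 2
  have hd : MemLp (deriv f) 2 volume := by
    have h1 : (SchwartzMap.derivCLM ℂ ℂ f : ℝ → ℂ) = deriv f := by
      ext x; simp
    rw [← h1]; exact SchwartzMap.memLp (SchwartzMap.derivCLM ℂ ℂ f) 2 volume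
  have hm : MemLp (fun x => f x - P.lowPass N f x) 2 volume := hf.sub (P.memLp_lowPass N hf)
  rw [← eLpNorm_ft hm, ← eLpNorm_ft hd,
    eLpNorm_congr_ae (P.ft_sub_lowPass N hf)]
  refine eLpNorm_le_mul_eLpNorm_of_ae_le_mul ?_ 2
  filter_upwards [ft_deriv f] with η h
  rw [h, norm_mul, norm_mul, ← mul_assoc]
  gcongr
  by_cases hη : |2 * Real.pi * η| < 3 / 8 * 2 ^ N
  · rw [sum_mult, P.sum_symbol_eq_one hN hη]; simp
  · refine (P.norm_one_sub_sum_mult_le N η).trans ?_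
    have e : ‖(2 * Real.pi * η * Complex.I : ℂ)‖ = |2 * Real.pi * η| := by
      rw [norm_mul, Complex.norm_I, mul_one]
      rw [← Real.norm_eq_abs, ← Complex.norm_real]; push_cast; rfl
    rw [e, div_mul_eq_mul_div, le_div_iff₀ (by positivity)]
    have : (0 : ℝ) < 2 ^ N := by positivity
    linarith

/-- On the Fourier side the integrand is i times a real function. This is the skewness that removes
transport from the energy identity. -/
theorem re_integral_conj_block_block_mul_deriv (n : ℕ) (f : 𝓢(ℝ, ℂ)) :
    (∫ x, conj (P.block n (P.block n f) x) * deriv f x).re = 0 := by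
  have hf : MemLp f 2 volume := f.memLp 2
  have hd : MemLp (deriv f) 2 volume := by
    have h1 : (SchwartzMap.derivCLM ℂ ℂ f : ℝ → ℂ) = deriv f := by
      ext x; simp
    rw [← h1]; exact SchwartzMap.memLp (SchwartzMap.derivCLM ℂ ℂ f) 2 volume
  have h2 := P.memLp_block n hf
  rw [← integral_conj_mul_ft (P.memLp_block n h2) hd]
  have h3 : ∫ η, conj (ft (P.block n (P.block n f)) η) * ft (deriv f) η =
      ∫ η : ℝ, ((P.symbol n (2 * Real.pi * η) ^ 2 * (2 * Real.pi * η) * ‖ft f η‖ ^ 2 : ℝ) : ℂ) *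
        Complex.I := by
    apply integral_congr_ae
    filter_upwards [P.ft_block n h2, P.ft_block n hf, ft_deriv f] with η e1 e2 e3
    rw [e1, e2, e3, map_mul, map_mul, conj_mult, mult_apply]
    have := Complex.conj_mul' (ft f η)
    push_cast
    linear_combination ((P.symbol n (2 * Real.pi * η) : ℂ) ^ 2 * (2 * Real.pi * η) * Complex.I) *
      this
  rw [h3, integral_mul_const, integral_complex_ofReal, Complex.re_ofReal_mul, Complex.I_re,
    mul_zero]

/-- A block is the sum of its compositions with the neighbouring blocks. -/
theorem block_eq_sum_block_block (n : ℕ) {u : ℝ → ℂ} (hu : MemLp u 2 volume) (x : ℝ) :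
    P.block n u x = ∑ m ∈ Finset.Icc (n - 1) (n + 1), P.block n (P.block m u) x := by
  have h1 : ∀ η, P.mult n η = ∑ m ∈ Finset.Icc (n - 1) (n + 1), P.mult n η * P.mult m η := by
    intro η
    have h2 : HasSum (fun m => P.mult m η) 1 := by
      simpa [mult_apply] using (P.hasSum_symbol (2 * Real.pi * η)).mapL Complex.ofRealCLM
    have h3 : HasSum (fun m => P.mult n η * P.mult m η) (P.mult n η) := by
      simpa using h2.mul_left (P.mult n η)
    refine h3.unique (hasSum_sum_of_ne_finset_zero fun m hm => P.mult_mul_mult ?_ η)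
    rw [Finset.mem_Icc] at hm; omega
  simp only [P.block_block_eq_ift n _ hu, P.block_eq_ift n hu, ift]
  rw [← integral_finsetSum]
  · congr 1; ext η
    conv_lhs => rw [h1 η]
    rw [Finset.sum_mul, Finset.mul_sum]
  · intro m _
    refine ((P.integrable_mult_mul n (P.memLp_mult_mul m (memLp_ft u))).bdd_mul (c := 1)
      (f := fun η : ℝ => Complex.exp (2 * Real.pi * x * η * Complex.I))
      (Continuous.aestronglyMeasurable (by fun_prop))
      (Filter.Eventually.of_forall fun η => (norm_expI _ _).le)).congr
      (Filter.Eventually.of_forall fun η => ?_)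
    simp only; ring

theorem integral_mul_block_eq_sum (n : ℕ) {u w : ℝ → ℂ} (hu : MemLp u 2 volume)
    (hw : MemLp w 2 volume) :
    ∫ x, u x * P.reflect.block n w x =
      ∑ m ∈ Finset.Icc (n - 1) (n + 1), ∫ x, P.block m u x * P.reflect.block n w x := by
  rw [← P.integral_block_mul n hu hw]
  simp only [fun m => (P.integral_block_mul n (P.memLp_block m hu) hw).symm]
  rw [← integral_finsetSum]
  · congr 1; ext x
    rw [P.block_eq_sum_block_block n hu, Finset.sum_mul]
  · intro m _
    exact integrable_mul_of_memLp (P.memLp_block n (P.memLp_block m hu)) hw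

/-! ### Frequencies of products of blocks. -/

theorem memLp_block_mul_block (P Q : LPCouple) (p q : ℕ) {u v : ℝ → ℂ} (hu : MemLp u 2 volume)
    (hv : MemLp v 2 volume) : MemLp (fun x => P.block p u x * Q.block q v x) 2 volume := by
  obtain ⟨C, hC⟩ := P.norm_block_le p hu
  exact memLp_two_of_bound (P.memLp_block p hu).1 hC (Q.memLp_block q hv)

/-- The product of two functions of low frequency has no high frequencies. -/
theorem block_mul_eq_zero (P Q R : LPCouple) {p q r : ℕ} (hp : p + 3 ≤ r) (hq : q + 3 ≤ r)
    {u v : ℝ → ℂ} (hu : MemLp u 2 volume) (hv : MemLp v 2 volume) (x : ℝ) :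
    R.block r (fun y => P.block p u y * Q.block q v y) x = 0 := by
  set U : ℝ → ℂ := fun η => P.mult p η * ft u η with hU
  set V : ℝ → ℂ := fun η => Q.mult q η * ft v η with hV
  have hU1 : Integrable U := P.integrable_mult_mul p (memLp_ft u)
  have hV1 : Integrable V := Q.integrable_mult_mul q (memLp_ft v)
  -- Frequencies add: a sum has size at most (4/3)(2^p + 2^q) ≤ 2^r/3, below the inner radius
  -- (3/8)2^r of the block r.
  have key : ∀ η ζ : ℝ, P.mult p η * Q.mult q ζ * R.mult r (η + ζ) = 0 := by
    intro η ζ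
    by_contra hne
    have h1 := left_ne_zero_of_mul (left_ne_zero_of_mul hne)
    have h2 := right_ne_zero_of_mul (left_ne_zero_of_mul hne)
    have h3 := right_ne_zero_of_mul hne
    have e1 := P.abs_le_of_symbol_ne_zero (Complex.ofReal_ne_zero.1 h1)
    have e2 := Q.abs_le_of_symbol_ne_zero (Complex.ofReal_ne_zero.1 h2)
    have e3 := R.le_abs_of_symbol_ne_zero (by omega) (Complex.ofReal_ne_zero.1 h3)
    rw [mul_add] at e3
    have e4 := abs_add_le (2 * Real.pi * η) (2 * Real.pi * ζ)
    have e5 : (2 : ℝ) ^ (p + 3) ≤ 2 ^ r := pow_le_pow_right₀ (by norm_num) hp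
    have e6 : (2 : ℝ) ^ (q + 3) ≤ 2 ^ r := pow_le_pow_right₀ (by norm_num) hq
    have e7 : (0 : ℝ) < 2 ^ r := by positivity
    rw [pow_add] at e5 e6
    linarith
  have hK : Integrable fun y => R.kernel r (x - y) := (R.integrable_kernel r).comp_sub_left x
  have hexp : ∀ η : ℝ, AEStronglyMeasurable
      (fun y : ℝ => Complex.exp (2 * Real.pi * y * η * Complex.I)) volume :=
    fun η => Continuous.aestronglyMeasurable (by fun_prop)
  have hVb : AEStronglyMeasurable (ift V) volume := (continuous_ift hV1).aestronglyMeasurable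
  have hg : Integrable fun y => R.kernel r (x - y) * ift V y :=
    hK.mul_bdd hVb (Filter.Eventually.of_forall norm_ift_le)
  have hK2 : ∀ ξ : ℝ, ∫ y : ℝ, Complex.exp (2 * Real.pi * y * ξ * Complex.I) *
      R.kernel r (x - y) = Complex.exp (2 * Real.pi * x * ξ * Complex.I) * R.mult r ξ := by
    intro ξ
    rw [← integral_sub_left_eq_self _ volume x, ← R.ft_kernel, ift, ← integral_const_mul]
    congr 1; ext y
    rw [sub_sub_cancel, ← mul_assoc, ← Complex.exp_add]
    congr 2; push_cast; ring
  rw [block, P.block_eq_ift p hu, Q.block_eq_ift q hv]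
  calc ∫ y, R.kernel r (x - y) * (ift U y * ift V y)
      = ∫ y, (R.kernel r (x - y) * ift V y) * ift U y := by congr 1; ext y; ring
    _ = ∫ η, ift (fun y => R.kernel r (x - y) * ift V y) η * U η := integral_mul_ift hU1 hg
    _ = ∫ η : ℝ, (0 : ℂ) := by
      congr 1; ext η
      have h1 : ift (fun y => R.kernel r (x - y) * ift V y) η =
          ∫ ζ : ℝ, ift (fun y : ℝ => Complex.exp (2 * Real.pi * y * η * Complex.I) *
            R.kernel r (x - y)) ζ * V ζ := by
        rw [← integral_mul_ift hV1 (hK.bdd_mul (hexp η)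
          (Filter.Eventually.of_forall fun y => (norm_expI y η).le)), ift]
        congr 1; ext y
        rw [show (2 * Real.pi * η * y * Complex.I : ℂ) = 2 * Real.pi * y * η * Complex.I by ring]
        ring
      rw [h1, ← integral_mul_const]
      refine integral_eq_zero_of_ae (Filter.Eventually.of_forall fun ζ => ?_)
      have h2 : ift (fun y : ℝ => Complex.exp (2 * Real.pi * y * η * Complex.I) *
            R.kernel r (x - y)) ζ =
          Complex.exp (2 * Real.pi * x * (η + ζ : ℝ) * Complex.I) * R.mult r (η + ζ) := by
        rw [← hK2, ift]
        congr 1; ext y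
        rw [← mul_assoc, ← Complex.exp_add]
        congr 2; push_cast; ring
      simp only [h2, Pi.zero_apply, hU, hV]
      linear_combination (Complex.exp (2 * Real.pi * x * (η + ζ : ℝ) * Complex.I) * ft u η *
        ft v ζ) * key η ζ
    _ = 0 := by simp

theorem integral_block_mul_block_mul_block_eq_zero (P Q R : LPCouple) {p q r : ℕ}
    (hp : p + 3 ≤ r) (hq : q + 3 ≤ r) {u v w : ℝ → ℂ} (hu : MemLp u 2 volume)
    (hv : MemLp v 2 volume) (hw : MemLp w 2 volume) :
    ∫ x, P.block p u x * Q.block q v x * R.block r w x = 0 := by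
  have h := R.reflect.integral_block_mul r (memLp_block_mul_block P Q p q hu hv) hw
  rw [reflect_reflect] at h
  rw [← h]
  simp [block_mul_eq_zero P Q R.reflect hp hq hu hv]

/-- In `∫ u Δ_q v Δ_r w` with `q` much smaller than `r` only the frequencies of `u` close to `2^r`
matter. -/
theorem integral_mul_block_mul_block (P Q R : LPCouple) {q r : ℕ} (hq : q + 3 ≤ r)
    {u v w : ℝ → ℂ} (hu : MemLp u 2 volume) (hv : MemLp v 2 volume) (hw : MemLp w 2 volume) :
    ∫ x, u x * Q.block q v x * R.block r w x =
      ∑ p ∈ Finset.Icc (r - 2) (r + 2), ∫ x, P.block p u x * Q.block q v x * R.block r w x := by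
  have hvw := memLp_block_mul_block Q R q r hv hw
  have hint : ∀ f : ℝ → ℂ, MemLp f 2 volume →
      Integrable (fun x => f x * Q.block q v x * R.block r w x) := fun f hf => by
    simpa only [mul_assoc] using integrable_mul_of_memLp hf hvw
  have h1 : ∀ N, r + 3 ≤ N → ∫ x, P.lowPass N u x * Q.block q v x * R.block r w x =
      ∑ p ∈ Finset.Icc (r - 2) (r + 2),
        ∫ x, P.block p u x * Q.block q v x * R.block r w x := by
    intro N hN
    simp only [lowPass, Finset.sum_mul]
    rw [integral_finsetSum _ fun p _ => hint _ (P.memLp_block p hu)]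
    symm
    refine Finset.sum_subset (fun p hp => ?_) fun p _ hp => ?_
    · rw [Finset.mem_Icc] at hp; rw [Finset.mem_range]; omega
    · rw [Finset.mem_Icc] at hp
      -- For p outside [r - 2, r + 2] one of the three frequencies exceeds the other two by three: p
      -- itself if it is large, and r if p is small.
      rcases le_or_gt (r + 3) p with h | h
      · have := integral_block_mul_block_mul_block_eq_zero Q R P (p := q) (q := r) (r := p)
          (by omega) h hv hw hu
        rw [← this]
        congr 1; ext x; ring
      · exact integral_block_mul_block_mul_block_eq_zero P Q R (by omega) hq hu hv hw
  have h2 : Filter.Tendsto (fun N => ∫ x, P.lowPass N u x * Q.block q v x * R.block r w x)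
      Filter.atTop (nhds (∫ x, u x * Q.block q v x * R.block r w x)) := by
    rw [tendsto_iff_edist_tendsto_0]
    have h3 := ENNReal.Tendsto.mul_const (P.tendsto_lowPass hu)
      (b := eLpNorm (fun x => Q.block q v x * R.block r w x) 2 volume) (Or.inr hvw.2.ne)
    rw [zero_mul] at h3
    refine tendsto_of_tendsto_of_tendsto_of_le_of_le tendsto_const_nhds h3 (fun _ => bot_le) ?_
    intro N
    beta_reduce
    rw [edist_comm, edist_eq_enorm_sub, ← integral_sub (hint _ hu) (hint _ (P.memLp_lowPass N hu))]
    refine le_trans (le_of_eq ?_)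
      (enorm_integral_mul_le (hu.sub (P.memLp_lowPass N hu)).1 hvw.1)
    congr 2; ext x; ring
  refine tendsto_nhds_unique h2 (tendsto_const_nhds.congr' ?_)
  filter_upwards [Filter.eventually_ge_atTop (r + 3)] with N hN
  exact (h1 N hN).symm

end LPCouple

end Kac

namespace Kac

open Polynomial
open scoped ComplexConjugate

/-! ### Gaussian expectations of polynomials -/

theorem maxwellian_pos (v : ℝ) : 0 < maxwellian v := by unfold maxwellian; positivity

theorem hasDerivAt_maxwellian (v : ℝ) : HasDerivAt maxwellian (-v * maxwellian v) v := by
  have h : HasDerivAt (fun v : ℝ => -v ^ 2 / 2) (-v) v := by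
    have := ((hasDerivAt_id v).fun_pow 2).fun_neg.div_const 2
    exact this.congr_deriv (by simp; ring)
  have := h.exp.const_mul ((Real.sqrt (2 * Real.pi))⁻¹)
  exact this.congr_deriv (by rw [maxwellian]; ring)

theorem integrable_eval_mul_exp {b : ℝ} (hb : 0 < b) (p : ℝ[X]) :
    Integrable fun y : ℝ => p.eval y * Real.exp (-b * y ^ 2) := by
  induction p using Polynomial.induction_on' with
  | add p q hp hq =>
    simp only [eval_add, add_mul]
    exact hp.add hq
  | monomial n a =>
    have h := integrable_rpow_mul_exp_neg_mul_sq hb (s := n) (by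
      have : (0 : ℝ) ≤ n := n.cast_nonneg
      linarith)
    simp only [Real.rpow_natCast] at h
    simpa [mul_assoc] using h.const_mul a

theorem integrable_eval_mul_maxwellian (p : ℝ[X]) :
    Integrable fun y : ℝ => p.eval y * maxwellian y := by
  have h := (integrable_eval_mul_exp (b := 1 / 2) (by norm_num) p).const_mul
    ((Real.sqrt (2 * Real.pi))⁻¹)
  refine h.congr (Filter.Eventually.of_forall fun y => ?_)
  simp only [maxwellian]
  rw [show -y ^ 2 / 2 = -(1 / 2) * y ^ 2 by ring]; ring

/-- The expectation of a polynomial under the standard Gaussian law. -/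
noncomputable def gaussExp (p : ℝ[X]) : ℝ := ∫ y, p.eval y * maxwellian y

theorem gaussExp_add (p q : ℝ[X]) : gaussExp (p + q) = gaussExp p + gaussExp q := by
  simp only [gaussExp, eval_add, add_mul]
  exact integral_add (integrable_eval_mul_maxwellian p) (integrable_eval_mul_maxwellian q)

theorem gaussExp_C_mul (a : ℝ) (p : ℝ[X]) : gaussExp (C a * p) = a * gaussExp p := by
  simp only [gaussExp, eval_mul, eval_C, mul_assoc]
  exact integral_const_mul _ _

theorem gaussExp_neg (p : ℝ[X]) : gaussExp (-p) = -gaussExp p := by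
  simp only [gaussExp, eval_neg, neg_mul]
  exact integral_neg _

theorem gaussExp_sub (p q : ℝ[X]) : gaussExp (p - q) = gaussExp p - gaussExp q := by
  rw [sub_eq_add_neg, gaussExp_add, gaussExp_neg, sub_eq_add_neg]

theorem gaussExp_one : gaussExp 1 = 1 := by
  have h := integral_gaussian (1 / 2)
  have h2 : ∫ y : ℝ, maxwellian y = (Real.sqrt (2 * Real.pi))⁻¹ * Real.sqrt (Real.pi / (1 / 2)) := by
    rw [← h, ← integral_const_mul]
    congr 1; ext y
    rw [maxwellian, show -y ^ 2 / 2 = -(1 / 2) * y ^ 2 by ring]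
  simp only [gaussExp, eval_one, one_mul, h2]
  rw [show Real.pi / (1 / 2) = 2 * Real.pi by ring]
  exact inv_mul_cancel₀ (by positivity)

/-- Gaussian integration by parts. -/
theorem gaussExp_X_mul (p : ℝ[X]) : gaussExp (X * p) = gaussExp (derivative p) := by
  have hd : ∀ y : ℝ, HasDerivAt (fun y => p.eval y * maxwellian y)
      ((derivative p - X * p).eval y * maxwellian y) y := fun y => by
    have := (p.hasDerivAt y).fun_mul (hasDerivAt_maxwellian y)
    exact this.congr_deriv (by simp only [eval_sub, eval_mul, eval_X]; ring)
  have h := integral_eq_zero_of_hasDerivAt_of_integrable hd (integrable_eval_mul_maxwellian _)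
    (integrable_eval_mul_maxwellian _)
  have h2 : gaussExp (derivative p - X * p) = 0 := h
  rw [gaussExp_sub] at h2
  linarith

/-! ### Hermite polynomials -/

/-- The probabilists' Hermite polynomials with real coefficients. -/
noncomputable def He (n : ℕ) : ℝ[X] := (hermite n).map (Int.castRingHom ℝ)

theorem He_zero : He 0 = 1 := by simp [He]

theorem He_succ (n : ℕ) : He (n + 1) = X * He n - derivative (He n) := by
  simp [He, hermite_succ, derivative_map]

theorem aeval_hermite (n : ℕ) (v : ℝ) : aeval v (hermite n) = (He n).eval v := by
  rw [He, eval_map, aeval_def, algebraMap_int_eq]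

theorem derivative_He_succ (n : ℕ) : derivative (He (n + 1)) = C ((n : ℝ) + 1) * He n := by
  induction n with
  | zero => simp [He_succ, He_zero]
  | succ n ih =>
    rw [He_succ (n + 1), derivative_sub, derivative_mul, derivative_X, ih, derivative_C_mul]
    have := He_succ n
    have h2 : X * He n = He (n + 1) + derivative (He n) := by rw [this]; ring
    push_cast
    simp only [C_add, C_1]
    linear_combination (C (n : ℝ) + 1) * h2

theorem derivative_He (n : ℕ) : derivative (He n) = C (n : ℝ) * He (n - 1) := by
  cases n with
  | zero => simp [He_zero]
  | succ n => rw [derivative_He_succ]; simp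

theorem X_mul_He (n : ℕ) : X * He n = He (n + 1) + C (n : ℝ) * He (n - 1) := by
  rw [He_succ, derivative_He]; ring

/-- X - d/dx is the adjoint of d/dx for the Gaussian weight. -/
theorem gaussExp_He_succ_mul (m : ℕ) (p : ℝ[X]) :
    gaussExp (He (m + 1) * p) = gaussExp (He m * derivative p) := by
  rw [He_succ, sub_mul, gaussExp_sub, mul_assoc, gaussExp_X_mul, derivative_mul, gaussExp_add]
  ring

theorem gaussExp_He_mul_He (m n : ℕ) :
    gaussExp (He m * He n) = if m = n then (n.factorial : ℝ) else 0 := by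
  have h0 : gaussExp 0 = 0 := by simp [gaussExp]
  induction m generalizing n with
  | zero =>
    cases n with
    | zero => simp [He_zero, gaussExp_one]
    | succ n =>
      rw [mul_comm, gaussExp_He_succ_mul, He_zero]; simp [h0]
  | succ m ih =>
    cases n with
    | zero => rw [gaussExp_He_succ_mul, He_zero]; simp [h0]
    | succ n =>
      rw [gaussExp_He_succ_mul, derivative_He_succ]
      have : He m * (C ((n : ℝ) + 1) * He n) = C ((n : ℝ) + 1) * (He m * He n) := by ring
      rw [this, gaussExp_C_mul, ih]
      by_cases h : m = n
      · simp [h, Nat.factorial_succ]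
      · simp [h]

/-- The Gaussian average of a product of rotated Hermite polynomials. -/
theorem gaussExp_He_comp_mul_He_comp {c s : ℝ} (hcs : c ^ 2 + s ^ 2 = 1) (x : ℝ) (k l : ℕ) :
    gaussExp ((He k).comp (C (x * s) + C c * X) * (He l).comp (C (x * c) - C s * X)) =
      s ^ k * c ^ l * (He (k + l)).eval x := by
  set A : ℝ[X] := C (x * s) + C c * X with hA
  set B : ℝ[X] := C (x * c) - C s * X with hB
  have dA : derivative A = C c := by simp [hA]
  have dB : derivative B = -C s := by simp [hB]
  have dcA : ∀ n, derivative ((He n).comp A) = C (c * n) * (He (n - 1)).comp A := fun n => by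
    rw [derivative_comp, dA, derivative_He]; simp; ring
  have dcB : ∀ n, derivative ((He n).comp B) = -(C (s * n) * (He (n - 1)).comp B) := fun n => by
    rw [derivative_comp, dB, derivative_He]; simp; ring
  have cA : ∀ n, (He (n + 1)).comp A = A * (He n).comp A - C (n : ℝ) * (He (n - 1)).comp A :=
    fun n => by rw [He_succ, derivative_He]; simp
  have cB : ∀ n, (He (n + 1)).comp B = B * (He n).comp B - C (n : ℝ) * (He (n - 1)).comp B :=
    fun n => by rw [He_succ, derivative_He]; simp
  set F : ℕ → ℕ → ℝ := fun k l => gaussExp ((He k).comp A * (He l).comp B) with hF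
  -- The three-term recurrence of He combined with Gaussian integration by parts yields recurrences
  -- in k and l, where c² + s² = 1 merges the two terms in k - 1. The truncated subtractions are
  -- harmless, since those terms carry a factor k or l.
  have rec1 : ∀ k l, F (k + 1) l = x * s * F k l - s ^ 2 * k * F (k - 1) l -
      s * c * l * F k (l - 1) := by
    intro k l
    have e : (He (k + 1)).comp A * (He l).comp B =
        C (x * s) * ((He k).comp A * (He l).comp B) + C c * (X * ((He k).comp A * (He l).comp B))
          - C (k : ℝ) * ((He (k - 1)).comp A * (He l).comp B) := by
      rw [cA, hA]; ring
    have e2 : derivative ((He k).comp A * (He l).comp B) =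
        C (c * k) * ((He (k - 1)).comp A * (He l).comp B) -
          C (s * l) * ((He k).comp A * (He (l - 1)).comp B) := by
      rw [derivative_mul, dcA, dcB]; ring
    simp only [hF]
    rw [e, gaussExp_sub, gaussExp_add, gaussExp_C_mul, gaussExp_C_mul, gaussExp_C_mul,
      gaussExp_X_mul, e2, gaussExp_sub, gaussExp_C_mul, gaussExp_C_mul]
    linear_combination (k * gaussExp ((He (k - 1)).comp A * (He l).comp B)) * hcs
  have rec2 : ∀ l, F 0 (l + 1) = x * c * F 0 l - c ^ 2 * l * F 0 (l - 1) := by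
    intro l
    have e : (He 0).comp A * (He (l + 1)).comp B =
        C (x * c) * ((He 0).comp A * (He l).comp B) - C s * (X * ((He 0).comp A * (He l).comp B))
          - C (l : ℝ) * ((He 0).comp A * (He (l - 1)).comp B) := by
      rw [cB, hB]; ring
    have e2 : derivative ((He 0).comp A * (He l).comp B) =
          -(C (s * l) * ((He 0).comp A * (He (l - 1)).comp B)) := by
      rw [derivative_mul, dcB, He_zero]; simp
    simp only [hF]
    rw [e, gaussExp_sub, gaussExp_sub, gaussExp_C_mul, gaussExp_C_mul, gaussExp_C_mul,
      gaussExp_X_mul, e2, gaussExp_neg, gaussExp_C_mul]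
    linear_combination (l * gaussExp ((He 0).comp A * (He (l - 1)).comp B)) * hcs
  have ev : ∀ n : ℕ, (He (n + 1)).eval x = x * (He n).eval x - n * (He (n - 1)).eval x := by
    intro n; rw [He_succ, derivative_He]; simp
  have base : ∀ l, F 0 l = c ^ l * (He l).eval x := by
    intro l
    induction l using Nat.strong_induction_on with
    | _ l ih =>
      match l with
      | 0 => simp [hF, He_zero, gaussExp_one]
      | 1 => rw [rec2, ih 0 (by norm_num)]; simp [He_zero, He_succ]; ring
      | l + 2 =>
        have e1 := rec2 (l + 1)
        have e2 := ev (l + 1)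
        simp only [Nat.add_sub_cancel] at e1 e2
        rw [show l + 2 = l + 1 + 1 from rfl, e1, e2, ih (l + 1) (by omega), ih l (by omega)]
        push_cast; ring
  change F k l = _
  induction k using Nat.strong_induction_on generalizing l with
  | _ k ih =>
    match k with
    | 0 => rw [base]; simp
    | k + 1 =>
      rw [rec1, ih k (by omega), show k + 1 + l = (k + l) + 1 by ring, ev]
      rcases k with _ | k <;> rcases l with _ | l
      · simp; ring
      · have h1 := ih 0 (by omega) l
        simp only [Nat.add_sub_cancel, h1]
        simp only [zero_add, Nat.add_sub_cancel]; push_cast; ring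
      · have h1 := ih k (by omega) 0
        simp only [Nat.add_sub_cancel, h1]
        simp only [add_zero, Nat.add_sub_cancel]; push_cast; ring
      · have h1 := ih k (by omega) (l + 1)
        have h2 := ih (k + 1) (by omega) l
        simp only [Nat.add_sub_cancel, h1, h2]
        rw [show k + 1 + (l + 1) - 1 = k + 1 + l by omega, show k + (l + 1) = k + 1 + l by omega]
        push_cast; ring

/-! ### Hermite functions -/

/-- The square root of the Maxwellian. -/
noncomputable def sqrtMu (v : ℝ) : ℝ := Real.sqrt (maxwellian v)

theorem sqrtMu_pos (v : ℝ) : 0 < sqrtMu v := Real.sqrt_pos.2 (maxwellian_pos v)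

theorem sqrtMu_mul_self (v : ℝ) : sqrtMu v * sqrtMu v = maxwellian v :=
  Real.mul_self_sqrt (maxwellian_pos v).le

theorem sqrtMu_eq (v : ℝ) :
    sqrtMu v = Real.sqrt (Real.sqrt (2 * Real.pi))⁻¹ * Real.exp (-(1 / 4) * v ^ 2) := by
  rw [sqrtMu, maxwellian, Real.sqrt_mul (by positivity)]
  congr 1
  rw [Real.sqrt_eq_iff_mul_self_eq (by positivity) (by positivity), ← Real.exp_add]
  congr 1; ring

theorem contDiff_sqrtMu : ContDiff ℝ ∞ sqrtMu := by
  have : sqrtMu = fun v => Real.sqrt (Real.sqrt (2 * Real.pi))⁻¹ *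
    Real.exp (-(1 / 4) * v ^ 2) := funext sqrtMu_eq
  rw [this]; fun_prop

theorem continuous_sqrtMu : Continuous sqrtMu := contDiff_sqrtMu.continuous

theorem hasDerivAt_sqrtMu (v : ℝ) : HasDerivAt sqrtMu (-(v / 2) * sqrtMu v) v := by
  have : sqrtMu = fun v => Real.sqrt (Real.sqrt (2 * Real.pi))⁻¹ *
    Real.exp (-(1 / 4) * v ^ 2) := funext sqrtMu_eq
  have h : HasDerivAt (fun v : ℝ => -(1 / 4) * v ^ 2) (-(v / 2)) v := by
    have := ((hasDerivAt_id v).fun_pow 2).const_mul (-(1 / 4) : ℝ)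
    exact this.congr_deriv (by simp; ring)
  rw [this]
  exact (h.exp.const_mul (Real.sqrt (Real.sqrt (2 * Real.pi))⁻¹)).congr_deriv (by ring)

theorem hermiteFun_eq (n : ℕ) (v : ℝ) :
    hermiteFun n v = (Real.sqrt (n.factorial : ℝ))⁻¹ * (He n).eval v * sqrtMu v := by
  rw [hermiteFun, aeval_hermite, sqrtMu]

theorem hermiteFun_zero (v : ℝ) : hermiteFun 0 v = sqrtMu v := by
  simp [hermiteFun_eq, He_zero]

theorem continuous_hermiteFun (n : ℕ) : Continuous (hermiteFun n) := by
  rw [funext (hermiteFun_eq n)]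
  exact (continuous_const.mul (He n).continuous).mul continuous_sqrtMu

theorem integral_hermiteFun_mul (m n : ℕ) :
    ∫ v, hermiteFun m v * hermiteFun n v = if m = n then 1 else 0 := by
  have h := gaussExp_He_mul_He m n
  have h2 : ∫ v, hermiteFun m v * hermiteFun n v =
      (Real.sqrt (m.factorial : ℝ))⁻¹ * (Real.sqrt (n.factorial : ℝ))⁻¹ *
        gaussExp (He m * He n) := by
    rw [gaussExp, ← integral_const_mul]
    congr 1; ext v
    rw [hermiteFun_eq, hermiteFun_eq, ← sqrtMu_mul_self, eval_mul]; ring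
  rw [h2, h]
  split_ifs with hmn
  · subst hmn
    have : (0 : ℝ) < m.factorial := by positivity
    rw [← mul_inv, Real.mul_self_sqrt this.le, inv_mul_cancel₀ this.ne']
  · simp

theorem memLp_ofReal_of_integrable_sq {f : ℝ → ℝ} (hc : Continuous f)
    (hf : Integrable fun v => f v ^ 2) : MemLp (fun v => (f v : ℂ)) 2 volume :=
  ((memLp_two_iff_integrable_sq hc.aestronglyMeasurable).2 hf).ofReal

theorem memLp_hermiteFun (n : ℕ) : MemLp (fun v => (hermiteFun n v : ℂ)) 2 volume := by
  refine memLp_ofReal_of_integrable_sq (continuous_hermiteFun n) ?_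
  have h := (integrable_eval_mul_maxwellian (He n * He n)).const_mul
    ((Real.sqrt (n.factorial : ℝ))⁻¹ ^ 2)
  refine h.congr (Filter.Eventually.of_forall fun v => ?_)
  simp only [hermiteFun_eq, ← sqrtMu_mul_self, eval_mul]; ring

theorem memLp_sqrtMu_mul_eval (p : ℝ[X]) :
    MemLp (fun v => ((sqrtMu v * p.eval v : ℝ) : ℂ)) 2 volume := by
  refine memLp_ofReal_of_integrable_sq (continuous_sqrtMu.mul p.continuous) ?_
  refine (integrable_eval_mul_maxwellian (p * p)).congr (Filter.Eventually.of_forall fun v => ?_)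
  simp only [← sqrtMu_mul_self, eval_mul]; ring

/-- A square integrable function orthogonal to all Hermite functions vanishes. -/
theorem ae_eq_zero_of_integral_mul_hermiteFun {f : ℝ → ℂ} (hf : MemLp f 2 volume)
    (h : ∀ n, ∫ v, f v * (hermiteFun n v : ℂ) = 0) : f =ᵐ[volume] 0 := by
  set G : ℝ → ℂ := fun v => (sqrtMu v : ℂ) * f v with hG
  have hint : ∀ p : ℝ[X], Integrable fun v => G v * ((p.eval v : ℝ) : ℂ) := fun p => by
    refine (integrable_mul_of_memLp hf (memLp_sqrtMu_mul_eval p)).congr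
      (Filter.Eventually.of_forall fun v => ?_)
    simp only [hG]; push_cast; ring
  have h0 : ∀ n, ∫ v, G v * (((He n).eval v : ℝ) : ℂ) = 0 := fun n => by
    have h1 : ∫ v, G v * (((He n).eval v : ℝ) : ℂ) =
        (Real.sqrt (n.factorial : ℝ) : ℂ) * ∫ v, f v * (hermiteFun n v : ℂ) := by
      rw [← integral_const_mul]
      congr 1; ext v
      have : (Real.sqrt (n.factorial : ℝ) : ℂ) ≠ 0 := by
        rw [Complex.ofReal_ne_zero]; positivity
      rw [hermiteFun_eq]; simp only [hG]; push_cast; field_simp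
    rw [h1, h, mul_zero]
  -- Multiplication by X stays in the span of the Hermite polynomials (`X_mul_He`), so all moments
  -- of √μ f vanish.
  have h1 : ∀ j n : ℕ, ∫ v, G v * (((X ^ j * He n).eval v : ℝ) : ℂ) = 0 := by
    intro j
    induction j with
    | zero => intro n; simpa using h0 n
    | succ j ih =>
      intro n
      have e : X ^ (j + 1) * He n = X ^ j * He (n + 1) + C (n : ℝ) * (X ^ j * He (n - 1)) := by
        rw [pow_succ, mul_assoc, X_mul_He]; ring
      have e2 : ∀ v, G v * (((X ^ (j + 1) * He n).eval v : ℝ) : ℂ) = G v * (((X ^ j * He (n + 1)).eval v : ℝ) : ℂ)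
          + (n : ℂ) * (G v * (((X ^ j * He (n - 1)).eval v : ℝ) : ℂ)) := fun v => by
        rw [e, eval_add, eval_mul (p := C (n : ℝ)), eval_C]; push_cast; ring
      simp only [e2]
      rw [integral_add (hint _) ((hint _).const_mul _), integral_const_mul, ih, ih]; simp
  have h2 : ∀ j : ℕ, ∫ v, G v * (v : ℂ) ^ j = 0 := fun j => by
    have := h1 j 0
    simpa [He_zero] using this
  have hG1 : Integrable G := by simpa using hint 1
  have hb : ∀ v, ‖(sqrtMu v : ℂ)‖ ≤ Real.sqrt (Real.sqrt (2 * Real.pi))⁻¹ := fun v => by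
    rw [Complex.norm_real, Real.norm_of_nonneg (sqrtMu_pos v).le, sqrtMu_eq]
    refine mul_le_of_le_one_right (by positivity) (Real.exp_le_one_iff.2 ?_)
    nlinarith [sq_nonneg v]
  have hG2 : MemLp G 2 volume := memLp_two_of_bound
    (Complex.continuous_ofReal.comp continuous_sqrtMu).aestronglyMeasurable hb hf
  -- The Fourier integral of √μ f is the sum of its moment series. Termwise integration is justified
  -- by √μ e^{|av|} ∈ L², and every term is zero.
  have hzero : ∀ x, ift G x = 0 := by
    intro x
    set a : ℝ := 2 * Real.pi * x with ha
    have hdom : MemLp (fun v => ((sqrtMu v * Real.exp |a * v| : ℝ) : ℂ)) 2 volume := by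
      refine memLp_ofReal_of_integrable_sq (continuous_sqrtMu.mul (by fun_prop)) ?_
      have hi := (integrable_eval_mul_exp (b := 1 / 4) (by norm_num) 1).const_mul
        ((Real.sqrt (2 * Real.pi))⁻¹ * Real.exp (4 * a ^ 2))
      refine hi.mono' (Continuous.aestronglyMeasurable
        ((continuous_sqrtMu.mul (by fun_prop)).pow 2)) (Filter.Eventually.of_forall fun v => ?_)
      rw [Real.norm_of_nonneg (by positivity), mul_pow, pow_two (sqrtMu v), sqrtMu_mul_self,
        maxwellian, eval_one, one_mul]
      -- Completing the square: 2|a||v| ≤ v²/4 + 4a².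
      have key : Real.exp (-v ^ 2 / 2) * Real.exp |a * v| ^ 2 ≤
          Real.exp (4 * a ^ 2) * Real.exp (-(1 / 4) * v ^ 2) := by
        rw [← Real.exp_nat_mul, ← Real.exp_add, ← Real.exp_add, Real.exp_le_exp, abs_mul]
        push_cast
        nlinarith [sq_nonneg (|v| / 2 - 2 * |a|), sq_abs v, sq_abs a]
      calc _ = (Real.sqrt (2 * Real.pi))⁻¹ * (Real.exp (-v ^ 2 / 2) * Real.exp |a * v| ^ 2) := by
            ring
        _ ≤ _ := mul_le_mul_of_nonneg_left key (by positivity)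
        _ = _ := by ring
    have hdi : Integrable fun v => ‖G v‖ * Real.exp |a * v| := by
      refine (integrable_mul_of_memLp hf hdom).norm.congr (Filter.Eventually.of_forall fun v => ?_)
      simp only [hG, norm_mul, Complex.norm_real, Complex.ofReal_mul, Real.norm_eq_abs,
        Real.abs_exp]
      ring
    have hs := hasSum_integral_of_dominated_convergence (μ := volume)
      (F := fun (j : ℕ) (v : ℝ) => ((a : ℂ) * Complex.I) ^ j / (j.factorial : ℂ) * (G v * (v : ℂ) ^ j))
      (f := fun v => Complex.exp (2 * Real.pi * x * v * Complex.I) * G v)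
      (fun j v => ‖G v‖ * (|a * v| ^ j / j.factorial)) ?_ ?_ ?_ ?_ ?_
    · refine (hs.unique ?_ :)
      simp only [integral_const_mul, h2, mul_zero]
      exact hasSum_zero
    · intro j
      exact ((hG1.1.mul (Continuous.aestronglyMeasurable (by fun_prop))).const_mul _)
    · intro j
      refine Filter.Eventually.of_forall fun v => le_of_eq ?_
      simp only [norm_mul, norm_div, norm_pow, Complex.norm_real, Complex.norm_I,
        Complex.norm_natCast, abs_mul, mul_pow, Real.norm_eq_abs]
      ring
    · exact Filter.Eventually.of_forall fun v =>
        (Real.summable_pow_div_factorial _).mul_left _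
    · refine hdi.congr (Filter.Eventually.of_forall fun v => ?_)
      simp only [tsum_mul_left]
      congr 1
      rw [Real.exp_eq_exp_ℝ, NormedSpace.exp_eq_tsum_div]
    · refine Filter.Eventually.of_forall fun v => ?_
      have h3 := (NormedSpace.expSeries_div_hasSum_exp (𝔸 := ℂ) ((a : ℂ) * Complex.I * v)).mul_right (G v)
      rw [← Complex.exp_eq_exp_ℂ] at h3
      have e : (2 * Real.pi * x * v * Complex.I : ℂ) = (a : ℂ) * Complex.I * v := by
        rw [ha]; push_cast; ring
      rw [e]
      have e2 : ∀ j : ℕ, ((a : ℂ) * Complex.I) ^ j / (j.factorial : ℂ) * (G v * (v : ℂ) ^ j) =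
          ((a : ℂ) * Complex.I * v) ^ j / (j.factorial : ℂ) * G v := fun j => by
        rw [mul_pow _ (v : ℂ)]; ring
      simpa only [e2] using h3
  have h5 := ft_ift hG1 hG2
  have h6 : ift G = fun _ => 0 := funext hzero
  have h7 : ft (fun _ : ℝ => (0 : ℂ)) =ᵐ[volume] 0 := by
    have := eLpNorm_ft (u := fun _ : ℝ => (0 : ℂ)) MemLp.zero
    rw [eLpNorm_zero'] at this
    exact (eLpNorm_eq_zero_iff (memLp_ft _).1 (by norm_num)).1 this
  rw [h6] at h5
  filter_upwards [h5, h7] with v e1 e2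
  have : G v = 0 := by rw [← e1, e2]; rfl
  rcases mul_eq_zero.1 this with h8 | h8
  · exact absurd (Complex.ofReal_eq_zero.1 h8) (sqrtMu_pos v).ne'
  · exact h8

/-! ### Hermite coefficients -/

/-- The Hermite coefficients of a function on the line. -/
noncomputable def coef (n : ℕ) (u : ℝ → ℂ) : ℂ := ∫ v, u v * (hermiteFun n v : ℂ)

/-- The Hermite functions as elements of `L²`. -/
noncomputable def hermiteLp (n : ℕ) : Lp ℂ 2 (volume : Measure ℝ) := (memLp_hermiteFun n).toLp _

theorem inner_hermiteLp (n : ℕ) (f : Lp ℂ 2 (volume : Measure ℝ)) :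
    inner ℂ (hermiteLp n) f = coef n f := by
  rw [L2.inner_def, coef]
  apply integral_congr_ae
  filter_upwards [(memLp_hermiteFun n).coeFn_toLp] with v hv
  rw [hermiteLp, hv, RCLike.inner_apply, Complex.conj_ofReal]

theorem coef_congr (n : ℕ) {u w : ℝ → ℂ} (h : u =ᵐ[volume] w) : coef n u = coef n w :=
  integral_congr_ae (h.mono fun v hv => by simp only [hv])

theorem coef_hermiteFun (m n : ℕ) :
    coef m (fun v => (hermiteFun n v : ℂ)) = if m = n then 1 else 0 := by
  have h : ∀ v, (hermiteFun n v : ℂ) * (hermiteFun m v : ℂ) =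
    ((hermiteFun m v * hermiteFun n v : ℝ) : ℂ) := fun v => by push_cast; ring
  simp only [coef, h]
  rw [integral_complex_ofReal, integral_hermiteFun_mul]
  split_ifs <;> simp

theorem orthonormal_hermiteLp : Orthonormal ℂ hermiteLp := by
  rw [orthonormal_iff_ite]
  intro m n
  rw [inner_hermiteLp, ← coef_hermiteFun m n]
  exact coef_congr _ (memLp_hermiteFun n).coeFn_toLp

/-- The Hermite basis of `L²`. -/
noncomputable def hermiteBasis : HilbertBasis ℕ ℂ (Lp ℂ 2 (volume : Measure ℝ)) :=
  HilbertBasis.mkOfOrthogonalEqBot orthonormal_hermiteLp (by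
    rw [Submodule.eq_bot_iff]
    intro f hf
    rw [Lp.eq_zero_iff_ae_eq_zero]
    refine ae_eq_zero_of_integral_mul_hermiteFun (Lp.memLp f) fun n => ?_
    have := (Submodule.mem_orthogonal _ _).1 hf (hermiteLp n)
      (Submodule.subset_span (mem_range_self n))
    rwa [inner_hermiteLp] at this)

theorem hermiteBasis_apply (n : ℕ) : hermiteBasis n = hermiteLp n := by
  rw [hermiteBasis, HilbertBasis.coe_mkOfOrthogonalEqBot]

theorem hermiteBasis_repr {u : ℝ → ℂ} (hu : MemLp u 2 volume) (n : ℕ) :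
    hermiteBasis.repr (hu.toLp u) n = coef n u := by
  rw [HilbertBasis.repr_apply_apply, hermiteBasis_apply, inner_hermiteLp]
  exact coef_congr n hu.coeFn_toLp

theorem conj_coef (n : ℕ) (u : ℝ → ℂ) : conj (coef n u) = coef n (fun v => conj (u v)) := by
  rw [coef, coef, ← integral_conj]
  congr 1; ext v; simp

/-- Parseval's identity for the Hermite expansion. -/
theorem hasSum_coef_mul_coef {u w : ℝ → ℂ} (hu : MemLp u 2 volume) (hw : MemLp w 2 volume) :
    HasSum (fun n => coef n u * coef n w) (∫ v, u v * w v) := by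
  have hc := memLp_conj hu
  have h := hermiteBasis.hasSum_inner_mul_inner (hc.toLp _) (hw.toLp w)
  have e : inner ℂ (hc.toLp _) (hw.toLp w) = ∫ v, u v * w v := by
    rw [L2.inner_def]
    apply integral_congr_ae
    filter_upwards [hc.coeFn_toLp, hw.coeFn_toLp] with v h1 h2
    rw [h1, h2, RCLike.inner_apply, Complex.conj_conj, mul_comm]
  rw [e] at h
  have e2 : ∀ n, inner ℂ (hc.toLp _) (hermiteBasis n) * inner ℂ (hermiteBasis n) (hw.toLp w) =
      coef n u * coef n w := fun n => by
    rw [hermiteBasis_apply, inner_hermiteLp, coef_congr n hw.coeFn_toLp, ← inner_conj_symm,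
      inner_hermiteLp, coef_congr n hc.coeFn_toLp, conj_coef]
    simp
  simpa only [e2] using h

theorem tsum_enorm_coef_sq {u : ℝ → ℂ} (hu : MemLp u 2 volume) :
    ∑' n, ‖coef n u‖ₑ ^ 2 = ∫⁻ v, ‖u v‖ₑ ^ 2 := by
  have h := hasSum_coef_mul_coef (memLp_conj hu) hu
  have e1 : ∀ n, coef n (fun v => conj (u v)) * coef n u = ((‖coef n u‖ ^ 2 : ℝ) : ℂ) := fun n => by
    rw [← conj_coef, Complex.conj_mul']; push_cast; rfl
  have e2 : ∫ v, conj (u v) * u v = ((∫ v, ‖u v‖ ^ 2 : ℝ) : ℂ) := by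
    rw [← integral_complex_ofReal]
    congr 1; ext v; rw [Complex.conj_mul']; push_cast; rfl
  simp only [e1, e2] at h
  have h' := Complex.hasSum_ofReal.1 h
  have h3 : ∑' n, ‖coef n u‖ₑ ^ 2 = ∑' n, ENNReal.ofReal (‖coef n u‖ ^ 2) := by
    congr 1; ext n; rw [ENNReal.ofReal_pow (norm_nonneg _), ofReal_norm]
  rw [h3, ← ENNReal.ofReal_tsum_of_nonneg (fun n => by positivity) h'.summable, h'.tsum_eq,
    ofReal_integral_eq_lintegral_ofReal ((memLp_two_iff_integrable_sq_norm hu.1).1 hu)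
      (Filter.Eventually.of_forall fun v => by positivity)]
  congr 1; ext v; rw [ENNReal.ofReal_pow (norm_nonneg _), ofReal_norm]

/-- The partial sums of the Hermite expansion. -/
noncomputable def hermiteSum (N : ℕ) (u : ℝ → ℂ) (v : ℝ) : ℂ :=
  ∑ n ∈ Finset.range N, coef n u * (hermiteFun n v : ℂ)

theorem memLp_hermiteSum (N : ℕ) (u : ℝ → ℂ) : MemLp (hermiteSum N u) 2 volume :=
  memLp_finsetSum _ fun n _ => (memLp_hermiteFun n).const_mul _

theorem tendsto_hermiteSum {u : ℝ → ℂ} (hu : MemLp u 2 volume) :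
    Filter.Tendsto (fun N => eLpNorm (fun v => u v - hermiteSum N u v) 2 volume)
      Filter.atTop (nhds 0) := by
  have h := (hermiteBasis.hasSum_repr (hu.toLp u)).tendsto_sum_nat
  rw [tendsto_iff_edist_tendsto_0] at h
  refine h.congr fun N => ?_
  have e : ∑ n ∈ Finset.range N, hermiteBasis.repr (hu.toLp u) n • hermiteBasis n =
      (memLp_hermiteSum N u).toLp (hermiteSum N u) := by
    have : (memLp_hermiteSum N u).toLp (hermiteSum N u) = ∑ n ∈ Finset.range N,
        ((memLp_hermiteFun n).const_mul (coef n u)).toLp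
          (fun v => coef n u * (hermiteFun n v : ℂ)) := by
      apply Lp.ext
      refine (MemLp.coeFn_toLp _).trans ?_
      refine Filter.EventuallyEq.trans ?_ (Lp.coeFn_finsetSum _ _).symm
      have : ∀ n, ((memLp_hermiteFun n).const_mul (coef n u)).toLp
          (fun v => coef n u * (hermiteFun n v : ℂ)) =ᵐ[volume]
            fun v => coef n u * (hermiteFun n v : ℂ) := fun n => MemLp.coeFn_toLp _
      filter_upwards [ae_all_iff.2 this] with v hv
      simp [hermiteSum, hv]
    rw [this]
    refine Finset.sum_congr rfl fun n _ => ?_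
    rw [hermiteBasis_repr hu, hermiteBasis_apply, hermiteLp, ← MemLp.toLp_const_smul]
    rfl
  rw [e, edist_comm, Lp.edist_toLp_toLp]
  rfl

/-! ### The harmonic oscillator on test functions -/

theorem hasDerivAt_hermiteFun (n : ℕ) (v : ℝ) : HasDerivAt (hermiteFun n)
    ((Real.sqrt (n.factorial : ℝ))⁻¹ * (derivative (He n) - C (1 / 2) * (X * He n)).eval v *
      sqrtMu v) v := by
  rw [funext (hermiteFun_eq n)]
  have := (((He n).hasDerivAt v).const_mul (Real.sqrt (n.factorial : ℝ))⁻¹).fun_mul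
    (hasDerivAt_sqrtMu v)
  refine this.congr_deriv ?_
  simp only [eval_sub, eval_mul, eval_C, eval_X]; ring

/-- Hermite's equation He'' = X He' - n He in disguise: with the previous derivative it says that
e_n is an eigenfunction of the oscillator with eigenvalue n + 1/2. -/
theorem hasDerivAt_hermiteFun' (n : ℕ) (v : ℝ) : HasDerivAt (fun v =>
    (Real.sqrt (n.factorial : ℝ))⁻¹ * (derivative (He n) - C (1 / 2) * (X * He n)).eval v *
      sqrtMu v) ((v ^ 2 / 4 - (n + 1 / 2)) * hermiteFun n v) v := by
  have := (((derivative (He n) - C (1 / 2) * (X * He n)).hasDerivAt v).const_mul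
    (Real.sqrt (n.factorial : ℝ))⁻¹).fun_mul (hasDerivAt_sqrtMu v)
  refine this.congr_deriv ?_
  rw [hermiteFun_eq]
  have h2 : derivative (derivative (He n)) = X * derivative (He n) - C (n : ℝ) * He n := by
    cases n with
    | zero => simp [He_zero]
    | succ n =>
      have h3 := He_succ n
      rw [derivative_He_succ, derivative_C_mul]
      push_cast
      rw [h3]; ring
  simp only [derivative_sub, derivative_mul, derivative_X, derivative_C, h2, eval_sub, eval_zero,
    eval_mul, eval_add, eval_C, eval_X, eval_one]
  ring

/-- The harmonic oscillator `-ψ'' + v² ψ / 4`. -/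
noncomputable def oscillator (ψ : ℝ → ℂ) (v : ℝ) : ℂ := -deriv (deriv ψ) v + v ^ 2 / 4 * ψ v

/-- Green's identity: the Wronskian ψ' e_n - ψ e_n' has compact support, so its derivative
integrates to zero. -/
theorem coef_oscillator {ψ : ℝ → ℂ} (hψ : ContDiff ℝ ∞ ψ) (hs : HasCompactSupport ψ) (n : ℕ) :
    coef n (oscillator ψ) = ((n : ℂ) + 1 / 2) * coef n ψ := by
  set e' : ℝ → ℝ := fun v => (Real.sqrt (n.factorial : ℝ))⁻¹ *
    (derivative (He n) - C (1 / 2) * (X * He n)).eval v * sqrtMu v with he'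
  have hd1 : ContDiff ℝ ∞ (deriv ψ) := ((contDiff_infty_iff_deriv (𝕜 := ℝ)).1 hψ).2
  have hd2 : ContDiff ℝ ∞ (deriv (deriv ψ)) := ((contDiff_infty_iff_deriv (𝕜 := ℝ)).1 hd1).2
  have he'c : Continuous e' := (continuous_const.mul (Polynomial.continuous _)).mul continuous_sqrtMu
  have hc := continuous_hermiteFun n
  have hW : ∀ v, HasDerivAt (fun v => deriv ψ v * (hermiteFun n v : ℂ) - ψ v * (e' v : ℂ))
      (deriv (deriv ψ) v * (hermiteFun n v : ℂ) -
        ψ v * (((v ^ 2 / 4 - (n + 1 / 2)) * hermiteFun n v : ℝ) : ℂ)) v := by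
    intro v
    have h1 := ((hψ.differentiable (by simp)) v).hasDerivAt
    have h2 := ((hd1.differentiable (by simp)) v).hasDerivAt
    have h3 := (hasDerivAt_hermiteFun n v).ofReal_comp
    have h4 := (hasDerivAt_hermiteFun' n v).ofReal_comp
    exact ((h2.fun_mul h3).fun_sub (h1.fun_mul h4)).congr_deriv (by ring)
  have i1 : ∀ f : ℝ → ℂ, Continuous f → ∀ g : ℝ → ℂ, Continuous g → HasCompactSupport f →
      Integrable fun v => f v * g v := fun f hf g hg hfs =>
    (hf.mul hg).integrable_of_hasCompactSupport hfs.mul_right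
  have hs1 := hs.deriv
  have hs2 := hs1.deriv
  have c1 : Continuous fun v => (hermiteFun n v : ℂ) := Complex.continuous_ofReal.comp hc
  have c2 : Continuous fun v => (e' v : ℂ) := Complex.continuous_ofReal.comp he'c
  have c3 : Continuous fun v : ℝ => (((v ^ 2 / 4 - (n + 1 / 2)) * hermiteFun n v : ℝ) : ℂ) :=
    Complex.continuous_ofReal.comp ((by fun_prop : Continuous fun v : ℝ =>
      v ^ 2 / 4 - ((n : ℝ) + 1 / 2)).mul hc)
  have I1 := i1 _ hd2.continuous _ c1 hs2
  have I2 := i1 _ hψ.continuous _ c3 hs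
  have h0 := integral_eq_zero_of_hasDerivAt_of_integrable hW (I1.sub I2)
    ((i1 _ hd1.continuous _ c1 hs1).sub (i1 _ hψ.continuous _ c2 hs))
  rw [integral_sub I1 I2, sub_eq_zero] at h0
  have I3 := i1 _ hψ.continuous (fun v : ℝ => (v ^ 2 / 4 * hermiteFun n v : ℂ)) (by fun_prop) hs
  calc coef n (oscillator ψ)
      = ∫ v, (ψ v * (v ^ 2 / 4 * hermiteFun n v : ℂ) -
          deriv (deriv ψ) v * (hermiteFun n v : ℂ)) := by
        rw [coef]; congr 1; ext v; rw [oscillator]; ring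
    _ = ∫ v, (ψ v * (v ^ 2 / 4 * hermiteFun n v : ℂ) -
          ψ v * (((v ^ 2 / 4 - (n + 1 / 2)) * hermiteFun n v : ℝ) : ℂ)) := by
        rw [integral_sub I3 I1, h0, integral_sub I3 I2]
    _ = _ := by
        rw [coef, ← integral_const_mul]
        congr 1; ext v; push_cast; ring

theorem continuous_oscillator {ψ : ℝ → ℂ} (hψ : ContDiff ℝ ∞ ψ) : Continuous (oscillator ψ) := by
  have hd1 : ContDiff ℝ ∞ (deriv ψ) := ((contDiff_infty_iff_deriv (𝕜 := ℝ)).1 hψ).2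
  have hd2 : ContDiff ℝ ∞ (deriv (deriv ψ)) := ((contDiff_infty_iff_deriv (𝕜 := ℝ)).1 hd1).2
  have := hψ.continuous
  have := hd2.continuous
  unfold oscillator
  fun_prop

theorem hasCompactSupport_oscillator {ψ : ℝ → ℂ} (hs : HasCompactSupport ψ) :
    HasCompactSupport (oscillator ψ) :=
  (hs.deriv.deriv.comp_left (g := Neg.neg) neg_zero).add hs.mul_left

end Kac

namespace Kac

/-! ### Moments of the cross section -/

/-- The interval of deviation angles. -/
def angles : Set ℝ := Icc (-(Real.pi / 4)) (Real.pi / 4)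

theorem measurableSet_angles : MeasurableSet angles := measurableSet_Icc

theorem abs_le_of_mem_angles {θ : ℝ} (h : θ ∈ angles) : |θ| ≤ Real.pi / 4 := abs_le.2 h

theorem abs_le_one_of_mem_angles {θ : ℝ} (h : θ ∈ angles) : |θ| ≤ 1 := by
  have := abs_le_of_mem_angles h
  linarith [Real.pi_le_four]

theorem cos_nonneg_of_mem_angles {θ : ℝ} (h : θ ∈ angles) : 0 ≤ Real.cos θ := by
  have h1 := abs_le_of_mem_angles h
  have h2 := abs_le.1 h1
  exact Real.cos_nonneg_of_neg_pi_div_two_le_of_le (by linarith [Real.pi_pos]) (by linarith [Real.pi_pos])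

theorem crossSection_nonneg (s θ : ℝ) : 0 ≤ crossSection s θ := by unfold crossSection; positivity

theorem measurable_crossSection (s : ℝ) : Measurable (crossSection s) := by
  unfold crossSection
  exact (by fun_prop : Measurable fun θ : ℝ => |Real.cos (θ / 2)|).div
    ((by fun_prop : Measurable fun θ : ℝ => |Real.sin (θ / 2)|).pow_const _)

theorem crossSection_le {s : ℝ} (hs0 : 0 < s) (hs1 : s < 1) {θ : ℝ} (h : θ ∈ angles) :
    crossSection s θ ≤ 64 * |θ| ^ (-1 - 2 * s) := by
  -- At θ = 0 both sides are 0 by convention: the left is a division by zero, the right a nonzero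
  -- power of zero.
  rcases eq_or_ne θ 0 with rfl | hθ
  · simp only [crossSection, zero_div, Real.sin_zero, abs_zero]
    rw [Real.zero_rpow (by linarith), Real.zero_rpow (by linarith)]; simp
  have h1 := abs_le_of_mem_angles h
  have h0 : 0 < |θ| := abs_pos.2 hθ
  have h2 : |θ| / 4 ≤ |Real.sin (θ / 2)| := by
    have := Real.mul_abs_le_abs_sin (x := θ / 2) (by rw [abs_div]; norm_num; linarith [Real.pi_pos])
    refine le_trans ?_ this
    rw [abs_div, abs_two, show 2 / Real.pi * (|θ| / 2) = |θ| / Real.pi by ring]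
    gcongr
    exact Real.pi_le_four
  have h3 : (|θ| / 4) ^ (1 + 2 * s) ≤ |Real.sin (θ / 2)| ^ (1 + 2 * s) :=
    Real.rpow_le_rpow (by positivity) h2 (by linarith)
  calc crossSection s θ ≤ 1 / (|θ| / 4) ^ (1 + 2 * s) := by
        unfold crossSection
        gcongr
        exact Real.abs_cos_le_one _
    _ = 4 ^ (1 + 2 * s) * |θ| ^ (-1 - 2 * s) := by
        rw [Real.div_rpow h0.le (by norm_num), show -1 - 2 * s = -(1 + 2 * s) by ring,
          Real.rpow_neg h0.le]
        field_simp
    _ ≤ _ := by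
        gcongr
        calc (4 : ℝ) ^ (1 + 2 * s) ≤ 4 ^ (3 : ℝ) :=
              Real.rpow_le_rpow_of_exponent_le (by norm_num) (by linarith)
          _ = 64 := by norm_num

theorem le_crossSection {s : ℝ} (hs0 : 0 < s) {θ : ℝ} (hθ : 0 < θ) (h1 : θ ≤ 1) :
    1 / 2 * θ ^ (-1 - 2 * s) ≤ crossSection s θ := by
  have hs : 0 < Real.sin (θ / 2) := Real.sin_pos_of_pos_of_lt_pi (by linarith)
    (by linarith [Real.pi_gt_three])
  have h2 : |Real.sin (θ / 2)| ≤ θ := by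
    rw [abs_of_pos hs]
    linarith [Real.sin_le (by linarith : 0 ≤ θ / 2)]
  have h3 : 1 / 2 ≤ |Real.cos (θ / 2)| := by
    have := Real.one_sub_sq_div_two_le_cos (x := θ / 2)
    refine le_trans ?_ (le_abs_self _)
    nlinarith
  unfold crossSection
  rw [show -1 - 2 * s = -(1 + 2 * s) by ring, Real.rpow_neg hθ.le, ← div_eq_mul_inv]
  have h4 : 0 < |Real.sin (θ / 2)| := abs_pos.2 hs.ne'
  gcongr

/-- The reference density for the moments of the cross section. -/
noncomputable def refDensity (s x : ℝ) : ℝ := |x| ^ (-1 - 2 * s) * min 1 (x ^ 2)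

theorem refDensity_nonneg (s x : ℝ) : 0 ≤ refDensity s x := by unfold refDensity; positivity

theorem integrable_refDensity {s : ℝ} (hs0 : 0 < s) (hs1 : s < 1) : Integrable (refDensity s) := by
  have h1 : IntegrableOn (refDensity s) (Ioi 1) := by
    refine (integrableOn_Ioi_rpow_of_lt (a := -1 - 2 * s) (by linarith) one_pos).congr_fun
      (fun x hx => ?_) measurableSet_Ioi
    have : (1 : ℝ) < x := hx
    simp only [refDensity]
    rw [abs_of_pos (by linarith), min_eq_left (by nlinarith), mul_one]
  have h2 : IntegrableOn (refDensity s) (Ioc 0 1) := by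
    have := (intervalIntegral.intervalIntegrable_rpow' (a := 0) (b := 1) (r := 1 - 2 * s)
      (by linarith)).1
    refine this.congr_fun (fun x hx => ?_) measurableSet_Ioc
    simp only [refDensity]
    rw [abs_of_pos hx.1, min_eq_right (by nlinarith [hx.1, hx.2]), ← Real.rpow_natCast x 2,
      ← Real.rpow_add hx.1]
    congr 1; push_cast; ring
  have h3 : IntegrableOn (refDensity s) (Ioi 0) := by
    rw [← Ioc_union_Ioi_eq_Ioi (zero_le_one' ℝ)]
    exact h2.union h1
  have h4 : IntegrableOn (refDensity s) (Iio 0) := by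
    rw [← integrable_indicator_iff measurableSet_Iio]
    refine ((integrable_indicator_iff measurableSet_Ioi).2 h3).comp_neg.congr
      (Filter.Eventually.of_forall fun x => ?_)
    simp [indicator, refDensity]
  rw [← integrableOn_univ, ← Iic_union_Ioi (a := (0 : ℝ)), integrableOn_union,
    integrableOn_Iic_iff_integrableOn_Iio]
  exact ⟨h4, h3⟩

/-- A bound for the moments of the cross section. -/
noncomputable def momentConst (s : ℝ) : ℝ := 64 * ∫ x, refDensity s x

theorem momentConst_nonneg (s : ℝ) : 0 ≤ momentConst s :=
  mul_nonneg (by norm_num) (integral_nonneg fun x => refDensity_nonneg s x)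

/-- Scaling x = √a θ. The factor a^{(1+2s)/2} loses √a to the Jacobian when integrated, which leaves
a^s; all growth exponents in the file come from here. -/
theorem crossSection_mul_min_le {s : ℝ} (hs0 : 0 < s) (hs1 : s < 1) {a : ℝ} (ha : 0 < a) {θ : ℝ}
    (h : θ ∈ angles) : crossSection s θ * min 1 (a * θ ^ 2) ≤
      64 * a ^ ((1 + 2 * s) / 2) * refDensity s (Real.sqrt a * θ) := by
  have h1 := crossSection_le hs0 hs1 h
  have hr : 0 < Real.sqrt a := Real.sqrt_pos.2 ha
  have e : refDensity s (Real.sqrt a * θ) =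
      (a ^ ((1 + 2 * s) / 2))⁻¹ * (|θ| ^ (-1 - 2 * s) * min 1 (a * θ ^ 2)) := by
    rw [refDensity, mul_pow, Real.sq_sqrt ha.le, abs_mul, abs_of_pos hr,
      Real.mul_rpow hr.le (abs_nonneg _), Real.sqrt_eq_rpow, ← Real.rpow_mul ha.le,
      ← Real.rpow_neg ha.le]
    rw [show 1 / 2 * (-1 - 2 * s) = -((1 + 2 * s) / 2) by ring]; ring
  rw [e]
  have hp : 0 < a ^ ((1 + 2 * s) / 2) := by positivity
  calc _ ≤ 64 * |θ| ^ (-1 - 2 * s) * min 1 (a * θ ^ 2) := by gcongr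
    _ = _ := by field_simp

theorem integrableOn_crossSection_mul_min {s : ℝ} (hs0 : 0 < s) (hs1 : s < 1) {a : ℝ} (ha : 0 < a) :
    IntegrableOn (fun θ => crossSection s θ * min 1 (a * θ ^ 2)) angles := by
  have h1 := ((integrable_refDensity hs0 hs1).comp_mul_left' (Real.sqrt_pos.2 ha).ne').const_mul
    (64 * a ^ ((1 + 2 * s) / 2))
  refine (h1.integrableOn (s := angles)).mono'
    ((measurable_crossSection s).mul (by fun_prop)).aestronglyMeasurable ?_
  refine (ae_restrict_iff' measurableSet_angles).2 (Filter.Eventually.of_forall fun θ hθ => ?_)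
  rw [Real.norm_of_nonneg (mul_nonneg (crossSection_nonneg s θ) (by positivity))]
  exact crossSection_mul_min_le hs0 hs1 ha hθ

theorem integral_crossSection_mul_min_le {s : ℝ} (hs0 : 0 < s) (hs1 : s < 1) {a : ℝ} (ha : 0 < a) :
    ∫ θ in angles, crossSection s θ * min 1 (a * θ ^ 2) ≤ momentConst s * a ^ s := by
  have hr := Real.sqrt_pos.2 ha
  have h1 := ((integrable_refDensity hs0 hs1).comp_mul_left' hr.ne').const_mul
    (64 * a ^ ((1 + 2 * s) / 2))
  calc _ ≤ ∫ θ in angles, 64 * a ^ ((1 + 2 * s) / 2) * refDensity s (Real.sqrt a * θ) :=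
        setIntegral_mono_on (integrableOn_crossSection_mul_min hs0 hs1 ha) h1.integrableOn
          measurableSet_angles fun θ hθ => crossSection_mul_min_le hs0 hs1 ha hθ
    _ ≤ ∫ θ, 64 * a ^ ((1 + 2 * s) / 2) * refDensity s (Real.sqrt a * θ) :=
        setIntegral_le_integral h1 (Filter.Eventually.of_forall fun θ =>
          mul_nonneg (by positivity) (refDensity_nonneg s _))
    _ = 64 * a ^ ((1 + 2 * s) / 2) * ((Real.sqrt a)⁻¹ * ∫ x, refDensity s x) := by
        rw [integral_const_mul, Measure.integral_comp_mul_left (refDensity s), abs_of_pos (by positivity),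
          smul_eq_mul]
    _ = _ := by
        have : a ^ ((1 + 2 * s) / 2) = a ^ s * Real.sqrt a := by
          rw [Real.sqrt_eq_rpow, ← Real.rpow_add ha]; congr 1; ring
        rw [this, momentConst]
        field_simp

theorem integrableOn_crossSection_mul {s : ℝ} (hs0 : 0 < s) (hs1 : s < 1) {φ : ℝ → ℝ} {C : ℝ}
    (hφ : Measurable φ) (hb : ∀ θ ∈ angles, |φ θ| ≤ C * θ ^ 2) :
    IntegrableOn (fun θ => crossSection s θ * φ θ) angles := by
  have h1 := (integrableOn_crossSection_mul_min hs0 hs1 one_pos).const_mul C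
  refine h1.mono' ((measurable_crossSection s).mul hφ).aestronglyMeasurable ?_
  refine (ae_restrict_iff' measurableSet_angles).2 (Filter.Eventually.of_forall fun θ hθ => ?_)
  have h2 := abs_le_one_of_mem_angles hθ
  have h3 : θ ^ 2 ≤ 1 := by rw [← sq_abs]; nlinarith [abs_nonneg θ]
  rw [norm_mul, Real.norm_of_nonneg (crossSection_nonneg s θ), Real.norm_eq_abs, one_mul,
    min_eq_right h3]
  calc _ ≤ crossSection s θ * (C * θ ^ 2) :=
        mul_le_mul_of_nonneg_left (hb θ hθ) (crossSection_nonneg s θ)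
    _ = _ := by ring

/-! ### The coefficients of the collision operator in the Hermite basis -/

/-- The angular factor of the collision of `e_k` and `e_l`. -/
noncomputable def angFactor (k l : ℕ) (θ : ℝ) : ℝ :=
  Real.sqrt ((k + l).choose k) * ((Real.sin θ ^ k + (-Real.sin θ) ^ k) / 2) * Real.cos θ ^ l -
    if k = 0 then 1 else 0

/-- The coefficients `α_{k,l}` with `Γ(e_k, e_l) = α_{k,l} e_{k+l}`. -/
noncomputable def alpha (s : ℝ) (k l : ℕ) : ℝ :=
  ∫ θ in angles, crossSection s θ * angFactor k l θ

theorem continuous_angFactor (k l : ℕ) : Continuous (angFactor k l) := by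
  unfold angFactor; fun_prop

/-- The binomial weight `C(k+l, k) sin^{2k} cos^{2l}`. -/
noncomputable def binWeight (k l : ℕ) (θ : ℝ) : ℝ :=
  ((k + l).choose k : ℝ) * (Real.sin θ ^ 2) ^ k * (Real.cos θ ^ 2) ^ l

theorem binWeight_nonneg (k l : ℕ) (θ : ℝ) : 0 ≤ binWeight k l θ := by
  unfold binWeight; positivity

/-- For k ≥ 1 the squared factor is dominated by the probability of k successes in k + l trials with
success probability sin²θ. Sums over k + l = n thus become probabilities for a single binomial law.
-/
theorem abs_angFactor_le {k : ℕ} (hk : k ≠ 0) (l : ℕ) (θ : ℝ) :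
    |angFactor k l θ| ≤ Real.sqrt (binWeight k l θ) := by
  have e : Real.sqrt (binWeight k l θ) =
      Real.sqrt ((k + l).choose k) * |Real.sin θ| ^ k * |Real.cos θ| ^ l := by
    rw [binWeight, Real.sqrt_mul (by positivity), Real.sqrt_mul (by positivity), ← pow_mul,
      mul_comm 2 k, pow_mul, Real.sqrt_sq_eq_abs, ← pow_mul, mul_comm 2 l, pow_mul,
      Real.sqrt_sq_eq_abs, abs_pow, abs_pow]
  rw [e, angFactor, if_neg hk, sub_zero, abs_mul, abs_mul, abs_pow,
    abs_of_nonneg (Real.sqrt_nonneg _)]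
  gcongr
  rw [abs_div, abs_two, div_le_iff₀ two_pos]
  refine (abs_add_le _ _).trans (le_of_eq ?_)
  rw [abs_pow, abs_pow, abs_neg]; ring

theorem angFactor_one (l : ℕ) (θ : ℝ) : angFactor 1 l θ = 0 := by simp [angFactor]

theorem alpha_one (s : ℝ) (l : ℕ) : alpha s 1 l = 0 := by simp [alpha, angFactor_one]

theorem binWeight_eq_bernstein {n k : ℕ} (hk : k ≤ n) (θ : ℝ) :
    binWeight k (n - k) θ = (bernsteinPolynomial ℝ n k).eval (Real.sin θ ^ 2) := by
  have h1 : 1 - Real.sin θ ^ 2 = Real.cos θ ^ 2 := by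
    linarith [Real.sin_sq_add_cos_sq θ]
  simp [binWeight, bernsteinPolynomial, Nat.add_sub_cancel' hk, h1]

theorem sum_binWeight (n : ℕ) (θ : ℝ) :
    ∑ k ∈ Finset.range (n + 1), binWeight k (n - k) θ = 1 := by
  have h := congrArg (Polynomial.eval (Real.sin θ ^ 2)) (bernsteinPolynomial.sum ℝ n)
  rw [Polynomial.eval_finsetSum, Polynomial.eval_one] at h
  rw [← h]
  exact Finset.sum_congr rfl fun k hk =>
    binWeight_eq_bernstein (Nat.lt_succ_iff.1 (Finset.mem_range.1 hk)) θ

theorem sum_mul_binWeight (n : ℕ) (θ : ℝ) :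
    ∑ k ∈ Finset.range (n + 1), ((k * (k - 1) : ℕ) : ℝ) * binWeight k (n - k) θ =
      ((n * (n - 1) : ℕ) : ℝ) * (Real.sin θ ^ 2) ^ 2 := by
  have h := congrArg (Polynomial.eval (Real.sin θ ^ 2)) (bernsteinPolynomial.sum_mul_smul ℝ n)
  rw [Polynomial.eval_finsetSum] at h
  simp only [nsmul_eq_mul, Polynomial.eval_mul, Polynomial.eval_natCast, Polynomial.eval_pow,
    Polynomial.eval_X] at h
  rw [← h]
  exact Finset.sum_congr rfl fun k hk => by
    rw [binWeight_eq_bernstein (Nat.lt_succ_iff.1 (Finset.mem_range.1 hk)) θ]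

theorem sin_sq_le (θ : ℝ) : Real.sin θ ^ 2 ≤ θ ^ 2 := Real.sin_sq_le_sq

/-- Markov's inequality for the second factorial moment n(n-1)sin⁴θ. The second moment is available
because k = 1 never contributes, the symmetrization in θ killing odd k. -/
theorem sum_filter_binWeight_le {n : ℕ} {p : ℕ → Prop} [DecidablePred p] {c : ℝ} (hc : 0 ≤ c)
    (hp : ∀ k, p k → 1 ≤ c * ((k * (k - 1) : ℕ) : ℝ)) (θ : ℝ) :
    ∑ k ∈ (Finset.range (n + 1)).filter p, binWeight k (n - k) θ ≤ c * n ^ 2 * (θ ^ 2) ^ 2 := by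
  calc _ ≤ ∑ k ∈ (Finset.range (n + 1)).filter p,
        c * (((k * (k - 1) : ℕ) : ℝ) * binWeight k (n - k) θ) := by
        refine Finset.sum_le_sum fun k hk => ?_
        rw [← mul_assoc]
        exact le_mul_of_one_le_left (binWeight_nonneg _ _ _) (hp k (Finset.mem_filter.1 hk).2)
    _ ≤ ∑ k ∈ Finset.range (n + 1), c * (((k * (k - 1) : ℕ) : ℝ) * binWeight k (n - k) θ) :=
        Finset.sum_le_sum_of_subset_of_nonneg (Finset.filter_subset _ _) fun k _ _ =>
          mul_nonneg hc (mul_nonneg (Nat.cast_nonneg _) (binWeight_nonneg _ _ _))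
    _ = c * (((n * (n - 1) : ℕ) : ℝ) * (Real.sin θ ^ 2) ^ 2) := by
        rw [← Finset.mul_sum, sum_mul_binWeight]
    _ ≤ _ := by
        rw [mul_assoc]
        refine mul_le_mul_of_nonneg_left (mul_le_mul ?_ ?_ (by positivity) (by positivity)) hc
        · rw [← Nat.cast_pow, pow_two]
          exact_mod_cast Nat.mul_le_mul_left n (Nat.sub_le n 1)
        · exact pow_le_pow_left₀ (sq_nonneg _) (sin_sq_le θ) 2

theorem sum_filter_binWeight_le_one {n : ℕ} (p : ℕ → Prop) [DecidablePred p] (θ : ℝ) :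
    ∑ k ∈ (Finset.range (n + 1)).filter p, binWeight k (n - k) θ ≤ 1 := by
  rw [← sum_binWeight n θ]
  exact Finset.sum_le_sum_of_subset_of_nonneg (Finset.filter_subset _ _) fun k _ _ =>
    binWeight_nonneg _ _ _

/-- Cauchy-Schwarz for the coefficients with respect to a weight `m`. -/
theorem sum_filter_alpha_sq_le {s : ℝ} {n : ℕ} (p : ℕ → Prop) [DecidablePred p]
    (hp : ∀ k, p k → k ≠ 0) {m : ℝ → ℝ} (hm : Measurable m) (hm0 : ∀ θ, θ ≠ 0 → 0 < m θ)
    {D : ℝ} (hD : 0 ≤ D)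
    (hmint : IntegrableOn (fun θ => crossSection s θ * m θ) angles)
    (hb : ∀ θ ∈ angles, ∑ k ∈ (Finset.range (n + 1)).filter p, binWeight k (n - k) θ ≤
      D * m θ ^ 2) :
    ∑ k ∈ (Finset.range (n + 1)).filter p, ‖alpha s k (n - k)‖ₑ ^ 2 ≤
      ENNReal.ofReal (D * (∫ θ in angles, crossSection s θ * m θ) ^ 2) := by
  set μ : Measure ℝ := volume.restrict angles with hμ
  have hae : ∀ᵐ θ ∂μ, θ ≠ 0 := by
    refine ae_restrict_of_ae ?_
    exact Measure.ae_ne volume 0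
  have hmem : ∀ᵐ θ ∂μ, θ ∈ angles := ae_restrict_mem measurableSet_angles
  have hmβ : Measurable fun θ => ENNReal.ofReal (crossSection s θ * m θ) :=
    ((measurable_crossSection s).mul hm).ennreal_ofReal
  have hbm : ∀ k, Measurable fun θ =>
      ENNReal.ofReal (crossSection s θ * binWeight k (n - k) θ / m θ) := fun k => by
    refine (((measurable_crossSection s).mul ?_).div hm).ennreal_ofReal
    unfold binWeight; fun_prop
  set I : ℝ := ∫ θ in angles, crossSection s θ * m θ with hI
  have hI' : ∫⁻ θ, ENNReal.ofReal (crossSection s θ * m θ) ∂μ = ENNReal.ofReal I := by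
    rw [hI, ofReal_integral_eq_lintegral_ofReal hmint]
    filter_upwards [hae] with θ hθ
    exact mul_nonneg (crossSection_nonneg s θ) (hm0 θ hθ).le
  have hI0 : 0 ≤ I := integral_nonneg_of_ae (by
    filter_upwards [hae] with θ hθ
    exact mul_nonneg (crossSection_nonneg s θ) (hm0 θ hθ).le)
  -- Cauchy-Schwarz in θ, distributing β b_k^{1/2} as (β m)^{1/2}(β b_k / m)^{1/2}; afterwards the
  -- sum over k passes under the integral.
  have h1 : ∀ k, p k → ‖alpha s k (n - k)‖ₑ ^ 2 ≤ ENNReal.ofReal I *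
      ∫⁻ θ, ENNReal.ofReal (crossSection s θ * binWeight k (n - k) θ / m θ) ∂μ := by
    intro k hk
    have e1 : ‖alpha s k (n - k)‖ₑ ≤
        ∫⁻ θ, (ENNReal.ofReal (crossSection s θ * m θ)) ^ (1 / 2 : ℝ) *
          (ENNReal.ofReal (crossSection s θ * binWeight k (n - k) θ / m θ)) ^ (1 / 2 : ℝ) ∂μ := by
      refine (enorm_integral_le_lintegral_enorm _).trans (lintegral_mono_ae ?_)
      filter_upwards [hae] with θ hθ
      have hmp := hm0 θ hθ
      have hc := crossSection_nonneg s θ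
      have hw := binWeight_nonneg k (n - k) θ
      rw [ENNReal.ofReal_rpow_of_nonneg (by positivity) (by norm_num),
        ENNReal.ofReal_rpow_of_nonneg (by positivity) (by norm_num),
        ← ENNReal.ofReal_mul (by positivity), ← Real.sqrt_eq_rpow, ← Real.sqrt_eq_rpow,
        ← Real.sqrt_mul (by positivity), Real.enorm_eq_ofReal_abs]
      refine ENNReal.ofReal_le_ofReal ?_
      have : crossSection s θ * m θ * (crossSection s θ * binWeight k (n - k) θ / m θ) =
          crossSection s θ ^ 2 * binWeight k (n - k) θ := by field_simp
      rw [this, Real.sqrt_mul (by positivity), Real.sqrt_sq hc, abs_mul, abs_of_nonneg hc]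
      exact mul_le_mul_of_nonneg_left (abs_angFactor_le (hp k hk) _ _) hc
    have e2 := ENNReal.lintegral_mul_le_Lp_mul_Lq μ Real.HolderConjugate.two_two
      (hmβ.pow_const (1 / 2 : ℝ)).aemeasurable ((hbm k).pow_const (1 / 2 : ℝ)).aemeasurable
    simp only [← ENNReal.rpow_mul] at e2
    norm_num at e2
    have e3 := pow_le_pow_left' (e1.trans (le_of_eq_of_le (by norm_num) e2)) 2
    refine e3.trans (le_of_eq ?_)
    rw [mul_pow, ← ENNReal.rpow_natCast, ← ENNReal.rpow_mul, ← ENNReal.rpow_natCast,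
      ← ENNReal.rpow_mul, ← hI']
    norm_num
  calc _ ≤ ∑ k ∈ (Finset.range (n + 1)).filter p, ENNReal.ofReal I *
        ∫⁻ θ, ENNReal.ofReal (crossSection s θ * binWeight k (n - k) θ / m θ) ∂μ :=
        Finset.sum_le_sum fun k hk => h1 k (Finset.mem_filter.1 hk).2
    _ = ENNReal.ofReal I * ∫⁻ θ, ∑ k ∈ (Finset.range (n + 1)).filter p,
        ENNReal.ofReal (crossSection s θ * binWeight k (n - k) θ / m θ) ∂μ := by
        rw [← Finset.mul_sum, lintegral_finsetSum _ fun k _ => hbm k]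
    _ ≤ ENNReal.ofReal I * ∫⁻ θ, ENNReal.ofReal (D * (crossSection s θ * m θ)) ∂μ := by
        gcongr 1
        refine lintegral_mono_ae ?_
        filter_upwards [hae, hmem] with θ hθ hθm
        have hmp := hm0 θ hθ
        have hc := crossSection_nonneg s θ
        rw [← ENNReal.ofReal_sum_of_nonneg fun k _ =>
          div_nonneg (mul_nonneg hc (binWeight_nonneg _ _ _)) hmp.le]
        refine ENNReal.ofReal_le_ofReal ?_
        rw [← Finset.sum_div, ← Finset.mul_sum, div_le_iff₀ hmp]
        calc _ ≤ crossSection s θ * (D * m θ ^ 2) :=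
              mul_le_mul_of_nonneg_left (hb θ hθm) hc
          _ = _ := by ring
    _ = _ := by
        simp only [ENNReal.ofReal_mul hD]
        rw [lintegral_const_mul _ hmβ, hI', ENNReal.ofReal_pow hI0]; ring

/-- The diagonal sums of squares of the coefficients. -/
theorem sum_alpha_sq_le {s : ℝ} (hs0 : 0 < s) (hs1 : s < 1) {n : ℕ} (hn : n ≠ 0) :
    ∑ k ∈ (Finset.range (n + 1)).filter (fun k => 2 ≤ k), ‖alpha s k (n - k)‖ₑ ^ 2 ≤
      ENNReal.ofReal ((momentConst s * n ^ s) ^ 2) := by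
  have hn' : (0 : ℝ) < n := by positivity
  have hint := integrableOn_crossSection_mul_min hs0 hs1 hn'
  -- This weight is the square root of the bound min(1, (nθ²)²) for the probability of k ≥ 2, and
  -- its β-integral is of order n^s.
  have h := sum_filter_alpha_sq_le (s := s) (n := n) (fun k => 2 ≤ k) (fun k hk => by omega)
    (m := fun θ => min 1 (n * θ ^ 2)) (by fun_prop) (fun θ hθ => by positivity) zero_le_one hint ?_
  · refine h.trans (ENNReal.ofReal_le_ofReal ?_)
    rw [one_mul]
    gcongr
    · exact integral_nonneg fun θ => mul_nonneg (crossSection_nonneg s θ) (by positivity)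
    · exact integral_crossSection_mul_min_le hs0 hs1 hn'
  · intro θ _
    rw [one_mul]
    rcases le_total 1 ((n : ℝ) * θ ^ 2) with h1 | h1
    · rw [min_eq_left h1, one_pow]; exact sum_filter_binWeight_le_one _ θ
    · rw [min_eq_right h1]
      refine (sum_filter_binWeight_le (p := fun k => 2 ≤ k) zero_le_one (fun k hk => ?_) θ).trans
        (le_of_eq (by ring))
      rw [one_mul]
      exact_mod_cast Nat.mul_pos (by omega) (by omega : 0 < k - 1)

/-- For k > n/2 the factor k(k-1) is of order n² and cancels the n² of the factorial moment, so no
growth in n remains. -/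
theorem sum_alpha_sq_le_of_half {s : ℝ} (hs0 : 0 < s) (hs1 : s < 1) {n : ℕ} (hn : n ≠ 0) :
    ∑ k ∈ (Finset.range (n + 1)).filter (fun k => 2 ≤ k ∧ n < 2 * k), ‖alpha s k (n - k)‖ₑ ^ 2 ≤
      ENNReal.ofReal (8 * momentConst s ^ 2) := by
  have hn' : (0 : ℝ) < n := by positivity
  have hint := integrableOn_crossSection_mul_min hs0 hs1 one_pos
  have h := sum_filter_alpha_sq_le (s := s) (n := n) (fun k => 2 ≤ k ∧ n < 2 * k)
    (fun k hk => by omega)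
    (m := fun θ => min 1 (1 * θ ^ 2)) (by fun_prop) (fun θ hθ => by positivity)
    (by norm_num : (0 : ℝ) ≤ 8) hint ?_
  · refine h.trans (ENNReal.ofReal_le_ofReal ?_)
    gcongr
    · exact integral_nonneg fun θ => mul_nonneg (crossSection_nonneg s θ) (by positivity)
    · simpa using integral_crossSection_mul_min_le hs0 hs1 one_pos
  · intro θ hθ
    have h2 := abs_le_one_of_mem_angles hθ
    have h3 : θ ^ 2 ≤ 1 := by rw [← sq_abs]; nlinarith [abs_nonneg θ]
    rw [one_mul, min_eq_right h3]
    -- The 8 works because n ≤ 2k and k ≥ 2 give n² ≤ 4k² ≤ 8k(k - 1).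
    refine (sum_filter_binWeight_le (p := fun k => 2 ≤ k ∧ n < 2 * k) (c := 8 / n ^ 2)
      (by positivity) (fun k hk => ?_) θ).trans (le_of_eq (by field_simp))
    rw [div_mul_eq_mul_div, one_le_div (by positivity)]
    obtain ⟨j, rfl⟩ : ∃ j, k = j + 2 := ⟨k - 2, by omega⟩
    have h4 : (n : ℝ) ≤ 2 * (j + 2) := by exact_mod_cast hk.2.le
    rw [show j + 2 - 1 = j + 1 by omega]
    push_cast
    nlinarith [(j.cast_nonneg : (0 : ℝ) ≤ j)]

theorem one_sub_cos_pow_le {θ : ℝ} (h : θ ∈ angles) (n : ℕ) :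
    1 - Real.cos θ ^ n ≤ min 1 (n * θ ^ 2) := by
  have hc := cos_nonneg_of_mem_angles h
  refine le_min (by linarith [pow_nonneg hc n]) ?_
  have h1 := one_add_mul_le_pow (a := Real.cos θ - 1) (by linarith) n
  have h2 := Real.one_sub_sq_div_two_le_cos (x := θ)
  rw [add_sub_cancel] at h1
  have : (n : ℝ) * (1 - Real.cos θ) ≤ n * θ ^ 2 := by gcongr; nlinarith [sq_nonneg θ]
  linarith

theorem angFactor_zero (n : ℕ) (θ : ℝ) : angFactor 0 n θ = Real.cos θ ^ n - 1 := by
  simp [angFactor]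

theorem abs_alpha_zero_le {s : ℝ} (hs0 : 0 < s) (hs1 : s < 1) {n : ℕ} (hn : n ≠ 0) :
    |alpha s 0 n| ≤ momentConst s * n ^ s := by
  have hn' : (0 : ℝ) < n := by positivity
  refine le_trans ?_ (integral_crossSection_mul_min_le hs0 hs1 hn')
  rw [alpha, ← Real.norm_eq_abs]
  refine norm_integral_le_of_norm_le (integrableOn_crossSection_mul_min hs0 hs1 hn') ?_
  refine (ae_restrict_iff' measurableSet_angles).2 (Filter.Eventually.of_forall fun θ hθ => ?_)
  have h1 := one_sub_cos_pow_le hθ n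
  have h2 : Real.cos θ ^ n ≤ 1 :=
    pow_le_one₀ (cos_nonneg_of_mem_angles hθ) (Real.cos_le_one θ)
  rw [norm_mul, Real.norm_of_nonneg (crossSection_nonneg s θ), angFactor_zero, Real.norm_eq_abs,
    abs_sub_comm, abs_of_nonneg (by linarith)]
  exact mul_le_mul_of_nonneg_left h1 (crossSection_nonneg s θ)

theorem alpha_zero_zero (s : ℝ) : alpha s 0 0 = 0 := by simp [alpha, angFactor]

end Kac

namespace Kac

/-! ### Weights and the trilinear estimate -/

/-- The weight `(n + 1/2)^r`. -/
noncomputable def wt (r : ℝ) (n : ℕ) : ℝ≥0∞ := ENNReal.ofReal (((n : ℝ) + 1 / 2) ^ r)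

theorem wt_ne_zero (r : ℝ) (n : ℕ) : wt r n ≠ 0 := by
  rw [wt, Ne, ENNReal.ofReal_eq_zero, not_le]; positivity

theorem wt_ne_top (r : ℝ) (n : ℕ) : wt r n ≠ ⊤ := ENNReal.ofReal_ne_top

theorem wt_zero (n : ℕ) : wt 0 n = 1 := by simp [wt]

theorem wt_mul (r r' : ℝ) (n : ℕ) : wt r n * wt r' n = wt (r + r') n := by
  rw [wt, wt, wt, ← ENNReal.ofReal_mul (by positivity), ← Real.rpow_add (by positivity)]

theorem tsum_mul_le_sqrt {ι : Type*} (a b : ι → ℝ≥0∞) :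
    ∑' i, a i * b i ≤ (∑' i, a i ^ 2) ^ (1 / 2 : ℝ) * (∑' i, b i ^ 2) ^ (1 / 2 : ℝ) := by
  let _ : MeasurableSpace ι := ⊤
  have := ENNReal.lintegral_mul_le_Lp_mul_Lq (Measure.count : Measure ι)
    Real.HolderConjugate.two_two (f := a) (g := b) (measurable_from_top).aemeasurable
    (measurable_from_top).aemeasurable
  simpa only [lintegral_count, Pi.mul_apply, ENNReal.rpow_two] using this

/-- Cauchy-Schwarz over pairs, grouped as (F_k w₁(l)^{1/2} G_l)·(A w₁(l)^{-1/2} H_{k+l}). The first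
square sum factorizes; the second is taken along antidiagonals, where H is constant and `hA`
applies. -/
theorem tsum_trilinear_le {A : ℕ → ℕ → ℝ≥0∞} {w₁ w₂ : ℕ → ℝ≥0∞} {C : ℝ≥0∞}
    (h0 : ∀ l, w₁ l ≠ 0) (h1 : ∀ l, w₁ l ≠ ⊤)
    (hA : ∀ n, ∑ p ∈ Finset.HasAntidiagonal.antidiagonal n, A p.1 p.2 ^ 2 * (w₁ p.2)⁻¹ ≤ C ^ 2 * w₂ n)
    (F G H : ℕ → ℝ≥0∞) :
    ∑' p : ℕ × ℕ, A p.1 p.2 * (F p.1 * G p.2 * H (p.1 + p.2)) ≤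
      C * (∑' k, F k ^ 2) ^ (1 / 2 : ℝ) * (∑' l, w₁ l * G l ^ 2) ^ (1 / 2 : ℝ) *
        (∑' n, w₂ n * H n ^ 2) ^ (1 / 2 : ℝ) := by
  have hr : ∀ x : ℝ≥0∞, (x ^ (1 / 2 : ℝ)) ^ 2 = x := fun x => by
    rw [← ENNReal.rpow_natCast, ← ENNReal.rpow_mul]; norm_num
  have hr' : ∀ x : ℝ≥0∞, (x ^ 2) ^ (1 / 2 : ℝ) = x := fun x => by
    rw [← ENNReal.rpow_natCast, ← ENNReal.rpow_mul]; norm_num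
  have e1 : ∑' p : ℕ × ℕ, (F p.1 * (w₁ p.2 ^ (1 / 2 : ℝ) * G p.2)) ^ 2 =
      (∑' k, F k ^ 2) * ∑' l, w₁ l * G l ^ 2 := by
    rw [ENNReal.tsum_prod (f := fun k l => (F k * (w₁ l ^ (1 / 2 : ℝ) * G l)) ^ 2), ← ENNReal.tsum_mul_right]
    refine tsum_congr fun k => ?_
    rw [← ENNReal.tsum_mul_left]
    exact tsum_congr fun l => by rw [mul_pow, mul_pow, hr]
  have e2 : ∑' p : ℕ × ℕ, (A p.1 p.2 * (w₁ p.2 ^ (1 / 2 : ℝ))⁻¹ * H (p.1 + p.2)) ^ 2 ≤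
      C ^ 2 * ∑' n, w₂ n * H n ^ 2 := by
    rw [← Finset.HasAntidiagonal.sigmaAntidiagonalEquivProd.tsum_eq, ENNReal.tsum_sigma', ← ENNReal.tsum_mul_left]
    refine ENNReal.tsum_le_tsum fun n => ?_
    rw [tsum_fintype, Finset.univ_eq_attach, ← mul_assoc]
    refine le_trans (le_of_eq ?_) (mul_le_mul_left (hA n) (H n ^ 2))
    rw [Finset.sum_mul]
    refine Eq.trans ?_ (Finset.sum_attach (Finset.HasAntidiagonal.antidiagonal n)
      (fun p => A p.1 p.2 ^ 2 * (w₁ p.2)⁻¹ * H n ^ 2))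
    refine Finset.sum_congr rfl fun p _ => ?_
    have hp := Finset.HasAntidiagonal.mem_antidiagonal.1 p.2
    simp only [Finset.HasAntidiagonal.sigmaAntidiagonalEquivProd_apply]
    rw [hp, mul_pow, mul_pow, ← ENNReal.inv_pow, hr]
  calc _ = ∑' p : ℕ × ℕ, (F p.1 * (w₁ p.2 ^ (1 / 2 : ℝ) * G p.2)) *
        (A p.1 p.2 * (w₁ p.2 ^ (1 / 2 : ℝ))⁻¹ * H (p.1 + p.2)) := by
        refine tsum_congr fun p => ?_
        have : w₁ p.2 ^ (1 / 2 : ℝ) * (w₁ p.2 ^ (1 / 2 : ℝ))⁻¹ = 1 :=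
          ENNReal.mul_inv_cancel (by simp [h0]) (by simp [h1])
        calc _ = A p.1 p.2 * (F p.1 * G p.2 * H (p.1 + p.2)) *
              (w₁ p.2 ^ (1 / 2 : ℝ) * (w₁ p.2 ^ (1 / 2 : ℝ))⁻¹) := by rw [this, mul_one]
          _ = _ := by ring
    _ ≤ _ := tsum_mul_le_sqrt _ _
    _ ≤ ((∑' k, F k ^ 2) * ∑' l, w₁ l * G l ^ 2) ^ (1 / 2 : ℝ) *
        (C ^ 2 * ∑' n, w₂ n * H n ^ 2) ^ (1 / 2 : ℝ) := by
        rw [e1]; gcongr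
    _ = _ := by
        rw [ENNReal.mul_rpow_of_nonneg _ _ (by norm_num), ENNReal.mul_rpow_of_nonneg _ _ (by norm_num),
          hr']
        ring

theorem enorm_alpha_zero_le {s : ℝ} (hs0 : 0 < s) (hs1 : s < 1) (n : ℕ) :
    ‖alpha s 0 n‖ₑ ^ 2 ≤ ENNReal.ofReal (momentConst s ^ 2) * wt (2 * s) n := by
  rcases eq_or_ne n 0 with rfl | hn
  · simp [alpha_zero_zero]
  rw [Real.enorm_eq_ofReal_abs, ← ENNReal.ofReal_pow (abs_nonneg _), wt,
    ← ENNReal.ofReal_mul (by positivity)]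
  refine ENNReal.ofReal_le_ofReal ?_
  calc |alpha s 0 n| ^ 2 ≤ (momentConst s * ((n : ℝ) + 1 / 2) ^ s) ^ 2 := by
        gcongr
        refine (abs_alpha_zero_le hs0 hs1 hn).trans ?_
        have := momentConst_nonneg s
        gcongr; linarith
    _ = _ := by rw [mul_pow, ← Real.rpow_natCast (_ ^ s), ← Real.rpow_mul (by positivity)]; congr 2; push_cast; ring

theorem sum_alpha_sq_le_wt {s : ℝ} (hs0 : 0 < s) (hs1 : s < 1) (n : ℕ) :
    ∑ k ∈ (Finset.range (n + 1)).filter (fun k => 2 ≤ k), ‖alpha s k (n - k)‖ₑ ^ 2 ≤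
      ENNReal.ofReal (momentConst s ^ 2) * wt (2 * s) n := by
  rcases eq_or_ne n 0 with rfl | hn
  · simp [Finset.sum_filter]
  refine (sum_alpha_sq_le hs0 hs1 hn).trans ?_
  rw [wt, ← ENNReal.ofReal_mul (by positivity)]
  refine ENNReal.ofReal_le_ofReal ?_
  calc (momentConst s * n ^ s) ^ 2 ≤ (momentConst s * ((n : ℝ) + 1 / 2) ^ s) ^ 2 := by
        have := momentConst_nonneg s
        gcongr; linarith
    _ = _ := by rw [mul_pow, ← Real.rpow_natCast (_ ^ s), ← Real.rpow_mul (by positivity)]; congr 2; push_cast; ring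

theorem sum_antidiagonal_alpha (s : ℝ) (w₁ : ℕ → ℝ≥0∞) (n : ℕ) :
    ∑ p ∈ Finset.HasAntidiagonal.antidiagonal n, ‖alpha s p.1 p.2‖ₑ ^ 2 * (w₁ p.2)⁻¹ =
      ‖alpha s 0 n‖ₑ ^ 2 * (w₁ n)⁻¹ +
        ∑ k ∈ (Finset.range (n + 1)).filter (fun k => 2 ≤ k),
          ‖alpha s k (n - k)‖ₑ ^ 2 * (w₁ (n - k))⁻¹ := by
  rw [Finset.Nat.sum_antidiagonal_eq_sum_range_succ (fun k l => ‖alpha s k l‖ₑ ^ 2 * (w₁ l)⁻¹),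
    Finset.sum_range_succ', add_comm, Nat.sub_zero, Finset.sum_filter, Finset.sum_range_succ']
  simp only [show ¬ (2 ≤ 0) by norm_num, if_false, add_zero]
  congr 1
  refine Finset.sum_congr rfl fun k _ => ?_
  split_ifs with h
  · rfl
  · obtain rfl : k = 0 := by omega
    simp [alpha_one]

/-- The whole loss of order 2s falls on the third argument and the first two need only be in L².
This is the version for smooth test functions; the balanced `sum_alpha_one` serves the energy
estimate. -/
theorem sum_alpha_two {s : ℝ} (hs0 : 0 < s) (hs1 : s < 1) (n : ℕ) :
    ∑ p ∈ Finset.HasAntidiagonal.antidiagonal n, ‖alpha s p.1 p.2‖ₑ ^ 2 * (wt 0 p.2)⁻¹ ≤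
      ENNReal.ofReal (6 * momentConst s) ^ 2 * wt (2 * s) n := by
  rw [sum_antidiagonal_alpha]
  simp only [wt_zero, inv_one, mul_one]
  refine (add_le_add (enorm_alpha_zero_le hs0 hs1 n) (sum_alpha_sq_le_wt hs0 hs1 n)).trans ?_
  have := momentConst_nonneg s
  rw [← add_mul, ← ENNReal.ofReal_add (by positivity) (by positivity),
    ← ENNReal.ofReal_pow (by positivity)]
  gcongr
  nlinarith [sq_nonneg (momentConst s)]

theorem wt_inv (r : ℝ) (n : ℕ) : (wt r n)⁻¹ = wt (-r) n := by
  rw [wt, wt, ← ENNReal.ofReal_inv_of_pos (by positivity), Real.rpow_neg (by positivity)]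

theorem wt_neg_le {s : ℝ} (hs0 : 0 < s) (hs1 : s < 1) (n : ℕ) : wt (-s) n ≤ 2 := by
  rw [wt, show (2 : ℝ≥0∞) = ENNReal.ofReal 2 by simp]
  refine ENNReal.ofReal_le_ofReal ?_
  calc ((n : ℝ) + 1 / 2) ^ (-s) ≤ (1 / 2 : ℝ) ^ (-s) :=
        Real.rpow_le_rpow_of_nonpos (by norm_num) (by linarith [(n.cast_nonneg : (0 : ℝ) ≤ n)])
          (by linarith)
    _ = 2 ^ s := by rw [one_div, Real.inv_rpow (by norm_num), Real.rpow_neg (by norm_num), inv_inv]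
    _ ≤ 2 ^ (1 : ℝ) := Real.rpow_le_rpow_of_exponent_le (by norm_num) hs1.le
    _ = 2 := by norm_num

theorem wt_neg_half_le {s : ℝ} (hs0 : 0 < s) (hs1 : s < 1) {n l : ℕ} (h : n ≤ 2 * l) :
    wt (-s) l ≤ 2 * wt (-s) n := by
  rw [wt, wt, show (2 : ℝ≥0∞) = ENNReal.ofReal 2 by simp, ← ENNReal.ofReal_mul (by norm_num)]
  refine ENNReal.ofReal_le_ofReal ?_
  have h' : (n : ℝ) ≤ 2 * l := by exact_mod_cast h
  calc ((l : ℝ) + 1 / 2) ^ (-s) ≤ (1 / 2 * ((n : ℝ) + 1 / 2)) ^ (-s) :=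
        Real.rpow_le_rpow_of_nonpos (by positivity) (by linarith) (by linarith)
    _ = 2 ^ s * ((n : ℝ) + 1 / 2) ^ (-s) := by
        rw [Real.mul_rpow (by norm_num) (by positivity), one_div, Real.inv_rpow (by norm_num),
          Real.rpow_neg (by norm_num), inv_inv]
    _ ≤ 2 ^ (1 : ℝ) * ((n : ℝ) + 1 / 2) ^ (-s) := by
        gcongr; norm_num
    _ = _ := by norm_num

theorem one_le_two_mul_wt {s : ℝ} (hs0 : 0 < s) (hs1 : s < 1) (n : ℕ) : 1 ≤ 2 * wt s n := by
  have h := mul_le_mul_left (wt_neg_le hs0 hs1 n) (wt s n)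
  rwa [wt_mul, neg_add_cancel, wt_zero] at h

/-- With l = n - k: if l ≥ n/2, then (l + 1/2)^{-s} is comparable to (n + 1/2)^{-s} and turns the
growth 2s into s. If l < n/2 the weight gives nothing, but then k > n/2 and the square sum is
bounded. -/
theorem sum_alpha_one {s : ℝ} (hs0 : 0 < s) (hs1 : s < 1) (n : ℕ) :
    ∑ p ∈ Finset.HasAntidiagonal.antidiagonal n, ‖alpha s p.1 p.2‖ₑ ^ 2 * (wt s p.2)⁻¹ ≤
      ENNReal.ofReal (6 * momentConst s) ^ 2 * wt s n := by
  have hM := momentConst_nonneg s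
  set M : ℝ≥0∞ := ENNReal.ofReal (momentConst s ^ 2) with hMdef
  have hw : wt (2 * s) n * wt (-s) n = wt s n := by rw [wt_mul]; congr 1; ring
  rw [sum_antidiagonal_alpha]
  simp only [wt_inv]
  have h1 : ‖alpha s 0 n‖ₑ ^ 2 * wt (-s) n ≤ M * wt s n := by
    rw [← hw, ← mul_assoc]
    gcongr
    exact enorm_alpha_zero_le hs0 hs1 n
  have h2 : ∑ k ∈ (Finset.range (n + 1)).filter (fun k => 2 ≤ k),
      ‖alpha s k (n - k)‖ₑ ^ 2 * wt (-s) (n - k) ≤ 2 * (M * wt s n) + 2 * (8 * M) := by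
    have hsplit : ∀ k ∈ (Finset.range (n + 1)).filter (fun k => 2 ≤ k),
        ‖alpha s k (n - k)‖ₑ ^ 2 * wt (-s) (n - k) ≤
        ‖alpha s k (n - k)‖ₑ ^ 2 * (2 * wt (-s) n) +
          if n < 2 * k then ‖alpha s k (n - k)‖ₑ ^ 2 * 2 else 0 := fun k hk => by
      have hk' := Finset.mem_range.1 (Finset.mem_filter.1 hk).1
      split_ifs with h
      · refine le_trans ?_ le_add_self
        gcongr
        exact wt_neg_le hs0 hs1 _
      · rw [add_zero]
        gcongr
        exact wt_neg_half_le hs0 hs1 (by omega)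
    refine (Finset.sum_le_sum hsplit).trans ?_
    rw [Finset.sum_add_distrib, ← Finset.sum_mul, ← Finset.sum_filter, Finset.filter_filter,
      ← Finset.sum_mul]
    refine add_le_add ?_ ?_
    · rw [← hw]
      calc _ ≤ M * wt (2 * s) n * (2 * wt (-s) n) := by
            gcongr; exact sum_alpha_sq_le_wt hs0 hs1 n
        _ = _ := by ring
    · rw [mul_comm]
      gcongr
      rcases eq_or_ne n 0 with rfl | hn
      · simp [Finset.sum_filter]
      · refine (sum_alpha_sq_le_of_half hs0 hs1 hn).trans (le_of_eq ?_)
        rw [ENNReal.ofReal_mul (by norm_num)]; simp [hMdef]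
  refine (add_le_add h1 h2).trans ?_
  have h3 : 2 * (8 * M) ≤ 2 * (8 * M) * (2 * wt s n) :=
    le_mul_of_one_le_right zero_le (one_le_two_mul_wt hs0 hs1 n)
  calc M * wt s n + (2 * (M * wt s n) + 2 * (8 * M))
      ≤ M * wt s n + (2 * (M * wt s n) + 2 * (8 * M) * (2 * wt s n)) := by gcongr
    -- 35 = 1 + 2 + 32, the last from 1 ≤ 2(n + 1/2)^s; it is absorbed in 36 = 6².
    _ = (35 * M) * wt s n := by ring
    _ ≤ _ := by
        gcongr
        rw [hMdef, ← ENNReal.ofReal_pow (by positivity),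
          show (35 : ℝ≥0∞) = ENNReal.ofReal 35 by simp, ← ENNReal.ofReal_mul (by norm_num)]
        gcongr
        nlinarith [sq_nonneg (momentConst s)]

/-! ### The eigenvalues of the linearized operator -/

/-- The eigenvalues of the linearized operator. -/
noncomputable def lam (s : ℝ) (n : ℕ) : ℝ := -alpha s 0 n - alpha s n 0

theorem enorm_lam_le {s : ℝ} (hs0 : 0 < s) (hs1 : s < 1) (n : ℕ) :
    ‖lam s n‖ₑ ≤ ENNReal.ofReal (2 * momentConst s) * wt s n := by
  have hM := momentConst_nonneg s
  have key : ∀ x : ℝ, ‖x‖ₑ ^ 2 ≤ ENNReal.ofReal (momentConst s ^ 2) * wt (2 * s) n →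
      ‖x‖ₑ ≤ ENNReal.ofReal (momentConst s) * wt s n := fun x hx => by
    have e : ENNReal.ofReal (momentConst s ^ 2) * wt (2 * s) n =
        (ENNReal.ofReal (momentConst s) * wt s n) ^ 2 := by
      rw [mul_pow, ENNReal.ofReal_pow hM, pow_two (wt s n), wt_mul]; congr 2; ring
    rw [e] at hx
    exact (ENNReal.pow_le_pow_left_iff two_ne_zero).1 hx
  have h1 := key _ (enorm_alpha_zero_le hs0 hs1 n)
  have h2 : ‖alpha s n 0‖ₑ ≤ ENNReal.ofReal (momentConst s) * wt s n := by
    rcases le_or_gt n 1 with hn | hn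
    · interval_cases n <;> simp [alpha_zero_zero, alpha_one]
    · refine key _ (le_trans ?_ (sum_alpha_sq_le_wt hs0 hs1 n))
      have := Finset.single_le_sum (f := fun k => ‖alpha s k (n - k)‖ₑ ^ 2)
        (s := (Finset.range (n + 1)).filter (fun k => 2 ≤ k)) (fun _ _ => zero_le) (a := n)
        (by simp; omega)
      simpa using this
  calc ‖lam s n‖ₑ ≤ ‖-alpha s 0 n‖ₑ + ‖alpha s n 0‖ₑ := enorm_sub_le
    _ ≤ _ := by
        rw [enorm_neg, two_mul, ENNReal.ofReal_add hM hM, add_mul]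
        exact add_le_add h1 h2

theorem integrableOn_one_sub_cos_pow {s : ℝ} (hs0 : 0 < s) (hs1 : s < 1) (n : ℕ) :
    IntegrableOn (fun θ => crossSection s θ * (1 - Real.cos θ ^ n)) angles := by
  refine integrableOn_crossSection_mul hs0 hs1 (C := n) (by fun_prop) fun θ hθ => ?_
  have h1 := one_sub_cos_pow_le hθ n
  have h2 : Real.cos θ ^ n ≤ 1 :=
    pow_le_one₀ (cos_nonneg_of_mem_angles hθ) (Real.cos_le_one θ)
  rw [abs_of_nonneg (by linarith)]
  exact h1.trans (min_le_right _ _)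

theorem integrableOn_sin_pow {s : ℝ} (hs0 : 0 < s) (hs1 : s < 1) {n : ℕ} (hn : 2 ≤ n) :
    IntegrableOn (fun θ => crossSection s θ *
      ((Real.sin θ ^ n + (-Real.sin θ) ^ n) / 2)) angles := by
  refine integrableOn_crossSection_mul hs0 hs1 (C := 1) (by fun_prop) fun θ hθ => ?_
  obtain ⟨m, rfl⟩ : ∃ m, n = m + 2 := ⟨n - 2, by omega⟩
  have h1 : |Real.sin θ| ^ (m + 2) ≤ θ ^ 2 := by
    calc |Real.sin θ| ^ (m + 2) ≤ |Real.sin θ| ^ 2 :=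
          pow_le_pow_of_le_one (abs_nonneg _) (Real.abs_sin_le_one θ) (by omega)
      _ ≤ _ := by rw [sq_abs]; exact sin_sq_le θ
  rw [abs_div, abs_two, div_le_iff₀ two_pos]
  refine (abs_add_le _ _).trans ?_
  rw [abs_pow, abs_pow, abs_neg]; linarith

theorem sqrt_choose_self (n : ℕ) : Real.sqrt ((n + 0).choose n) = 1 := by simp

/-- On |θ| ≤ π/4 one has |sin θ| ≤ cos θ, so the even part of sin^{m+2} is at most sin² cos^m, and
cos^{m+2} + sin² cos^m = cos^m. The gain row α_{n,0} thus costs only two powers of the cosine. -/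
theorem integral_one_sub_cos_pow_le_lam {s : ℝ} (hs0 : 0 < s) (hs1 : s < 1) (m : ℕ) :
    ∫ θ in angles, crossSection s θ * (1 - Real.cos θ ^ m) ≤ lam s (m + 2) := by
  have e1 : alpha s 0 (m + 2) = -∫ θ in angles, crossSection s θ * (1 - Real.cos θ ^ (m + 2)) := by
    rw [alpha, ← integral_neg]
    refine integral_congr_ae (Filter.Eventually.of_forall fun θ => ?_)
    simp only [angFactor_zero]; ring
  have e2 : alpha s (m + 2) 0 = ∫ θ in angles, crossSection s θ *
      ((Real.sin θ ^ (m + 2) + (-Real.sin θ) ^ (m + 2)) / 2) := by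
    rw [alpha]
    refine integral_congr_ae (Filter.Eventually.of_forall fun θ => ?_)
    simp only [angFactor, sqrt_choose_self]; simp
  have i1 := integrableOn_one_sub_cos_pow hs0 hs1 (m + 2)
  have i2 := integrableOn_sin_pow hs0 hs1 (by omega : 2 ≤ m + 2)
  rw [lam, e1, e2, neg_neg, ← integral_sub i1 i2]
  refine setIntegral_mono_on (integrableOn_one_sub_cos_pow hs0 hs1 m) (i1.sub i2)
    measurableSet_angles fun θ hθ => ?_
  rw [← mul_sub]
  refine mul_le_mul_of_nonneg_left ?_ (crossSection_nonneg s θ)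
  have hc := cos_nonneg_of_mem_angles hθ
  have hsc : |Real.sin θ| ≤ Real.cos θ := by
    refine abs_le_of_sq_le_sq ?_ hc
    have h1 : 0 ≤ Real.cos (2 * θ) := by
      have := abs_le.1 (abs_le_of_mem_angles hθ)
      exact Real.cos_nonneg_of_neg_pi_div_two_le_of_le (by linarith) (by linarith)
    rw [Real.cos_two_mul'] at h1
    linarith
  have h2 : (Real.sin θ ^ (m + 2) + (-Real.sin θ) ^ (m + 2)) / 2 ≤
      Real.sin θ ^ 2 * Real.cos θ ^ m := by
    have h3 : |Real.sin θ| ^ (m + 2) ≤ Real.sin θ ^ 2 * Real.cos θ ^ m := by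
      rw [pow_add, sq_abs, mul_comm]
      gcongr
    have h4 := le_abs_self (Real.sin θ ^ (m + 2))
    have h5 := le_abs_self ((-Real.sin θ) ^ (m + 2))
    rw [abs_pow] at h4 h5
    rw [abs_neg] at h5
    linarith
  have h6 : Real.cos θ ^ (m + 2) + Real.sin θ ^ 2 * Real.cos θ ^ m = Real.cos θ ^ m := by
    rw [pow_add]
    linear_combination Real.cos θ ^ m * Real.sin_sq_add_cos_sq θ
  linarith

/-- Only the angles of size r = m^{-1/2} are kept. There β is of order r^{-1-2s} and 1 - cos^m is
bounded below, while the interval has length r/4, which gives r^{-2s} = m^s. -/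
theorem le_integral_one_sub_cos_pow {s : ℝ} (hs0 : 0 < s) (hs1 : s < 1) {m : ℕ} (hm : m ≠ 0) :
    1 / 168 * (m : ℝ) ^ s ≤ ∫ θ in angles, crossSection s θ * (1 - Real.cos θ ^ m) := by
  have hm1 : (1 : ℝ) ≤ m := by exact_mod_cast Nat.one_le_iff_ne_zero.2 hm
  have hm0 : (0 : ℝ) < m := by linarith
  set r : ℝ := (Real.sqrt m)⁻¹ with hr
  have hsq : 1 ≤ Real.sqrt m := by rw [Real.one_le_sqrt]; exact hm1
  have hr0 : 0 < r := by positivity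
  have hr1 : r ≤ 1 := inv_le_one_of_one_le₀ hsq
  have hr2 : r ^ 2 = (m : ℝ)⁻¹ := by rw [hr, inv_pow, Real.sq_sqrt hm0.le]
  have hpi := Real.pi_gt_three
  have hsub : Icc (1 / 2 * r) (3 / 4 * r) ⊆ angles := fun θ hθ =>
    ⟨by linarith [hθ.1], by linarith [hθ.2]⟩
  have hint := integrableOn_one_sub_cos_pow hs0 hs1 m
  have hlow : ∀ θ ∈ Icc (1 / 2 * r) (3 / 4 * r),
      1 / 42 * r ^ (-1 - 2 * s) ≤ crossSection s θ * (1 - Real.cos θ ^ m) := fun θ hθ => by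
    have hθ0 : 0 < θ := by linarith [hθ.1]
    have hθ1 : θ ≤ r := by linarith [hθ.2]
    have h1 : 1 / 2 * r ^ (-1 - 2 * s) ≤ crossSection s θ := by
      refine le_trans ?_ (le_crossSection hs0 hθ0 (hθ1.trans hr1))
      gcongr 1 / 2 * ?_
      exact Real.rpow_le_rpow_of_nonpos hθ0 hθ1 (by linarith)
    -- From 1 - cos θ ≥ (2/π²)θ², 2/π² ≥ 1/5 and θ² ≥ 1/(4m).
    have h2 : Real.cos θ ≤ 1 - 1 / (20 * m) := by
      have h3 := Real.cos_le_one_sub_mul_cos_sq (x := θ) (by rw [abs_of_pos hθ0]; linarith)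
      have h4 : (1 : ℝ) / 5 ≤ 2 / Real.pi ^ 2 := by
        rw [div_le_div_iff₀ (by norm_num) (by positivity)]
        nlinarith [Real.pi_lt_d2]
      have h5 : 1 / 4 * r ^ 2 ≤ θ ^ 2 := by nlinarith [hθ.1]
      have h6 : 1 / (20 * (m : ℝ)) = 1 / 5 * (1 / 4 * r ^ 2) := by rw [hr2]; field_simp; norm_num
      have h7 : 1 / 5 * (1 / 4 * r ^ 2) ≤ 2 / Real.pi ^ 2 * θ ^ 2 := by gcongr
      linarith
    have hc := cos_nonneg_of_mem_angles (hsub hθ)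
    have h8 : Real.cos θ ^ m ≤ 20 / 21 := by
      calc Real.cos θ ^ m ≤ (Real.exp (-(1 / (20 * m)))) ^ m := by
            gcongr
            linarith [Real.add_one_le_exp (-(1 / (20 * (m : ℝ))))]
        _ = Real.exp (-(1 / 20)) := by
            rw [← Real.exp_nat_mul]; congr 1; field_simp
        _ ≤ 20 / 21 := by
            rw [Real.exp_neg, inv_le_comm₀ (Real.exp_pos _) (by norm_num)]
            linarith [Real.add_one_le_exp (1 / 20 : ℝ)]
    calc 1 / 42 * r ^ (-1 - 2 * s) = 1 / 2 * r ^ (-1 - 2 * s) * (1 / 21) := by ring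
      _ ≤ _ := mul_le_mul h1 (by linarith) (by norm_num) (crossSection_nonneg s θ)
  calc 1 / 168 * (m : ℝ) ^ s
      = ∫ θ in Icc (1 / 2 * r) (3 / 4 * r), 1 / 42 * r ^ (-1 - 2 * s) := by
        rw [setIntegral_const, Measure.real, Real.volume_Icc, ENNReal.toReal_ofReal (by linarith),
          smul_eq_mul]
        have : r ^ (-1 - 2 * s) = r⁻¹ * (m : ℝ) ^ s := by
          rw [show -1 - 2 * s = -1 + 2 * (-s) by ring, Real.rpow_add hr0, Real.rpow_neg_one,
            Real.rpow_mul hr0.le, Real.rpow_two, hr2, Real.inv_rpow hm0.le, Real.rpow_neg hm0.le,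
            inv_inv, inv_inv]
        rw [this]
        field_simp; norm_num
    _ ≤ ∫ θ in Icc (1 / 2 * r) (3 / 4 * r), crossSection s θ * (1 - Real.cos θ ^ m) :=
        setIntegral_mono_on (integrableOn_const (by simp)) (hint.mono_set hsub)
          measurableSet_Icc hlow
    _ ≤ _ := by
        refine setIntegral_mono_set hint ?_ hsub.eventuallyLE
        refine (ae_restrict_iff' measurableSet_angles).2 (Filter.Eventually.of_forall fun θ hθ => ?_)
        exact mul_nonneg (crossSection_nonneg s θ) (sub_nonneg.2
          (pow_le_one₀ (cos_nonneg_of_mem_angles hθ) (Real.cos_le_one θ)))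

theorem lam_zero (s : ℝ) : lam s 0 = 0 := by simp [lam, alpha_zero_zero]

theorem lam_nonneg {s : ℝ} (hs0 : 0 < s) (hs1 : s < 1) (n : ℕ) : 0 ≤ lam s n := by
  have h0 : ∀ m : ℕ, 0 ≤ ∫ θ in angles, crossSection s θ * (1 - Real.cos θ ^ m) := fun m =>
    setIntegral_nonneg measurableSet_angles fun θ hθ =>
      mul_nonneg (crossSection_nonneg s θ) (sub_nonneg.2
        (pow_le_one₀ (cos_nonneg_of_mem_angles hθ) (Real.cos_le_one θ)))
  rcases n with _ | _ | m
  · rw [lam_zero]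
  · rw [lam, alpha_one, sub_zero, alpha, ← integral_neg]
    refine (h0 1).trans (le_of_eq (integral_congr_ae (Filter.Eventually.of_forall fun θ => ?_)))
    simp only [angFactor_zero]; ring
  · exact (h0 m).trans (integral_one_sub_cos_pow_le_lam hs0 hs1 m)

/-- Coercivity of the linearized operator. -/
theorem wt_le_one_add_lam {s : ℝ} (hs0 : 0 < s) (hs1 : s < 1) (n : ℕ) :
    1 / 600 * ((n : ℝ) + 1 / 2) ^ s ≤ 1 + lam s n := by
  -- Small n rely on the added 1: λ_0 and λ_2 vanish, so the operator alone is not coercive.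
  rcases le_or_gt n 2 with hn | hn
  · have h1 : (n : ℝ) ≤ 2 := by exact_mod_cast hn
    have h2 : ((n : ℝ) + 1 / 2) ^ s ≤ (3 : ℝ) ^ (1 : ℝ) :=
      (Real.rpow_le_rpow (by positivity) (by linarith) hs0.le).trans
        (Real.rpow_le_rpow_of_exponent_le (by norm_num) hs1.le)
    rw [Real.rpow_one] at h2
    linarith [lam_nonneg hs0 hs1 n]
  · obtain ⟨m, rfl⟩ : ∃ m, n = m + 2 := ⟨n - 2, by omega⟩
    have hm : m ≠ 0 := by omega
    have h1 := (le_integral_one_sub_cos_pow hs0 hs1 hm).trans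
      (integral_one_sub_cos_pow_le_lam hs0 hs1 m)
    have hm1 : (1 : ℝ) ≤ m := by exact_mod_cast Nat.one_le_iff_ne_zero.2 hm
    -- m + 5/2 ≤ (7/2)m, and 168 · 7/2 = 588 ≤ 600.
    have h2 : (((m + 2 : ℕ) : ℝ) + 1 / 2) ^ s ≤ 7 / 2 * (m : ℝ) ^ s := by
      calc _ ≤ (7 / 2 * (m : ℝ)) ^ s := by
            refine Real.rpow_le_rpow (by positivity) ?_ hs0.le
            push_cast; linarith
        _ = (7 / 2) ^ s * (m : ℝ) ^ s := Real.mul_rpow (by norm_num) (by positivity)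
        _ ≤ (7 / 2) ^ (1 : ℝ) * (m : ℝ) ^ s := by
            gcongr
            norm_num
        _ = _ := by norm_num
    linarith [show 0 ≤ (m : ℝ) ^ s by positivity]

end Kac

/-! ### The collision pairing evaluated on Hermite functions. -/

namespace Kac

open Polynomial in
/-- The orthogonal change of variables `(x, y) ↦ (x c - y s, x s + y c)` preserves the measure. -/
theorem integral_comp_rotation {c s : ℝ} (hcs : c ^ 2 + s ^ 2 = 1) {F : ℝ × ℝ → ℂ}
    (hF : Continuous F) :
    ∫ z : ℝ × ℝ, F z = ∫ z : ℝ × ℝ, F (z.1 * c - z.2 * s, z.1 * s + z.2 * c) := by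
  set f : ℝ × ℝ →ₗ[ℝ] ℝ × ℝ :=
    Matrix.toLin (Module.Basis.finTwoProd ℝ) (Module.Basis.finTwoProd ℝ) !![c, -s; s, c] with hf
  have hdet : LinearMap.det f = 1 := by
    rw [hf, LinearMap.det_toLin, Matrix.det_fin_two_of]; linarith
  have hmap : Measure.map f volume = volume := by
    rw [Measure.map_linearMap_addHaar_eq_smul_addHaar volume (by rw [hdet]; exact one_ne_zero), hdet]
    simp
  have hfc : Measurable f := (LinearMap.continuous_of_finiteDimensional f).measurable
  conv_lhs => rw [← hmap]
  rw [integral_map hfc.aemeasurable hF.aestronglyMeasurable]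
  refine integral_congr_ae (Filter.Eventually.of_forall fun z => ?_)
  simp only [hf, Matrix.toLin_finTwoProd_apply]
  congr 2 <;> ring

theorem integrable_comp_rotation {c s : ℝ} (hcs : c ^ 2 + s ^ 2 = 1) {F : ℝ × ℝ → ℂ}
    (hF : Integrable F) :
    Integrable fun z : ℝ × ℝ => F (z.1 * c - z.2 * s, z.1 * s + z.2 * c) := by
  set f : ℝ × ℝ →ₗ[ℝ] ℝ × ℝ :=
    Matrix.toLin (Module.Basis.finTwoProd ℝ) (Module.Basis.finTwoProd ℝ) !![c, -s; s, c] with hf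
  have hdet : LinearMap.det f = 1 := by
    rw [hf, LinearMap.det_toLin, Matrix.det_fin_two_of]; linarith
  have hmap : Measure.map f volume = volume := by
    rw [Measure.map_linearMap_addHaar_eq_smul_addHaar volume (by rw [hdet]; exact one_ne_zero), hdet]
    simp
  have hfc : Measurable f := (LinearMap.continuous_of_finiteDimensional f).measurable
  have hF' : Integrable F (Measure.map f volume) := by rwa [hmap]
  refine (hF'.comp_measurable hfc).congr (Filter.Eventually.of_forall fun z => ?_)
  simp only [hf, Matrix.toLin_finTwoProd_apply, Function.comp]
  congr 2 <;> ring

theorem mulSqrtMu_eq (f : ℝ → ℂ) (v : ℝ) : mulSqrtMu f v = (sqrtMu v : ℂ) * f v := rfl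

theorem divSqrtMu_eq (f : ℝ → ℂ) (v : ℝ) : divSqrtMu f v = (sqrtMu v : ℂ)⁻¹ * f v := rfl

/-- The Hermite function `e_n`, complex valued. -/
noncomputable def hermiteC (n : ℕ) (v : ℝ) : ℂ := (hermiteFun n v : ℂ)

theorem mulSqrtMu_hermiteC (n : ℕ) (v : ℝ) : mulSqrtMu (hermiteC n) v =
    (((Real.sqrt (n.factorial : ℝ))⁻¹ * (He n).eval v * maxwellian v : ℝ) : ℂ) := by
  rw [mulSqrtMu_eq, hermiteC, hermiteFun_eq, ← sqrtMu_mul_self]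
  push_cast; ring

theorem continuous_mulSqrtMu_hermiteC (n : ℕ) : Continuous (mulSqrtMu (hermiteC n)) := by
  have : mulSqrtMu (hermiteC n) = fun v => ((sqrtMu v : ℂ) * (hermiteFun n v : ℂ)) := rfl
  rw [this]
  exact (Complex.continuous_ofReal.comp continuous_sqrtMu).mul
    (Complex.continuous_ofReal.comp (continuous_hermiteFun n))

theorem memLp_hermiteC (n : ℕ) : MemLp (hermiteC n) 2 volume := memLp_hermiteFun n

theorem memLp_weight_mul_sqrtMu : MemLp (fun v : ℝ => (((1 + v ^ 2) * sqrtMu v : ℝ) : ℂ)) 2 volume := by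
  have := memLp_sqrtMu_mul_eval (1 + Polynomial.X ^ 2)
  have e : (fun v : ℝ => ((sqrtMu v * (1 + Polynomial.X ^ 2 : Polynomial ℝ).eval v : ℝ) : ℂ)) =
      fun v : ℝ => (((1 + v ^ 2) * sqrtMu v : ℝ) : ℂ) := by
    ext v; simp [mul_comm]
  rwa [e] at this

theorem memLp_sqrtMu : MemLp (fun v : ℝ => (sqrtMu v : ℂ)) 2 volume := by
  have := memLp_hermiteFun 0
  simpa only [hermiteFun_zero] using this

theorem integrable_mulSqrtMu {f : ℝ → ℂ} (hf : MemLp f 2 volume) : Integrable (mulSqrtMu f) :=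
  integrable_mul_of_memLp memLp_sqrtMu hf

/-- A weighted norm of `μ^{1/2}`. -/
noncomputable def muConst : ℝ≥0∞ :=
  eLpNorm (fun v : ℝ => (((1 + v ^ 2) * sqrtMu v : ℝ) : ℂ)) 2 volume

theorem muConst_ne_top : muConst ≠ ⊤ := memLp_weight_mul_sqrtMu.2.ne

theorem lintegral_weight_mulSqrtMu_le {f : ℝ → ℂ} (hf : MemLp f 2 volume) :
    ∫⁻ v, ENNReal.ofReal (1 + v ^ 2) * ‖mulSqrtMu f v‖ₑ ≤ muConst * eLpNorm f 2 volume := by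
  have h := ENNReal.lintegral_mul_le_Lp_mul_Lq volume Real.HolderConjugate.two_two
    memLp_weight_mul_sqrtMu.1.enorm hf.1.enorm
  refine le_trans (le_of_eq ?_) (h.trans (le_of_eq ?_))
  · refine lintegral_congr fun v => ?_
    rw [Pi.mul_apply, mulSqrtMu_eq, enorm_mul, ← mul_assoc]
    congr 1
    have : ‖(((1 + v ^ 2) * sqrtMu v : ℝ) : ℂ)‖ₑ = ENNReal.ofReal (1 + v ^ 2) * ‖(sqrtMu v : ℂ)‖ₑ := by
      rw [Complex.ofReal_mul, enorm_mul]
      congr 1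
      rw [← ofReal_norm, Complex.norm_real, Real.norm_of_nonneg (by positivity)]
    exact this.symm
  · rw [muConst, eLpNorm_eq_lintegral_rpow_enorm_toReal two_ne_zero (by simp),
      eLpNorm_eq_lintegral_rpow_enorm_toReal two_ne_zero (by simp)]
    simp

/-! ### Second differences -/

/-- The symmetrized difference `(Ψ(v c + w s) + Ψ(v c - w s))/2 - Ψ(v)`. -/
noncomputable def avgDiff (Ψ : ℝ → ℂ) (c s v w : ℝ) : ℂ :=
  (Ψ (v * c + w * s) + Ψ (v * c - w * s)) / 2 - Ψ v

/-- The mean value inequality twice: r ↦ Ψ(a + r) + Ψ(a - r) has derivative Ψ'(a + r) - Ψ'(a - r),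
of size 2M|r|. -/
theorem norm_second_diff_le {Ψ : ℝ → ℂ} (hΨ : ContDiff ℝ ∞ Ψ) {M : ℝ}
    (hM : ∀ x, ‖deriv (deriv Ψ) x‖ ≤ M) (a b : ℝ) :
    ‖Ψ (a + b) + Ψ (a - b) - 2 * Ψ a‖ ≤ 2 * M * b ^ 2 := by
  have hd : Differentiable ℝ Ψ := hΨ.differentiable (by simp)
  have hΨ' : ContDiff ℝ ∞ (deriv Ψ) := (contDiff_infty_iff_deriv.1 hΨ).2
  have hd' : Differentiable ℝ (deriv Ψ) := hΨ'.differentiable (by simp)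
  have hM0 : 0 ≤ M := (norm_nonneg _).trans (hM 0)
  have hder : ∀ r : ℝ, HasDerivAt (fun r => Ψ (a + r) + Ψ (a - r))
      (deriv Ψ (a + r) - deriv Ψ (a - r)) r := fun r => by
    have h1 := (hd (a + r)).hasDerivAt.comp_const_add a r
    have h2 := (hd (a - r)).hasDerivAt.comp_const_sub a r
    exact (h1.fun_add h2).congr_deriv (by ring)
  have hlip : ∀ r ∈ Icc (-|b|) |b|, ‖deriv Ψ (a + r) - deriv Ψ (a - r)‖ ≤ 2 * M * |b| :=
    fun r hr => by
    have := convex_univ.norm_image_sub_le_of_norm_hasDerivWithin_le (f := deriv Ψ)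
      (f' := deriv (deriv Ψ)) (C := M) (x := a - r) (y := a + r)
      (fun x _ => (hd' x).hasDerivAt.hasDerivWithinAt) (fun x _ => hM x) trivial trivial
    refine this.trans ?_
    rw [Real.norm_eq_abs, show a + r - (a - r) = 2 * r by ring, abs_mul, abs_two]
    nlinarith [abs_le.2 hr, mul_le_mul_of_nonneg_left (abs_le.2 hr) hM0]
  have := (convex_Icc (-|b|) |b|).norm_image_sub_le_of_norm_hasDerivWithin_le
    (f := fun r => Ψ (a + r) + Ψ (a - r)) (x := 0) (y := b)
    (fun x _ => (hder x).hasDerivWithinAt) hlip (by simp) (abs_le.1 le_rfl)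
  simp only [add_zero, sub_zero] at this
  rw [← two_mul, Real.norm_eq_abs] at this
  refine this.trans (le_of_eq ?_)
  rw [mul_assoc, ← pow_two, sq_abs]

/-- The two reflected shifts ±w sin θ cancel to first order, and the shift from v to v cos θ is
already quadratic in θ. The factor θ² is what makes the singularity of β integrable; the polynomial
weights are absorbed by √μ. -/
theorem norm_avgDiff_le {Ψ : ℝ → ℂ} (hΨ : ContDiff ℝ ∞ Ψ) (hs : HasCompactSupport Ψ) :
    ∃ C : ℝ, 0 ≤ C ∧ ∀ θ v w : ℝ, ‖avgDiff Ψ (Real.cos θ) (Real.sin θ) v w‖ ≤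
      C * θ ^ 2 * ((1 + w ^ 2) * (1 + v ^ 2)) := by
  have hd : Differentiable ℝ Ψ := hΨ.differentiable (by simp)
  have hΨ' : ContDiff ℝ ∞ (deriv Ψ) := (contDiff_infty_iff_deriv.1 hΨ).2
  have hΨ'' : ContDiff ℝ ∞ (deriv (deriv Ψ)) := (contDiff_infty_iff_deriv.1 hΨ').2
  obtain ⟨M₁, hM₁⟩ := hs.deriv.exists_bound_of_continuous hΨ'.continuous
  obtain ⟨M₂, hM₂⟩ := hs.deriv.deriv.exists_bound_of_continuous hΨ''.continuous
  have h1 : 0 ≤ M₁ := (norm_nonneg _).trans (hM₁ 0)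
  have h2 : 0 ≤ M₂ := (norm_nonneg _).trans (hM₂ 0)
  refine ⟨M₁ + M₂, by positivity, fun θ v w => ?_⟩
  have e : avgDiff Ψ (Real.cos θ) (Real.sin θ) v w =
      (Ψ (v * Real.cos θ + w * Real.sin θ) + Ψ (v * Real.cos θ - w * Real.sin θ) -
        2 * Ψ (v * Real.cos θ)) / 2 + (Ψ (v * Real.cos θ) - Ψ v) := by
    unfold avgDiff; ring
  have a1 := norm_second_diff_le hΨ hM₂ (v * Real.cos θ) (w * Real.sin θ)
  have a2 : ‖Ψ (v * Real.cos θ) - Ψ v‖ ≤ M₁ * ‖v * Real.cos θ - v‖ :=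
    convex_univ.norm_image_sub_le_of_norm_hasDerivWithin_le (f := Ψ) (f' := deriv Ψ)
      (fun x _ => (hd x).hasDerivAt.hasDerivWithinAt) (fun x _ => hM₁ x) trivial trivial
  have a3 : ‖v * Real.cos θ - v‖ ≤ |v| * θ ^ 2 := by
    rw [Real.norm_eq_abs, show v * Real.cos θ - v = v * (Real.cos θ - 1) by ring, abs_mul]
    gcongr
    rw [abs_sub_comm, abs_of_nonneg (by linarith [Real.cos_le_one θ])]
    have := Real.one_sub_sq_div_two_le_cos (x := θ)
    nlinarith [sq_nonneg θ]
  have a4 : (w * Real.sin θ) ^ 2 ≤ w ^ 2 * θ ^ 2 := by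
    rw [mul_pow]; gcongr ?_ * ?_; exact sin_sq_le θ
  rw [e]
  have b1 : ‖(Ψ (v * Real.cos θ + w * Real.sin θ) + Ψ (v * Real.cos θ - w * Real.sin θ) -
        2 * Ψ (v * Real.cos θ)) / 2‖ ≤ M₂ * (w ^ 2 * θ ^ 2) := by
    rw [norm_div, Complex.norm_ofNat, div_le_iff₀ two_pos]
    nlinarith
  have b2 : ‖Ψ (v * Real.cos θ) - Ψ v‖ ≤ M₁ * (|v| * θ ^ 2) :=
    a2.trans (mul_le_mul_of_nonneg_left a3 h1)
  have hv : |v| ≤ 1 + v ^ 2 := by nlinarith [sq_abs v, sq_nonneg (|v| - 1), abs_nonneg v]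
  have hA : w ^ 2 ≤ (1 + w ^ 2) * (1 + v ^ 2) := by nlinarith [sq_nonneg w, sq_nonneg v, mul_nonneg (sq_nonneg w) (sq_nonneg v)]
  have hB : |v| ≤ (1 + w ^ 2) * (1 + v ^ 2) := by nlinarith [sq_nonneg w, sq_nonneg v, mul_nonneg (sq_nonneg w) (sq_nonneg v)]
  calc _ ≤ M₂ * (w ^ 2 * θ ^ 2) + M₁ * (|v| * θ ^ 2) := (norm_add_le _ _).trans (add_le_add b1 b2)
    _ ≤ M₂ * ((1 + w ^ 2) * (1 + v ^ 2) * θ ^ 2) + M₁ * ((1 + w ^ 2) * (1 + v ^ 2) * θ ^ 2) := by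
        gcongr
    _ = _ := by ring

/-! ### The angular pairing -/

/-- The collision pairing at a fixed deviation angle. -/
noncomputable def angPairing (f g Ψ : ℝ → ℂ) (θ : ℝ) : ℂ :=
  ∫ v : ℝ, ∫ w : ℝ, mulSqrtMu f w * mulSqrtMu g v * avgDiff Ψ (Real.cos θ) (Real.sin θ) v w

theorem gammaPairing_eq_integral (s : ℝ) (f g ψ : ℝ → ℂ) :
    gammaPairing s f g ψ =
      ∫ θ in angles, (crossSection s θ : ℂ) * angPairing f g (divSqrtMu ψ) θ := by
  simp only [gammaPairing, kacPairing, angPairing, avgDiff, angles]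

theorem integrable_angPairing {f g Ψ : ℝ → ℂ} (hf : MemLp f 2 volume) (hg : MemLp g 2 volume)
    (hΨ : Continuous Ψ) (hs : HasCompactSupport Ψ) (c s : ℝ) :
    Integrable fun z : ℝ × ℝ => mulSqrtMu f z.2 * mulSqrtMu g z.1 * avgDiff Ψ c s z.1 z.2 := by
  obtain ⟨M, hM⟩ := hs.exists_bound_of_continuous hΨ
  have h1 : Integrable fun z : ℝ × ℝ => mulSqrtMu f z.2 * mulSqrtMu g z.1 :=
    ((integrable_mulSqrtMu hg).mul_prod (integrable_mulSqrtMu hf)).congr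
      (Filter.Eventually.of_forall fun z => mul_comm _ _)
  refine h1.mul_bdd (c := 2 * M) ?_ (Filter.Eventually.of_forall fun z => ?_)
  · unfold avgDiff
    exact (by fun_prop : Continuous _).aestronglyMeasurable
  · unfold avgDiff
    refine (norm_sub_le _ _).trans ?_
    rw [norm_div, Complex.norm_ofNat]
    have := norm_add_le (Ψ (z.1 * c + z.2 * s)) (Ψ (z.1 * c - z.2 * s))
    linarith [hM (z.1 * c + z.2 * s), hM (z.1 * c - z.2 * s), hM z.1]

theorem angPairing_eq {f g Ψ : ℝ → ℂ} (hf : MemLp f 2 volume) (hg : MemLp g 2 volume)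
    (hΨ : Continuous Ψ) (hs : HasCompactSupport Ψ) (θ : ℝ) :
    angPairing f g Ψ θ = ∫ z : ℝ × ℝ, mulSqrtMu f z.2 * mulSqrtMu g z.1 *
      avgDiff Ψ (Real.cos θ) (Real.sin θ) z.1 z.2 :=
  (integral_prod _ (integrable_angPairing hf hg hΨ hs _ _)).symm

theorem enorm_angPairing_le {f g Ψ : ℝ → ℂ} (hf : MemLp f 2 volume) (hg : MemLp g 2 volume)
    {C θ : ℝ} (hC : ∀ v w : ℝ, ‖avgDiff Ψ (Real.cos θ) (Real.sin θ) v w‖ ≤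
      C * ((1 + w ^ 2) * (1 + v ^ 2))) (hC0 : 0 ≤ C) :
    ‖angPairing f g Ψ θ‖ₑ ≤ ENNReal.ofReal C *
      (muConst * eLpNorm f 2 volume * (muConst * eLpNorm g 2 volume)) := by
  have hF := lintegral_weight_mulSqrtMu_le hf
  have hG := lintegral_weight_mulSqrtMu_le hg
  have hFt : muConst * eLpNorm f 2 volume ≠ ⊤ := ENNReal.mul_ne_top muConst_ne_top hf.2.ne
  refine (enorm_integral_le_lintegral_enorm _).trans ?_
  have h1 : ∀ v, ‖∫ w : ℝ, mulSqrtMu f w * mulSqrtMu g v *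
      avgDiff Ψ (Real.cos θ) (Real.sin θ) v w‖ₑ ≤
      ENNReal.ofReal C * (muConst * eLpNorm f 2 volume) *
        (ENNReal.ofReal (1 + v ^ 2) * ‖mulSqrtMu g v‖ₑ) := fun v => by
    refine (enorm_integral_le_lintegral_enorm _).trans ?_
    calc _ ≤ ∫⁻ w, ENNReal.ofReal C * (ENNReal.ofReal (1 + v ^ 2) * ‖mulSqrtMu g v‖ₑ) *
          (ENNReal.ofReal (1 + w ^ 2) * ‖mulSqrtMu f w‖ₑ) := by
          refine lintegral_mono fun w => ?_
          rw [enorm_mul, enorm_mul]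
          have : ‖avgDiff Ψ (Real.cos θ) (Real.sin θ) v w‖ₑ ≤
              ENNReal.ofReal C * (ENNReal.ofReal (1 + w ^ 2) * ENNReal.ofReal (1 + v ^ 2)) := by
            rw [← ENNReal.ofReal_mul (by positivity), ← ENNReal.ofReal_mul hC0, ← ofReal_norm]
            exact ENNReal.ofReal_le_ofReal (hC v w)
          calc _ ≤ ‖mulSqrtMu f w‖ₑ * ‖mulSqrtMu g v‖ₑ *
                (ENNReal.ofReal C * (ENNReal.ofReal (1 + w ^ 2) * ENNReal.ofReal (1 + v ^ 2))) := by
                gcongr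
            _ = _ := by ring
      _ = ENNReal.ofReal C * (ENNReal.ofReal (1 + v ^ 2) * ‖mulSqrtMu g v‖ₑ) *
          ∫⁻ w, ENNReal.ofReal (1 + w ^ 2) * ‖mulSqrtMu f w‖ₑ := by
          rw [lintegral_const_mul' _ _ (by finiteness)]
      _ ≤ ENNReal.ofReal C * (ENNReal.ofReal (1 + v ^ 2) * ‖mulSqrtMu g v‖ₑ) *
          (muConst * eLpNorm f 2 volume) := by gcongr
      _ = _ := by ring
  calc _ ≤ _ := lintegral_mono h1
    _ = ENNReal.ofReal C * (muConst * eLpNorm f 2 volume) *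
        ∫⁻ v, ENNReal.ofReal (1 + v ^ 2) * ‖mulSqrtMu g v‖ₑ := by
        rw [lintegral_const_mul' _ _ (ENNReal.mul_ne_top ENNReal.ofReal_ne_top hFt)]
    _ ≤ ENNReal.ofReal C * (muConst * eLpNorm f 2 volume) * (muConst * eLpNorm g 2 volume) := by
        gcongr
    _ = _ := by ring

theorem angPairing_sub {f f' g g' Ψ : ℝ → ℂ} (hf : MemLp f 2 volume) (hf' : MemLp f' 2 volume)
    (hg : MemLp g 2 volume) (hg' : MemLp g' 2 volume) (hΨ : Continuous Ψ)
    (hs : HasCompactSupport Ψ) (θ : ℝ) :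
    angPairing f g Ψ θ - angPairing f' g' Ψ θ =
      angPairing (fun v => f v - f' v) g Ψ θ + angPairing f' (fun v => g v - g' v) Ψ θ := by
  have h1 : MemLp (fun v => f v - f' v) 2 volume := hf.sub hf'
  have h2 : MemLp (fun v => g v - g' v) 2 volume := hg.sub hg'
  rw [angPairing_eq hf hg hΨ hs, angPairing_eq hf' hg' hΨ hs, angPairing_eq h1 hg hΨ hs,
    angPairing_eq hf' h2 hΨ hs, ← integral_sub (integrable_angPairing hf hg hΨ hs _ _)
    (integrable_angPairing hf' hg' hΨ hs _ _),
    ← integral_add (integrable_angPairing h1 hg hΨ hs _ _)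
    (integrable_angPairing hf' h2 hΨ hs _ _)]
  refine integral_congr_ae (Filter.Eventually.of_forall fun z => ?_)
  simp only [mulSqrtMu_eq]; ring

/-! ### The pairing of two Hermite functions -/

/-- After a rotation the test function depends on one coordinate only and the product of Maxwellians
is unchanged. The other coordinate is integrated by `gaussExp_He_comp_mul_He_comp`. -/
theorem integral_hermite_rotation {c s : ℝ} (hcs : c ^ 2 + s ^ 2 = 1) {ψ : ℝ → ℂ}
    (hψ : Continuous (divSqrtMu ψ)) (hs : HasCompactSupport (divSqrtMu ψ)) (k l : ℕ) :
    ∫ z : ℝ × ℝ, mulSqrtMu (hermiteC k) z.2 * mulSqrtMu (hermiteC l) z.1 *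
        divSqrtMu ψ (z.1 * c + z.2 * s) =
      ((Real.sqrt ((k + l).choose k) * s ^ k * c ^ l : ℝ) : ℂ) * coef (k + l) ψ := by
  have hck := continuous_mulSqrtMu_hermiteC k
  have hcl := continuous_mulSqrtMu_hermiteC l
  have hcont : Continuous fun z : ℝ × ℝ => mulSqrtMu (hermiteC k) z.2 *
      mulSqrtMu (hermiteC l) z.1 * divSqrtMu ψ (z.1 * c + z.2 * s) := by fun_prop
  obtain ⟨M, hM⟩ := hs.exists_bound_of_continuous hψ
  have hint : Integrable fun z : ℝ × ℝ => mulSqrtMu (hermiteC k) z.2 *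
      mulSqrtMu (hermiteC l) z.1 * divSqrtMu ψ (z.1 * c + z.2 * s) := by
    have h1 : Integrable fun z : ℝ × ℝ => mulSqrtMu (hermiteC k) z.2 * mulSqrtMu (hermiteC l) z.1 :=
      ((integrable_mulSqrtMu (memLp_hermiteC l)).mul_prod
        (integrable_mulSqrtMu (memLp_hermiteC k))).congr
        (Filter.Eventually.of_forall fun z => mul_comm _ _)
    exact h1.mul_bdd (c := M) (by fun_prop : Continuous _).aestronglyMeasurable
      (Filter.Eventually.of_forall fun z => hM _)
  rw [integral_comp_rotation hcs hcont]
  have hint' := integrable_comp_rotation hcs hint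
  rw [Measure.volume_eq_prod] at hint' ⊢
  rw [integral_prod _ hint']
  set a : ℝ := (Real.sqrt (k.factorial : ℝ))⁻¹ with ha
  set b : ℝ := (Real.sqrt (l.factorial : ℝ))⁻¹ with hb
  have hinner : ∀ x : ℝ, ∫ y : ℝ, mulSqrtMu (hermiteC k) (x * s + y * c) *
      mulSqrtMu (hermiteC l) (x * c - y * s) *
        divSqrtMu ψ ((x * c - y * s) * c + (x * s + y * c) * s) =
      ((Real.sqrt ((k + l).choose k) * s ^ k * c ^ l : ℝ) : ℂ) *
        (ψ x * (hermiteFun (k + l) x : ℂ)) := fun x => by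
    have e1 : ∀ y : ℝ, mulSqrtMu (hermiteC k) (x * s + y * c) *
        mulSqrtMu (hermiteC l) (x * c - y * s) *
          divSqrtMu ψ ((x * c - y * s) * c + (x * s + y * c) * s) =
        (a * b * maxwellian x : ℝ) * divSqrtMu ψ x *
        (((((He k).comp (Polynomial.C (x * s) + Polynomial.C c * Polynomial.X) *
          (He l).comp (Polynomial.C (x * c) - Polynomial.C s * Polynomial.X)).eval y *
            maxwellian y : ℝ)) : ℂ) := fun y => by
      have e2 : (x * c - y * s) * c + (x * s + y * c) * s = x := by linear_combination x * hcs
      have e3 : maxwellian (x * s + y * c) * maxwellian (x * c - y * s) =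
          maxwellian x * maxwellian y := by
        have : ∀ p q : ℝ, maxwellian p * maxwellian q =
            ((Real.sqrt (2 * Real.pi))⁻¹) ^ 2 * Real.exp (-(p ^ 2 + q ^ 2) / 2) := fun p q => by
          unfold maxwellian
          rw [show -(p ^ 2 + q ^ 2) / 2 = -p ^ 2 / 2 + -q ^ 2 / 2 by ring, Real.exp_add]; ring
        rw [this, this]
        congr 3
        linear_combination -(x ^ 2 + y ^ 2) * hcs
      rw [e2, mulSqrtMu_hermiteC, mulSqrtMu_hermiteC, ← ha, ← hb]
      simp only [Polynomial.eval_mul, Polynomial.eval_comp, Polynomial.eval_add,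
        Polynomial.eval_sub, Polynomial.eval_C, Polynomial.eval_X]
      have e4 : (((a * (He k).eval (x * s + y * c) * maxwellian (x * s + y * c) : ℝ)) : ℂ) *
          ((b * (He l).eval (x * c - y * s) * maxwellian (x * c - y * s) : ℝ) : ℂ) =
          ((a * b * ((He k).eval (x * s + c * y) * (He l).eval (x * c - s * y)) *
            (maxwellian x * maxwellian y) : ℝ) : ℂ) := by
        rw [← e3, ← Complex.ofReal_mul, mul_comm c y, mul_comm s y]
        congr 1; ring
      rw [e4]; push_cast; ring
    simp only [e1]
    rw [integral_const_mul, integral_complex_ofReal]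
    have e5 := gaussExp_He_comp_mul_He_comp hcs x k l
    rw [gaussExp] at e5
    rw [e5, divSqrtMu_eq, hermiteFun_eq]
    have hs0 : (sqrtMu x : ℂ) ≠ 0 := by exact_mod_cast (sqrtMu_pos x).ne'
    -- The normalizations combine: (k! l!)^{-1/2} is the square root of the binomial coefficient
    -- times (k+l)!^{-1/2}.
    have e6 : a * b = Real.sqrt ((k + l).choose k) * (Real.sqrt ((k + l).factorial : ℝ))⁻¹ := by
      rw [ha, hb, ← mul_inv, ← Real.sqrt_mul (by positivity), ← Real.sqrt_inv, ← Real.sqrt_inv,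
        ← Real.sqrt_mul (by positivity)]
      congr 1
      have := Nat.choose_mul_factorial_mul_factorial (Nat.le_add_right k l)
      rw [Nat.add_sub_cancel_left] at this
      have h : ((k + l).choose k : ℝ) * (k.factorial * l.factorial) = (k + l).factorial := by
        rw [← mul_assoc]; exact_mod_cast this
      have h3 : ((k + l).factorial : ℝ) ≠ 0 := by positivity
      field_simp
      linarith
    rw [← sqrtMu_mul_self, e6]
    push_cast
    field_simp
  simp only [hinner]
  rw [integral_const_mul, coef]

/-- The three terms are rotations by θ, by -θ and by 0. The rotation by 0 survives only for k = 0,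
which explains the exceptional 1 in `angFactor`. -/
theorem angPairing_hermiteC {ψ : ℝ → ℂ} (hψ : Continuous (divSqrtMu ψ))
    (hs : HasCompactSupport (divSqrtMu ψ)) (k l : ℕ) (θ : ℝ) :
    angPairing (hermiteC k) (hermiteC l) (divSqrtMu ψ) θ =
      (angFactor k l θ : ℂ) * coef (k + l) ψ := by
  have hck := continuous_mulSqrtMu_hermiteC k
  have hcl := continuous_mulSqrtMu_hermiteC l
  obtain ⟨M, hM⟩ := hs.exists_bound_of_continuous hψ
  have hint : ∀ c s : ℝ, Integrable fun z : ℝ × ℝ => mulSqrtMu (hermiteC k) z.2 *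
      mulSqrtMu (hermiteC l) z.1 * divSqrtMu ψ (z.1 * c + z.2 * s) := fun c s => by
    have h1 : Integrable fun z : ℝ × ℝ => mulSqrtMu (hermiteC k) z.2 * mulSqrtMu (hermiteC l) z.1 :=
      ((integrable_mulSqrtMu (memLp_hermiteC l)).mul_prod
        (integrable_mulSqrtMu (memLp_hermiteC k))).congr
        (Filter.Eventually.of_forall fun z => mul_comm _ _)
    exact h1.mul_bdd (c := M) (by fun_prop : Continuous _).aestronglyMeasurable
      (Filter.Eventually.of_forall fun z => hM _)
  have h0 := integral_hermite_rotation (c := 1) (s := 0) (by norm_num) hψ hs k l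
  have h1 := integral_hermite_rotation (Real.cos_sq_add_sin_sq θ) hψ hs k l
  have h2 := integral_hermite_rotation (c := Real.cos θ) (s := -Real.sin θ)
    (by rw [neg_sq]; exact Real.cos_sq_add_sin_sq θ) hψ hs k l
  rw [angPairing_eq (memLp_hermiteC k) (memLp_hermiteC l) hψ hs]
  have e : ∀ z : ℝ × ℝ, mulSqrtMu (hermiteC k) z.2 * mulSqrtMu (hermiteC l) z.1 *
      avgDiff (divSqrtMu ψ) (Real.cos θ) (Real.sin θ) z.1 z.2 =
      (1 / 2 : ℂ) * (mulSqrtMu (hermiteC k) z.2 * mulSqrtMu (hermiteC l) z.1 *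
        divSqrtMu ψ (z.1 * Real.cos θ + z.2 * Real.sin θ)) +
      (1 / 2 : ℂ) * (mulSqrtMu (hermiteC k) z.2 * mulSqrtMu (hermiteC l) z.1 *
        divSqrtMu ψ (z.1 * Real.cos θ + z.2 * (-Real.sin θ))) -
      mulSqrtMu (hermiteC k) z.2 * mulSqrtMu (hermiteC l) z.1 *
        divSqrtMu ψ (z.1 * 1 + z.2 * 0) := fun z => by
    rw [avgDiff, mul_one, mul_zero, add_zero, mul_neg, ← sub_eq_add_neg]; ring
  simp only [e]
  rw [integral_sub (((hint _ _).const_mul _).fun_add ((hint _ _).const_mul _)) (hint _ _),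
    integral_add ((hint _ _).const_mul _) ((hint _ _).const_mul _), integral_const_mul,
    integral_const_mul, h0, h1, h2, angFactor]
  rcases eq_or_ne k 0 with rfl | hk
  · simp; ring
  · simp only [if_neg hk, zero_pow hk]; push_cast; ring

theorem angPairing_hermiteSum {ψ : ℝ → ℂ} (hψ : Continuous (divSqrtMu ψ))
    (hs : HasCompactSupport (divSqrtMu ψ)) (f g : ℝ → ℂ) (N : ℕ) (θ : ℝ) :
    angPairing (hermiteSum N f) (hermiteSum N g) (divSqrtMu ψ) θ =
      ∑ p ∈ Finset.range N ×ˢ Finset.range N,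
        (angFactor p.1 p.2 θ : ℂ) * (coef p.1 f * coef p.2 g * coef (p.1 + p.2) ψ) := by
  rw [angPairing_eq (memLp_hermiteSum N f) (memLp_hermiteSum N g) hψ hs]
  have e : ∀ z : ℝ × ℝ, mulSqrtMu (hermiteSum N f) z.2 * mulSqrtMu (hermiteSum N g) z.1 *
      avgDiff (divSqrtMu ψ) (Real.cos θ) (Real.sin θ) z.1 z.2 =
      ∑ p ∈ Finset.range N ×ˢ Finset.range N, coef p.1 f * coef p.2 g *
        (mulSqrtMu (hermiteC p.1) z.2 * mulSqrtMu (hermiteC p.2) z.1 *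
          avgDiff (divSqrtMu ψ) (Real.cos θ) (Real.sin θ) z.1 z.2) := fun z => by
    rw [mulSqrtMu_eq, mulSqrtMu_eq, hermiteSum, hermiteSum, Finset.mul_sum, Finset.mul_sum,
      Finset.sum_mul_sum, ← Finset.sum_product', Finset.sum_mul]
    refine Finset.sum_congr rfl fun p _ => ?_
    simp only [mulSqrtMu_eq, hermiteC]; ring
  simp only [e]
  rw [integral_finsetSum _ fun p _ => (integrable_angPairing (memLp_hermiteC p.1)
    (memLp_hermiteC p.2) hψ hs _ _).const_mul _]
  refine Finset.sum_congr rfl fun p _ => ?_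
  rw [integral_const_mul, ← angPairing_eq (memLp_hermiteC p.1) (memLp_hermiteC p.2) hψ hs,
    angPairing_hermiteC hψ hs]
  ring

end Kac

namespace Kac

/-! ### The collision operator in the Hermite basis -/

theorem integrableOn_crossSection_mul_angFactor {s : ℝ} (hs0 : 0 < s) (hs1 : s < 1) (k l : ℕ) :
    IntegrableOn (fun θ => crossSection s θ * angFactor k l θ) angles := by
  rcases eq_or_ne k 0 with rfl | hk
  · refine (integrableOn_one_sub_cos_pow hs0 hs1 l).neg.congr
      (Filter.Eventually.of_forall fun θ => ?_)
    simp only [angFactor_zero, Pi.neg_apply]; ring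
  rcases eq_or_ne k 1 with rfl | hk1
  · simp [angFactor_one, IntegrableOn]
  have h := (integrableOn_sin_pow hs0 hs1 (by omega : 2 ≤ k)).mul_bdd
    (g := fun θ => Real.sqrt ((k + l).choose k) * Real.cos θ ^ l)
    (c := Real.sqrt ((k + l).choose k)) (by fun_prop : Continuous _).aestronglyMeasurable
    (Filter.Eventually.of_forall fun θ => by
      rw [norm_mul, norm_pow, Real.norm_of_nonneg (Real.sqrt_nonneg _)]
      exact mul_le_of_le_one_right (Real.sqrt_nonneg _)
        (pow_le_one₀ (norm_nonneg _) (Real.abs_cos_le_one θ)))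
  refine h.congr (Filter.Eventually.of_forall fun θ => ?_)
  simp only [angFactor, if_neg hk]; ring

theorem contDiff_divSqrtMu {ψ : ℝ → ℂ} (hψ : ContDiff ℝ ∞ ψ) : ContDiff ℝ ∞ (divSqrtMu ψ) := by
  have h : ContDiff ℝ ∞ fun v => (sqrtMu v)⁻¹ := contDiff_sqrtMu.inv fun v => (sqrtMu_pos v).ne'
  have h2 : ContDiff ℝ ∞ fun v => (((sqrtMu v)⁻¹ : ℝ) : ℂ) := Complex.ofRealCLM.contDiff.comp h
  have e : divSqrtMu ψ = fun v => (((sqrtMu v)⁻¹ : ℝ) : ℂ) * ψ v := by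
    ext v; rw [divSqrtMu_eq, Complex.ofReal_inv]
  rw [e]; exact h2.mul hψ

theorem hasCompactSupport_divSqrtMu {ψ : ℝ → ℂ} (hs : HasCompactSupport ψ) :
    HasCompactSupport (divSqrtMu ψ) := hs.mul_left

theorem eventually_eLpNorm_hermiteSum_le {u : ℝ → ℂ} (hu : MemLp u 2 volume) :
    ∀ᶠ N in Filter.atTop, eLpNorm (hermiteSum N u) 2 volume ≤ eLpNorm u 2 volume + 1 := by
  filter_upwards [(tendsto_hermiteSum hu).eventually_le_const one_pos] with N hN
  have e : hermiteSum N u = fun v => u v - (u v - hermiteSum N u v) := by ext v; ring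
  calc eLpNorm (hermiteSum N u) 2 volume
      = eLpNorm (fun v => u v - (u v - hermiteSum N u v)) 2 volume := by rw [← e]
    _ ≤ eLpNorm u 2 volume + eLpNorm (fun v => u v - hermiteSum N u v) 2 volume :=
        eLpNorm_sub_le hu.1 (hu.sub (memLp_hermiteSum N u)).1 (by norm_num)
    _ ≤ _ := by gcongr

/-- For truncated Hermite expansions the pairing is a finite sum. The truncation is removed by
dominated convergence in θ, because the pairing at a fixed angle is O(θ²) with a constant depending
only on L² norms. -/
theorem tendsto_sum_gammaPairing {s : ℝ} (hs0 : 0 < s) (hs1 : s < 1) {f g ψ : ℝ → ℂ}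
    (hf : MemLp f 2 volume) (hg : MemLp g 2 volume) (hψ : ContDiff ℝ ∞ ψ)
    (hc : HasCompactSupport ψ) :
    Filter.Tendsto (fun N => ∑ p ∈ Finset.range N ×ˢ Finset.range N,
      (alpha s p.1 p.2 : ℂ) * (coef p.1 f * coef p.2 g * coef (p.1 + p.2) ψ)) Filter.atTop
      (nhds (gammaPairing s f g ψ)) := by
  have hΨ := contDiff_divSqrtMu hψ
  have hΨc := hasCompactSupport_divSqrtMu hc
  obtain ⟨C, hC0, hC⟩ := norm_avgDiff_le hΨ hΨc
  have hbd : ∀ {f g : ℝ → ℂ}, MemLp f 2 volume → MemLp g 2 volume → ∀ θ,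
      ‖angPairing f g (divSqrtMu ψ) θ‖ₑ ≤ ENNReal.ofReal (C * θ ^ 2) *
      (muConst * eLpNorm f 2 volume * (muConst * eLpNorm g 2 volume)) := fun hf hg θ =>
    enorm_angPairing_le hf hg (hC θ) (by positivity)
  have hfin : ∀ N, ∑ p ∈ Finset.range N ×ˢ Finset.range N,
      (alpha s p.1 p.2 : ℂ) * (coef p.1 f * coef p.2 g * coef (p.1 + p.2) ψ) =
      ∫ θ in angles, (crossSection s θ : ℂ) *
        angPairing (hermiteSum N f) (hermiteSum N g) (divSqrtMu ψ) θ := fun N => by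
    have e : ∀ θ, (crossSection s θ : ℂ) *
        angPairing (hermiteSum N f) (hermiteSum N g) (divSqrtMu ψ) θ =
        ∑ p ∈ Finset.range N ×ˢ Finset.range N,
          ((crossSection s θ * angFactor p.1 p.2 θ : ℝ) : ℂ) *
            (coef p.1 f * coef p.2 g * coef (p.1 + p.2) ψ) := fun θ => by
      rw [angPairing_hermiteSum hΨ.continuous hΨc, Finset.mul_sum]
      refine Finset.sum_congr rfl fun p _ => ?_
      push_cast; ring
    simp only [e]
    rw [integral_finsetSum _ fun p _ =>
      ((integrableOn_crossSection_mul_angFactor hs0 hs1 p.1 p.2).ofReal.mul_const _)]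
    refine Finset.sum_congr rfl fun p _ => ?_
    rw [integral_mul_const, integral_complex_ofReal, alpha]
  simp only [hfin]
  rw [gammaPairing_eq_integral]
  -- The added 1 lets a single constant dominate all truncations from some N on.
  set M : ℝ≥0∞ := muConst * (eLpNorm f 2 volume + 1) * (muConst * (eLpNorm g 2 volume + 1)) with hM
  have hMt : M ≠ ⊤ := by
    have := muConst_ne_top
    have := hf.2.ne
    have := hg.2.ne
    rw [hM]; finiteness
  refine tendsto_integral_filter_of_dominated_convergence
    (fun θ => crossSection s θ * (C * M.toReal * θ ^ 2)) ?_ ?_ ?_ ?_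
  · refine Filter.Eventually.of_forall fun N => ?_
    have e : (fun θ => (crossSection s θ : ℂ) *
        angPairing (hermiteSum N f) (hermiteSum N g) (divSqrtMu ψ) θ) = fun θ =>
        (crossSection s θ : ℂ) * ∑ p ∈ Finset.range N ×ˢ Finset.range N,
          (angFactor p.1 p.2 θ : ℂ) * (coef p.1 f * coef p.2 g * coef (p.1 + p.2) ψ) := by
      ext θ; rw [angPairing_hermiteSum hΨ.continuous hΨc]
    rw [e]
    have hca : ∀ k l, Measurable fun θ => (angFactor k l θ : ℂ) := fun k l =>
      (Complex.continuous_ofReal.comp (continuous_angFactor k l)).measurable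
    exact ((Complex.measurable_ofReal.comp (measurable_crossSection s)).mul
      (Finset.measurable_fun_sum _ fun p _ => (hca _ _).mul_const _)).aestronglyMeasurable
  · filter_upwards [eventually_eLpNorm_hermiteSum_le hf, eventually_eLpNorm_hermiteSum_le hg]
      with N hN1 hN2
    refine Filter.Eventually.of_forall fun θ => ?_
    rw [norm_mul, Complex.norm_real, Real.norm_of_nonneg (crossSection_nonneg s θ)]
    refine mul_le_mul_of_nonneg_left ?_ (crossSection_nonneg s θ)
    have h1 := (hbd (memLp_hermiteSum N f) (memLp_hermiteSum N g) θ).trans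
      (mul_le_mul_right (mul_le_mul' (mul_le_mul_right hN1 _) (mul_le_mul_right hN2 _)) _)
    rw [← hM, ← ofReal_norm, ← ENNReal.ofReal_toReal hMt, ← ENNReal.ofReal_mul (by positivity)] at h1
    have h2 := (ENNReal.ofReal_le_ofReal_iff (by positivity)).1 h1
    linarith
  · exact integrableOn_crossSection_mul hs0 hs1 (C := C * M.toReal) (by fun_prop) fun θ _ => by
      rw [abs_of_nonneg (by positivity)]
  · refine Filter.Eventually.of_forall fun θ => Filter.Tendsto.const_mul _ ?_
    rw [tendsto_iff_edist_tendsto_0]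
    set c : ℝ≥0∞ := ENNReal.ofReal (C * θ ^ 2) with hcdef
    have hlim : Filter.Tendsto (fun N => c *
        (muConst * eLpNorm (fun v => f v - hermiteSum N f v) 2 volume *
          (muConst * eLpNorm g 2 volume)) + c * (muConst * (eLpNorm f 2 volume + 1) *
        (muConst * eLpNorm (fun v => g v - hermiteSum N g v) 2 volume))) Filter.atTop (nhds 0) := by
      have hmu := muConst_ne_top
      have hft := hf.2.ne
      have hgt := hg.2.ne
      have a1 : Filter.Tendsto (fun N => muConst *
          eLpNorm (fun v => f v - hermiteSum N f v) 2 volume) Filter.atTop (nhds 0) := by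
        simpa using ENNReal.Tendsto.const_mul (tendsto_hermiteSum hf) (Or.inr hmu)
      have a2 : Filter.Tendsto (fun N => muConst *
          eLpNorm (fun v => g v - hermiteSum N g v) 2 volume) Filter.atTop (nhds 0) := by
        simpa using ENNReal.Tendsto.const_mul (tendsto_hermiteSum hg) (Or.inr hmu)
      have b1 := ENNReal.Tendsto.const_mul (a := c) (ENNReal.Tendsto.mul_const
        (b := muConst * eLpNorm g 2 volume) a1 (Or.inr (by finiteness)))
        (Or.inr ENNReal.ofReal_ne_top)
      have b2 := ENNReal.Tendsto.const_mul (a := c) (ENNReal.Tendsto.const_mul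
        (a := muConst * (eLpNorm f 2 volume + 1)) a2 (Or.inr (by finiteness)))
        (Or.inr ENNReal.ofReal_ne_top)
      simpa using b1.add b2
    refine tendsto_of_tendsto_of_tendsto_of_le_of_le' tendsto_const_nhds hlim
      (Filter.Eventually.of_forall fun N => zero_le) ?_
    filter_upwards [eventually_eLpNorm_hermiteSum_le hf] with N hN
    rw [edist_comm, edist_eq_enorm_sub, angPairing_sub hf (memLp_hermiteSum N f) hg
      (memLp_hermiteSum N g) hΨ.continuous hΨc]
    refine (enorm_add_le _ _).trans (add_le_add ?_ ?_)
    · exact hbd (hf.sub (memLp_hermiteSum N f)) hg θ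
    · refine (hbd (memLp_hermiteSum N f) (hg.sub (memLp_hermiteSum N g)) θ).trans ?_
      exact mul_le_mul_right (mul_le_mul_left (mul_le_mul_right hN _) _) _

theorem wt_le_four_mul {r : ℝ} (h0 : 0 ≤ r) (h2 : r ≤ 2) (n : ℕ) : wt r n ≤ 4 * wt 2 n := by
  rw [wt, wt, show (4 : ℝ≥0∞) = ENNReal.ofReal 4 by simp, ← ENNReal.ofReal_mul (by norm_num)]
  refine ENNReal.ofReal_le_ofReal ?_
  set x : ℝ := (n : ℝ) + 1 / 2 with hx
  have hx0 : 1 ≤ 2 * x := by rw [hx]; linarith [(n.cast_nonneg : (0 : ℝ) ≤ n)]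
  have hxp : 0 < x := by linarith
  calc x ^ r ≤ 2 ^ r * x ^ r :=
        le_mul_of_one_le_left (by positivity) (Real.one_le_rpow (by norm_num) h0)
    _ = (2 * x) ^ r := (Real.mul_rpow (by norm_num) hxp.le).symm
    _ ≤ (2 * x) ^ (2 : ℝ) := Real.rpow_le_rpow_of_exponent_le hx0 h2
    _ = 4 * x ^ (2 : ℝ) := by
        rw [Real.mul_rpow (by norm_num) hxp.le]; norm_num

theorem tsum_wt_two_coef {ψ : ℝ → ℂ} (hψ : ContDiff ℝ ∞ ψ) (hc : HasCompactSupport ψ) :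
    ∑' n, wt 2 n * ‖coef n ψ‖ₑ ^ 2 = ∫⁻ v, ‖oscillator ψ v‖ₑ ^ 2 := by
  rw [← tsum_enorm_coef_sq ((continuous_oscillator hψ).memLp_of_hasCompactSupport
    (hasCompactSupport_oscillator hc))]
  refine tsum_congr fun n => ?_
  rw [coef_oscillator hψ hc, enorm_mul, mul_pow, wt, Real.rpow_two, ENNReal.ofReal_pow (by positivity)]
  congr 2
  rw [← ofReal_norm, show ((n : ℂ) + 1 / 2) = (((n : ℝ) + 1 / 2 : ℝ) : ℂ) by push_cast; rfl,
    Complex.norm_real, Real.norm_of_nonneg (by positivity)]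

theorem tsum_wt_two_coef_lt_top {ψ : ℝ → ℂ} (hψ : ContDiff ℝ ∞ ψ) (hc : HasCompactSupport ψ) :
    ∑' n, wt 2 n * ‖coef n ψ‖ₑ ^ 2 < ⊤ := by
  have h : MemLp (oscillator ψ) 2 volume := (continuous_oscillator hψ).memLp_of_hasCompactSupport
    (hasCompactSupport_oscillator hc)
  rw [tsum_wt_two_coef hψ hc]
  have := lintegral_rpow_enorm_lt_top_of_eLpNorm_lt_top two_ne_zero (by simp) h.2
  simpa using this

theorem summable_of_tsum_enorm_lt_top {ι : Type*} {a : ι → ℂ} (h : ∑' i, ‖a i‖ₑ < ⊤) :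
    Summable a := by
  refine Summable.of_enorm h.ne

/-- The trilinear form in Hermite coefficients, with the weight on the last argument. -/
theorem tsum_alpha_le_two {s : ℝ} (hs0 : 0 < s) (hs1 : s < 1) (F G H : ℕ → ℝ≥0∞) :
    ∑' p : ℕ × ℕ, ‖alpha s p.1 p.2‖ₑ * (F p.1 * G p.2 * H (p.1 + p.2)) ≤
      ENNReal.ofReal (6 * momentConst s) * (∑' k, F k ^ 2) ^ (1 / 2 : ℝ) *
        (∑' l, G l ^ 2) ^ (1 / 2 : ℝ) * (∑' n, wt (2 * s) n * H n ^ 2) ^ (1 / 2 : ℝ) := by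
  have := tsum_trilinear_le (A := fun k l => ‖alpha s k l‖ₑ) (w₁ := wt 0) (w₂ := wt (2 * s))
    (wt_ne_zero 0) (wt_ne_top 0) (sum_alpha_two hs0 hs1) F G H
  simpa only [wt_zero, one_mul] using this

/-- The trilinear form in Hermite coefficients, with the weight on the last two arguments. -/
theorem tsum_alpha_le_one {s : ℝ} (hs0 : 0 < s) (hs1 : s < 1) (F G H : ℕ → ℝ≥0∞) :
    ∑' p : ℕ × ℕ, ‖alpha s p.1 p.2‖ₑ * (F p.1 * G p.2 * H (p.1 + p.2)) ≤
      ENNReal.ofReal (6 * momentConst s) * (∑' k, F k ^ 2) ^ (1 / 2 : ℝ) *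
        (∑' l, wt s l * G l ^ 2) ^ (1 / 2 : ℝ) * (∑' n, wt s n * H n ^ 2) ^ (1 / 2 : ℝ) :=
  tsum_trilinear_le (A := fun k l => ‖alpha s k l‖ₑ) (w₁ := wt s) (w₂ := wt s)
    (wt_ne_zero s) (wt_ne_top s) (sum_alpha_one hs0 hs1) F G H

theorem tsum_coef_sq_lt_top {u : ℝ → ℂ} (hu : MemLp u 2 volume) :
    ∑' n, ‖coef n u‖ₑ ^ 2 < ⊤ := by
  rw [tsum_enorm_coef_sq hu]
  have := lintegral_rpow_enorm_lt_top_of_eLpNorm_lt_top two_ne_zero (by simp) hu.2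
  simpa using this

/-- Absolute summability follows from the trilinear bound, since a test function lies in the domain
of the oscillator and 2s ≤ 2. The sum is then identified along square boxes. -/
theorem hasSum_gammaPairing {s : ℝ} (hs0 : 0 < s) (hs1 : s < 1) {f g ψ : ℝ → ℂ}
    (hf : MemLp f 2 volume) (hg : MemLp g 2 volume) (hψ : ContDiff ℝ ∞ ψ)
    (hc : HasCompactSupport ψ) :
    HasSum (fun p : ℕ × ℕ =>
      (alpha s p.1 p.2 : ℂ) * (coef p.1 f * coef p.2 g * coef (p.1 + p.2) ψ))
      (gammaPairing s f g ψ) := by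
  have hsum : Summable fun p : ℕ × ℕ =>
      (alpha s p.1 p.2 : ℂ) * (coef p.1 f * coef p.2 g * coef (p.1 + p.2) ψ) := by
    refine summable_of_tsum_enorm_lt_top ?_
    have h1 := tsum_alpha_le_two hs0 hs1 (fun k => ‖coef k f‖ₑ) (fun l => ‖coef l g‖ₑ)
      (fun n => ‖coef n ψ‖ₑ)
    have e : ∀ x : ℝ, ‖(x : ℂ)‖ₑ = ‖x‖ₑ := fun x => by
      rw [← ofReal_norm, ← ofReal_norm, Complex.norm_real]
    simp only [enorm_mul, e]
    refine h1.trans_lt ?_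
    have a1 := (tsum_coef_sq_lt_top hf).ne
    have a2 := (tsum_coef_sq_lt_top hg).ne
    have a3 : ∑' n, wt (2 * s) n * ‖coef n ψ‖ₑ ^ 2 ≠ ⊤ := by
      refine ne_top_of_le_ne_top (ENNReal.mul_ne_top (by simp : (4 : ℝ≥0∞) ≠ ⊤)
        (tsum_wt_two_coef_lt_top hψ hc).ne) ?_
      rw [← ENNReal.tsum_mul_left]
      refine ENNReal.tsum_le_tsum fun n => ?_
      rw [← mul_assoc]
      gcongr
      exact wt_le_four_mul (by linarith) (by linarith) n
    refine lt_top_iff_ne_top.2 (ENNReal.mul_ne_top (ENNReal.mul_ne_top (ENNReal.mul_ne_top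
      ENNReal.ofReal_ne_top ?_) ?_) ?_) <;>
    exact ENNReal.rpow_ne_top_of_nonneg (by norm_num) (by assumption)
  have hbox : Filter.Tendsto (fun N : ℕ => Finset.range N ×ˢ Finset.range N) Filter.atTop
      Filter.atTop := by
    refine Filter.tendsto_atTop_finset_of_monotone (fun a b h => Finset.product_subset_product
      (Finset.range_mono h) (Finset.range_mono h)) fun p => ⟨p.1 + p.2 + 1, ?_⟩
    simp
  have := (hsum.hasSum.comp hbox : Filter.Tendsto _ _ _)
  have h2 := tendsto_nhds_unique this (tendsto_sum_gammaPairing hs0 hs1 hf hg hψ hc)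
  rw [← h2]; exact hsum.hasSum

theorem mulSqrtMu_hermiteC_zero : (fun v => (maxwellian v : ℂ)) = mulSqrtMu (hermiteC 0) := by
  ext v
  rw [mulSqrtMu_eq, hermiteC, hermiteFun_zero, ← sqrtMu_mul_self, Complex.ofReal_mul]

theorem coef_hermiteC (m n : ℕ) : coef m (hermiteC n) = if m = n then 1 else 0 :=
  coef_hermiteFun m n

/-- As μ = μ^{1/2} e_0, the two halves of the operator are the row k = 0 and the column l = 0 of the
coefficients α. -/
theorem hasSum_linKacPairing {s : ℝ} (hs0 : 0 < s) (hs1 : s < 1) {g ψ : ℝ → ℂ}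
    (hg : MemLp g 2 volume) (hψ : ContDiff ℝ ∞ ψ) (hc : HasCompactSupport ψ) :
    HasSum (fun n : ℕ => (lam s n : ℂ) * (coef n g * coef n ψ)) (linKacPairing s g ψ) := by
  have h1 := hasSum_gammaPairing hs0 hs1 (memLp_hermiteC 0) hg hψ hc
  have h2 := hasSum_gammaPairing hs0 hs1 hg (memLp_hermiteC 0) hψ hc
  have i1 : Function.Injective fun n : ℕ => ((0, n) : ℕ × ℕ) := fun a b h => (Prod.ext_iff.1 h).2
  have i2 : Function.Injective fun n : ℕ => ((n, 0) : ℕ × ℕ) := fun a b h => (Prod.ext_iff.1 h).1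
  rw [← i1.hasSum_iff] at h1
  · rw [← i2.hasSum_iff] at h2
    · have h3 := h1.neg.sub h2
      have e : linKacPairing s g ψ = -gammaPairing s (hermiteC 0) g ψ -
          gammaPairing s g (hermiteC 0) ψ := by
        simp only [linKacPairing, gammaPairing, mulSqrtMu_hermiteC_zero]
      rw [e]
      have e2 : (fun n : ℕ => (lam s n : ℂ) * (coef n g * coef n ψ)) = fun n =>
          -(((fun p : ℕ × ℕ => (alpha s p.1 p.2 : ℂ) * (coef p.1 (hermiteC 0) * coef p.2 g *
            coef (p.1 + p.2) ψ)) ∘ fun n : ℕ => ((0, n) : ℕ × ℕ)) n) -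
          ((fun p : ℕ × ℕ => (alpha s p.1 p.2 : ℂ) * (coef p.1 g * coef p.2 (hermiteC 0) *
            coef (p.1 + p.2) ψ)) ∘ fun n : ℕ => ((n, 0) : ℕ × ℕ)) n := by
        ext n
        simp only [Function.comp, coef_hermiteC, if_true, zero_add, add_zero, lam]
        push_cast; ring
      rw [e2]; exact h3
    · rintro ⟨k, l⟩ h
      have : l ≠ 0 := fun h0 => h ⟨k, by rw [h0]⟩
      simp [coef_hermiteC, this]
  · rintro ⟨k, l⟩ h
    have : k ≠ 0 := fun h0 => h ⟨l, by rw [h0]⟩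
    simp [coef_hermiteC, this]

end Kac

namespace Kac

/-! ### Functions of position and velocity -/

theorem eLpNorm_two_sq {α ε : Type*} [MeasurableSpace α] {ν : Measure α} [TopologicalSpace ε]
    [ContinuousENorm ε] (f : α → ε) :
    eLpNorm f 2 ν ^ 2 = ∫⁻ x, ‖f x‖ₑ ^ 2 ∂ν := by
  rw [eLpNorm_eq_lintegral_rpow_enorm_toReal two_ne_zero (by simp), ← ENNReal.rpow_natCast,
    ← ENNReal.rpow_mul]
  norm_num

theorem sq_le_sq_iff_ennreal {a b : ℝ≥0∞} : a ^ 2 ≤ b ^ 2 ↔ a ≤ b :=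
  ENNReal.pow_le_pow_left_iff two_ne_zero

theorem eq_of_sq_eq_ennreal {a b : ℝ≥0∞} (h : a ^ 2 = b ^ 2) : a = b :=
  le_antisymm (sq_le_sq_iff_ennreal.1 h.le) (sq_le_sq_iff_ennreal.1 h.ge)

theorem rpow_half_sq (a : ℝ≥0∞) : (a ^ (1 / 2 : ℝ)) ^ 2 = a := by
  rw [← ENNReal.rpow_natCast, ← ENNReal.rpow_mul]; norm_num

theorem memLp_two_iff_sq_lt_top {α : Type*} [MeasurableSpace α] {ν : Measure α} {f : α → ℂ}
    (hf : AEStronglyMeasurable f ν) : MemLp f 2 ν ↔ ∫⁻ x, ‖f x‖ₑ ^ 2 ∂ν < ⊤ := by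
  rw [← eLpNorm_two_sq]
  refine ⟨fun h => ENNReal.pow_lt_top h.2, fun h => ⟨hf, ?_⟩⟩
  by_contra h'
  rw [not_lt, top_le_iff] at h'
  simp [h'] at h

/-- The slice at a fixed velocity. -/
theorem ae_memLp_slice_fst {α β : Type*} [MeasurableSpace α] [MeasurableSpace β] {μ : Measure α}
    {ν : Measure β} [SFinite μ] [SFinite ν] {U : α × β → ℂ} (hU : MemLp U 2 (μ.prod ν)) :
    ∀ᵐ x ∂μ, MemLp (fun y => U (x, y)) 2 ν := by
  have h1 := hU.1.prodMk_left
  have h2 : ∫⁻ z, ‖U z‖ₑ ^ 2 ∂(μ.prod ν) < ⊤ := (memLp_two_iff_sq_lt_top hU.1).1 hU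
  rw [lintegral_prod _ (hU.1.enorm.pow_const 2)] at h2
  have h3 := ae_lt_top' (hU.1.enorm.pow_const 2).lintegral_prod_right' h2.ne
  filter_upwards [h1, h3] with x a b
  exact (memLp_two_iff_sq_lt_top a).2 b

theorem ae_memLp_slice_snd {α β : Type*} [MeasurableSpace α] [MeasurableSpace β] {μ : Measure α}
    {ν : Measure β} [SFinite μ] [SFinite ν] {U : α × β → ℂ} (hU : MemLp U 2 (μ.prod ν)) :
    ∀ᵐ y ∂ν, MemLp (fun x => U (x, y)) 2 μ :=
  ae_memLp_slice_fst (hU.comp_measurePreserving Measure.measurePreserving_swap)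

theorem lintegral_sq_prod {α β : Type*} [MeasurableSpace α] [MeasurableSpace β] {μ : Measure α}
    {ν : Measure β} [SFinite μ] [SFinite ν] {U : α × β → ℂ}
    (hU : AEStronglyMeasurable U (μ.prod ν)) :
    ∫⁻ z, ‖U z‖ₑ ^ 2 ∂(μ.prod ν) = ∫⁻ x, ∫⁻ y, ‖U (x, y)‖ₑ ^ 2 ∂ν ∂μ :=
  lintegral_prod _ (hU.enorm.pow_const 2)

theorem lintegral_sq_prod_symm {α β : Type*} [MeasurableSpace α] [MeasurableSpace β] {μ : Measure α}
    {ν : Measure β} [SFinite μ] [SFinite ν] {U : α × β → ℂ}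
    (hU : AEStronglyMeasurable U (μ.prod ν)) :
    ∫⁻ z, ‖U z‖ₑ ^ 2 ∂(μ.prod ν) = ∫⁻ y, ∫⁻ x, ‖U (x, y)‖ₑ ^ 2 ∂μ ∂ν :=
  lintegral_prod_symm _ (hU.enorm.pow_const 2)

theorem normVX_eq {U : ℝ × ℝ → ℂ} (hU : AEStronglyMeasurable U volume) :
    normVX 2 2 U = eLpNorm U 2 volume := by
  refine eq_of_sq_eq_ennreal ?_
  rw [normVX, eLpNorm_two_sq, eLpNorm_two_sq, Measure.volume_eq_prod]
  simp only [enorm_eq_self, eLpNorm_two_sq]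
  exact (lintegral_sq_prod_symm hU).symm

/-- The block `Δ_{n-1}` acting on the first variable. -/
noncomputable def blkX (P : LPCouple) (n : ℕ) (U : ℝ × ℝ → ℂ) (z : ℝ × ℝ) : ℂ :=
  P.block n (fun y => U (y, z.2)) z.1

/-- The Hermite coefficient in the second variable. -/
noncomputable def cf (n : ℕ) (U : ℝ × ℝ → ℂ) (x : ℝ) : ℂ := coef n fun v => U (x, v)

theorem aestronglyMeasurable_blkX (P : LPCouple) (n : ℕ) {U : ℝ × ℝ → ℂ}
    (hU : AEStronglyMeasurable U volume) : AEStronglyMeasurable (blkX P n U) volume := by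
  have h1 : Measure.QuasiMeasurePreserving (fun p : (ℝ × ℝ) × ℝ => (p.2, p.1.2))
      ((volume.prod volume).prod volume) (volume.prod volume) :=
    (MeasureTheory.QuasiMeasurePreserving.prodMap (Measure.QuasiMeasurePreserving.id _) Measure.quasiMeasurePreserving_snd).comp
      Measure.measurePreserving_swap.quasiMeasurePreserving
  have h2 := hU.comp_quasiMeasurePreserving h1
  have h3 : AEStronglyMeasurable (fun p : (ℝ × ℝ) × ℝ => P.kernel n (p.1.1 - p.2))
      ((volume.prod volume).prod volume) :=
    ((P.continuous_kernel n).comp (by fun_prop :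
      Continuous fun p : (ℝ × ℝ) × ℝ => p.1.1 - p.2)).aestronglyMeasurable
  exact (h3.mul h2).integral_prod_right'

theorem eLpNorm_blkX_le (P : LPCouple) (n : ℕ) {U : ℝ × ℝ → ℂ} (hU : MemLp U 2 volume) :
    eLpNorm (blkX P n U) 2 volume ≤ eLpNorm U 2 volume := by
  rw [← sq_le_sq_iff_ennreal, eLpNorm_two_sq, eLpNorm_two_sq, Measure.volume_eq_prod,
    lintegral_sq_prod_symm (aestronglyMeasurable_blkX P n hU.1), lintegral_sq_prod_symm hU.1]
  refine lintegral_mono_ae ?_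
  filter_upwards [ae_memLp_slice_snd hU] with v hv
  rw [← eLpNorm_two_sq, ← eLpNorm_two_sq]
  exact pow_le_pow_left' (P.eLpNorm_block_le n hv) 2

theorem memLp_blkX (P : LPCouple) (n : ℕ) {U : ℝ × ℝ → ℂ} (hU : MemLp U 2 volume) :
    MemLp (blkX P n U) 2 volume :=
  ⟨aestronglyMeasurable_blkX P n hU.1, (eLpNorm_blkX_le P n hU).trans_lt hU.2⟩

theorem integral_prod_symm_xv {F : ℝ × ℝ → ℂ} (hF : Integrable F) :
    ∫ z, F z = ∫ v, ∫ x, F (x, v) := by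
  rw [Measure.volume_eq_prod] at hF ⊢
  rw [integral_prod_symm _ hF]

theorem integral_blkX_mul (P : LPCouple) (n : ℕ) {U W : ℝ × ℝ → ℂ} (hU : MemLp U 2 volume)
    (hW : MemLp W 2 volume) : ∫ z, blkX P n U z * W z = ∫ z, U z * blkX P.reflect n W z := by
  rw [integral_prod_symm_xv (integrable_mul_of_memLp (memLp_blkX P n hU) hW),
    integral_prod_symm_xv (integrable_mul_of_memLp hU (memLp_blkX P.reflect n hW))]
  refine integral_congr_ae ?_
  filter_upwards [ae_memLp_slice_snd hU, ae_memLp_slice_snd hW] with v hu hw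
  exact P.integral_block_mul n hu hw

theorem conj_blkX (P : LPCouple) (n : ℕ) (U : ℝ × ℝ → ℂ) (z : ℝ × ℝ) :
    (starRingEnd ℂ) (blkX P n U z) = blkX P.reflect n (fun z => (starRingEnd ℂ) (U z)) z :=
  P.conj_block n _ _

theorem aestronglyMeasurable_cf (n : ℕ) {U : ℝ × ℝ → ℂ} (hU : AEStronglyMeasurable U volume) :
    AEStronglyMeasurable (cf n U) volume := by
  have h3 : AEStronglyMeasurable (fun p : ℝ × ℝ => (hermiteFun n p.2 : ℂ)) volume :=
    (Complex.continuous_ofReal.comp ((continuous_hermiteFun n).comp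
      continuous_snd)).aestronglyMeasurable
  exact AEStronglyMeasurable.integral_prod_right' (μ := volume) (ν := volume) (hU.mul h3)

theorem tsum_eLpNorm_cf_sq {U : ℝ × ℝ → ℂ} (hU : MemLp U 2 volume) :
    ∑' n, eLpNorm (cf n U) 2 volume ^ 2 = eLpNorm U 2 volume ^ 2 := by
  simp only [eLpNorm_two_sq]
  rw [← lintegral_tsum fun n => (aestronglyMeasurable_cf n hU.1).enorm.pow_const 2,
    Measure.volume_eq_prod, lintegral_sq_prod hU.1]
  refine lintegral_congr_ae ?_
  filter_upwards [ae_memLp_slice_fst hU] with x hx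
  exact tsum_enorm_coef_sq hx

theorem memLp_cf (n : ℕ) {U : ℝ × ℝ → ℂ} (hU : MemLp U 2 volume) : MemLp (cf n U) 2 volume := by
  refine (memLp_two_iff_sq_lt_top (aestronglyMeasurable_cf n hU.1)).2 ?_
  rw [← eLpNorm_two_sq]
  refine lt_of_le_of_lt ?_ (ENNReal.pow_lt_top (n := 2) hU.2)
  rw [← tsum_eLpNorm_cf_sq hU]
  exact ENNReal.le_tsum n

/-- Δ acts in x and the coefficient integrates in v. Fubini applies because the kernel tensored with
a Hermite function is square integrable. -/
theorem cf_blkX (P : LPCouple) (n m : ℕ) {U : ℝ × ℝ → ℂ} (hU : MemLp U 2 volume) (x : ℝ) :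
    cf m (blkX P n U) x = P.block n (cf m U) x := by
  have hk : MemLp (fun z : ℝ × ℝ => P.kernel n (x - z.1) * (hermiteFun m z.2 : ℂ)) 2
      (volume.prod volume) := by
    have h1 := P.memLp_kernel_sub n x
    have h2 := memLp_hermiteFun m
    have hm : AEStronglyMeasurable
        (fun z : ℝ × ℝ => P.kernel n (x - z.1) * (hermiteFun m z.2 : ℂ)) (volume.prod volume) :=
      (((P.continuous_kernel n).comp (by fun_prop : Continuous fun z : ℝ × ℝ => x - z.1)).mul
        (Complex.continuous_ofReal.comp ((continuous_hermiteFun m).comp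
          continuous_snd))).aestronglyMeasurable
    refine (memLp_two_iff_sq_lt_top hm).2 ?_
    rw [lintegral_sq_prod hm]
    simp only [enorm_mul, mul_pow]
    have hb := (memLp_two_iff_sq_lt_top h2.1).1 h2
    have ha := (memLp_two_iff_sq_lt_top h1.1).1 h1
    calc _ = ∫⁻ y, ‖P.kernel n (x - y)‖ₑ ^ 2 * ∫⁻ v, ‖(hermiteFun m v : ℂ)‖ₑ ^ 2 := by
          refine lintegral_congr fun y => ?_
          rw [lintegral_const_mul' _ _ (by finiteness)]
      _ = (∫⁻ y, ‖P.kernel n (x - y)‖ₑ ^ 2) * ∫⁻ v, ‖(hermiteFun m v : ℂ)‖ₑ ^ 2 :=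
          lintegral_mul_const' _ _ hb.ne
      _ < ⊤ := ENNReal.mul_lt_top ha hb
  have hint : Integrable (fun z : ℝ × ℝ => P.kernel n (x - z.1) * U z * (hermiteFun m z.2 : ℂ))
      (volume.prod volume) :=
    (integrable_mul_of_memLp hk hU).congr (Filter.Eventually.of_forall fun z => by ring)
  have hsw := integral_integral_swap (f := fun y v => P.kernel n (x - y) * U (y, v) *
    (hermiteFun m v : ℂ)) hint
  simp only [cf, coef, blkX, LPCouple.block]
  simp only [← integral_mul_const, ← integral_const_mul]
  rw [← hsw]
  congr 1; ext y; congr 1; ext v; ring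

theorem tsum_eLpNorm_block_cf_sq (P : LPCouple) (n : ℕ) {U : ℝ × ℝ → ℂ} (hU : MemLp U 2 volume) :
    ∑' m, eLpNorm (P.block n (cf m U)) 2 volume ^ 2 = eLpNorm (blkX P n U) 2 volume ^ 2 := by
  rw [← tsum_eLpNorm_cf_sq (memLp_blkX P n hU)]
  refine tsum_congr fun m => ?_
  congr 2; ext x; exact (cf_blkX P n m hU x).symm

theorem cf_conj (n : ℕ) (U : ℝ × ℝ → ℂ) (x : ℝ) :
    cf n (fun z => (starRingEnd ℂ) (U z)) x = (starRingEnd ℂ) (cf n U x) :=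
  (conj_coef n _).symm

/-! ### Functions of time, position and velocity -/

/-- Lebesgue measure on `[0, T]`. -/
noncomputable def timeM (T : ℝ) : Measure ℝ := volume.restrict (Icc 0 T)

instance (T : ℝ) : IsFiniteMeasure (timeM T) := by unfold timeM; infer_instance

theorem slab_eq (T : ℝ) : slab T = (timeM T).prod (volume : Measure (ℝ × ℝ)) := by
  have h := Measure.prod_restrict (μ := (volume : Measure ℝ)) (ν := (volume : Measure (ℝ × ℝ)))
    (Icc 0 T) univ
  rw [Measure.restrict_univ] at h
  rw [slab, timeM, h]
  rfl

/-- The slice at time `t`. -/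
def sl (U : ℝ × ℝ × ℝ → ℂ) (t : ℝ) (z : ℝ × ℝ) : ℂ := U (t, z)

theorem ae_memLp_sl {T : ℝ} {U : ℝ × ℝ × ℝ → ℂ} (hU : MemLp U 2 (slab T)) :
    ∀ᵐ t ∂timeM T, MemLp (sl U t) 2 volume := by
  rw [slab_eq] at hU
  exact ae_memLp_slice_fst hU

theorem eLpNorm_slab_sq {T : ℝ} {U : ℝ × ℝ × ℝ → ℂ} (hU : AEStronglyMeasurable U (slab T)) :
    eLpNorm U 2 (slab T) ^ 2 = ∫⁻ t, eLpNorm (sl U t) 2 volume ^ 2 ∂timeM T := by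
  rw [eLpNorm_two_sq, slab_eq, lintegral_sq_prod (by rwa [slab_eq] at hU)]
  simp only [eLpNorm_two_sq, sl]

theorem ae_aestronglyMeasurable_sl {T : ℝ} {U : ℝ × ℝ × ℝ → ℂ}
    (hU : AEStronglyMeasurable U (slab T)) :
    ∀ᵐ t ∂timeM T, AEStronglyMeasurable (sl U t) volume := by
  rw [slab_eq] at hU
  exact hU.prodMk_left

theorem aemeasurable_eLpNorm_sl {T : ℝ} {U : ℝ × ℝ × ℝ → ℂ} (hU : AEStronglyMeasurable U (slab T)) :
    AEMeasurable (fun t => eLpNorm (sl U t) 2 volume) (timeM T) := by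
  rw [slab_eq] at hU
  have h := (hU.enorm.pow_const 2).lintegral_prod_right'
  refine (h.pow_const (1 / 2 : ℝ)).congr (Filter.Eventually.of_forall fun t => ?_)
  beta_reduce
  refine eq_of_sq_eq_ennreal ?_
  rw [rpow_half_sq, eLpNorm_two_sq]; rfl

/-- The norm of `L^p_T L²_{x,v}`. -/
noncomputable def normT (T : ℝ) (p : ℝ≥0∞) (U : ℝ × ℝ × ℝ → ℂ) : ℝ≥0∞ :=
  eLpNorm (fun t => eLpNorm (sl U t) 2 volume) p (timeM T)

theorem normTVX_eq {T : ℝ} {p : ℝ≥0∞} {U : ℝ × ℝ × ℝ → ℂ} (hU : AEStronglyMeasurable U (slab T)) :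
    normTVX T p 2 2 U = normT T p U := by
  refine eLpNorm_congr_ae ?_
  filter_upwards [ae_aestronglyMeasurable_sl hU] with t ht
  exact normVX_eq ht

theorem normT_two {T : ℝ} {U : ℝ × ℝ × ℝ → ℂ} (hU : AEStronglyMeasurable U (slab T)) :
    normT T 2 U = eLpNorm U 2 (slab T) := by
  refine eq_of_sq_eq_ennreal ?_
  rw [normT, eLpNorm_two_sq, eLpNorm_slab_sq hU]
  simp only [enorm_eq_self]

/-- The block `Δ_{n-1}` acting on the position variable. -/
noncomputable def blkT (P : LPCouple) (n : ℕ) (U : ℝ × ℝ × ℝ → ℂ) (z : ℝ × ℝ × ℝ) : ℂ :=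
  P.block n (fun y => U (z.1, y, z.2.2)) z.2.1

theorem sl_blkT (P : LPCouple) (n : ℕ) (U : ℝ × ℝ × ℝ → ℂ) (t : ℝ) :
    sl (blkT P n U) t = blkX P n (sl U t) := rfl

theorem aestronglyMeasurable_blkT (P : LPCouple) (n : ℕ) {T : ℝ} {U : ℝ × ℝ × ℝ → ℂ}
    (hU : AEStronglyMeasurable U (slab T)) : AEStronglyMeasurable (blkT P n U) (slab T) := by
  have h1 : Measure.QuasiMeasurePreserving (fun p : (ℝ × ℝ) × ℝ => (p.2, p.1.2))
      ((volume.prod volume).prod volume) (volume.prod volume) :=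
    (MeasureTheory.QuasiMeasurePreserving.prodMap (Measure.QuasiMeasurePreserving.id _) Measure.quasiMeasurePreserving_snd).comp
      Measure.measurePreserving_swap.quasiMeasurePreserving
  have h2 : Measure.QuasiMeasurePreserving (fun p : (ℝ × ℝ × ℝ) × ℝ => (p.1.1, p.2, p.1.2.2))
      ((slab T).prod volume) (slab T) := by
    rw [slab_eq]
    exact (MeasureTheory.QuasiMeasurePreserving.prodMap (Measure.QuasiMeasurePreserving.id (timeM T)) h1).comp
      (measurePreserving_prodAssoc (timeM T) (volume : Measure (ℝ × ℝ))
        (volume : Measure ℝ)).quasiMeasurePreserving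
  have h3 : AEStronglyMeasurable (fun p : (ℝ × ℝ × ℝ) × ℝ => P.kernel n (p.1.2.1 - p.2))
      ((slab T).prod volume) :=
    ((P.continuous_kernel n).comp (by fun_prop :
      Continuous fun p : (ℝ × ℝ × ℝ) × ℝ => p.1.2.1 - p.2)).aestronglyMeasurable
  exact (h3.mul (hU.comp_quasiMeasurePreserving h2)).integral_prod_right'

theorem eLpNorm_sl_blkT_le (P : LPCouple) (n : ℕ) {T : ℝ} {U : ℝ × ℝ × ℝ → ℂ}
    (hU : MemLp U 2 (slab T)) :
    ∀ᵐ t ∂timeM T, eLpNorm (sl (blkT P n U) t) 2 volume ≤ eLpNorm (sl U t) 2 volume := by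
  filter_upwards [ae_memLp_sl hU] with t ht
  rw [sl_blkT]
  exact eLpNorm_blkX_le P n ht

theorem memLp_blkT (P : LPCouple) (n : ℕ) {T : ℝ} {U : ℝ × ℝ × ℝ → ℂ} (hU : MemLp U 2 (slab T)) :
    MemLp (blkT P n U) 2 (slab T) := by
  have hm := aestronglyMeasurable_blkT P n hU.1
  refine ⟨hm, lt_of_le_of_lt ?_ hU.2⟩
  rw [← sq_le_sq_iff_ennreal, eLpNorm_slab_sq hm, eLpNorm_slab_sq hU.1]
  refine lintegral_mono_ae ?_
  filter_upwards [eLpNorm_sl_blkT_le P n hU] with t ht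
  exact pow_le_pow_left' ht 2

theorem integral_slab {T : ℝ} {F : ℝ × ℝ × ℝ → ℂ} (hF : Integrable F (slab T)) :
    ∫ z, F z ∂slab T = ∫ t, (∫ z, F (t, z)) ∂timeM T := by
  rw [slab_eq] at hF ⊢
  exact integral_prod _ hF

theorem integral_blkT_mul (P : LPCouple) (n : ℕ) {T : ℝ} {U W : ℝ × ℝ × ℝ → ℂ}
    (hU : MemLp U 2 (slab T)) (hW : MemLp W 2 (slab T)) :
    ∫ z, blkT P n U z * W z ∂slab T = ∫ z, U z * blkT P.reflect n W z ∂slab T := by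
  rw [integral_slab (integrable_mul_of_memLp (memLp_blkT P n hU) hW),
    integral_slab (integrable_mul_of_memLp hU (memLp_blkT P.reflect n hW))]
  refine integral_congr_ae ?_
  filter_upwards [ae_memLp_sl hU, ae_memLp_sl hW] with t hu hw
  exact integral_blkX_mul P n hu hw

/-- Lebesgue measure on `[0, T] × ℝ_x`. -/
noncomputable def timeX (T : ℝ) : Measure (ℝ × ℝ) := (timeM T).prod volume

theorem timeX_eq (T : ℝ) : timeX T = volume.restrict (Icc 0 T ×ˢ univ) := by
  have h := Measure.prod_restrict (μ := (volume : Measure ℝ)) (ν := (volume : Measure ℝ))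
    (Icc 0 T) univ
  rw [Measure.restrict_univ] at h
  rw [timeX, timeM, h]
  rfl

instance (T : ℝ) : SFinite (timeX T) := by unfold timeX; infer_instance

/-- The Hermite coefficient of a function of time, position and velocity. -/
noncomputable def cfT (n : ℕ) (U : ℝ × ℝ × ℝ → ℂ) (z : ℝ × ℝ) : ℂ :=
  coef n fun v => U (z.1, z.2, v)

theorem cfT_eq (n : ℕ) (U : ℝ × ℝ × ℝ → ℂ) (t x : ℝ) : cfT n U (t, x) = cf n (sl U t) x := rfl

theorem measurePreserving_assoc_slab (T : ℝ) :
    MeasurePreserving (MeasurableEquiv.prodAssoc : (ℝ × ℝ) × ℝ ≃ᵐ ℝ × ℝ × ℝ)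
      ((timeX T).prod volume) (slab T) := by
  rw [slab_eq]
  exact measurePreserving_prodAssoc (timeM T) volume volume

theorem aestronglyMeasurable_cfT (n : ℕ) {T : ℝ} {U : ℝ × ℝ × ℝ → ℂ}
    (hU : AEStronglyMeasurable U (slab T)) : AEStronglyMeasurable (cfT n U) (timeX T) := by
  have h2 := hU.comp_measurePreserving (measurePreserving_assoc_slab T)
  have h3 : AEStronglyMeasurable (fun p : (ℝ × ℝ) × ℝ => (hermiteFun n p.2 : ℂ))
      ((timeX T).prod volume) :=
    (Complex.continuous_ofReal.comp ((continuous_hermiteFun n).comp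
      continuous_snd)).aestronglyMeasurable
  exact AEStronglyMeasurable.integral_prod_right' (h2.mul h3)

theorem ae_memLp_velocity {T : ℝ} {U : ℝ × ℝ × ℝ → ℂ} (hU : MemLp U 2 (slab T)) :
    ∀ᵐ z ∂timeX T, MemLp (fun v => U (z.1, z.2, v)) 2 volume :=
  ae_memLp_slice_fst (hU.comp_measurePreserving (measurePreserving_assoc_slab T))

theorem tsum_eLpNorm_cfT_sq {T : ℝ} {U : ℝ × ℝ × ℝ → ℂ} (hU : MemLp U 2 (slab T)) :
    ∑' n, eLpNorm (cfT n U) 2 (timeX T) ^ 2 = eLpNorm U 2 (slab T) ^ 2 := by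
  have h := hU.comp_measurePreserving (measurePreserving_assoc_slab T)
  rw [← eLpNorm_comp_measurePreserving hU.1 (measurePreserving_assoc_slab T)]
  simp only [eLpNorm_two_sq]
  rw [← lintegral_tsum fun n => (aestronglyMeasurable_cfT n hU.1).enorm.pow_const 2,
    lintegral_sq_prod h.1]
  refine lintegral_congr_ae ?_
  filter_upwards [ae_memLp_velocity hU] with z hz
  exact tsum_enorm_coef_sq hz

theorem memLp_cfT (n : ℕ) {T : ℝ} {U : ℝ × ℝ × ℝ → ℂ} (hU : MemLp U 2 (slab T)) :
    MemLp (cfT n U) 2 (timeX T) := by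
  refine (memLp_two_iff_sq_lt_top (aestronglyMeasurable_cfT n hU.1)).2 ?_
  rw [← eLpNorm_two_sq]
  refine lt_of_le_of_lt ?_ (ENNReal.pow_lt_top (n := 2) hU.2)
  rw [← tsum_eLpNorm_cfT_sq hU]
  exact ENNReal.le_tsum n

/-- Parseval's identity in the velocity variable. -/
theorem hasSum_integral_cfT_mul {T : ℝ} {U W : ℝ × ℝ × ℝ → ℂ} (hU : MemLp U 2 (slab T))
    (hW : MemLp W 2 (slab T)) :
    HasSum (fun n => ∫ z, cfT n U z * cfT n W z ∂timeX T) (∫ z, U z * W z ∂slab T) := by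
  have hU' := hU.comp_measurePreserving (measurePreserving_assoc_slab T)
  have hW' := hW.comp_measurePreserving (measurePreserving_assoc_slab T)
  have e : ∫ z, U z * W z ∂slab T = ∫ z, (∫ v, U (z.1, z.2, v) * W (z.1, z.2, v)) ∂timeX T := by
    rw [← (measurePreserving_assoc_slab T).integral_comp'
      (fun z => U z * W z)]
    exact integral_prod _ (integrable_mul_of_memLp hU' hW')
  have e2 : ∫ z, (∫ v, U (z.1, z.2, v) * W (z.1, z.2, v)) ∂timeX T =
      ∫ z, ∑' n, cfT n U z * cfT n W z ∂timeX T := by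
    refine integral_congr_ae ?_
    filter_upwards [ae_memLp_velocity hU, ae_memLp_velocity hW] with z h1 h2
    exact (hasSum_coef_mul_coef h1 h2).tsum_eq.symm
  have hfin : ∑' n, ∫⁻ z, ‖cfT n U z * cfT n W z‖ₑ ∂timeX T ≠ ⊤ := by
    have h1 : ∀ n, ∫⁻ z, ‖cfT n U z * cfT n W z‖ₑ ∂timeX T ≤
        eLpNorm (cfT n U) 2 (timeX T) * eLpNorm (cfT n W) 2 (timeX T) := fun n => by
      have := ENNReal.lintegral_mul_le_Lp_mul_Lq (timeX T) Real.HolderConjugate.two_two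
        (aestronglyMeasurable_cfT n hU.1).enorm (aestronglyMeasurable_cfT n hW.1).enorm
      simp only [enorm_mul]
      rw [eLpNorm_eq_lintegral_rpow_enorm_toReal two_ne_zero (by simp),
        eLpNorm_eq_lintegral_rpow_enorm_toReal two_ne_zero (by simp)]
      simpa using this
    refine ne_top_of_le_ne_top ?_ ((ENNReal.tsum_le_tsum h1).trans (tsum_mul_le_sqrt _ _))
    rw [tsum_eLpNorm_cfT_sq hU, tsum_eLpNorm_cfT_sq hW]
    have := hU.2.ne
    have := hW.2.ne
    finiteness
  rw [e, e2, integral_tsum (f := fun n z => cfT n U z * cfT n W z)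
    (fun n => (memLp_cfT n hU).1.mul (memLp_cfT n hW).1) hfin]
  have hsum : Summable fun n => ∫ z, cfT n U z * cfT n W z ∂timeX T :=
    summable_of_tsum_enorm_lt_top (lt_of_le_of_lt (ENNReal.tsum_le_tsum fun n =>
      enorm_integral_le_lintegral_enorm _) hfin.lt_top)
  exact hsum.hasSum

end Kac

namespace Kac

/-! ### Test functions -/

/-- Smooth functions of `(t, x, v)` with compact support. -/
structure IsNice (h : ℝ × ℝ × ℝ → ℂ) : Prop where
  smooth : ContDiff ℝ ∞ h
  compact : HasCompactSupport h

/-- The derivative in time. -/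
noncomputable def dt (h : ℝ × ℝ × ℝ → ℂ) (z : ℝ × ℝ × ℝ) : ℂ :=
  deriv (fun τ : ℝ => h (τ, z.2.1, z.2.2)) z.1

/-- The derivative in position. -/
noncomputable def dx (h : ℝ × ℝ × ℝ → ℂ) (z : ℝ × ℝ × ℝ) : ℂ :=
  deriv (fun y : ℝ => h (z.1, y, z.2.2)) z.2.1

/-- The derivative in velocity. -/
noncomputable def dv (h : ℝ × ℝ × ℝ → ℂ) (z : ℝ × ℝ × ℝ) : ℂ :=
  deriv (fun w : ℝ => h (z.1, z.2.1, w)) z.2.2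

/-- The harmonic oscillator in the velocity variable. -/
noncomputable def osc (h : ℝ × ℝ × ℝ → ℂ) (z : ℝ × ℝ × ℝ) : ℂ :=
  oscillator (fun w => h (z.1, z.2.1, w)) z.2.2

namespace IsNice

variable {h k : ℝ × ℝ × ℝ → ℂ}

theorem continuous (hh : IsNice h) : Continuous h := hh.smooth.continuous

theorem differentiable (hh : IsNice h) : Differentiable ℝ h := hh.smooth.differentiable (by simp)

theorem add (hh : IsNice h) (hk : IsNice k) : IsNice fun z => h z + k z :=
  ⟨hh.smooth.add hk.smooth, hh.compact.add hk.compact⟩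

theorem mul_left (hh : IsNice h) (hk : ContDiff ℝ ∞ k) : IsNice fun z => k z * h z :=
  ⟨hk.mul hh.smooth, hh.compact.mul_left⟩

theorem const_mul (hh : IsNice h) (c : ℂ) : IsNice fun z => c * h z :=
  hh.mul_left contDiff_const

theorem sub (hh : IsNice h) (hk : IsNice k) : IsNice fun z => h z - k z := by
  have := hh.add (hk.const_mul (-1))
  simpa only [neg_one_mul, ← sub_eq_add_neg] using this

theorem fderiv_apply (hh : IsNice h) (e : ℝ × ℝ × ℝ) : IsNice fun z => fderiv ℝ h z e :=
  ⟨(hh.smooth.fderiv_right (m := ∞) (by simp)).clm_apply contDiff_const,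
    hh.compact.fderiv_apply (𝕜 := ℝ) e⟩

theorem hasDerivAt_time (hh : IsNice h) (t x v : ℝ) :
    HasDerivAt (fun τ => h (τ, x, v)) (fderiv ℝ h (t, x, v) (1, 0, 0)) t := by
  have h1 : HasDerivAt (fun τ : ℝ => (τ, x, v)) ((1 : ℝ), (0 : ℝ), (0 : ℝ)) t :=
    (hasDerivAt_id t).prodMk (hasDerivAt_const t (x, v))
  exact (hh.differentiable _).hasFDerivAt.comp_hasDerivAt t h1

theorem hasDerivAt_pos (hh : IsNice h) (t x v : ℝ) :
    HasDerivAt (fun y => h (t, y, v)) (fderiv ℝ h (t, x, v) (0, 1, 0)) x := by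
  have h1 : HasDerivAt (fun y : ℝ => (t, y, v)) ((0 : ℝ), (1 : ℝ), (0 : ℝ)) x :=
    (hasDerivAt_const x t).prodMk ((hasDerivAt_id x).prodMk (hasDerivAt_const x v))
  exact (hh.differentiable _).hasFDerivAt.comp_hasDerivAt x h1

theorem hasDerivAt_vel (hh : IsNice h) (t x v : ℝ) :
    HasDerivAt (fun w => h (t, x, w)) (fderiv ℝ h (t, x, v) (0, 0, 1)) v := by
  have h1 : HasDerivAt (fun w : ℝ => (t, x, w)) ((0 : ℝ), (0 : ℝ), (1 : ℝ)) v :=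
    (hasDerivAt_const v t).prodMk ((hasDerivAt_const v x).prodMk (hasDerivAt_id v))
  exact (hh.differentiable _).hasFDerivAt.comp_hasDerivAt v h1

theorem dt_eq (hh : IsNice h) : dt h = fun z => fderiv ℝ h z (1, 0, 0) := by
  ext z; exact (hh.hasDerivAt_time z.1 z.2.1 z.2.2).deriv

theorem dx_eq (hh : IsNice h) : dx h = fun z => fderiv ℝ h z (0, 1, 0) := by
  ext z; exact (hh.hasDerivAt_pos z.1 z.2.1 z.2.2).deriv

theorem dv_eq (hh : IsNice h) : dv h = fun z => fderiv ℝ h z (0, 0, 1) := by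
  ext z; exact (hh.hasDerivAt_vel z.1 z.2.1 z.2.2).deriv

theorem dt (hh : IsNice h) : IsNice (dt h) := by rw [hh.dt_eq]; exact hh.fderiv_apply _

theorem dx (hh : IsNice h) : IsNice (dx h) := by rw [hh.dx_eq]; exact hh.fderiv_apply _

theorem dv (hh : IsNice h) : IsNice (dv h) := by rw [hh.dv_eq]; exact hh.fderiv_apply _

theorem hasDerivAt_dt (hh : IsNice h) (t x v : ℝ) :
    HasDerivAt (fun τ => h (τ, x, v)) (Kac.dt h (t, x, v)) t := by
  rw [hh.dt_eq]; exact hh.hasDerivAt_time t x v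

theorem vel_mul (hh : IsNice h) : IsNice fun z => (z.2.2 : ℂ) * h z :=
  hh.mul_left (Complex.ofRealCLM.contDiff.comp (contDiff_snd.comp contDiff_snd))

theorem osc_eq (h : ℝ × ℝ × ℝ → ℂ) : osc h = fun z => (-1) * Kac.dv (Kac.dv h) z +
    (z.2.2 : ℂ) ^ 2 / 4 * h z := by
  ext z
  rw [neg_one_mul]; rfl

theorem osc (hh : IsNice h) : IsNice (osc h) := by
  rw [osc_eq]
  refine (hh.dv.dv.const_mul (-1)).add (hh.mul_left ?_)
  exact ((Complex.ofRealCLM.contDiff.comp (contDiff_snd.comp contDiff_snd)).pow 2).div_const 4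

theorem slice_vel (hh : IsNice h) (t x : ℝ) :
    ContDiff ℝ ∞ (fun v => h (t, x, v)) ∧ HasCompactSupport (fun v => h (t, x, v)) := by
  refine ⟨hh.smooth.comp (by fun_prop), ?_⟩
  refine HasCompactSupport.intro (hh.compact.isCompact.image continuous_snd |>.image continuous_snd)
    fun v hv => ?_
  by_contra hne
  exact hv ⟨(x, v), ⟨(t, x, v), subset_tsupport h hne, rfl⟩, rfl⟩

theorem slice_pos (hh : IsNice h) (t v : ℝ) :
    ContDiff ℝ ∞ (fun x => h (t, x, v)) ∧ HasCompactSupport (fun x => h (t, x, v)) := by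
  refine ⟨hh.smooth.comp (by fun_prop), ?_⟩
  refine HasCompactSupport.intro (hh.compact.isCompact.image continuous_snd |>.image continuous_fst)
    fun x hx => ?_
  by_contra hne
  exact hx ⟨(x, v), ⟨(t, x, v), subset_tsupport h hne, rfl⟩, rfl⟩

theorem slice_sl (hh : IsNice h) (t : ℝ) :
    Continuous (sl h t) ∧ HasCompactSupport (sl h t) := by
  refine ⟨hh.continuous.comp (by fun_prop), ?_⟩
  refine HasCompactSupport.intro (hh.compact.isCompact.image continuous_snd) fun z hz => ?_
  by_contra hne
  exact hz ⟨(t, z), subset_tsupport h hne, rfl⟩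

theorem memLp_sl (hh : IsNice h) (t : ℝ) : MemLp (sl h t) 2 volume :=
  (hh.slice_sl t).1.memLp_of_hasCompactSupport (hh.slice_sl t).2

theorem memLp_slab (hh : IsNice h) (T : ℝ) : MemLp h 2 (slab T) :=
  (hh.continuous.memLp_of_hasCompactSupport (μ := volume) hh.compact).mono_measure
    Measure.restrict_le_self

theorem exists_bound (hh : IsNice h) : ∃ C : ℝ, 0 ≤ C ∧ ∀ z, ‖h z‖ ≤ C := by
  obtain ⟨C, hC⟩ := hh.compact.exists_bound_of_continuous hh.continuous
  exact ⟨C, (norm_nonneg _).trans (hC 0), hC⟩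

/-- Uniform bound for the time slices. -/
theorem exists_eLpNorm_sl_le (hh : IsNice h) :
    ∃ C : ℝ≥0∞, C ≠ ⊤ ∧ ∀ t, eLpNorm (sl h t) 2 volume ≤ C := by
  obtain ⟨M, hM0, hM⟩ := hh.exists_bound
  set K : Set (ℝ × ℝ) := Prod.snd '' tsupport h with hK
  have hKc : IsCompact K := hh.compact.isCompact.image continuous_snd
  have hmem : MemLp (K.indicator fun _ => (M : ℂ)) 2 volume :=
    memLp_indicator_const 2 hKc.measurableSet _ (Or.inr hKc.measure_lt_top.ne)
  refine ⟨_, hmem.2.ne, fun t => eLpNorm_mono fun z => ?_⟩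
  by_cases hz : z ∈ K
  · rw [indicator_of_mem hz, Complex.norm_real, Real.norm_of_nonneg hM0]; exact hM _
  · rw [indicator_of_notMem hz]
    have : h (t, z) = 0 := by
      by_contra hne
      exact hz ⟨(t, z), subset_tsupport h hne, rfl⟩
    simp [sl, this]

/-- Uniform bound for the velocity slices. -/
theorem exists_lintegral_vel_le (hh : IsNice h) :
    ∃ C : ℝ≥0∞, C ≠ ⊤ ∧ ∀ t x, ∫⁻ v, ‖h (t, x, v)‖ₑ ^ 2 ≤ C := by
  obtain ⟨M, hM0, hM⟩ := hh.exists_bound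
  set K : Set ℝ := Prod.snd '' (Prod.snd '' tsupport h) with hK
  have hKc : IsCompact K := (hh.compact.isCompact.image continuous_snd).image continuous_snd
  refine ⟨∫⁻ v, K.indicator (fun _ => ENNReal.ofReal M ^ 2) v, ?_, fun t x =>
    lintegral_mono fun v => ?_⟩
  · rw [lintegral_indicator hKc.measurableSet, setLIntegral_const]
    exact ENNReal.mul_ne_top (by finiteness) hKc.measure_lt_top.ne
  · by_cases hz : v ∈ K
    · rw [indicator_of_mem hz, ← ofReal_norm]
      gcongr; exact hM _
    · rw [indicator_of_notMem hz]
      have : h (t, x, v) = 0 := by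
        by_contra hne
        exact hz ⟨(x, v), ⟨(t, x, v), subset_tsupport h hne, rfl⟩, rfl⟩
      simp [this]

theorem coef_osc (hh : IsNice h) (n : ℕ) (t x : ℝ) :
    cf n (sl (Kac.osc h) t) x = ((n : ℂ) + 1 / 2) * cf n (sl h t) x :=
  coef_oscillator (hh.slice_vel t x).1 (hh.slice_vel t x).2 n

theorem tsum_wt_two_cf (hh : IsNice h) (t : ℝ) :
    ∑' n, wt 2 n * eLpNorm (cf n (sl h t)) 2 volume ^ 2 =
      eLpNorm (sl (Kac.osc h) t) 2 volume ^ 2 := by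
  rw [← tsum_eLpNorm_cf_sq (hh.osc.memLp_sl t)]
  refine tsum_congr fun n => ?_
  have e : cf n (sl (Kac.osc h) t) = ((n : ℂ) + 1 / 2) • cf n (sl h t) := by
    ext x; exact hh.coef_osc n t x
  rw [e, eLpNorm_const_smul, mul_pow, wt, Real.rpow_two, ENNReal.ofReal_pow (by positivity)]
  congr 2
  rw [← ofReal_norm, show ((n : ℂ) + 1 / 2) = (((n : ℝ) + 1 / 2 : ℝ) : ℂ) by push_cast; rfl,
    Complex.norm_real, Real.norm_of_nonneg (by positivity)]

end IsNice

end Kac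

/-! ### The energy identity of ∂_t + v∂_x for blocks of test functions. -/

namespace Kac

open ComplexConjugate

theorem LPCouple.block_eq_conv (P : LPCouple) (n : ℕ) (u : ℝ → ℂ) (x : ℝ) :
    P.block n u x = ∫ y, P.kernel n y * u (x - y) := by
  rw [LPCouple.block, ← integral_sub_left_eq_self (fun y => P.kernel n y * u (x - y)) volume x]
  simp

theorem IsNice.continuous_blkT {h : ℝ × ℝ × ℝ → ℂ} (hh : IsNice h) (P : LPCouple) (n : ℕ) :
    Continuous (blkT P n h) := by
  obtain ⟨M, hM0, hM⟩ := hh.exists_bound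
  have e : blkT P n h = fun z => ∫ y, P.kernel n y * h (z.1, z.2.1 - y, z.2.2) := by
    ext z; exact P.block_eq_conv n _ _
  rw [e]
  have hc := P.continuous_kernel n
  have hc2 := hh.continuous
  refine continuous_of_dominated (bound := fun y => ‖P.kernel n y‖ * M)
    (fun z => (by fun_prop : Continuous _).aestronglyMeasurable)
    (fun z => Filter.Eventually.of_forall fun y => ?_) ((P.integrable_kernel n).norm.mul_const M)
    (Filter.Eventually.of_forall fun y => by fun_prop)
  rw [norm_mul]
  gcongr
  exact hM _

theorem IsNice.hasDerivAt_blkT {h : ℝ × ℝ × ℝ → ℂ} (hh : IsNice h) (P : LPCouple) (n : ℕ)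
    (t : ℝ) (z : ℝ × ℝ) :
    HasDerivAt (fun τ => blkT P n h (τ, z)) (blkT P n (Kac.dt h) (t, z)) t := by
  obtain ⟨M, hM0, hM⟩ := hh.exists_bound
  obtain ⟨M', hM0', hM'⟩ := hh.dt.exists_bound
  have hc := P.continuous_kernel n
  have hc2 := hh.continuous
  have hc3 := hh.dt.continuous
  have e : ∀ k : ℝ × ℝ × ℝ → ℂ, ∀ τ, blkT P n k (τ, z) =
      ∫ y, P.kernel n y * k (τ, z.1 - y, z.2) := fun k τ => P.block_eq_conv n _ _
  simp only [e]
  refine (hasDerivAt_integral_of_dominated_loc_of_deriv_le (s := univ)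
    (bound := fun y => ‖P.kernel n y‖ * M') Filter.univ_mem
    (F := fun τ y => P.kernel n y * h (τ, z.1 - y, z.2))
    (F' := fun τ y => P.kernel n y * Kac.dt h (τ, z.1 - y, z.2))
    (Filter.Eventually.of_forall fun τ => (by fun_prop : Continuous _).aestronglyMeasurable) ?_
    (by fun_prop : Continuous _).aestronglyMeasurable ?_
    ((P.integrable_kernel n).norm.mul_const M') ?_).2
  · exact (P.integrable_kernel n).mul_bdd (c := M) (by fun_prop : Continuous _).aestronglyMeasurable
      (Filter.Eventually.of_forall fun y => hM _)
  · refine Filter.Eventually.of_forall fun y τ _ => ?_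
    rw [norm_mul]; gcongr; exact hM' _
  · refine Filter.Eventually.of_forall fun y τ _ => ?_
    exact (hh.hasDerivAt_dt τ (z.1 - y) z.2).const_mul _

theorem toReal_eLpNorm_sq {α : Type*} [MeasurableSpace α] {ν : Measure α} {f : α → ℂ}
    (hf : MemLp f 2 ν) : ((eLpNorm f 2 ν).toReal ^ 2 : ℝ) = (∫ x, conj (f x) * f x ∂ν).re := by
  have e : ∀ x, conj (f x) * f x = ((‖f x‖ ^ 2 : ℝ) : ℂ) := fun x => by
    rw [mul_comm, Complex.mul_conj, Complex.normSq_eq_norm_sq]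
  simp only [e]
  have hm : AEStronglyMeasurable (fun x => ‖f x‖ ^ 2) ν := hf.1.norm.pow 2
  rw [integral_complex_ofReal, Complex.ofReal_re, ← ENNReal.toReal_pow, eLpNorm_two_sq,
    integral_eq_lintegral_of_nonneg_ae (Filter.Eventually.of_forall fun x => by positivity) hm]
  congr 1
  refine lintegral_congr fun x => ?_
  rw [ENNReal.ofReal_pow (norm_nonneg _), ofReal_norm]

theorem integral_conj_blkX_mul (P : LPCouple) (n : ℕ) {U W : ℝ × ℝ → ℂ} (hU : MemLp U 2 volume)
    (hW : MemLp W 2 volume) :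
    ∫ z, conj (blkX P n U z) * W z = ∫ z, conj (U z) * blkX P n W z := by
  simp only [conj_blkX]
  rw [integral_blkX_mul P.reflect n (memLp_conj hU) hW, LPCouple.reflect_reflect]

/-- The characteristic function of `[t₀, ∞)`. -/
noncomputable def cut (t₀ t : ℝ) : ℝ := (Ici t₀).indicator (fun _ => 1) t

theorem measurable_cut (t₀ : ℝ) : Measurable (cut t₀) :=
  measurable_const.indicator measurableSet_Ici

theorem cut_mem (t₀ t : ℝ) : cut t₀ t ∈ Icc (0 : ℝ) 1 := by
  unfold cut indicator; split_ifs <;> simp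

theorem norm_cut_le (t₀ t : ℝ) : ‖(cut t₀ t : ℂ)‖ ≤ 1 := by
  rw [Complex.norm_real, Real.norm_of_nonneg (cut_mem t₀ t).1]; exact (cut_mem t₀ t).2

theorem cut_zero_ae (T : ℝ) : ∀ᵐ t ∂timeM T, cut 0 t = 1 := by
  filter_upwards [ae_restrict_mem measurableSet_Icc] with t ht
  simp [cut, ht.1]

theorem integral_cut_mul {t₀ T : ℝ} (h0 : t₀ ∈ Icc 0 T) (F : ℝ → ℂ) :
    ∫ t, (cut t₀ t : ℂ) * F t ∂timeM T = ∫ t in t₀..T, F t := by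
  rw [intervalIntegral.integral_of_le h0.2, ← integral_Icc_eq_integral_Ioc, timeM]
  have e : (fun t => (cut t₀ t : ℂ) * F t) = (Ici t₀).indicator F := by
    ext t; by_cases ht : t ∈ Ici t₀ <;> simp [cut, ht]
  rw [e, integral_indicator measurableSet_Ici, Measure.restrict_restrict measurableSet_Ici]
  congr 2
  ext t; simp only [mem_inter_iff, mem_Ici, mem_Icc]
  exact ⟨fun h => ⟨h.1, h.2.2⟩, fun h => ⟨h.1, h0.1.trans h.1, h.2⟩⟩

theorem integrable_cut_mul {T : ℝ} (t₀ : ℝ) {F : ℝ × ℝ × ℝ → ℂ} (hF : Integrable F (slab T)) :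
    Integrable (fun z => (cut t₀ z.1 : ℂ) * F z) (slab T) :=
  hF.bdd_mul (c := 1) (Complex.measurable_ofReal.comp
    ((measurable_cut t₀).comp measurable_fst)).aestronglyMeasurable
    (Filter.Eventually.of_forall fun _ => norm_cut_le _ _)

theorem memLp_cut_mul {T : ℝ} (t₀ : ℝ) {F : ℝ × ℝ × ℝ → ℂ} (hF : MemLp F 2 (slab T)) :
    MemLp (fun z => (cut t₀ z.1 : ℂ) * F z) 2 (slab T) :=
  hF.of_le ((Complex.measurable_ofReal.comp
    ((measurable_cut t₀).comp measurable_fst)).aestronglyMeasurable.mul hF.1)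
    (Filter.Eventually.of_forall fun z => by
      rw [norm_mul]; exact mul_le_of_le_one_left (norm_nonneg _) (norm_cut_le _ _))

/-- The time derivative part of the energy identity. -/
theorem IsNice.re_integral_conj_blkT_dt {h : ℝ × ℝ × ℝ → ℂ} (hh : IsNice h) (P : LPCouple) (n : ℕ)
    {t₀ T : ℝ} (h0 : t₀ ∈ Icc 0 T) (hT : ∀ z, h (T, z) = 0) :
    (∫ z, (cut t₀ z.1 : ℂ) * (conj (blkT P n h z) * blkT P n (Kac.dt h) z) ∂slab T).re =
      -(1 / 2) * (eLpNorm (blkX P n (sl h t₀)) 2 volume).toReal ^ 2 := by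
  set u := blkT P n h with hu
  set w := blkT P n (Kac.dt h) with hw
  have huc : Continuous u := hh.continuous_blkT P n
  have hwc : Continuous w := hh.dt.continuous_blkT P n
  have hu2 : MemLp u 2 (slab T) := memLp_blkT P n (hh.memLp_slab T)
  have hw2 : MemLp w 2 (slab T) := memLp_blkT P n (hh.dt.memLp_slab T)
  have i1 : Integrable (fun z => conj (u z) * w z) (slab T) :=
    integrable_mul_of_memLp (memLp_conj hu2) hw2
  have i2 : Integrable (fun z => conj (w z) * u z) (slab T) :=
    integrable_mul_of_memLp (memLp_conj hw2) hu2
  have i3 := integrable_cut_mul t₀ (i1.fun_add i2)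
  have key : ∫ z, (cut t₀ z.1 : ℂ) * (conj (u z) * w z + conj (w z) * u z) ∂slab T =
      -∫ z, conj (u (t₀, z)) * u (t₀, z) := by
    rw [slab_eq] at i3 ⊢
    rw [integral_prod_symm _ i3, ← integral_neg]
    refine integral_congr_ae (Filter.Eventually.of_forall fun z => ?_)
    beta_reduce
    -- The indicator turns the integral into one over [t₀, T], and the integrand is the time
    -- derivative of |Δ_n h|²; the boundary term at T vanishes with h.
    rw [integral_cut_mul h0 (fun t => conj (u (t, z)) * w (t, z) + conj (w (t, z)) * u (t, z))]
    have hd : ∀ t, HasDerivAt (fun t => conj (u (t, z)) * u (t, z))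
        (conj (u (t, z)) * w (t, z) + conj (w (t, z)) * u (t, z)) t := fun t => by
      have h1 := hh.hasDerivAt_blkT P n t z
      have h2 : HasDerivAt (fun t => conj (u (t, z))) (conj (w (t, z))) t := h1.star
      exact (h2.fun_mul h1).congr_deriv (by ring)
    rw [intervalIntegral.integral_eq_sub_of_hasDerivAt (fun t _ => hd t)]
    · have : u (T, z) = 0 := by
        rw [hu]; simp [blkT, LPCouple.block, hT]
      rw [this, mul_zero, zero_sub]
    · have c1 : Continuous fun t => u (t, z) := huc.comp (by fun_prop)
      have c2 : Continuous fun t => w (t, z) := hwc.comp (by fun_prop)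
      exact (((Complex.continuous_conj.comp c1).mul c2).add
        ((Complex.continuous_conj.comp c2).mul c1)).intervalIntegrable _ _
  have e2 : (∫ z, (cut t₀ z.1 : ℂ) * (conj (w z) * u z) ∂slab T).re =
      (∫ z, (cut t₀ z.1 : ℂ) * (conj (u z) * w z) ∂slab T).re := by
    rw [← Complex.conj_re, ← integral_conj]
    congr 2; ext z
    simp only [map_mul, Complex.conj_conj, Complex.conj_ofReal]; ring
  have e3 := congrArg Complex.re key
  simp only [mul_add] at e3
  rw [integral_add (integrable_cut_mul t₀ i1) (integrable_cut_mul t₀ i2), Complex.add_re, e2,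
    Complex.neg_re] at e3
  have e4 := toReal_eLpNorm_sq (memLp_blkX P n (hh.memLp_sl t₀))
  have e5 : (∫ z, conj (u (t₀, z)) * u (t₀, z)).re =
      (eLpNorm (blkX P n (sl h t₀)) 2 volume).toReal ^ 2 := by rw [e4]; rfl
  rw [e5] at e3
  linarith

theorem sl_dx (h : ℝ × ℝ × ℝ → ℂ) (t x v : ℝ) :
    sl (dx h) t (x, v) = deriv (fun y => h (t, y, v)) x := rfl

/-- The transport term does not contribute to the energy. -/
theorem IsNice.re_integral_transport {h : ℝ × ℝ × ℝ → ℂ} (hh : IsNice h) (P : LPCouple) (n : ℕ)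
    (t : ℝ) : (∫ z : ℝ × ℝ, conj (blkX P n (blkX P n (sl h t)) z) *
      ((z.2 : ℂ) * sl (Kac.dx h) t z)).re = 0 := by
  have hint : Integrable fun z : ℝ × ℝ => conj (blkX P n (blkX P n (sl h t)) z) *
      ((z.2 : ℂ) * sl (Kac.dx h) t z) :=
    integrable_mul_of_memLp (memLp_conj (memLp_blkX P n (memLp_blkX P n (hh.memLp_sl t))))
      (hh.dx.vel_mul.memLp_sl t)
  rw [integral_prod_symm_xv hint]
  have h1 : ∀ v : ℝ, (∫ x, conj (blkX P n (blkX P n (sl h t)) (x, v)) *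
      ((v : ℂ) * sl (Kac.dx h) t (x, v))).re = 0 := fun v => by
    have := P.re_integral_conj_block_block_mul_deriv n
      ((hh.slice_pos t v).2.toSchwartzMap (hh.slice_pos t v).1)
    have e : ∫ x, conj (blkX P n (blkX P n (sl h t)) (x, v)) *
        ((v : ℂ) * sl (Kac.dx h) t (x, v)) = (v : ℂ) *
        ∫ x, conj (P.block n (P.block n (fun y => h (t, y, v))) x) *
          deriv (fun y => h (t, y, v)) x := by
      rw [← integral_const_mul]
      refine integral_congr_ae (Filter.Eventually.of_forall fun x => ?_)
      beta_reduce
      rw [sl_dx]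
      simp only [blkX, sl]; ring
    rw [e, Complex.re_ofReal_mul]
    exact mul_eq_zero_of_right _ this
  have hi2 : Integrable fun v : ℝ => ∫ x, conj (blkX P n (blkX P n (sl h t)) (x, v)) *
      ((v : ℂ) * sl (Kac.dx h) t (x, v)) := hint.integral_prod_right
  have := integral_re hi2
  simp only [RCLike.re_eq_complex_re] at this
  rw [← this]
  simp [h1]

/-- The contribution of the transport operator to the energy identity. -/
theorem IsNice.re_integral_energy {h : ℝ × ℝ × ℝ → ℂ} (hh : IsNice h) (P : LPCouple) (n : ℕ)
    {t₀ T : ℝ} (h0 : t₀ ∈ Icc 0 T) (hT : ∀ z, h (T, z) = 0) :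
    (∫ z, ((cut t₀ z.1 : ℂ) * conj (blkT P n (blkT P n h) z)) *
      (h z - Kac.dt h z - (z.2.2 : ℂ) * Kac.dx h z) ∂slab T).re =
      1 / 2 * (eLpNorm (blkX P n (sl h t₀)) 2 volume).toReal ^ 2 +
      (∫ z, ((cut t₀ z.1 : ℂ) * conj (blkT P n (blkT P n h) z)) * h z ∂slab T).re := by
  set G : ℝ × ℝ × ℝ → ℂ := fun z => (cut t₀ z.1 : ℂ) * conj (blkT P n (blkT P n h) z) with hG
  have hG2 : MemLp G 2 (slab T) :=
    memLp_cut_mul t₀ (memLp_conj (memLp_blkT P n (memLp_blkT P n (hh.memLp_slab T))))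
  have i1 := integrable_mul_of_memLp hG2 (hh.memLp_slab T)
  have i2 := integrable_mul_of_memLp hG2 (hh.dt.memLp_slab T)
  have i3 := integrable_mul_of_memLp hG2 (hh.dx.vel_mul.memLp_slab T)
  have e0 : (fun z => G z * (h z - Kac.dt h z - (z.2.2 : ℂ) * Kac.dx h z)) = fun z =>
      G z * h z - G z * Kac.dt h z - G z * ((z.2.2 : ℂ) * Kac.dx h z) := by ext z; ring
  have i12 : Integrable (fun z => G z * h z - G z * Kac.dt h z) (slab T) := i1.sub i2
  rw [e0, integral_sub i12 i3, integral_sub i1 i2, Complex.sub_re, Complex.sub_re]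
  have e1 : (∫ z, G z * ((z.2.2 : ℂ) * Kac.dx h z) ∂slab T).re = 0 := by
    have i4 := i3
    rw [slab_eq] at i4
    rw [integral_slab i3]
    have hi := i4.integral_prod_left
    have := integral_re hi
    simp only [RCLike.re_eq_complex_re] at this
    rw [← this]
    refine integral_eq_zero_of_ae (Filter.Eventually.of_forall fun t => ?_)
    have e : ∫ z : ℝ × ℝ, G (t, z) * ((z.2 : ℂ) * Kac.dx h (t, z)) = (cut t₀ t : ℂ) *
        ∫ z : ℝ × ℝ, conj (blkX P n (blkX P n (sl h t)) z) * ((z.2 : ℂ) * sl (Kac.dx h) t z) := by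
      rw [← integral_const_mul]
      refine integral_congr_ae (Filter.Eventually.of_forall fun z => ?_)
      exact mul_assoc _ _ _
    beta_reduce
    rw [e, Complex.re_ofReal_mul, hh.re_integral_transport P n t, mul_zero]; rfl
  -- One of the two blocks moves to the other factor, so that the identity becomes an energy for Δ_n
  -- h.
  have e2 : ∫ z, G z * Kac.dt h z ∂slab T =
      ∫ z, (cut t₀ z.1 : ℂ) * (conj (blkT P n h z) * blkT P n (Kac.dt h) z) ∂slab T := by
    have hu2 : MemLp (blkT P n h) 2 (slab T) := memLp_blkT P n (hh.memLp_slab T)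
    have hw2 : MemLp (blkT P n (Kac.dt h)) 2 (slab T) := memLp_blkT P n (hh.dt.memLp_slab T)
    rw [integral_slab i2, integral_slab (integrable_cut_mul t₀
      (integrable_mul_of_memLp (memLp_conj hu2) hw2))]
    refine integral_congr_ae (Filter.Eventually.of_forall fun t => ?_)
    have := integral_conj_blkX_mul P n (memLp_blkX P n (hh.memLp_sl t)) (hh.dt.memLp_sl t)
    calc _ = (cut t₀ t : ℂ) * ∫ z, conj (blkX P n (blkX P n (sl h t)) z) * sl (Kac.dt h) t z := by
          rw [← integral_const_mul]
          refine integral_congr_ae (Filter.Eventually.of_forall fun z => ?_)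
          exact mul_assoc _ _ _
      _ = _ := by rw [this, ← integral_const_mul]; rfl
  rw [e1, e2, hh.re_integral_conj_blkT_dt P n h0 hT]
  ring

/-- Low frequency cut-off in the position variable. -/
noncomputable def lowPassX (P : LPCouple) (N : ℕ) (U : ℝ × ℝ → ℂ) (z : ℝ × ℝ) : ℂ :=
  P.lowPass N (fun y => U (y, z.2)) z.1

theorem lowPassX_eq (P : LPCouple) (N : ℕ) (U : ℝ × ℝ → ℂ) (z : ℝ × ℝ) :
    lowPassX P N U z = ∑ n ∈ Finset.range N, blkX P n U z := rfl

theorem memLp_lowPassX (P : LPCouple) (N : ℕ) {U : ℝ × ℝ → ℂ} (hU : MemLp U 2 volume) :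
    MemLp (lowPassX P N U) 2 volume :=
  memLp_finsetSum (Finset.range N) fun n _ => memLp_blkX P n hU

theorem IsNice.eLpNorm_sub_lowPassX_le {h : ℝ × ℝ × ℝ → ℂ} (hh : IsNice h) (P : LPCouple) {N : ℕ}
    (hN : N ≠ 0) (t : ℝ) :
    eLpNorm (fun z => sl h t z - lowPassX P N (sl h t) z) 2 volume ≤
      ENNReal.ofReal (3 / 2 ^ N) * eLpNorm (sl (Kac.dx h) t) 2 volume := by
  have hm := (hh.memLp_sl t).sub (memLp_lowPassX P N (hh.memLp_sl t))
  rw [← sq_le_sq_iff_ennreal, mul_pow, eLpNorm_two_sq, eLpNorm_two_sq, Measure.volume_eq_prod]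
  refine (lintegral_sq_prod_symm hm.1).le.trans ?_
  rw [lintegral_sq_prod_symm (hh.dx.memLp_sl t).1, ← lintegral_const_mul' _ _ (by finiteness)]
  refine lintegral_mono fun v => ?_
  have := P.eLpNorm_sub_lowPass_le hN ((hh.slice_pos t v).2.toSchwartzMap (hh.slice_pos t v).1)
  have h2 := pow_le_pow_left' this 2
  rw [mul_pow, eLpNorm_two_sq, eLpNorm_two_sq] at h2
  exact h2

end Kac

namespace Kac

open ComplexConjugate

/-! ### Dyadic weights -/

/-- The weight `2^{n/2}`. -/
noncomputable def rt (n : ℕ) : ℝ≥0∞ := ENNReal.ofReal (Real.sqrt 2 ^ n)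

theorem rt_eq (n : ℕ) : rt n = (2 : ℝ≥0∞) ^ ((n : ℝ) / 2) := by
  rw [rt, Real.sqrt_eq_rpow, ← Real.rpow_natCast, ← Real.rpow_mul (by norm_num),
    ← ENNReal.ofReal_rpow_of_pos two_pos, ENNReal.ofReal_ofNat]
  congr 1; ring

theorem rt_ne_zero (n : ℕ) : rt n ≠ 0 := by
  rw [rt, Ne, ENNReal.ofReal_eq_zero, not_le]; positivity

theorem rt_ne_top (n : ℕ) : rt n ≠ ⊤ := ENNReal.ofReal_ne_top

theorem rt_add (m n : ℕ) : rt (m + n) = rt m * rt n := by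
  rw [rt, rt, rt, ← ENNReal.ofReal_mul (by positivity), pow_add]

theorem rt_mono {m n : ℕ} (h : m ≤ n) : rt m ≤ rt n := by
  refine ENNReal.ofReal_le_ofReal (pow_le_pow_right₀ ?_ h)
  rw [Real.one_le_sqrt]; norm_num

theorem rt_two : rt 2 = 2 := by
  rw [rt, Real.sq_sqrt (by norm_num)]; simp

theorem rt_three_le : rt 3 ≤ 3 := by
  rw [rt, show (3 : ℝ≥0∞) = ENNReal.ofReal 3 by simp]
  refine ENNReal.ofReal_le_ofReal ?_
  rw [pow_succ, Real.sq_sqrt (by norm_num)]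
  nlinarith [Real.sqrt_nonneg 2, Real.sq_sqrt (show (0 : ℝ) ≤ 2 by norm_num)]

theorem sum_rt_le (N : ℕ) : ∑ r ∈ Finset.range N, rt r ≤ 3 * rt N := by
  have h : ∀ N, ∑ r ∈ Finset.range N, Real.sqrt 2 ^ r ≤ 3 * Real.sqrt 2 ^ N := by
    intro N
    induction N with
    | zero => simp
    | succ n ih =>
      rw [Finset.sum_range_succ, pow_succ]
      -- The induction step needs 1 + 3 ≤ 3√2.
      have h1 : (4 : ℝ) / 3 ≤ Real.sqrt 2 := Real.le_sqrt_of_sq_le (by norm_num)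
      nlinarith [pow_nonneg (Real.sqrt_nonneg 2) n]
  unfold rt
  rw [← ENNReal.ofReal_sum_of_nonneg fun _ _ => by positivity,
    show (3 : ℝ≥0∞) = ENNReal.ofReal 3 by simp, ← ENNReal.ofReal_mul (by norm_num)]
  exact ENNReal.ofReal_le_ofReal (h N)

/-- The gain in the paraproduct decomposition: `p`, `q`, `r` are the frequencies of the
coefficient, of the unknown and of the test function. -/
noncomputable def paraWeight (q r p : ℕ) : ℝ≥0∞ :=
  if r < q + 3 then rt p else if p ∈ Finset.Icc (r - 2) (r + 2) then rt q else 0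

/-- For r < q + 3 the geometric sum of 2^{r/2} is at most 9 · 2^{q/2}. Otherwise r takes at most
five values near p, each with 2^{r/2} ≤ 2 · 2^{p/2}. The total is 9 + 10. Either way one factor
2^{p/2} lands on the coefficient f, which is the B^{1/2}_{2,1} weight, while a norm of sup type
suffices for the test function. -/
theorem sum_paraWeight_le (q p R : ℕ) :
    ∑ r ∈ Finset.range R, paraWeight q r p * rt r ≤ 19 * rt q * rt p := by
  have h1 : ∀ r ∈ Finset.range R, paraWeight q r p * rt r ≤
      (if r < q + 3 then rt p * rt r else 0) +
      (if r ∈ Finset.Icc (p - 2) (p + 2) then rt q * (2 * rt p) else 0) := fun r _ => by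
    unfold paraWeight
    by_cases a : r < q + 3
    · rw [if_pos a, if_pos a]; exact le_self_add
    rw [if_neg a, if_neg a, zero_add]
    by_cases b : p ∈ Finset.Icc (r - 2) (r + 2)
    · have c : r ∈ Finset.Icc (p - 2) (p + 2) := by simp only [Finset.mem_Icc] at b ⊢; omega
      rw [if_pos b, if_pos c]
      refine mul_le_mul_right ?_ _
      rw [← rt_two, ← rt_add, add_comm]
      exact rt_mono (by simp only [Finset.mem_Icc] at c; omega)
    · rw [if_neg b, zero_mul]; exact zero_le
  refine (Finset.sum_le_sum h1).trans ?_
  rw [Finset.sum_add_distrib]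
  have h2 : ∑ r ∈ Finset.range R, (if r < q + 3 then rt p * rt r else 0) ≤ 9 * rt q * rt p := by
    rw [← Finset.sum_filter, ← Finset.mul_sum]
    calc _ ≤ rt p * ∑ r ∈ Finset.range (q + 3), rt r := by
          gcongr
          exact fun r hr => Finset.mem_range.2 (Finset.mem_filter.1 hr).2
      _ ≤ rt p * (3 * rt (q + 3)) := by gcongr; exact sum_rt_le _
      _ ≤ rt p * (3 * (rt q * 3)) := by rw [rt_add]; gcongr; exact rt_three_le
      _ = _ := by ring
  have h3 : ∑ r ∈ Finset.range R, (if r ∈ Finset.Icc (p - 2) (p + 2) then rt q * (2 * rt p) else 0) ≤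
      10 * rt q * rt p := by
    rw [← Finset.sum_filter, Finset.sum_const, nsmul_eq_mul]
    have : ((Finset.range R).filter (fun r => r ∈ Finset.Icc (p - 2) (p + 2))).card ≤ 5 := by
      refine (Finset.card_le_card (t := Finset.Icc (p - 2) (p + 2)) fun r hr =>
        (Finset.mem_filter.1 hr).2).trans ?_
      rw [Nat.card_Icc]; omega
    calc _ ≤ (5 : ℝ≥0∞) * (rt q * (2 * rt p)) := by gcongr; exact_mod_cast this
      _ = _ := by ring
  calc _ ≤ 9 * rt q * rt p + 10 * rt q * rt p := add_le_add h2 h3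
    _ = _ := by ring

/-! ### The trilinear estimate at a fixed time -/

theorem eLpNorm_two_mul_le_of_bound {f g : ℝ → ℂ} {C : ℝ≥0∞} (hC : C ≠ ⊤)
    (hb : ∀ x, ‖f x‖ₑ ≤ C) :
    eLpNorm (fun x => f x * g x) 2 volume ≤ C * eLpNorm g 2 volume := by
  rw [← sq_le_sq_iff_ennreal, mul_pow, eLpNorm_two_sq, eLpNorm_two_sq,
    ← lintegral_const_mul' _ _ (by finiteness)]
  refine lintegral_mono fun x => ?_
  rw [enorm_mul, mul_pow]
  gcongr
  exact hb x

namespace LPCouple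

variable (P : LPCouple)

theorem enorm_block_le_rt (n : ℕ) {u : ℝ → ℂ} (hu : MemLp u 2 volume) (x : ℝ) :
    ‖P.block n u x‖ₑ ≤ rt n * eLpNorm (P.block n u) 2 volume := by
  rw [rt_eq]; exact P.enorm_block_le n hu x

theorem enorm_integral_mul_le_tsum {u w : ℝ → ℂ} (hu : MemLp u 2 volume) (hw : MemLp w 2 volume) :
    ‖∫ x, u x * w x‖ₑ ≤ ∑' p, ‖∫ x, P.block p u x * w x‖ₑ := by
  have h1 : ∀ N, ‖∫ x, u x * w x‖ₑ ≤ ∑' p, ‖∫ x, P.block p u x * w x‖ₑ +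
      eLpNorm (fun x => u x - P.lowPass N u x) 2 volume * eLpNorm w 2 volume := fun N => by
    have hd : MemLp (fun x => u x - P.lowPass N u x) 2 volume := hu.sub (P.memLp_lowPass N hu)
    have e : ∫ x, u x * w x = ∑ p ∈ Finset.range N, (∫ x, P.block p u x * w x) +
        ∫ x, (u x - P.lowPass N u x) * w x := by
      rw [← integral_finsetSum _ fun p _ => integrable_mul_of_memLp (P.memLp_block p hu) hw,
        ← integral_add (integrable_finsetSum _ fun p _ =>
          integrable_mul_of_memLp (P.memLp_block p hu) hw) (integrable_mul_of_memLp hd hw)]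
      congr 1; ext x
      rw [lowPass, ← Finset.sum_mul]; ring
    rw [e]
    refine (enorm_add_le _ _).trans (add_le_add ?_ (enorm_integral_mul_le hd.1 hw.1))
    exact (enorm_sum_le _ _).trans (ENNReal.sum_le_tsum _)
  have h2 := (ENNReal.Tendsto.mul_const (b := eLpNorm w 2 volume) (P.tendsto_lowPass hu)
    (Or.inr hw.2.ne)).const_add (∑' p, ‖∫ x, P.block p u x * w x‖ₑ)
  rw [zero_mul, add_zero] at h2
  exact ge_of_tendsto' h2 h1

/-- The trilinear estimate for frequency localized functions. -/
theorem enorm_integral_trilinear_le (Q : LPCouple) (q r : ℕ) {u g w : ℝ → ℂ}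
    (hu : MemLp u 2 volume) (hg : MemLp g 2 volume) (hw : MemLp w 2 volume) :
    ‖∫ x, u x * P.block q g x * Q.block r w x‖ₑ ≤ ∑' p, paraWeight q r p *
      (eLpNorm (P.block p u) 2 volume * eLpNorm (P.block q g) 2 volume *
        eLpNorm (Q.block r w) 2 volume) := by
  have hgw := memLp_block_mul_block P Q q r hg hw
  -- Bernstein is applied to the coefficient when r is not much larger than q, and to the block q
  -- when r is; in the latter case the coefficient must itself have frequency near 2^r.
  by_cases hr : r < q + 3
  · have h := P.enorm_integral_mul_le_tsum hu hgw
    simp only [← mul_assoc] at h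
    refine h.trans (ENNReal.tsum_le_tsum fun p => ?_)
    have hpt : rt p * eLpNorm (P.block p u) 2 volume ≠ ⊤ :=
      ENNReal.mul_ne_top (rt_ne_top p) (P.memLp_block p hu).2.ne
    have h1 := enorm_integral_mul_le (memLp_block_mul_block P P p q hu hg).1 (Q.memLp_block r hw).1
    refine h1.trans ?_
    rw [paraWeight, if_pos hr]
    calc _ ≤ rt p * eLpNorm (P.block p u) 2 volume * eLpNorm (P.block q g) 2 volume *
          eLpNorm (Q.block r w) 2 volume := by
          gcongr
          exact eLpNorm_two_mul_le_of_bound hpt (P.enorm_block_le_rt p hu)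
      _ = _ := by ring
  · rw [integral_mul_block_mul_block P P Q (by omega) hu hg hw]
    refine (enorm_sum_le _ _).trans ?_
    refine le_trans (Finset.sum_le_sum fun p hp => ?_) (ENNReal.sum_le_tsum (Finset.Icc (r - 2) (r + 2)))
    have hpt : rt q * eLpNorm (P.block q g) 2 volume ≠ ⊤ :=
      ENNReal.mul_ne_top (rt_ne_top q) (P.memLp_block q hg).2.ne
    have h1 := enorm_integral_mul_le (memLp_block_mul_block P P p q hu hg).1 (Q.memLp_block r hw).1
    refine h1.trans ?_
    rw [paraWeight, if_neg hr, if_pos hp]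
    have h2 := eLpNorm_two_mul_le_of_bound (g := P.block p u) hpt (P.enorm_block_le_rt q hg)
    simp only [mul_comm (P.block q g _)] at h2
    calc _ ≤ rt q * eLpNorm (P.block q g) 2 volume * eLpNorm (P.block p u) 2 volume *
          eLpNorm (Q.block r w) 2 volume := by gcongr
      _ = _ := by ring

end LPCouple

/-- The square of the weighted norm `(∑ (n + 1/2)^s ‖Δ_r W_n‖²)^{1/2}`. -/
noncomputable def wtNormSq (s : ℝ) (Q : LPCouple) (r : ℕ) (W : ℝ × ℝ → ℂ) : ℝ≥0∞ :=
  ∑' n, wt s n * eLpNorm (Q.block r (cf n W)) 2 volume ^ 2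

theorem rpow_half_of_sq (a : ℝ≥0∞) : (a ^ 2) ^ (1 / 2 : ℝ) = a := by
  rw [← ENNReal.rpow_natCast, ← ENNReal.rpow_mul]; norm_num

theorem block_conj_block (P : LPCouple) (q : ℕ) (u : ℝ → ℂ) :
    P.block q (fun x => conj (P.reflect.block q u x)) =
      fun x => conj (P.reflect.block q (P.reflect.block q u) x) := by
  ext x
  rw [P.reflect.conj_block, LPCouple.reflect_reflect]

theorem ae_cf_eq_sum_add (Q : LPCouple) (R n : ℕ) {W : ℝ × ℝ → ℂ} (hW : MemLp W 2 volume) :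
    ∀ᵐ x, cf n W x = ∑ r ∈ Finset.range R, Q.block r (cf n W) x +
      cf n (fun z => W z - lowPassX Q R W z) x := by
  have h1 : ∀ᵐ x, MemLp (fun v => W (x, v)) 2 volume := ae_memLp_slice_fst hW
  have h2 : ∀ᵐ x, ∀ r, MemLp (fun v => blkX Q r W (x, v)) 2 volume :=
    ae_all_iff.2 fun r => ae_memLp_slice_fst (memLp_blkX Q r hW)
  filter_upwards [h1, h2] with x hx hr
  have i0 := integrable_mul_of_memLp hx (memLp_hermiteFun n)
  have ir := fun r => integrable_mul_of_memLp (hr r) (memLp_hermiteFun n)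
  have e : cf n (fun z => W z - lowPassX Q R W z) x =
      cf n W x - ∑ r ∈ Finset.range R, cf n (blkX Q r W) x := by
    unfold cf coef
    rw [← integral_finsetSum _ fun r _ => ir r, ← integral_sub i0 (integrable_finsetSum _ fun r _ => ir r)]
    congr 1; ext v
    beta_reduce
    rw [lowPassX_eq, sub_mul, Finset.sum_mul]
  rw [e, Finset.sum_congr rfl fun r _ => cf_blkX Q r n hW x]
  ring

/-- The trilinear estimate at a fixed time. -/
theorem tsum_alpha_integral_le {s : ℝ} (hs0 : 0 < s) (hs1 : s < 1) (P : LPCouple) (q R : ℕ)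
    {U W : ℝ × ℝ → ℂ} (hU : MemLp U 2 volume) (hW : MemLp W 2 volume) :
    ∑' p : ℕ × ℕ, ‖alpha s p.1 p.2‖ₑ * ‖∫ x, cf p.1 U x *
        conj (P.reflect.block q (P.reflect.block q (cf p.2 W)) x) * cf (p.1 + p.2) W x‖ₑ ≤
      ENNReal.ofReal (6 * momentConst s) *
      (∑ r ∈ Finset.range R, ∑' p, paraWeight q r p * (eLpNorm (blkX P p U) 2 volume *
        wtNormSq s P.reflect q W ^ (1 / 2 : ℝ) * wtNormSq s P.reflect r W ^ (1 / 2 : ℝ)) +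
      rt q * eLpNorm U 2 volume * eLpNorm W 2 volume *
        (∑' n, wt (2 * s) n * eLpNorm (cf n fun z => W z - lowPassX P.reflect R W z) 2 volume ^ 2) ^
          (1 / 2 : ℝ)) := by
  set Q := P.reflect with hQ
  set C := ENNReal.ofReal (6 * momentConst s) with hC
  set D : ℝ × ℝ → ℂ := fun z => W z - lowPassX Q R W z with hD
  have hD2 : MemLp D 2 volume := hW.sub (memLp_lowPassX Q R hW)
  have hcU := fun k => memLp_cf k hU
  have hcW := fun k => memLp_cf k hW
  have hcD := fun k => memLp_cf k hD2
  have hG : ∀ l, MemLp (fun x => conj (Q.block q (cf l W) x)) 2 volume := fun l =>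
    memLp_conj (Q.memLp_block q (hcW l))
  -- One block acts on conj(Δ_q W) as an outer operator; keeping it explicit permits Bernstein and
  -- the product rules at frequency q.
  have eG : ∀ l, P.block q (fun x => conj (Q.block q (cf l W) x)) =
      fun x => conj (Q.block q (Q.block q (cf l W)) x) := fun l => block_conj_block P q _
  have nG : ∀ l, eLpNorm (P.block q (fun x => conj (Q.block q (cf l W) x))) 2 volume ≤
      eLpNorm (Q.block q (cf l W)) 2 volume := fun l =>
    (P.eLpNorm_block_le q (hG l)).trans (eLpNorm_conj _).le
  -- decomposition of the third factor
  have hdec : ∀ n, ∀ᵐ x, cf n W x = ∑ r ∈ Finset.range R, Q.block r (cf n W) x + cf n D x :=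
    fun n => ae_cf_eq_sum_add Q R n hW
  have hterm : ∀ k l, ‖∫ x, cf k U x * conj (Q.block q (Q.block q (cf l W)) x) *
      cf (k + l) W x‖ₑ ≤ ∑ r ∈ Finset.range R, ∑' p, paraWeight q r p *
      (eLpNorm (P.block p (cf k U)) 2 volume * eLpNorm (Q.block q (cf l W)) 2 volume *
        eLpNorm (Q.block r (cf (k + l) W)) 2 volume) +
      rt q * (eLpNorm (cf k U) 2 volume * eLpNorm (cf l W) 2 volume *
        eLpNorm (cf (k + l) D) 2 volume) := fun k l => by
    have hUG : MemLp (fun x => cf k U x * conj (Q.block q (Q.block q (cf l W)) x)) 2 volume := by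
      have := (P.memLp_block q (hG l))
      obtain ⟨B, hB⟩ := P.norm_block_le q (hG l)
      rw [eG l] at this hB
      have h := memLp_two_of_bound this.1 hB (hcU k)
      simpa only [mul_comm] using h
    have e : ∫ x, cf k U x * conj (Q.block q (Q.block q (cf l W)) x) * cf (k + l) W x =
        ∑ r ∈ Finset.range R, (∫ x, cf k U x * conj (Q.block q (Q.block q (cf l W)) x) *
          Q.block r (cf (k + l) W) x) +
        ∫ x, cf k U x * conj (Q.block q (Q.block q (cf l W)) x) * cf (k + l) D x := by
      have ir : ∀ r ∈ Finset.range R, Integrable fun x => cf k U x *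
          conj (Q.block q (Q.block q (cf l W)) x) * Q.block r (cf (k + l) W) x := fun r _ =>
        integrable_mul_of_memLp hUG (Q.memLp_block r (hcW (k + l)))
      rw [← integral_finsetSum _ ir, ← integral_add (integrable_finsetSum _ ir)
        (integrable_mul_of_memLp hUG (hcD (k + l)))]
      refine integral_congr_ae ?_
      filter_upwards [hdec (k + l)] with x hx
      rw [← Finset.mul_sum, ← mul_add, ← hx]
    rw [e]
    refine (enorm_add_le _ _).trans (add_le_add ((enorm_sum_le _ _).trans
      (Finset.sum_le_sum fun r _ => ?_)) ?_)
    · have h := P.enorm_integral_trilinear_le Q q r (hcU k) (hG l) (hcW (k + l))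
      rw [eG l] at h
      refine h.trans (ENNReal.tsum_le_tsum fun p => ?_)
      have hn := nG l
      rw [eG l] at hn
      gcongr
    · refine (enorm_integral_mul_le hUG.1 (hcD (k + l)).1).trans ?_
      have hpt : rt q * eLpNorm (Q.block q (cf l W)) 2 volume ≠ ⊤ :=
        ENNReal.mul_ne_top (rt_ne_top q) (Q.memLp_block q (hcW l)).2.ne
      have hb : ∀ x, ‖conj (Q.block q (Q.block q (cf l W)) x)‖ₑ ≤
          rt q * eLpNorm (Q.block q (cf l W)) 2 volume := fun x => by
        have h := P.enorm_block_le_rt q (hG l) x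
        rw [eG l] at h
        have hn := nG l
        rw [eG l] at hn
        exact h.trans (mul_le_mul_right hn _)
      have h2 := eLpNorm_two_mul_le_of_bound (g := cf k U) hpt hb
      simp only [mul_comm (conj _)] at h2
      calc _ ≤ rt q * eLpNorm (Q.block q (cf l W)) 2 volume * eLpNorm (cf k U) 2 volume *
            eLpNorm (cf (k + l) D) 2 volume := by gcongr
        _ ≤ rt q * eLpNorm (cf l W) 2 volume * eLpNorm (cf k U) 2 volume *
            eLpNorm (cf (k + l) D) 2 volume := by gcongr; exact Q.eLpNorm_block_le q (hcW l)
        _ = _ := by ring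
  calc _ ≤ ∑' p : ℕ × ℕ, ‖alpha s p.1 p.2‖ₑ * (∑ r ∈ Finset.range R, ∑' j, paraWeight q r j *
      (eLpNorm (P.block j (cf p.1 U)) 2 volume * eLpNorm (Q.block q (cf p.2 W)) 2 volume *
        eLpNorm (Q.block r (cf (p.1 + p.2) W)) 2 volume) +
      rt q * (eLpNorm (cf p.1 U) 2 volume * eLpNorm (cf p.2 W) 2 volume *
        eLpNorm (cf (p.1 + p.2) D) 2 volume)) :=
        ENNReal.tsum_le_tsum fun p => mul_le_mul_right (hterm p.1 p.2) _
    _ = (∑ r ∈ Finset.range R, ∑' j, paraWeight q r j * ∑' p : ℕ × ℕ, ‖alpha s p.1 p.2‖ₑ *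
      (eLpNorm (P.block j (cf p.1 U)) 2 volume * eLpNorm (Q.block q (cf p.2 W)) 2 volume *
        eLpNorm (Q.block r (cf (p.1 + p.2) W)) 2 volume)) +
      rt q * ∑' p : ℕ × ℕ, ‖alpha s p.1 p.2‖ₑ * (eLpNorm (cf p.1 U) 2 volume *
        eLpNorm (cf p.2 W) 2 volume * eLpNorm (cf (p.1 + p.2) D) 2 volume) := by
        simp only [mul_add]
        rw [ENNReal.tsum_add]
        congr 1
        · simp only [Finset.mul_sum]
          rw [Summable.tsum_finsetSum fun _ _ => ENNReal.summable]
          refine Finset.sum_congr rfl fun r _ => ?_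
          simp only [← ENNReal.tsum_mul_left]
          rw [ENNReal.tsum_comm]
          exact tsum_congr fun j => tsum_congr fun p => by ring
        · rw [← ENNReal.tsum_mul_left]
          exact tsum_congr fun p => by ring
    _ ≤ (∑ r ∈ Finset.range R, ∑' j, paraWeight q r j * (C * eLpNorm (blkX P j U) 2 volume *
        wtNormSq s Q q W ^ (1 / 2 : ℝ) * wtNormSq s Q r W ^ (1 / 2 : ℝ))) +
      rt q * (C * eLpNorm U 2 volume * eLpNorm W 2 volume *
        (∑' n, wt (2 * s) n * eLpNorm (cf n D) 2 volume ^ 2) ^ (1 / 2 : ℝ)) := by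
        gcongr with r _ j
        -- Blocks use the balanced trilinear bound, which matches the coercivity of the energy.
        · refine (tsum_alpha_le_one hs0 hs1 (fun k => eLpNorm (P.block j (cf k U)) 2 volume)
            (fun l => eLpNorm (Q.block q (cf l W)) 2 volume)
            (fun n => eLpNorm (Q.block r (cf n W)) 2 volume)).trans (le_of_eq ?_)
          rw [tsum_eLpNorm_block_cf_sq P j hU, rpow_half_of_sq]; rfl
        -- The high-frequency remainder uses the bound of order 2s on the last argument; it will be
        -- small by smoothness, so the loss is irrelevant.
        · refine (tsum_alpha_le_two hs0 hs1 (fun k => eLpNorm (cf k U) 2 volume)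
            (fun l => eLpNorm (cf l W) 2 volume)
            (fun n => eLpNorm (cf n D) 2 volume)).trans (le_of_eq ?_)
          rw [tsum_eLpNorm_cf_sq hU, tsum_eLpNorm_cf_sq hW, rpow_half_of_sq, rpow_half_of_sq]
    _ = _ := by
        rw [mul_add, Finset.mul_sum]
        congr 1
        · refine Finset.sum_congr rfl fun r _ => ?_
          rw [← ENNReal.tsum_mul_left]
          exact tsum_congr fun j => by ring
        · ring

end Kac

namespace Kac

open ComplexConjugate

/-! ### The weighted norm on the slab -/

/-- The square of the norm `‖ℋ^{s/2} U‖` on the slab. -/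
noncomputable def wtNormT (s T : ℝ) (U : ℝ × ℝ × ℝ → ℂ) : ℝ≥0∞ :=
  ∑' n, wt s n * eLpNorm (cfT n U) 2 (timeX T) ^ 2

theorem aemeasurable_eLpNorm_timeX {T : ℝ} {F : ℝ × ℝ → ℂ} (hF : AEStronglyMeasurable F (timeX T)) :
    AEMeasurable (fun t => eLpNorm (fun x => F (t, x)) 2 volume ^ 2) (timeM T) := by
  simp only [eLpNorm_two_sq]
  exact (hF.enorm.pow_const 2).lintegral_prod_right'

theorem eLpNorm_timeX_sq {T : ℝ} {F : ℝ × ℝ → ℂ} (hF : AEStronglyMeasurable F (timeX T)) :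
    eLpNorm F 2 (timeX T) ^ 2 = ∫⁻ t, eLpNorm (fun x => F (t, x)) 2 volume ^ 2 ∂timeM T := by
  simp only [eLpNorm_two_sq]
  exact lintegral_sq_prod hF

theorem ae_cfT_blkT (Q : LPCouple) (q : ℕ) {T : ℝ} {U : ℝ × ℝ × ℝ → ℂ} (hU : MemLp U 2 (slab T)) :
    ∀ᵐ t ∂timeM T, ∀ n x, cfT n (blkT Q q U) (t, x) = Q.block q (cf n (sl U t)) x := by
  filter_upwards [ae_memLp_sl hU] with t ht n x
  rw [cfT_eq, sl_blkT, cf_blkX Q q n ht]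

theorem aemeasurable_eLpNorm_block_cf (Q : LPCouple) (q n : ℕ) {T : ℝ} {U : ℝ × ℝ × ℝ → ℂ}
    (hU : MemLp U 2 (slab T)) :
    AEMeasurable (fun t => eLpNorm (Q.block q (cf n (sl U t))) 2 volume ^ 2) (timeM T) := by
  refine (aemeasurable_eLpNorm_timeX (aestronglyMeasurable_cfT n
    (aestronglyMeasurable_blkT Q q hU.1))).congr ?_
  filter_upwards [ae_cfT_blkT Q q hU] with t ht
  rw [show (fun x => cfT n (blkT Q q U) (t, x)) = Q.block q (cf n (sl U t)) from funext (ht n)]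

theorem aemeasurable_wtNormSq (s : ℝ) (Q : LPCouple) (q : ℕ) {T : ℝ} {U : ℝ × ℝ × ℝ → ℂ}
    (hU : MemLp U 2 (slab T)) : AEMeasurable (fun t => wtNormSq s Q q (sl U t)) (timeM T) :=
  AEMeasurable.tsum fun n => (aemeasurable_eLpNorm_block_cf Q q n hU).const_mul _

theorem lintegral_wtNormSq (s : ℝ) (Q : LPCouple) (q : ℕ) {T : ℝ} {U : ℝ × ℝ × ℝ → ℂ}
    (hU : MemLp U 2 (slab T)) :
    ∫⁻ t, wtNormSq s Q q (sl U t) ∂timeM T = wtNormT s T (blkT Q q U) := by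
  unfold wtNormSq wtNormT
  rw [lintegral_tsum fun n => (aemeasurable_eLpNorm_block_cf Q q n hU).const_mul _]
  refine tsum_congr fun n => ?_
  rw [lintegral_const_mul'' _ (aemeasurable_eLpNorm_block_cf Q q n hU),
    eLpNorm_timeX_sq (aestronglyMeasurable_cfT n (aestronglyMeasurable_blkT Q q hU.1))]
  congr 1
  refine lintegral_congr_ae ?_
  filter_upwards [ae_cfT_blkT Q q hU] with t ht
  rw [show (fun x => cfT n (blkT Q q U) (t, x)) = Q.block q (cf n (sl U t)) from funext (ht n)]

theorem IsNice.wtNormSq_le {h : ℝ × ℝ × ℝ → ℂ} (hh : IsNice h) {s : ℝ} (hs0 : 0 ≤ s) (hs2 : s ≤ 2)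
    (Q : LPCouple) (q : ℕ) (t : ℝ) :
    wtNormSq s Q q (sl h t) ≤ 4 * eLpNorm (sl (Kac.osc h) t) 2 volume ^ 2 := by
  rw [← hh.tsum_wt_two_cf t, ← ENNReal.tsum_mul_left]
  refine ENNReal.tsum_le_tsum fun n => ?_
  rw [← mul_assoc]
  gcongr
  · exact wt_le_four_mul hs0 hs2 n
  · exact Q.eLpNorm_block_le q (memLp_cf n (hh.memLp_sl t))

theorem IsNice.wtNormT_le {h : ℝ × ℝ × ℝ → ℂ} (hh : IsNice h) {s : ℝ} (hs0 : 0 ≤ s) (hs2 : s ≤ 2)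
    (Q : LPCouple) (q : ℕ) (T : ℝ) :
    wtNormT s T (blkT Q q h) ≤ 4 * eLpNorm (Kac.osc h) 2 (slab T) ^ 2 := by
  rw [← lintegral_wtNormSq s Q q (hh.memLp_slab T), eLpNorm_slab_sq (hh.osc.memLp_slab T).1,
    ← lintegral_const_mul' _ _ (by norm_num)]
  exact lintegral_mono fun t => hh.wtNormSq_le hs0 hs2 Q q t

theorem wt_two_eq (n : ℕ) : wt 2 n = ‖((n : ℂ) + 1 / 2)‖ₑ ^ 2 := by
  have h : ((n : ℂ) + 1 / 2) = (((n : ℝ) + 1 / 2 : ℝ) : ℂ) := by push_cast; ring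
  rw [h, ← ofReal_norm, Complex.norm_real, Real.norm_of_nonneg (by positivity), wt,
    ← ENNReal.ofReal_pow (by positivity)]
  norm_cast

/-- High frequencies of a nice function are small, with two powers of the oscillator. -/
theorem IsNice.tsum_wt_cf_sub_lowPassX_le {h : ℝ × ℝ × ℝ → ℂ} (hh : IsNice h) {r : ℝ} (h0 : 0 ≤ r)
    (h2 : r ≤ 2) (Q : LPCouple) {R : ℕ} (hR : R ≠ 0) (t : ℝ) :
    ∑' n, wt r n * eLpNorm (cf n fun z => sl h t z - lowPassX Q R (sl h t) z) 2 volume ^ 2 ≤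
      4 * (ENNReal.ofReal (3 / 2 ^ R) * eLpNorm (sl (Kac.dx (Kac.osc h)) t) 2 volume) ^ 2 := by
  have hW := hh.memLp_sl t
  have hO := hh.osc.memLp_sl t
  have hD : MemLp (fun z => sl (Kac.osc h) t z - lowPassX Q R (sl (Kac.osc h) t) z) 2 volume :=
    hO.sub (memLp_lowPassX Q R hO)
  -- The oscillator acts in v and the cut-off in x, so they commute and the weight of order 2
  -- becomes an oscillator applied to h before the cut-off.
  have e : ∀ n, wt 2 n * eLpNorm (cf n fun z => sl h t z - lowPassX Q R (sl h t) z) 2 volume ^ 2 =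
      eLpNorm (cf n fun z => sl (Kac.osc h) t z - lowPassX Q R (sl (Kac.osc h) t) z) 2 volume ^ 2 :=
      fun n => by
    rw [wt_two_eq, ← mul_pow, ← eLpNorm_const_smul]
    congr 1
    refine eLpNorm_congr_ae ?_
    filter_upwards [ae_cf_eq_sum_add Q R n hW, ae_cf_eq_sum_add Q R n hO] with x h1 h3
    have e1 : cf n (sl (Kac.osc h) t) = fun x => ((n : ℂ) + 1 / 2) * cf n (sl h t) x :=
      funext fun x => hh.coef_osc n t x
    have e2 : ∀ r, Q.block r (cf n (sl (Kac.osc h) t)) x =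
        ((n : ℂ) + 1 / 2) * Q.block r (cf n (sl h t)) x := fun r => by
      rw [e1]; exact Q.block_const_mul r _ _ x
    rw [hh.coef_osc n t x, h1, Finset.sum_congr rfl fun r _ => e2 r, ← Finset.mul_sum, mul_add] at h3
    simpa using h3
  calc _ ≤ ∑' n, 4 * (wt 2 n *
        eLpNorm (cf n fun z => sl h t z - lowPassX Q R (sl h t) z) 2 volume ^ 2) :=
        ENNReal.tsum_le_tsum fun n => by
          rw [← mul_assoc]; gcongr; exact wt_le_four_mul h0 h2 n
    _ = 4 * eLpNorm (fun z => sl (Kac.osc h) t z - lowPassX Q R (sl (Kac.osc h) t) z) 2 volume ^ 2 := by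
        rw [ENNReal.tsum_mul_left, tsum_congr e, tsum_eLpNorm_cf_sq hD]
    _ ≤ _ := by gcongr; exact hh.osc.eLpNorm_sub_lowPassX_le Q hR t

/-! ### Coefficients of nice functions -/

theorem IsNice.exists_enorm_cfT_le {h : ℝ × ℝ × ℝ → ℂ} (hh : IsNice h) :
    ∃ C : ℝ≥0∞, C ≠ ⊤ ∧ ∀ n z, ‖cfT n h z‖ₑ ≤ C := by
  obtain ⟨C, hC, hb⟩ := hh.exists_lintegral_vel_le
  refine ⟨C ^ (1 / 2 : ℝ), by finiteness, fun n z => ?_⟩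
  have hm : MemLp (fun v => h (z.1, z.2, v)) 2 volume :=
    (hh.slice_vel z.1 z.2).1.continuous.memLp_of_hasCompactSupport (hh.slice_vel z.1 z.2).2
  rw [← sq_le_sq_iff_ennreal, rpow_half_sq]
  refine le_trans ?_ (hb z.1 z.2)
  rw [← tsum_enorm_coef_sq hm]
  exact ENNReal.le_tsum n

theorem integrable_mul_mul_of_enorm_le {α : Type*} [MeasurableSpace α] {ν : Measure α}
    {u g w : α → ℂ} (hu : MemLp u 2 ν) (hg : MemLp g 2 ν) (hw : AEStronglyMeasurable w ν)
    {C : ℝ≥0∞} (hC : C ≠ ⊤) (hb : ∀ x, ‖w x‖ₑ ≤ C) : Integrable (fun x => u x * g x * w x) ν := by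
  have h := integrable_mul_of_memLp hu hg
  refine h.mul_bdd (c := C.toReal) hw (Filter.Eventually.of_forall fun x => ?_)
  rw [← ENNReal.ofReal_le_ofReal_iff ENNReal.toReal_nonneg, ofReal_norm, ENNReal.ofReal_toReal hC]
  exact hb x

theorem IsNice.integrable_cfT_mul {h : ℝ × ℝ × ℝ → ℂ} (hh : IsNice h) {T : ℝ} (k l m : ℕ)
    {f g : ℝ × ℝ × ℝ → ℂ} (hf : MemLp f 2 (slab T)) (hg : MemLp g 2 (slab T)) :
    Integrable (fun z => cfT k f z * cfT l g z * cfT m h z) (timeX T) := by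
  obtain ⟨C, hC, hb⟩ := hh.exists_enorm_cfT_le
  exact integrable_mul_mul_of_enorm_le (memLp_cfT k hf) (memLp_cfT l hg)
    (memLp_cfT m (hh.memLp_slab T)).1 hC (hb m)

/-! ### The test function of the energy estimate -/

/-- The function `1_{t ≥ t₀} conj (Δ_q Δ_q h)`. -/
noncomputable def energyTest (Q : LPCouple) (q : ℕ) (t₀ : ℝ) (h : ℝ × ℝ × ℝ → ℂ)
    (z : ℝ × ℝ × ℝ) : ℂ :=
  (cut t₀ z.1 : ℂ) * conj (blkT Q q (blkT Q q h) z)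

theorem memLp_energyTest (Q : LPCouple) (q : ℕ) (t₀ : ℝ) {T : ℝ} {h : ℝ × ℝ × ℝ → ℂ}
    (hh : MemLp h 2 (slab T)) : MemLp (energyTest Q q t₀ h) 2 (slab T) :=
  memLp_cut_mul t₀ (memLp_conj (memLp_blkT Q q (memLp_blkT Q q hh)))

theorem coef_const_mul (n : ℕ) (c : ℂ) (u : ℝ → ℂ) : coef n (fun v => c * u v) = c * coef n u := by
  unfold coef
  rw [← integral_const_mul]
  congr 1; ext v; ring

theorem cfT_energyTest (Q : LPCouple) (q n : ℕ) (t₀ t x : ℝ) {h : ℝ × ℝ × ℝ → ℂ}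
    (hh : MemLp (sl h t) 2 volume) : cfT n (energyTest Q q t₀ h) (t, x) =
      (cut t₀ t : ℂ) * conj (Q.block q (Q.block q (cf n (sl h t))) x) := by
  have h1 : cf n (blkX Q q (sl h t)) = Q.block q (cf n (sl h t)) := funext (cf_blkX Q q n hh)
  rw [← h1, ← cf_blkX Q q n (memLp_blkX Q q hh), ← cf_conj]
  exact coef_const_mul n (cut t₀ t : ℂ) fun v => conj (blkX Q q (blkX Q q (sl h t)) (x, v))

/-! ### The trilinear estimate integrated in time -/

theorem lintegral_sqrt_mul_sqrt_le {α : Type*} [MeasurableSpace α] {ν : Measure α} {a b : α → ℝ≥0∞}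
    (ha : AEMeasurable a ν) (hb : AEMeasurable b ν) :
    ∫⁻ t, a t ^ (1 / 2 : ℝ) * b t ^ (1 / 2 : ℝ) ∂ν ≤
      (∫⁻ t, a t ∂ν) ^ (1 / 2 : ℝ) * (∫⁻ t, b t ∂ν) ^ (1 / 2 : ℝ) := by
  have h := ENNReal.lintegral_mul_le_Lp_mul_Lq ν (p := 2) (q := 2)
    (Real.holderConjugate_iff.2 ⟨by norm_num, by norm_num⟩) (ha.pow_const (1 / 2 : ℝ))
    (hb.pow_const (1 / 2 : ℝ))
  have e : ∀ x : ℝ≥0∞, (x ^ (1 / 2 : ℝ)) ^ (2 : ℝ) = x := fun x => by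
    rw [← ENNReal.rpow_mul]; norm_num
  simpa only [Pi.mul_apply, e] using h

/-- The fixed-time estimate integrated in t: f is taken in L^∞_T, the two copies of h in L²_T by
Cauchy-Schwarz, and the remainder beyond R blocks keeps its factor 2^{-R}. -/
theorem IsNice.tsum_alpha_energyTest_le {s : ℝ} (hs0 : 0 < s) (hs1 : s < 1) (P : LPCouple) (q : ℕ)
    {T : ℝ} (t₀ : ℝ) {f h : ℝ × ℝ × ℝ → ℂ} (hf : MemLp f 2 (slab T)) (hh : IsNice h) {R : ℕ}
    (hR : R ≠ 0) :
    ∑' p : ℕ × ℕ, ‖alpha s p.1 p.2‖ₑ * ‖∫ z, cfT p.1 f z *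
        cfT p.2 (energyTest P.reflect q t₀ h) z * cfT (p.1 + p.2) h z ∂timeX T‖ₑ ≤
      ENNReal.ofReal (6 * momentConst s) *
      (∑ r ∈ Finset.range R, (∑' p, paraWeight q r p * normT T ⊤ (blkT P p f)) *
        (wtNormT s T (blkT P.reflect q h) ^ (1 / 2 : ℝ) *
          wtNormT s T (blkT P.reflect r h) ^ (1 / 2 : ℝ)) +
      ENNReal.ofReal (3 / 2 ^ R) * (2 * rt q * ∫⁻ t, eLpNorm (sl f t) 2 volume *
        eLpNorm (sl h t) 2 volume * eLpNorm (sl (Kac.dx (Kac.osc h)) t) 2 volume ∂timeM T)) := by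
  set Q := P.reflect with hQ
  have hG := memLp_energyTest Q q t₀ (hh.memLp_slab T)
  have hint := fun k l => hh.integrable_cfT_mul k l (k + l) hf hG
  have hmeas : ∀ p : ℕ × ℕ, AEMeasurable (fun t => ‖alpha s p.1 p.2‖ₑ * ‖∫ x, cfT p.1 f (t, x) *
      cfT p.2 (energyTest Q q t₀ h) (t, x) * cfT (p.1 + p.2) h (t, x)‖ₑ) (timeM T) := fun p =>
    ((hint p.1 p.2).1.integral_prod_right'.enorm).const_mul _
  have hN := fun r => aemeasurable_wtNormSq s Q r (hh.memLp_slab T)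
  calc _ ≤ ∑' p : ℕ × ℕ, ∫⁻ t, ‖alpha s p.1 p.2‖ₑ * ‖∫ x, cfT p.1 f (t, x) *
        cfT p.2 (energyTest Q q t₀ h) (t, x) * cfT (p.1 + p.2) h (t, x)‖ₑ ∂timeM T := by
        refine ENNReal.tsum_le_tsum fun p => ?_
        rw [lintegral_const_mul' _ _ enorm_ne_top, timeX, integral_prod _ (hint p.1 p.2)]
        gcongr
        exact enorm_integral_le_lintegral_enorm _
    _ = ∫⁻ t, ∑' p : ℕ × ℕ, ‖alpha s p.1 p.2‖ₑ * ‖∫ x, cfT p.1 f (t, x) *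
        cfT p.2 (energyTest Q q t₀ h) (t, x) * cfT (p.1 + p.2) h (t, x)‖ₑ ∂timeM T :=
        (lintegral_tsum hmeas).symm
    _ ≤ ∫⁻ t, ENNReal.ofReal (6 * momentConst s) *
        (∑ r ∈ Finset.range R, (∑' p, paraWeight q r p * normT T ⊤ (blkT P p f)) *
          (wtNormSq s Q q (sl h t) ^ (1 / 2 : ℝ) * wtNormSq s Q r (sl h t) ^ (1 / 2 : ℝ)) +
        ENNReal.ofReal (3 / 2 ^ R) * (2 * rt q * (eLpNorm (sl f t) 2 volume *
          eLpNorm (sl h t) 2 volume * eLpNorm (sl (Kac.dx (Kac.osc h)) t) 2 volume))) ∂timeM T := by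
        refine lintegral_mono_ae ?_
        have hF : ∀ᵐ t ∂timeM T, ∀ p, eLpNorm (sl (blkT P p f) t) 2 volume ≤
            normT T ⊤ (blkT P p f) := ae_all_iff.2 fun p => by
          have := enorm_ae_le_eLpNormEssSup (fun t => eLpNorm (sl (blkT P p f) t) 2 volume) (timeM T)
          simpa [normT, eLpNorm_exponent_top] using this
        filter_upwards [ae_memLp_sl hf, hF] with t ht hFt
        have hW := hh.memLp_sl t
        refine le_trans (ENNReal.tsum_le_tsum fun p => ?_)
          ((tsum_alpha_integral_le hs0 hs1 P q R ht hW).trans ?_)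
        · gcongr
          have e : (fun x => cfT p.1 f (t, x) * cfT p.2 (energyTest Q q t₀ h) (t, x) *
              cfT (p.1 + p.2) h (t, x)) = fun x => (cut t₀ t : ℂ) * (cf p.1 (sl f t) x *
              conj (Q.block q (Q.block q (cf p.2 (sl h t))) x) * cf (p.1 + p.2) (sl h t) x) := by
            ext x
            rw [cfT_energyTest Q q p.2 t₀ t x hW, cfT_eq, cfT_eq]; ring
          rw [e, integral_const_mul, enorm_mul]
          refine (mul_le_mul_left ?_ _).trans (one_mul _).le
          rw [← ofReal_norm, ← ENNReal.ofReal_one]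
          exact ENNReal.ofReal_le_ofReal (norm_cut_le t₀ t)
        · refine mul_le_mul_right (add_le_add (Finset.sum_le_sum fun r _ => ?_) ?_) _
          · rw [← ENNReal.tsum_mul_right]
            refine ENNReal.tsum_le_tsum fun p => ?_
            calc _ = paraWeight q r p * eLpNorm (sl (blkT P p f) t) 2 volume *
                  (wtNormSq s Q q (sl h t) ^ (1 / 2 : ℝ) *
                    wtNormSq s Q r (sl h t) ^ (1 / 2 : ℝ)) := by rw [sl_blkT, ← hQ]; ring
              _ ≤ _ := by gcongr; exact hFt p
          · have h1 := hh.tsum_wt_cf_sub_lowPassX_le (r := 2 * s) (by linarith) (by linarith) Q hR t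
            have h2 := ENNReal.rpow_le_rpow h1 (show (0 : ℝ) ≤ 1 / 2 by norm_num)
            rw [show (4 : ℝ≥0∞) = 2 ^ 2 by norm_num, ← mul_pow, rpow_half_of_sq] at h2
            calc _ ≤ rt q * eLpNorm (sl f t) 2 volume * eLpNorm (sl h t) 2 volume *
                  (2 * (ENNReal.ofReal (3 / 2 ^ R) *
                    eLpNorm (sl (Kac.dx (Kac.osc h)) t) 2 volume)) := mul_le_mul_right h2 _
              _ = _ := by ring
    _ ≤ _ := by
        rw [lintegral_const_mul' _ _ ENNReal.ofReal_ne_top]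
        gcongr
        have hm : ∀ r, AEMeasurable (fun t => wtNormSq s Q q (sl h t) ^ (1 / 2 : ℝ) *
            wtNormSq s Q r (sl h t) ^ (1 / 2 : ℝ)) (timeM T) := fun r =>
          ((hN q).pow_const _).mul ((hN r).pow_const _)
        rw [lintegral_add_left' (Finset.aemeasurable_fun_sum _ fun r _ => (hm r).const_mul _),
          lintegral_const_mul' _ _ ENNReal.ofReal_ne_top, lintegral_const_mul' _ _
          (ENNReal.mul_ne_top (by norm_num) (rt_ne_top q)),
          lintegral_finsetSum' _ fun r _ => (hm r).const_mul _]
        gcongr with r _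
        rw [lintegral_const_mul'' _ (hm r)]
        gcongr
        refine (lintegral_sqrt_mul_sqrt_le (hN q) (hN r)).trans ?_
        rw [lintegral_wtNormSq s Q q (hh.memLp_slab T), lintegral_wtNormSq s Q r (hh.memLp_slab T)]

/-- The trilinear term of the energy estimate. -/
theorem IsNice.tsum_alpha_energyTest_le_mul {s : ℝ} (hs0 : 0 < s) (hs1 : s < 1) (P : LPCouple)
    (q : ℕ) {T : ℝ} (t₀ : ℝ) {f h : ℝ × ℝ × ℝ → ℂ} (hf : MemLp f 2 (slab T)) (hh : IsNice h)
    {S : ℝ≥0∞} (hS : ∀ r, wtNormT s T (blkT P.reflect r h) ^ (1 / 2 : ℝ) ≤ S * rt r) :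
    ∑' p : ℕ × ℕ, ‖alpha s p.1 p.2‖ₑ * ‖∫ z, cfT p.1 f z *
        cfT p.2 (energyTest P.reflect q t₀ h) z * cfT (p.1 + p.2) h z ∂timeX T‖ₑ ≤
      ENNReal.ofReal (6 * momentConst s) * (19 * (∑' p, rt p * normT T ⊤ (blkT P p f)) *
        rt q * wtNormT s T (blkT P.reflect q h) ^ (1 / 2 : ℝ) * S) := by
  set Q := P.reflect with hQ
  set Z := wtNormT s T (blkT Q q h) ^ (1 / 2 : ℝ) with hZ
  -- Finiteness, not size, is all that matters here: the quantity will be multiplied by 2^{-R}.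
  have hfin : ∫⁻ t, eLpNorm (sl f t) 2 volume * eLpNorm (sl h t) 2 volume *
      eLpNorm (sl (Kac.dx (Kac.osc h)) t) 2 volume ∂timeM T ≠ ⊤ := by
    obtain ⟨C1, hC1, hb1⟩ := hh.exists_eLpNorm_sl_le
    obtain ⟨C2, hC2, hb2⟩ := hh.osc.dx.exists_eLpNorm_sl_le
    have h1 : ∫⁻ t, eLpNorm (sl f t) 2 volume ∂timeM T ≠ ⊤ := by
      have h := lintegral_sqrt_mul_sqrt_le (ν := timeM T)
        ((aemeasurable_eLpNorm_sl hf.1).pow_const 2) (aemeasurable_const (b := (1 : ℝ≥0∞)))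
      simp only [rpow_half_of_sq, ENNReal.one_rpow, mul_one] at h
      rw [← eLpNorm_slab_sq hf.1, rpow_half_of_sq] at h
      refine ne_top_of_le_ne_top (ENNReal.mul_ne_top hf.2.ne ?_) h
      refine ENNReal.rpow_ne_top_of_nonneg (by norm_num) ?_
      simp
    refine ne_top_of_le_ne_top (ENNReal.mul_ne_top h1 (ENNReal.mul_ne_top hC1 hC2)) ?_
    rw [← lintegral_mul_const' _ _ (ENNReal.mul_ne_top hC1 hC2)]
    refine lintegral_mono fun t => ?_
    rw [mul_assoc]
    gcongr
    exacts [hb1 t, hb2 t]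
  set I := ∫⁻ t, eLpNorm (sl f t) 2 volume * eLpNorm (sl h t) 2 volume *
      eLpNorm (sl (Kac.dx (Kac.osc h)) t) 2 volume ∂timeM T with hI
  have hsum : ∀ R, ∑ r ∈ Finset.range R, (∑' p, paraWeight q r p * normT T ⊤ (blkT P p f)) *
      (Z * wtNormT s T (blkT Q r h) ^ (1 / 2 : ℝ)) ≤
      19 * (∑' p, rt p * normT T ⊤ (blkT P p f)) * rt q * Z * S := fun R => by
    calc _ ≤ ∑ r ∈ Finset.range R, (∑' p, paraWeight q r p * normT T ⊤ (blkT P p f)) *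
          (Z * (S * rt r)) := by gcongr with r _; exact hS r
      _ = ∑' p, (∑ r ∈ Finset.range R, paraWeight q r p * rt r) *
          (normT T ⊤ (blkT P p f) * (Z * S)) := by
          simp only [Finset.sum_mul]
          rw [Summable.tsum_finsetSum fun _ _ => ENNReal.summable]
          refine Finset.sum_congr rfl fun r _ => ?_
          rw [← ENNReal.tsum_mul_right]
          exact tsum_congr fun p => by ring
      _ ≤ ∑' p, 19 * rt q * rt p * (normT T ⊤ (blkT P p f) * (Z * S)) :=
          ENNReal.tsum_le_tsum fun p => mul_le_mul_left (sum_paraWeight_le q p R) _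
      _ = _ := by
          rw [← ENNReal.tsum_mul_left, ← ENNReal.tsum_mul_right, ← ENNReal.tsum_mul_right,
            ← ENNReal.tsum_mul_right]
          exact tsum_congr fun p => by ring
  -- The number R of blocks is free and the left side does not depend on it, so the remainder
  -- disappears in the limit.
  have hlim : Filter.Tendsto (fun R : ℕ => ENNReal.ofReal (6 * momentConst s) *
      (19 * (∑' p, rt p * normT T ⊤ (blkT P p f)) * rt q * Z * S +
        ENNReal.ofReal (3 / 2 ^ R) * (2 * rt q * I))) Filter.atTop
      (nhds (ENNReal.ofReal (6 * momentConst s) *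
      (19 * (∑' p, rt p * normT T ⊤ (blkT P p f)) * rt q * Z * S + 0))) := by
    refine ENNReal.Tendsto.const_mul (Filter.Tendsto.const_add _ ?_) (Or.inr ENNReal.ofReal_ne_top)
    have h0 : Filter.Tendsto (fun R : ℕ => ENNReal.ofReal (3 / 2 ^ R)) Filter.atTop (nhds 0) := by
      rw [← ENNReal.ofReal_zero]
      refine ENNReal.tendsto_ofReal ?_
      have := (tendsto_pow_atTop_nhds_zero_of_lt_one (show (0 : ℝ) ≤ 1 / 2 by norm_num)
        (by norm_num)).const_mul 3
      simpa [div_eq_mul_inv] using this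
    have h1 := ENNReal.Tendsto.mul_const (b := 2 * rt q * I) h0
      (Or.inr (ENNReal.mul_ne_top (ENNReal.mul_ne_top (by norm_num) (rt_ne_top q)) hfin))
    rwa [zero_mul] at h1
  rw [add_zero] at hlim
  refine ge_of_tendsto hlim ?_
  filter_upwards [Filter.eventually_ne_atTop 0] with R hR
  refine (hh.tsum_alpha_energyTest_le hs0 hs1 P q t₀ hf hR).trans ?_
  gcongr
  exact hsum R

end Kac

namespace Kac

open ComplexConjugate

/-! ### The adjoint form -/

/-- The linearized operator, tested against `h`. -/
noncomputable def lamForm (s T : ℝ) (g h : ℝ × ℝ × ℝ → ℂ) : ℂ :=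
  ∑' n : ℕ, (lam s n : ℂ) * ∫ z, cfT n g z * cfT n h z ∂timeX T

/-- The nonlinear operator, tested against `h`. -/
noncomputable def alphaForm (s T : ℝ) (f g h : ℝ × ℝ × ℝ → ℂ) : ℂ :=
  ∑' p : ℕ × ℕ, (alpha s p.1 p.2 : ℂ) *
    ∫ z, cfT p.1 f z * cfT p.2 g z * cfT (p.1 + p.2) h z ∂timeX T

/-- The weak form of the operator `1 + ∂_t + v ∂_x + 𝒦 - Γ(f, ·)`. -/
noncomputable def adjForm (s T : ℝ) (f g h : ℝ × ℝ × ℝ → ℂ) : ℂ :=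
  ∫ z, g z * (h z - dt h z - (z.2.2 : ℂ) * dx h z) ∂slab T + lamForm s T g h - alphaForm s T f g h

theorem enorm_ofReal (x : ℝ) : ‖(x : ℂ)‖ₑ = ‖x‖ₑ := by
  rw [← ofReal_norm, Complex.norm_real, ofReal_norm]

theorem enorm_integral_cfT_mul_le (n : ℕ) {T : ℝ} {g h : ℝ × ℝ × ℝ → ℂ} (hg : MemLp g 2 (slab T))
    (hh : MemLp h 2 (slab T)) : ‖∫ z, cfT n g z * cfT n h z ∂timeX T‖ₑ ≤
      eLpNorm (cfT n g) 2 (timeX T) * eLpNorm (cfT n h) 2 (timeX T) :=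
  enorm_integral_mul_le (memLp_cfT n hg).1 (memLp_cfT n hh).1

theorem tsum_mul_eLpNorm_cfT_le {r T : ℝ} {g h : ℝ × ℝ × ℝ → ℂ} (hg : MemLp g 2 (slab T)) :
    ∑' n, wt r n * (eLpNorm (cfT n g) 2 (timeX T) * eLpNorm (cfT n h) 2 (timeX T)) ≤
      eLpNorm g 2 (slab T) * wtNormT (2 * r) T h ^ (1 / 2 : ℝ) := by
  have h1 := tsum_mul_le_sqrt (fun n => eLpNorm (cfT n g) 2 (timeX T))
    (fun n => wt r n * eLpNorm (cfT n h) 2 (timeX T))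
  rw [tsum_eLpNorm_cfT_sq hg, rpow_half_of_sq] at h1
  refine (le_of_eq (tsum_congr fun n => by ring)).trans (h1.trans (le_of_eq ?_))
  congr 2
  refine tsum_congr fun n => ?_
  rw [mul_pow, pow_two (wt r n), wt_mul, two_mul]

theorem IsNice.wtNormT_self_le {h : ℝ × ℝ × ℝ → ℂ} (hh : IsNice h) {s : ℝ} (hs0 : 0 ≤ s)
    (hs2 : s ≤ 2) (T : ℝ) : wtNormT s T h ≤ 4 * eLpNorm (Kac.osc h) 2 (slab T) ^ 2 := by
  unfold wtNormT
  rw [eLpNorm_slab_sq (hh.osc.memLp_slab T).1]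
  have e : ∀ n, eLpNorm (cfT n h) 2 (timeX T) ^ 2 =
      ∫⁻ t, eLpNorm (cf n (sl h t)) 2 volume ^ 2 ∂timeM T := fun n =>
    eLpNorm_timeX_sq (F := cfT n h) (memLp_cfT n (hh.memLp_slab T)).1
  have hm : ∀ n, AEMeasurable (fun t => eLpNorm (cf n (sl h t)) 2 volume ^ 2) (timeM T) := fun n =>
    aemeasurable_eLpNorm_timeX (F := cfT n h) (memLp_cfT n (hh.memLp_slab T)).1
  calc _ = ∫⁻ t, ∑' n, wt s n * eLpNorm (cf n (sl h t)) 2 volume ^ 2 ∂timeM T := by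
        rw [lintegral_tsum fun n => (hm n).const_mul _]
        refine tsum_congr fun n => ?_
        rw [e, lintegral_const_mul'' _ (hm n)]
    _ ≤ ∫⁻ t, 4 * eLpNorm (sl (Kac.osc h) t) 2 volume ^ 2 ∂timeM T := by
        refine lintegral_mono fun t => ?_
        have h1 := hh.tsum_wt_two_cf t
        calc _ ≤ ∑' n, 4 * (wt 2 n * eLpNorm (cf n (sl h t)) 2 volume ^ 2) :=
              ENNReal.tsum_le_tsum fun n => by
                rw [← mul_assoc]; gcongr; exact wt_le_four_mul hs0 hs2 n
          _ = _ := by rw [ENNReal.tsum_mul_left, h1]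
    _ = _ := lintegral_const_mul' _ _ (by norm_num)

theorem IsNice.tsum_lam_le {s : ℝ} (hs0 : 0 < s) (hs1 : s < 1) {T : ℝ} {g h : ℝ × ℝ × ℝ → ℂ}
    (hg : MemLp g 2 (slab T)) (hh : IsNice h) :
    ∑' n : ℕ, ‖(lam s n : ℂ) * ∫ z, cfT n g z * cfT n h z ∂timeX T‖ₑ ≤
      ENNReal.ofReal (2 * momentConst s) * (2 * eLpNorm (Kac.osc h) 2 (slab T)) *
        eLpNorm g 2 (slab T) := by
  have h1 := ENNReal.rpow_le_rpow (hh.wtNormT_self_le (s := 2 * s) (by linarith) (by linarith) T)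
    (show (0 : ℝ) ≤ 1 / 2 by norm_num)
  rw [show (4 : ℝ≥0∞) = 2 ^ 2 by norm_num, ← mul_pow, rpow_half_of_sq] at h1
  calc _ ≤ ∑' n : ℕ, ENNReal.ofReal (2 * momentConst s) * (wt s n *
        (eLpNorm (cfT n g) 2 (timeX T) * eLpNorm (cfT n h) 2 (timeX T))) := by
        refine ENNReal.tsum_le_tsum fun n => ?_
        rw [enorm_mul, enorm_ofReal, ← mul_assoc]
        gcongr
        · exact enorm_lam_le hs0 hs1 n
        · exact enorm_integral_cfT_mul_le n hg (hh.memLp_slab T)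
    _ ≤ ENNReal.ofReal (2 * momentConst s) * (eLpNorm g 2 (slab T) *
        (2 * eLpNorm (Kac.osc h) 2 (slab T))) := by
        rw [ENNReal.tsum_mul_left]
        gcongr
        exact (tsum_mul_eLpNorm_cfT_le hg).trans (mul_le_mul_right h1 _)
    _ = _ := by ring

/-! ### The energy identity -/

theorem conj_blkT (P : LPCouple) (n : ℕ) (U : ℝ × ℝ × ℝ → ℂ) (z : ℝ × ℝ × ℝ) :
    conj (blkT P n U z) = blkT P.reflect n (fun z => conj (U z)) z :=
  P.conj_block n _ _

theorem cut_mul_self (t₀ t : ℝ) : cut t₀ t * cut t₀ t = cut t₀ t := by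
  unfold cut indicator
  split_ifs <;> simp

theorem blkT_cut_mul (P : LPCouple) (n : ℕ) (t₀ : ℝ) (U : ℝ × ℝ × ℝ → ℂ) (z : ℝ × ℝ × ℝ) :
    blkT P n (fun z => (cut t₀ z.1 : ℂ) * U z) z = (cut t₀ z.1 : ℂ) * blkT P n U z :=
  P.block_const_mul n (cut t₀ z.1 : ℂ) (fun y => U (z.1, y, z.2.2)) z.2.1

theorem energyTest_eq (P : LPCouple) (q : ℕ) (t₀ : ℝ) (h : ℝ × ℝ × ℝ → ℂ) :
    energyTest P.reflect q t₀ h =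
      blkT P q (fun z => (cut t₀ z.1 : ℂ) * conj (blkT P.reflect q h z)) := by
  ext z
  rw [blkT_cut_mul, energyTest, conj_blkT, LPCouple.reflect_reflect]

theorem integral_energyTest_mul (P : LPCouple) (q : ℕ) (t₀ : ℝ) {T : ℝ} {h a : ℝ × ℝ × ℝ → ℂ}
    (hh : MemLp h 2 (slab T)) (ha : MemLp a 2 (slab T)) :
    ∫ z, energyTest P.reflect q t₀ h z * a z ∂slab T =
      ∫ z, ((cut t₀ z.1 : ℂ) * conj (blkT P.reflect q h z)) * blkT P.reflect q a z ∂slab T := by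
  rw [energyTest_eq, integral_blkT_mul P q (memLp_cut_mul t₀ (memLp_conj (memLp_blkT _ q hh))) ha]

theorem enorm_cut_mul_le (t₀ t : ℝ) (c : ℂ) : ‖(cut t₀ t : ℂ) * c‖ₑ ≤ ‖c‖ₑ := by
  rw [enorm_mul]
  refine (mul_le_mul_left ?_ _).trans (one_mul _).le
  rw [← ofReal_norm, ← ENNReal.ofReal_one]
  exact ENNReal.ofReal_le_ofReal (norm_cut_le t₀ t)

theorem normT_one (T : ℝ) (U : ℝ × ℝ × ℝ → ℂ) :
    normT T 1 U = ∫⁻ t, eLpNorm (sl U t) 2 volume ∂timeM T := by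
  rw [normT, eLpNorm_one_eq_lintegral_enorm]
  simp

/-- Pairing of L^∞_T with L¹_T; it handles the part a of the adjoint datum, and its dual will be the
L^∞_T bound on the solution. -/
theorem enorm_integral_energyTest_mul_le (P : LPCouple) (q : ℕ) (t₀ : ℝ) {T : ℝ}
    {h a : ℝ × ℝ × ℝ → ℂ} (hh : MemLp h 2 (slab T)) (ha : MemLp a 2 (slab T)) {X : ℝ≥0∞}
    (hX : ∀ t ∈ Icc 0 T, eLpNorm (blkX P.reflect q (sl h t)) 2 volume ≤ X) :
    ‖∫ z, energyTest P.reflect q t₀ h z * a z ∂slab T‖ₑ ≤ X * normT T 1 (blkT P.reflect q a) := by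
  set Q := P.reflect
  have hV := memLp_cut_mul t₀ (memLp_conj (memLp_blkT Q q hh))
  have hA := memLp_blkT Q q ha
  rw [integral_energyTest_mul P q t₀ hh ha, integral_slab (integrable_mul_of_memLp hV hA), normT_one,
    ← lintegral_const_mul'' _ (aemeasurable_eLpNorm_sl hA.1)]
  refine (enorm_integral_le_lintegral_enorm _).trans (lintegral_mono_ae ?_)
  have hmem : ∀ᵐ t ∂timeM T, t ∈ Icc 0 T := ae_restrict_mem measurableSet_Icc
  filter_upwards [hmem, ae_aestronglyMeasurable_sl hV.1, ae_aestronglyMeasurable_sl hA.1]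
    with t ht h1 h2
  refine (enorm_integral_mul_le h1 h2).trans ?_
  gcongr
  refine le_trans (eLpNorm_mono_enorm fun z => ?_) (hX t ht)
  refine (enorm_cut_mul_le _ _ _).trans (le_of_eq ?_)
  rw [← ofReal_norm, RCLike.norm_conj, ofReal_norm]; rfl

theorem IsOscillatorPower.ae_cfT_blkT {T r : ℝ} {c d : ℝ × ℝ × ℝ → ℂ}
    (hcd : IsOscillatorPower T r c d) (hc : MemLp c 2 (slab T)) (hd : MemLp d 2 (slab T))
    (Q : LPCouple) (q n : ℕ) : cfT n (blkT Q q d) =ᵐ[timeX T]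
      fun z => ((((n : ℝ) + 1 / 2) ^ r : ℝ) : ℂ) * cfT n (blkT Q q c) z := by
  have h1 : ∀ᵐ z ∂timeX T, cfT n d z = ((((n : ℝ) + 1 / 2) ^ r : ℝ) : ℂ) * cfT n c z := by
    rw [timeX_eq]
    filter_upwards [hcd] with z hz
    exact hz n
  have h2 : ∀ᵐ t ∂timeM T, ∀ x, cfT n (blkT Q q d) (t, x) =
      ((((n : ℝ) + 1 / 2) ^ r : ℝ) : ℂ) * cfT n (blkT Q q c) (t, x) := by
    filter_upwards [Measure.ae_ae_of_ae_prod h1, Kac.ae_cfT_blkT Q q hc, Kac.ae_cfT_blkT Q q hd]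
      with t h1 h3 h4 x
    rw [h3, h4, ← Q.block_const_mul]
    exact congrFun (Q.block_congr q h1) x
  have h3 : ∀ᵐ z ∂timeX T, ∀ x, cfT n (blkT Q q d) (z.1, x) =
      ((((n : ℝ) + 1 / 2) ^ r : ℝ) : ℂ) * cfT n (blkT Q q c) (z.1, x) :=
    Measure.quasiMeasurePreserving_fst.ae h2
  filter_upwards [h3] with z hz
  exact hz z.2

theorem cfT_cut_conj (n : ℕ) (t₀ : ℝ) (U : ℝ × ℝ × ℝ → ℂ) (z : ℝ × ℝ) :
    cfT n (fun z => (cut t₀ z.1 : ℂ) * conj (U z)) z = (cut t₀ z.1 : ℂ) * conj (cfT n U z) := by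
  rw [cfT, cfT, conj_coef]
  exact coef_const_mul n (cut t₀ z.1 : ℂ) fun v => conj (U (z.1, z.2, v))

theorem enorm_conj (c : ℂ) : ‖conj c‖ₑ = ‖c‖ₑ := by
  rw [← ofReal_norm, RCLike.norm_conj, ofReal_norm]

theorem enorm_rpow_half (s : ℝ) (n : ℕ) :
    ‖((((n : ℝ) + 1 / 2) ^ s : ℝ) : ℂ)‖ₑ = wt s n := by
  rw [enorm_ofReal, Real.enorm_eq_ofReal (by positivity)]; rfl

/-- In Hermite coefficients d = ℋ^{s/2}c, and the factor (n + 1/2)^{s/2} is transferred from d to h,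
where the energy controls it in L²_T. -/
theorem enorm_integral_energyTest_osc_le (P : LPCouple) (q : ℕ) (t₀ : ℝ) {s T : ℝ}
    {h c d : ℝ × ℝ × ℝ → ℂ} (hh : MemLp h 2 (slab T)) (hc : MemLp c 2 (slab T))
    (hd : MemLp d 2 (slab T)) (hcd : IsOscillatorPower T (s / 2) c d) :
    ‖∫ z, energyTest P.reflect q t₀ h z * d z ∂slab T‖ₑ ≤
      wtNormT s T (blkT P.reflect q h) ^ (1 / 2 : ℝ) * normT T 2 (blkT P.reflect q c) := by
  set Q := P.reflect
  have hH := memLp_blkT Q q hh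
  have hV := memLp_cut_mul t₀ (memLp_conj hH)
  have hC := memLp_blkT Q q hc
  have hD := memLp_blkT Q q hd
  have hcut : ∀ n, eLpNorm (cfT n fun z => (cut t₀ z.1 : ℂ) * conj (blkT Q q h z)) 2 (timeX T) ≤
      eLpNorm (cfT n (blkT Q q h)) 2 (timeX T) := fun n => eLpNorm_mono_enorm fun z => by
    rw [cfT_cut_conj]
    exact (enorm_cut_mul_le _ _ _).trans (enorm_conj _).le
  have heq : ∀ n, eLpNorm (cfT n (blkT Q q d)) 2 (timeX T) =
      wt (s / 2) n * eLpNorm (cfT n (blkT Q q c)) 2 (timeX T) := fun n => by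
    rw [eLpNorm_congr_ae (hcd.ae_cfT_blkT hc hd Q q n), ← enorm_rpow_half, ← eLpNorm_const_smul]
    rfl
  rw [integral_energyTest_mul P q t₀ hh hd, ← (hasSum_integral_cfT_mul hV hD).tsum_eq]
  refine enorm_tsum_le_tsum_enorm.trans ?_
  calc _ ≤ ∑' n, wt (s / 2) n * (eLpNorm (cfT n (blkT Q q c)) 2 (timeX T) *
        eLpNorm (cfT n (blkT Q q h)) 2 (timeX T)) := by
        refine ENNReal.tsum_le_tsum fun n => (enorm_integral_cfT_mul_le n hV hD).trans ?_
        rw [heq]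
        calc _ ≤ eLpNorm (cfT n (blkT Q q h)) 2 (timeX T) *
              (wt (s / 2) n * eLpNorm (cfT n (blkT Q q c)) 2 (timeX T)) := by gcongr; exact hcut n
          _ = _ := by ring
    _ ≤ _ := by
        refine (tsum_mul_eLpNorm_cfT_le hC).trans (le_of_eq ?_)
        rw [normT_two hC.1, mul_comm, mul_div_cancel₀ _ two_ne_zero]

/-- The coefficients of the energy test function. -/
theorem IsNice.re_integral_cfT_energyTest {h : ℝ × ℝ × ℝ → ℂ} (hh : IsNice h) (P : LPCouple)
    (q n : ℕ) (t₀ T : ℝ) :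
    (∫ z, cfT n (energyTest P.reflect q t₀ h) z * cfT n h z ∂timeX T).re =
      (eLpNorm (fun z => (cut t₀ z.1 : ℂ) * cfT n (blkT P.reflect q h) z) 2 (timeX T)).toReal ^ 2 := by
  set Q := P.reflect
  have hH := hh.memLp_slab T
  have hK : MemLp (fun z => (cut t₀ z.1 : ℂ) * cfT n (blkT Q q h) z) 2 (timeX T) := by
    have h1 := memLp_conj (memLp_cfT n (memLp_cut_mul t₀ (memLp_conj (memLp_blkT Q q hH))))
    refine (memLp_congr_ae (Filter.Eventually.of_forall fun z => ?_)).1 h1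
    rw [cfT_cut_conj, map_mul, Complex.conj_conj, Complex.conj_ofReal]
  rw [toReal_eLpNorm_sq hK]
  congr 1
  rw [timeX, integral_prod _ (integrable_mul_of_memLp (memLp_cfT n (memLp_energyTest Q q t₀ hH))
    (memLp_cfT n hH)), integral_prod _ (integrable_mul_of_memLp (memLp_conj hK) hK)]
  congr 1; ext t
  have hW := hh.memLp_sl t
  have hu := memLp_cf n hW
  have e1 : ∀ x, cfT n (energyTest Q q t₀ h) (t, x) * cfT n h (t, x) =
      (cut t₀ t : ℂ) * (conj (Q.block q (Q.block q (cf n (sl h t))) x) * cf n (sl h t) x) := fun x => by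
    rw [cfT_energyTest Q q n t₀ t x hW, cfT_eq]; ring
  have e2 : ∀ x, conj ((cut t₀ t : ℂ) * cfT n (blkT Q q h) (t, x)) *
      ((cut t₀ t : ℂ) * cfT n (blkT Q q h) (t, x)) =
      (cut t₀ t : ℂ) * (conj (Q.block q (cf n (sl h t)) x) * Q.block q (cf n (sl h t)) x) := fun x => by
    rw [cfT_eq, sl_blkT, cf_blkX Q q n hW, map_mul, Complex.conj_ofReal]
    nth_rewrite 3 [← cut_mul_self]
    push_cast; ring
  simp only [e1, e2]
  rw [integral_const_mul, integral_const_mul, Q.integral_conj_block_mul q (Q.memLp_block q hu) hu]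

/-- The positive part of the energy identity. -/
theorem IsNice.hasSum_energy {s : ℝ} (hs0 : 0 < s) (hs1 : s < 1) {h : ℝ × ℝ × ℝ → ℂ}
    (hh : IsNice h) (P : LPCouple) (q : ℕ) (t₀ T : ℝ) :
    HasSum (fun n => (1 + lam s n) * (eLpNorm (fun z => (cut t₀ z.1 : ℂ) *
      cfT n (blkT P.reflect q h) z) 2 (timeX T)).toReal ^ 2)
      (∫ z, energyTest P.reflect q t₀ h z * h z ∂slab T +
        lamForm s T (energyTest P.reflect q t₀ h) h).re := by
  have hH := hh.memLp_slab T
  have hG := memLp_energyTest P.reflect q t₀ hH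
  have h1 := hasSum_integral_cfT_mul hG hH
  have h2 : HasSum (fun n => (lam s n : ℂ) *
      ∫ z, cfT n (energyTest P.reflect q t₀ h) z * cfT n h z ∂timeX T)
      (lamForm s T (energyTest P.reflect q t₀ h) h) := by
    refine (summable_of_tsum_enorm_lt_top ?_).hasSum
    refine (hh.tsum_lam_le hs0 hs1 hG).trans_lt ?_
    exact ENNReal.mul_lt_top (ENNReal.mul_lt_top ENNReal.ofReal_lt_top
      (ENNReal.mul_lt_top (by norm_num) (hh.osc.memLp_slab T).2)) hG.2
  have h3 := Complex.hasSum_re (h1.add h2)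
  have e : (fun n => (1 + lam s n) * (eLpNorm (fun z => (cut t₀ z.1 : ℂ) *
      cfT n (blkT P.reflect q h) z) 2 (timeX T)).toReal ^ 2) = fun n =>
      (∫ z, cfT n (energyTest P.reflect q t₀ h) z * cfT n h z ∂timeX T +
      (lam s n : ℂ) * ∫ z, cfT n (energyTest P.reflect q t₀ h) z * cfT n h z ∂timeX T).re := by
    ext n
    rw [← hh.re_integral_cfT_energyTest P q n t₀ T, Complex.add_re, Complex.re_ofReal_mul]
    ring
  rw [e]
  exact h3

end Kac

namespace Kac

open ComplexConjugate

/-! ### The energy estimate for the adjoint problem -/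

theorem IsNice.energy_nonneg {s : ℝ} (hs0 : 0 < s) (hs1 : s < 1) {h : ℝ × ℝ × ℝ → ℂ}
    (hh : IsNice h) (P : LPCouple) (q : ℕ) (t₀ T : ℝ) :
    0 ≤ (∫ z, energyTest P.reflect q t₀ h z * h z ∂slab T +
        lamForm s T (energyTest P.reflect q t₀ h) h).re :=
  (hh.hasSum_energy hs0 hs1 P q t₀ T).nonneg fun n =>
    mul_nonneg (by linarith [lam_nonneg hs0 hs1 n]) (sq_nonneg _)

/-- Coercivity coefficient by coefficient; with t₀ = 0 the time cut-off equals 1 almost everywhere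
on the slab. -/
theorem IsNice.wtNormT_le_energy {s : ℝ} (hs0 : 0 < s) (hs1 : s < 1) {h : ℝ × ℝ × ℝ → ℂ}
    (hh : IsNice h) (P : LPCouple) (q : ℕ) (T : ℝ) :
    ENNReal.ofReal (1 / 600) * wtNormT s T (blkT P.reflect q h) ≤
      ENNReal.ofReal (∫ z, energyTest P.reflect q 0 h z * h z ∂slab T +
        lamForm s T (energyTest P.reflect q 0 h) h).re := by
  have hs := hh.hasSum_energy hs0 hs1 P q 0 T
  have h0 : ∀ n, 0 ≤ (1 + lam s n) * (eLpNorm (fun z => (cut 0 z.1 : ℂ) *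
      cfT n (blkT P.reflect q h) z) 2 (timeX T)).toReal ^ 2 := fun n =>
    mul_nonneg (by linarith [lam_nonneg hs0 hs1 n]) (sq_nonneg _)
  rw [← hs.tsum_eq, ENNReal.ofReal_tsum_of_nonneg h0 hs.summable, wtNormT, ← ENNReal.tsum_mul_left]
  refine ENNReal.tsum_le_tsum fun n => ?_
  have hm := memLp_cfT n (memLp_blkT P.reflect q (hh.memLp_slab T))
  have e : eLpNorm (fun z => (cut 0 z.1 : ℂ) * cfT n (blkT P.reflect q h) z) 2 (timeX T) =
      eLpNorm (cfT n (blkT P.reflect q h)) 2 (timeX T) := by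
    refine eLpNorm_congr_ae ?_
    have h1 : ∀ᵐ z ∂timeX T, cut 0 z.1 = 1 :=
      Measure.quasiMeasurePreserving_fst.ae (cut_zero_ae T)
    filter_upwards [h1] with z hz
    rw [hz]; simp
  rw [e]
  set y := eLpNorm (cfT n (blkT P.reflect q h)) 2 (timeX T)
  have hy : y ≠ ⊤ := hm.2.ne
  rw [← ENNReal.ofReal_toReal hy, wt, ← ENNReal.ofReal_pow ENNReal.toReal_nonneg,
    ← ENNReal.ofReal_mul (by positivity), ← ENNReal.ofReal_mul (by positivity), ← mul_assoc,
    ENNReal.toReal_ofReal ENNReal.toReal_nonneg]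
  exact ENNReal.ofReal_le_ofReal (mul_le_mul_of_nonneg_right (wt_le_one_add_lam hs0 hs1 n)
    (sq_nonneg _))

/-- The energy test function is inserted as g in the adjoint identity `hB` and real parts are taken.
The left side is kinetic energy at t₀ plus dissipation; on the right stand the two parts of the
datum and the trilinear term. -/
theorem IsNice.energy_le {s : ℝ} (hs0 : 0 < s) (hs1 : s < 1) (P : LPCouple) (q : ℕ) {t₀ T : ℝ}
    (ht₀ : t₀ ∈ Icc 0 T) {f h a c d : ℝ × ℝ × ℝ → ℂ} (hf : MemLp f 2 (slab T)) (hh : IsNice h)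
    (hT : ∀ z, h (T, z) = 0) (ha : MemLp a 2 (slab T)) (hc : MemLp c 2 (slab T))
    (hd : MemLp d 2 (slab T)) (hcd : IsOscillatorPower T (s / 2) c d)
    (hB : ∀ g, MemLp g 2 (slab T) → adjForm s T f g h = ∫ z, g z * (a z + d z) ∂slab T)
    {X S : ℝ≥0∞} (hX : ∀ t ∈ Icc 0 T, eLpNorm (blkX P.reflect q (sl h t)) 2 volume ≤ X)
    (hS : ∀ r, wtNormT s T (blkT P.reflect r h) ^ (1 / 2 : ℝ) ≤ S * rt r) :
    ENNReal.ofReal (1 / 2 * (eLpNorm (blkX P.reflect q (sl h t₀)) 2 volume).toReal ^ 2 +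
      (∫ z, energyTest P.reflect q t₀ h z * h z ∂slab T +
        lamForm s T (energyTest P.reflect q t₀ h) h).re) ≤
      X * normT T 1 (blkT P.reflect q a) +
      wtNormT s T (blkT P.reflect q h) ^ (1 / 2 : ℝ) * normT T 2 (blkT P.reflect q c) +
      ENNReal.ofReal (6 * momentConst s) * (19 * (∑' p, rt p * normT T ⊤ (blkT P p f)) *
        rt q * wtNormT s T (blkT P.reflect q h) ^ (1 / 2 : ℝ) * S) := by
  have hH := hh.memLp_slab T
  have hG := memLp_energyTest P.reflect q t₀ hH
  have h1 := hh.re_integral_energy P.reflect q ht₀ hT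
  have h2 := hB _ hG
  have h3 : ∫ z, energyTest P.reflect q t₀ h z * (a z + d z) ∂slab T =
      ∫ z, energyTest P.reflect q t₀ h z * a z ∂slab T +
      ∫ z, energyTest P.reflect q t₀ h z * d z ∂slab T := by
    rw [← integral_add (integrable_mul_of_memLp hG ha) (integrable_mul_of_memLp hG hd)]
    congr 1; ext z; ring
  have h4 : 1 / 2 * (eLpNorm (blkX P.reflect q (sl h t₀)) 2 volume).toReal ^ 2 +
      (∫ z, energyTest P.reflect q t₀ h z * h z ∂slab T +
        lamForm s T (energyTest P.reflect q t₀ h) h).re =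
      (∫ z, energyTest P.reflect q t₀ h z * a z ∂slab T +
      ∫ z, energyTest P.reflect q t₀ h z * d z ∂slab T +
      alphaForm s T f (energyTest P.reflect q t₀ h) h).re := by
    have h5 : (∫ z, energyTest P.reflect q t₀ h z *
        (h z - Kac.dt h z - (z.2.2 : ℂ) * Kac.dx h z) ∂slab T).re = 1 / 2 *
        (eLpNorm (blkX P.reflect q (sl h t₀)) 2 volume).toReal ^ 2 +
        (∫ z, energyTest P.reflect q t₀ h z * h z ∂slab T).re := h1
    rw [← h3, ← h2, adjForm, Complex.add_re, Complex.add_re, Complex.sub_re, Complex.add_re, h5]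
    ring
  rw [h4]
  refine (ENNReal.ofReal_le_ofReal (Complex.re_le_norm _)).trans ?_
  rw [ofReal_norm]
  refine (enorm_add_le _ _).trans (add_le_add ((enorm_add_le _ _).trans (add_le_add ?_ ?_)) ?_)
  · exact enorm_integral_energyTest_mul_le P q t₀ hH ha hX
  · exact enorm_integral_energyTest_osc_le P q t₀ hH hc hd hcd
  · refine (enorm_tsum_le_tsum_enorm).trans
      (le_trans (le_of_eq (tsum_congr fun p => ?_))
        (hh.tsum_alpha_energyTest_le_mul hs0 hs1 P q t₀ hf hS))
    rw [enorm_mul, enorm_ofReal]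

/-- Adding `h1` and `h2`, the term 2δS² takes at most half of S²/600. With 2xA ≤ x²/4 + 4A² and 2Sc
≤ S²/1200 + 1200c² this leaves x² ≤ 16A² + 4800c². -/
theorem le_of_energy {x S A c δ k : ℝ} (hA : 0 ≤ A) (hc : 0 ≤ c) (hδ : δ ≤ 1 / 2400)
    (hk : k = x * A + S * c + δ * S ^ 2) (h1 : 1 / 2 * x ^ 2 ≤ k) (h2 : 1 / 600 * S ^ 2 ≤ k) :
    x ≤ 100 * (A + c) := by
  have h3 : x ^ 2 ≤ 16 * A ^ 2 + 4800 * c ^ 2 := by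
    nlinarith [sq_nonneg (x - 4 * A), sq_nonneg (S - 1200 * c), sq_nonneg S]
  refine abs_le_of_sq_le_sq' ?_ (by positivity) |>.2
  nlinarith [mul_nonneg hA hc, sq_nonneg A, sq_nonneg c]

theorem one_le_rt (n : ℕ) : 1 ≤ rt n := by
  have h : rt 0 = 1 := by simp [rt]
  rw [← h]; exact rt_mono (Nat.zero_le n)

/-- The a priori estimate for the adjoint problem. -/
theorem IsNice.eLpNorm_blkX_le_of_adjForm {s : ℝ} (hs0 : 0 < s) (hs1 : s < 1) (P : LPCouple)
    {T : ℝ} (hT0 : 0 < T) {f h a c d : ℝ × ℝ × ℝ → ℂ} (hf : MemLp f 2 (slab T))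
    (hsmall : ENNReal.ofReal (6 * momentConst s) *
      (19 * ∑' p, rt p * normT T ⊤ (blkT P p f)) ≤ ENNReal.ofReal (1 / 2400))
    (hh : IsNice h) (hT : ∀ z, h (T, z) = 0) (ha : MemLp a 2 (slab T)) (hc : MemLp c 2 (slab T))
    (hd : MemLp d 2 (slab T)) (hcd : IsOscillatorPower T (s / 2) c d)
    (hB : ∀ g, MemLp g 2 (slab T) → adjForm s T f g h = ∫ z, g z * (a z + d z) ∂slab T)
    {A C : ℝ≥0∞} (hA : ∀ q, normT T 1 (blkT P.reflect q a) ≤ A * rt q)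
    (hC : ∀ q, normT T 2 (blkT P.reflect q c) ≤ C * rt q) (q : ℕ) {t : ℝ} (ht : t ∈ Icc 0 T) :
    eLpNorm (blkX P.reflect q (sl h t)) 2 volume ≤ 100 * (A + C) * rt q := by
  by_cases hAt : A = ⊤
  · rw [hAt, top_add, ENNReal.mul_top (by norm_num), ENNReal.top_mul (rt_ne_zero q)]; exact le_top
  by_cases hCt : C = ⊤
  · rw [hCt, add_top, ENNReal.mul_top (by norm_num), ENNReal.top_mul (rt_ne_zero q)]; exact le_top
  set Q := P.reflect
  set δ := ENNReal.ofReal (6 * momentConst s) * (19 * ∑' p, rt p * normT T ⊤ (blkT P p f)) with hδ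
  have hδt : δ ≠ ⊤ := ne_top_of_le_ne_top ENNReal.ofReal_ne_top hsmall
  set Y : ℕ → ℝ → ℝ≥0∞ := fun q t => eLpNorm (blkX Q q (sl h t)) 2 volume with hY
  set Z : ℕ → ℝ≥0∞ := fun q => wtNormT s T (blkT Q q h) ^ (1 / 2 : ℝ) with hZ
  -- The sup norms of the energy and of the dissipation over all blocks. They are finite because h
  -- is smooth with compact support, so absorbing the trilinear term on the right is legitimate.
  set X : ℝ≥0∞ := ⨆ q, ⨆ t ∈ Icc 0 T, Y q t / rt q with hXdef
  set S : ℝ≥0∞ := ⨆ q, Z q / rt q with hSdef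
  have hYt : ∀ q t, Y q t ≠ ⊤ := fun q t => (memLp_blkX Q q (hh.memLp_sl t)).2.ne
  have hdiv : ∀ (y z : ℝ≥0∞) (q : ℕ), y / rt q ≤ z ↔ y ≤ z * rt q := fun y z q =>
    ENNReal.div_le_iff (rt_ne_zero q) (rt_ne_top q)
  have hX : ∀ q, ∀ t ∈ Icc 0 T, Y q t ≤ X * rt q := fun q t ht => by
    rw [← hdiv]
    exact le_iSup_of_le q (le_iSup₂_of_le t ht le_rfl)
  have hS : ∀ q, Z q ≤ S * rt q := fun q => by
    rw [← hdiv]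
    exact le_iSup (fun q => Z q / rt q) q
  have hXt : X ≠ ⊤ := by
    obtain ⟨B, hBt, hb⟩ := hh.exists_eLpNorm_sl_le
    refine ne_top_of_le_ne_top hBt (iSup_le fun q => iSup₂_le fun t _ => ?_)
    rw [hdiv]
    calc Y q t ≤ B := (eLpNorm_blkX_le Q q (hh.memLp_sl t)).trans (hb t)
      _ ≤ B * rt q := le_mul_of_one_le_right' (one_le_rt q)
  have hSt : S ≠ ⊤ := by
    have hBt : 2 * eLpNorm (Kac.osc h) 2 (slab T) ≠ ⊤ :=
      ENNReal.mul_ne_top (by norm_num) (hh.osc.memLp_slab T).2.ne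
    refine ne_top_of_le_ne_top hBt (iSup_le fun q => ?_)
    rw [hdiv]
    calc Z q ≤ 2 * eLpNorm (Kac.osc h) 2 (slab T) := by
          rw [← sq_le_sq_iff_ennreal, rpow_half_sq, mul_pow]
          refine (hh.wtNormT_le hs0.le (by linarith) Q q T).trans (le_of_eq ?_)
          norm_num
      _ ≤ _ := le_mul_of_one_le_right' (one_le_rt q)
  set K := X * A + S * C + δ * S ^ 2 with hK
  have hKt : K ≠ ⊤ := by finiteness
  have hmain : ∀ q, ∀ t ∈ Icc 0 T, ENNReal.ofReal (1 / 2 * (Y q t).toReal ^ 2 +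
      (∫ z, energyTest Q q t h z * h z ∂slab T + lamForm s T (energyTest Q q t h) h).re) ≤
      K * rt q ^ 2 := fun q t ht => by
    refine (hh.energy_le hs0 hs1 P q ht hf hT ha hc hd hcd hB (hX q) hS).trans ?_
    calc _ ≤ X * rt q * (A * rt q) + S * rt q * (C * rt q) +
          ENNReal.ofReal (6 * momentConst s) * (19 * (∑' p, rt p * normT T ⊤ (blkT P p f)) *
            rt q * (S * rt q) * S) := by
          gcongr
          exacts [hA q, hS q, hC q, hS q]
      _ = _ := by rw [hK, hδ]; ring
  -- The energy inequality at an arbitrary t, discarding the nonnegative dissipation.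
  have hX2 : ENNReal.ofReal (1 / 2) * X ^ 2 ≤ K := by
    have h1 : X ≤ (2 * K) ^ (1 / 2 : ℝ) := by
      refine iSup_le fun q => iSup₂_le fun t ht => ?_
      rw [hdiv, ← sq_le_sq_iff_ennreal, mul_pow, rpow_half_sq]
      have h2 := hmain q t ht
      have h3 : ENNReal.ofReal (1 / 2 * (Y q t).toReal ^ 2) ≤ K * rt q ^ 2 :=
        (ENNReal.ofReal_le_ofReal (le_add_of_nonneg_right
          (hh.energy_nonneg hs0 hs1 P q t T))).trans h2
      rw [ENNReal.ofReal_mul (by norm_num), ENNReal.ofReal_pow ENNReal.toReal_nonneg,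
        ENNReal.ofReal_toReal (hYt q t)] at h3
      calc Y q t ^ 2 = 2 * (ENNReal.ofReal (1 / 2) * Y q t ^ 2) := by
            rw [← mul_assoc, show (2 : ℝ≥0∞) = ENNReal.ofReal 2 by simp,
              ← ENNReal.ofReal_mul (by norm_num)]
            norm_num
        _ ≤ 2 * (K * rt q ^ 2) := by gcongr
        _ = _ := by ring
    rw [← sq_le_sq_iff_ennreal, rpow_half_sq] at h1
    calc _ ≤ ENNReal.ofReal (1 / 2) * (2 * K) := by gcongr
      _ = K := by
        rw [← mul_assoc, show (2 : ℝ≥0∞) = ENNReal.ofReal 2 by simp,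
          ← ENNReal.ofReal_mul (by norm_num)]
        norm_num
  have hS2 : ENNReal.ofReal (1 / 600) * S ^ 2 ≤ K := by
    have h1 : S ≤ (600 * K) ^ (1 / 2 : ℝ) := by
      refine iSup_le fun q => ?_
      rw [hdiv, ← sq_le_sq_iff_ennreal, mul_pow, rpow_half_sq, rpow_half_sq]
      -- The starting time 0 captures the dissipation over the whole interval.
      have h2 := hmain q 0 ⟨le_rfl, hT0.le⟩
      have h3 : ENNReal.ofReal (1 / 600) * wtNormT s T (blkT Q q h) ≤ K * rt q ^ 2 :=
        (hh.wtNormT_le_energy hs0 hs1 P q T).trans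
          ((ENNReal.ofReal_le_ofReal (le_add_of_nonneg_left (by positivity))).trans h2)
      calc wtNormT s T (blkT Q q h) = 600 * (ENNReal.ofReal (1 / 600) * wtNormT s T (blkT Q q h)) := by
            rw [← mul_assoc, show (600 : ℝ≥0∞) = ENNReal.ofReal 600 by simp,
              ← ENNReal.ofReal_mul (by norm_num)]
            norm_num
        _ ≤ 600 * (K * rt q ^ 2) := by gcongr
        _ = _ := by ring
    rw [← sq_le_sq_iff_ennreal, rpow_half_sq] at h1
    calc _ ≤ ENNReal.ofReal (1 / 600) * (600 * K) := by gcongr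
      _ = K := by
        rw [← mul_assoc, show (600 : ℝ≥0∞) = ENNReal.ofReal 600 by simp,
          ← ENNReal.ofReal_mul (by norm_num)]
        norm_num
  have hkr : K.toReal = X.toReal * A.toReal + S.toReal * C.toReal + δ.toReal * S.toReal ^ 2 := by
    rw [hK, ENNReal.toReal_add (by finiteness) (by finiteness),
      ENNReal.toReal_add (by finiteness) (by finiteness)]
    simp only [ENNReal.toReal_mul, ENNReal.toReal_pow]
  have hfin := le_of_energy ENNReal.toReal_nonneg ENNReal.toReal_nonneg
    (ENNReal.toReal_le_of_le_ofReal (by norm_num) hsmall) hkr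
    (by simpa using ENNReal.toReal_mono hKt hX2) (by simpa using ENNReal.toReal_mono hKt hS2)
  have hXle : X ≤ 100 * (A + C) := by
    rw [← ENNReal.ofReal_toReal hXt, ← ENNReal.ofReal_toReal hAt, ← ENNReal.ofReal_toReal hCt,
      ← ENNReal.ofReal_add ENNReal.toReal_nonneg ENNReal.toReal_nonneg,
      show (100 : ℝ≥0∞) = ENNReal.ofReal 100 by simp, ← ENNReal.ofReal_mul (by norm_num)]
    exact ENNReal.ofReal_le_ofReal hfin
  exact (hX q t ht).trans (mul_le_mul_left hXle _)

end Kac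

namespace Kac

open ComplexConjugate

/-! ### Bounds for the forms -/

theorem lintegral_enorm_mul_le {α : Type*} [MeasurableSpace α] {ν : Measure α} {u w : α → ℂ}
    (hu : AEStronglyMeasurable u ν) (hw : AEStronglyMeasurable w ν) :
    ∫⁻ x, ‖u x * w x‖ₑ ∂ν ≤ eLpNorm u 2 ν * eLpNorm w 2 ν := by
  have h := lintegral_sqrt_mul_sqrt_le (hu.enorm.pow_const 2) (hw.enorm.pow_const 2)
  simp only [rpow_half_of_sq] at h
  rw [← eLpNorm_two_sq, ← eLpNorm_two_sq, rpow_half_of_sq, rpow_half_of_sq] at h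
  simpa only [enorm_mul] using h

theorem IsNice.tsum_lam_lintegral_ne_top {s : ℝ} (hs0 : 0 < s) (hs1 : s < 1) {T : ℝ}
    {g h : ℝ × ℝ × ℝ → ℂ} (hg : MemLp g 2 (slab T)) (hh : IsNice h) :
    ∑' n : ℕ, ∫⁻ z, ‖(lam s n : ℂ) * (cfT n g z * cfT n h z)‖ₑ ∂timeX T ≠ ⊤ := by
  have hbd : ∑' n : ℕ, ENNReal.ofReal (2 * momentConst s) * (wt s n *
      (eLpNorm (cfT n g) 2 (timeX T) * eLpNorm (cfT n h) 2 (timeX T))) ≠ ⊤ := by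
    rw [ENNReal.tsum_mul_left]
    refine ENNReal.mul_ne_top ENNReal.ofReal_ne_top (ne_top_of_le_ne_top ?_
      (tsum_mul_eLpNorm_cfT_le hg))
    refine ENNReal.mul_ne_top hg.2.ne (ENNReal.rpow_ne_top_of_nonneg (by norm_num) ?_)
    refine ne_top_of_le_ne_top ?_ (hh.wtNormT_self_le (s := 2 * s) (by linarith) (by linarith) T)
    have := (hh.osc.memLp_slab T).2.ne
    finiteness
  refine ne_top_of_le_ne_top hbd (ENNReal.tsum_le_tsum fun n => ?_)
  simp only [enorm_mul (lam s n : ℂ), enorm_ofReal]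
  rw [lintegral_const_mul' _ _ enorm_ne_top, ← mul_assoc]
  gcongr
  · exact enorm_lam_le hs0 hs1 n
  · exact lintegral_enorm_mul_le (memLp_cfT n hg).1 (memLp_cfT n (hh.memLp_slab T)).1

theorem IsNice.exists_tsum_wt_cfT_le {h : ℝ × ℝ × ℝ → ℂ} (hh : IsNice h) {r : ℝ} (h0 : 0 ≤ r)
    (h2 : r ≤ 2) : ∃ C : ℝ≥0∞, C ≠ ⊤ ∧ ∀ z, ∑' n, wt r n * ‖cfT n h z‖ₑ ^ 2 ≤ C := by
  obtain ⟨B, hB, hb⟩ := hh.osc.exists_lintegral_vel_le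
  refine ⟨4 * B, by finiteness, fun z => ?_⟩
  have h3 := tsum_wt_two_coef (hh.slice_vel z.1 z.2).1 (hh.slice_vel z.1 z.2).2
  calc _ ≤ ∑' n, 4 * (wt 2 n * ‖coef n fun v => h (z.1, z.2, v)‖ₑ ^ 2) :=
        ENNReal.tsum_le_tsum fun n => by
          rw [← mul_assoc]; exact mul_le_mul_left (wt_le_four_mul h0 h2 n) _
    _ ≤ 4 * B := by
        rw [ENNReal.tsum_mul_left, h3]
        exact mul_le_mul_right (hb z.1 z.2) _

theorem lintegral_tsum_enorm_cfT_sq {T : ℝ} {f : ℝ × ℝ × ℝ → ℂ} (hf : MemLp f 2 (slab T)) :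
    ∫⁻ z, ∑' k, ‖cfT k f z‖ₑ ^ 2 ∂timeX T = eLpNorm f 2 (slab T) ^ 2 := by
  rw [lintegral_tsum fun k => (memLp_cfT k hf).1.enorm.pow_const 2, ← tsum_eLpNorm_cfT_sq hf]
  exact tsum_congr fun k => (eLpNorm_two_sq _).symm

/-- For smooth h the coefficients weighted by order 2s are square summable uniformly in (t, x), so
the trilinear bound holds pointwise and Cauchy-Schwarz in (t, x) finishes. Having the integral
inside the sum also justifies later interchanges. -/
theorem IsNice.exists_tsum_alpha_lintegral_le {s : ℝ} (hs0 : 0 < s) (hs1 : s < 1) (T : ℝ)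
    {h : ℝ × ℝ × ℝ → ℂ} (hh : IsNice h) : ∃ C : ℝ≥0∞, C ≠ ⊤ ∧ ∀ f g : ℝ × ℝ × ℝ → ℂ,
      MemLp f 2 (slab T) → MemLp g 2 (slab T) →
      ∑' p : ℕ × ℕ, ∫⁻ z, ‖(alpha s p.1 p.2 : ℂ) * (cfT p.1 f z * cfT p.2 g z *
        cfT (p.1 + p.2) h z)‖ₑ ∂timeX T ≤ C * (eLpNorm f 2 (slab T) * eLpNorm g 2 (slab T)) := by
  obtain ⟨B, hB, hb⟩ := hh.exists_tsum_wt_cfT_le (r := 2 * s) (by linarith) (by linarith)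
  refine ⟨ENNReal.ofReal (6 * momentConst s) * B ^ (1 / 2 : ℝ), ENNReal.mul_ne_top
    ENNReal.ofReal_ne_top (ENNReal.rpow_ne_top_of_nonneg (by norm_num) hB), fun f g hf hg => ?_⟩
  have hcf := fun k => memLp_cfT k hf
  have hcg := fun k => memLp_cfT k hg
  have hch := fun k => memLp_cfT k (hh.memLp_slab T)
  have ha : ∀ U : ℝ × ℝ × ℝ → ℂ, MemLp U 2 (slab T) →
      AEMeasurable (fun z => ∑' k, ‖cfT k U z‖ₑ ^ 2) (timeX T) := fun U hU =>
    AEMeasurable.tsum fun k => (memLp_cfT k hU).1.enorm.pow_const 2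
  have hab : AEMeasurable (fun z => (∑' k, ‖cfT k f z‖ₑ ^ 2) ^ (1 / 2 : ℝ) *
      (∑' k, ‖cfT k g z‖ₑ ^ 2) ^ (1 / 2 : ℝ)) (timeX T) := (((ha f hf).pow_const (1 / 2 : ℝ)).mul ((ha g hg).pow_const (1 / 2 : ℝ)))
  have hm : ∀ p : ℕ × ℕ, AEMeasurable (fun z => ‖(alpha s p.1 p.2 : ℂ) * (cfT p.1 f z * cfT p.2 g z *
      cfT (p.1 + p.2) h z)‖ₑ) (timeX T) := fun p => by
    have h1 : AEStronglyMeasurable (fun z => cfT p.1 f z * cfT p.2 g z * cfT (p.1 + p.2) h z)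
        (timeX T) := ((hcf p.1).1.mul (hcg p.2).1).mul (hch (p.1 + p.2)).1
    exact (h1.const_mul (alpha s p.1 p.2 : ℂ)).enorm
  rw [← lintegral_tsum hm]
  calc _ ≤ ∫⁻ z, (ENNReal.ofReal (6 * momentConst s) * B ^ (1 / 2 : ℝ)) *
        ((∑' k, ‖cfT k f z‖ₑ ^ 2) ^ (1 / 2 : ℝ) * (∑' k, ‖cfT k g z‖ₑ ^ 2) ^ (1 / 2 : ℝ)) ∂timeX T := by
        refine lintegral_mono fun z => ?_
        have e : ∀ p : ℕ × ℕ, ‖(alpha s p.1 p.2 : ℂ) * (cfT p.1 f z * cfT p.2 g z *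
            cfT (p.1 + p.2) h z)‖ₑ = ‖alpha s p.1 p.2‖ₑ * (‖cfT p.1 f z‖ₑ * ‖cfT p.2 g z‖ₑ *
            ‖cfT (p.1 + p.2) h z‖ₑ) := fun p => by
          rw [enorm_mul, enorm_mul, enorm_mul, enorm_ofReal]
        rw [tsum_congr e]
        refine (tsum_alpha_le_two hs0 hs1 (fun k => ‖cfT k f z‖ₑ) (fun k => ‖cfT k g z‖ₑ)
          (fun k => ‖cfT k h z‖ₑ)).trans ?_
        calc _ ≤ ENNReal.ofReal (6 * momentConst s) * (∑' k, ‖cfT k f z‖ₑ ^ 2) ^ (1 / 2 : ℝ) *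
              (∑' k, ‖cfT k g z‖ₑ ^ 2) ^ (1 / 2 : ℝ) * B ^ (1 / 2 : ℝ) := by
              gcongr; exact hb z
          _ = _ := by ring
    _ ≤ _ := by
        rw [lintegral_const_mul'' _ hab]
        refine mul_le_mul_right ?_ _
        refine (lintegral_sqrt_mul_sqrt_le (ha f hf) (ha g hg)).trans (le_of_eq ?_)
        rw [lintegral_tsum_enorm_cfT_sq hf, lintegral_tsum_enorm_cfT_sq hg, rpow_half_of_sq,
          rpow_half_of_sq]

theorem enorm_mul_integral_le {α : Type*} [MeasurableSpace α] {ν : Measure α} (c : ℂ) (F : α → ℂ) :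
    ‖c * ∫ z, F z ∂ν‖ₑ ≤ ∫⁻ z, ‖c * F z‖ₑ ∂ν := by
  rw [← integral_const_mul]; exact enorm_integral_le_lintegral_enorm _

theorem IsNice.hasSum_lamForm {s : ℝ} (hs0 : 0 < s) (hs1 : s < 1) {T : ℝ}
    {g h : ℝ × ℝ × ℝ → ℂ} (hg : MemLp g 2 (slab T)) (hh : IsNice h) :
    HasSum (fun n : ℕ => (lam s n : ℂ) * ∫ z, cfT n g z * cfT n h z ∂timeX T) (lamForm s T g h) :=
  (summable_of_tsum_enorm_lt_top (lt_of_le_of_lt (ENNReal.tsum_le_tsum fun _ =>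
    enorm_mul_integral_le _ _) (hh.tsum_lam_lintegral_ne_top hs0 hs1 hg).lt_top)).hasSum

theorem IsNice.hasSum_alphaForm {s : ℝ} (hs0 : 0 < s) (hs1 : s < 1) {T : ℝ}
    {f g h : ℝ × ℝ × ℝ → ℂ} (hf : MemLp f 2 (slab T)) (hg : MemLp g 2 (slab T)) (hh : IsNice h) :
    HasSum (fun p : ℕ × ℕ => (alpha s p.1 p.2 : ℂ) *
      ∫ z, cfT p.1 f z * cfT p.2 g z * cfT (p.1 + p.2) h z ∂timeX T) (alphaForm s T f g h) := by
  obtain ⟨C, hC, hb⟩ := hh.exists_tsum_alpha_lintegral_le hs0 hs1 T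
  refine (summable_of_tsum_enorm_lt_top (lt_of_le_of_lt (ENNReal.tsum_le_tsum fun _ =>
    enorm_mul_integral_le _ _) ((hb f g hf hg).trans_lt ?_))).hasSum
  exact ENNReal.mul_lt_top hC.lt_top (ENNReal.mul_lt_top hf.2 hg.2)

/-- The transport part of the adjoint operator. -/
noncomputable def transport (h : ℝ × ℝ × ℝ → ℂ) (z : ℝ × ℝ × ℝ) : ℂ :=
  h z - dt h z - (z.2.2 : ℂ) * dx h z

theorem IsNice.transport {h : ℝ × ℝ × ℝ → ℂ} (hh : IsNice h) : IsNice (transport h) :=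
  (hh.sub hh.dt).sub hh.dx.vel_mul

/-- All unbounded operators act on h, so only the L² norm of g enters. This admits test functions
that jump in time, and gives a Riesz representative of the adjoint operator applied to h. -/
theorem IsNice.exists_enorm_adjForm_le {s : ℝ} (hs0 : 0 < s) (hs1 : s < 1) {T : ℝ}
    {f h : ℝ × ℝ × ℝ → ℂ} (hf : MemLp f 2 (slab T)) (hh : IsNice h) :
    ∃ C : ℝ≥0∞, C ≠ ⊤ ∧ ∀ g, MemLp g 2 (slab T) →
      ‖adjForm s T f g h‖ₑ ≤ C * eLpNorm g 2 (slab T) := by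
  obtain ⟨C, hC, hb⟩ := hh.exists_tsum_alpha_lintegral_le hs0 hs1 T
  have ho := (hh.osc.memLp_slab T).2.ne
  have ht := (hh.transport.memLp_slab T).2.ne
  have hf' := hf.2.ne
  refine ⟨eLpNorm (Kac.transport h) 2 (slab T) +
    ENNReal.ofReal (2 * momentConst s) * (2 * eLpNorm (Kac.osc h) 2 (slab T)) +
    C * eLpNorm f 2 (slab T), by finiteness, fun g hg => ?_⟩
  unfold adjForm
  rw [add_mul, add_mul]
  refine (enorm_sub_le).trans (add_le_add ((enorm_add_le _ _).trans (add_le_add ?_ ?_)) ?_)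
  · rw [mul_comm]
    exact enorm_integral_mul_le hg.1 (hh.transport.memLp_slab T).1
  · exact enorm_tsum_le_tsum_enorm.trans (hh.tsum_lam_le hs0 hs1 hg)
  · refine enorm_tsum_le_tsum_enorm.trans ((ENNReal.tsum_le_tsum fun _ =>
      enorm_mul_integral_le _ _).trans ((hb f g hf hg).trans (le_of_eq (by ring))))

/-! ### Linearity of the forms -/

theorem ae_velocity {T : ℝ} {p : ℝ × ℝ × ℝ → Prop} (h : ∀ᵐ z ∂slab T, p z) :
    ∀ᵐ z ∂timeX T, ∀ᵐ v, p (z.1, z.2, v) :=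
  Measure.ae_ae_of_ae_prod ((measurePreserving_assoc_slab T).quasiMeasurePreserving.ae h)

theorem coef_mul_add (n : ℕ) (c : ℂ) {u w : ℝ → ℂ} (hu : MemLp u 2 volume) (hw : MemLp w 2 volume) :
    coef n (fun v => c * u v + w v) = c * coef n u + coef n w := by
  unfold coef
  rw [← integral_const_mul, ← integral_add
    ((integrable_mul_of_memLp hu (memLp_hermiteFun n)).const_mul c)
    (integrable_mul_of_memLp hw (memLp_hermiteFun n))]
  congr 1; ext v; ring

theorem cfT_mul_add_ae (n : ℕ) (c : ℂ) {T : ℝ} {g g' k : ℝ × ℝ × ℝ → ℂ} (hg : MemLp g 2 (slab T))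
    (hg' : MemLp g' 2 (slab T)) (hk : k =ᵐ[slab T] fun z => c * g z + g' z) :
    cfT n k =ᵐ[timeX T] fun z => c * cfT n g z + cfT n g' z := by
  filter_upwards [ae_velocity hk, ae_memLp_velocity hg, ae_memLp_velocity hg'] with z h1 h2 h3
  rw [cfT, coef_congr n h1]
  exact coef_mul_add n c h2 h3

theorem adjForm_mul_add_left {s : ℝ} (hs0 : 0 < s) (hs1 : s < 1) (c : ℂ) {T : ℝ}
    {f g g' k h : ℝ × ℝ × ℝ → ℂ} (hf : MemLp f 2 (slab T)) (hg : MemLp g 2 (slab T))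
    (hg' : MemLp g' 2 (slab T)) (hk : k =ᵐ[slab T] fun z => c * g z + g' z) (hh : IsNice h) :
    adjForm s T f k h = c * adjForm s T f g h + adjForm s T f g' h := by
  have hH := hh.memLp_slab T
  have hL := hh.transport.memLp_slab T
  have e1 : ∫ z, k z * transport h z ∂slab T =
      c * ∫ z, g z * transport h z ∂slab T + ∫ z, g' z * transport h z ∂slab T := by
    rw [← integral_const_mul, ← integral_add ((integrable_mul_of_memLp hg hL).const_mul c)
      (integrable_mul_of_memLp hg' hL)]
    refine integral_congr_ae ?_
    filter_upwards [hk] with z hz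
    rw [hz]; ring
  have e2 : lamForm s T k h = c * lamForm s T g h + lamForm s T g' h := by
    rw [← (((hh.hasSum_lamForm hs0 hs1 hg).mul_left c).add (hh.hasSum_lamForm hs0 hs1 hg')).tsum_eq]
    refine tsum_congr fun n => ?_
    have i1 := integrable_mul_of_memLp (memLp_cfT n hg) (memLp_cfT n hH)
    have i2 := integrable_mul_of_memLp (memLp_cfT n hg') (memLp_cfT n hH)
    have e : ∫ z, cfT n k z * cfT n h z ∂timeX T =
        c * ∫ z, cfT n g z * cfT n h z ∂timeX T + ∫ z, cfT n g' z * cfT n h z ∂timeX T := by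
      rw [← integral_const_mul, ← integral_add (i1.const_mul c) i2]
      refine integral_congr_ae ?_
      filter_upwards [cfT_mul_add_ae n c hg hg' hk] with z hz
      rw [hz]; ring
    rw [e]; ring
  have e3 : alphaForm s T f k h = c * alphaForm s T f g h + alphaForm s T f g' h := by
    rw [← (((hh.hasSum_alphaForm hs0 hs1 hf hg).mul_left c).add
      (hh.hasSum_alphaForm hs0 hs1 hf hg')).tsum_eq]
    refine tsum_congr fun p => ?_
    have i1 := hh.integrable_cfT_mul p.1 p.2 (p.1 + p.2) hf hg
    have i2 := hh.integrable_cfT_mul p.1 p.2 (p.1 + p.2) hf hg'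
    have e : ∫ z, cfT p.1 f z * cfT p.2 k z * cfT (p.1 + p.2) h z ∂timeX T =
        c * ∫ z, cfT p.1 f z * cfT p.2 g z * cfT (p.1 + p.2) h z ∂timeX T +
        ∫ z, cfT p.1 f z * cfT p.2 g' z * cfT (p.1 + p.2) h z ∂timeX T := by
      rw [← integral_const_mul, ← integral_add (i1.const_mul c) i2]
      refine integral_congr_ae ?_
      filter_upwards [cfT_mul_add_ae p.2 c hg hg' hk] with z hz
      rw [hz]; ring
    rw [e]; ring
  unfold adjForm
  unfold transport at e1
  rw [e1, e2, e3]; ring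

theorem IsNice.cfT_mul_add {h k : ℝ × ℝ × ℝ → ℂ} (hh : IsNice h) (hk : IsNice k) (c : ℂ) (n : ℕ)
    (z : ℝ × ℝ) : cfT n (fun z => c * h z + k z) z = c * cfT n h z + cfT n k z :=
  coef_mul_add n c
    ((hh.slice_vel z.1 z.2).1.continuous.memLp_of_hasCompactSupport (hh.slice_vel z.1 z.2).2)
    ((hk.slice_vel z.1 z.2).1.continuous.memLp_of_hasCompactSupport (hk.slice_vel z.1 z.2).2)

theorem IsNice.transport_mul_add {h k : ℝ × ℝ × ℝ → ℂ} (hh : IsNice h) (hk : IsNice k) (c : ℂ)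
    (z : ℝ × ℝ × ℝ) : Kac.transport (fun z => c * h z + k z) z =
      c * Kac.transport h z + Kac.transport k z := by
  have h1 : Kac.dt (fun z => c * h z + k z) z = c * Kac.dt h z + Kac.dt k z :=
    (((hh.hasDerivAt_time z.1 z.2.1 z.2.2).differentiableAt.hasDerivAt.const_mul c).add
      (hk.hasDerivAt_time z.1 z.2.1 z.2.2).differentiableAt.hasDerivAt).deriv
  have h2 : Kac.dx (fun z => c * h z + k z) z = c * Kac.dx h z + Kac.dx k z :=
    (((hh.hasDerivAt_pos z.1 z.2.1 z.2.2).differentiableAt.hasDerivAt.const_mul c).add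
      (hk.hasDerivAt_pos z.1 z.2.1 z.2.2).differentiableAt.hasDerivAt).deriv
  unfold Kac.transport
  rw [h1, h2]; ring

theorem adjForm_mul_add_right {s : ℝ} (hs0 : 0 < s) (hs1 : s < 1) (c : ℂ) {T : ℝ}
    {f g h k : ℝ × ℝ × ℝ → ℂ} (hf : MemLp f 2 (slab T)) (hg : MemLp g 2 (slab T))
    (hh : IsNice h) (hk : IsNice k) :
    adjForm s T f g (fun z => c * h z + k z) = c * adjForm s T f g h + adjForm s T f g k := by
  have e1 : ∫ z, g z * transport (fun z => c * h z + k z) z ∂slab T =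
      c * ∫ z, g z * transport h z ∂slab T + ∫ z, g z * transport k z ∂slab T := by
    rw [← integral_const_mul, ← integral_add
      ((integrable_mul_of_memLp hg (hh.transport.memLp_slab T)).const_mul c)
      (integrable_mul_of_memLp hg (hk.transport.memLp_slab T))]
    congr 1; ext z
    rw [hh.transport_mul_add hk]; ring
  have e2 : lamForm s T g (fun z => c * h z + k z) = c * lamForm s T g h + lamForm s T g k := by
    rw [← (((hh.hasSum_lamForm hs0 hs1 hg).mul_left c).add (hk.hasSum_lamForm hs0 hs1 hg)).tsum_eq]
    refine tsum_congr fun n => ?_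
    have i1 := integrable_mul_of_memLp (memLp_cfT n hg) (memLp_cfT n (hh.memLp_slab T))
    have i2 := integrable_mul_of_memLp (memLp_cfT n hg) (memLp_cfT n (hk.memLp_slab T))
    have e : ∫ z, cfT n g z * cfT n (fun z => c * h z + k z) z ∂timeX T =
        c * ∫ z, cfT n g z * cfT n h z ∂timeX T + ∫ z, cfT n g z * cfT n k z ∂timeX T := by
      rw [← integral_const_mul, ← integral_add (i1.const_mul c) i2]
      congr 1; ext z
      rw [hh.cfT_mul_add hk]; ring
    rw [e]; ring
  have e3 : alphaForm s T f g (fun z => c * h z + k z) =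
      c * alphaForm s T f g h + alphaForm s T f g k := by
    rw [← (((hh.hasSum_alphaForm hs0 hs1 hf hg).mul_left c).add
      (hk.hasSum_alphaForm hs0 hs1 hf hg)).tsum_eq]
    refine tsum_congr fun p => ?_
    have i1 := hh.integrable_cfT_mul p.1 p.2 (p.1 + p.2) hf hg
    have i2 := hk.integrable_cfT_mul p.1 p.2 (p.1 + p.2) hf hg
    have e : ∫ z, cfT p.1 f z * cfT p.2 g z * cfT (p.1 + p.2) (fun z => c * h z + k z) z ∂timeX T =
        c * ∫ z, cfT p.1 f z * cfT p.2 g z * cfT (p.1 + p.2) h z ∂timeX T +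
        ∫ z, cfT p.1 f z * cfT p.2 g z * cfT (p.1 + p.2) k z ∂timeX T := by
      rw [← integral_const_mul, ← integral_add (i1.const_mul c) i2]
      congr 1; ext z
      rw [hh.cfT_mul_add hk]; ring
    rw [e]; ring
  unfold adjForm
  unfold transport at e1
  rw [e1, e2, e3]; ring

/-! ### Riesz representation on the slab. -/

/-- The space `L²([0, T] × ℝ²)`. -/
abbrev SlabL2 (T : ℝ) : Type := Lp ℂ 2 (slab T)

/-- A continuous linear functional on `L²` is given by integration. -/
theorem exists_eq_integral {T : ℝ} (ℓ : SlabL2 T →L[ℂ] ℂ) :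
    ∃ w : SlabL2 T, ∀ g : SlabL2 T, ℓ g = ∫ z, w z * g z ∂slab T := by
  set y := (InnerProductSpace.toDual ℂ (SlabL2 T)).symm ℓ with hy
  have h1 : MemLp (fun z => conj (y z)) 2 (slab T) := memLp_conj (Lp.memLp y)
  refine ⟨h1.toLp _, fun g => ?_⟩
  have h2 : ℓ g = inner ℂ y g := by
    rw [← InnerProductSpace.toDual_apply_apply, hy, LinearIsometryEquiv.apply_symm_apply]
  rw [h2, L2.inner_def]
  refine integral_congr_ae ?_
  filter_upwards [h1.coeFn_toLp] with z hz
  rw [hz, RCLike.inner_apply, mul_comm]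

theorem integral_toLp_mul {T : ℝ} {g w : ℝ × ℝ × ℝ → ℂ} (hg : MemLp g 2 (slab T)) :
    ∫ z, w z * (hg.toLp g) z ∂slab T = ∫ z, w z * g z ∂slab T := by
  refine integral_congr_ae ?_
  filter_upwards [hg.coeFn_toLp] with z hz
  rw [hz]

theorem IsNice.exists_adjForm_eq_integral {s : ℝ} (hs0 : 0 < s) (hs1 : s < 1) {T : ℝ}
    {f h : ℝ × ℝ × ℝ → ℂ} (hf : MemLp f 2 (slab T)) (hh : IsNice h) :
    ∃ a : SlabL2 T, ∀ g : SlabL2 T, adjForm s T f g h = ∫ z, g z * a z ∂slab T := by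
  obtain ⟨C, hC, hb⟩ := hh.exists_enorm_adjForm_le hs0 hs1 hf
  have key : ∀ (c : ℂ) (g g' : SlabL2 T),
      adjForm s T f (c • g + g' : SlabL2 T) h = c * adjForm s T f g h + adjForm s T f g' h :=
    fun c g g' => by
      refine adjForm_mul_add_left hs0 hs1 c hf (Lp.memLp g) (Lp.memLp g') ?_ hh
      filter_upwards [Lp.coeFn_add (c • g) g', Lp.coeFn_smul c g] with z h1 h2
      rw [h1, Pi.add_apply, h2]; rfl
  have h0 : adjForm s T f (0 : SlabL2 T) h = 0 := by
    have := key 1 0 0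
    rw [smul_zero, zero_add, one_mul] at this
    exact left_eq_add.1 this
  let ℓ : SlabL2 T →ₗ[ℂ] ℂ :=
    { toFun := fun g => adjForm s T f g h
      map_add' := fun g g' => by have := key 1 g g'; rwa [one_smul, one_mul] at this
      map_smul' := fun c g => by
        have := key c g 0
        rwa [add_zero, h0, add_zero] at this }
  obtain ⟨w, hw⟩ := exists_eq_integral (ℓ.mkContinuous C.toReal fun g => by
    have h1 := ENNReal.toReal_mono (by have := (Lp.memLp g).2.ne; finiteness) (hb g (Lp.memLp g))
    rwa [toReal_enorm, ENNReal.toReal_mul, ← Lp.norm_def] at h1)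
  refine ⟨w, fun g => (hw g).trans ?_⟩
  congr 1; ext z; ring

end Kac

namespace Kac

open ComplexConjugate

/-! ### The initial value -/

/-- Each m has at most three neighbours r, each with 2^{r/2} ≤ 2 · 2^{m/2}; hence 6. -/
theorem sum_neighbours_le (R : ℕ) (F : ℕ → ℝ≥0∞) :
    ∑ r ∈ Finset.range R, ∑ m ∈ Finset.Icc (r - 1) (r + 1), F m * rt r ≤ 6 * ∑' m, rt m * F m := by
  have h1 : ∀ r, ∑ m ∈ Finset.Icc (r - 1) (r + 1), F m * rt r =
      ∑' m, if m ∈ Finset.Icc (r - 1) (r + 1) then F m * rt r else 0 := fun r => by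
    rw [tsum_eq_sum (s := Finset.Icc (r - 1) (r + 1)) fun m hm => if_neg hm]
    exact Finset.sum_congr rfl fun m hm => (if_pos hm).symm
  simp only [h1]
  rw [← Summable.tsum_finsetSum fun _ _ => ENNReal.summable, ← ENNReal.tsum_mul_left]
  refine ENNReal.tsum_le_tsum fun m => ?_
  have h2 : ∀ r ∈ Finset.range R, (if m ∈ Finset.Icc (r - 1) (r + 1) then F m * rt r else 0) ≤
      if r ∈ Finset.Icc (m - 1) (m + 1) then F m * (2 * rt m) else 0 := fun r _ => by
    by_cases h : m ∈ Finset.Icc (r - 1) (r + 1)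
    · have h' : r ∈ Finset.Icc (m - 1) (m + 1) := by simp only [Finset.mem_Icc] at h ⊢; omega
      rw [if_pos h, if_pos h']
      refine mul_le_mul_right ?_ _
      rw [← rt_two, ← rt_add]
      exact rt_mono (by simp only [Finset.mem_Icc] at h'; omega)
    · rw [if_neg h]; exact zero_le
  refine (Finset.sum_le_sum h2).trans ?_
  rw [← Finset.sum_filter, Finset.sum_const, nsmul_eq_mul]
  have h3 : ((Finset.range R).filter (fun r => r ∈ Finset.Icc (m - 1) (m + 1))).card ≤ 3 := by
    refine (Finset.card_le_card (t := Finset.Icc (m - 1) (m + 1)) fun r hr =>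
      (Finset.mem_filter.1 hr).2).trans ?_
    rw [Nat.card_Icc]; omega
  calc _ ≤ (3 : ℝ≥0∞) * (F m * (2 * rt m)) := by gcongr; exact_mod_cast h3
    _ = _ := by ring

theorem integral_mul_blkX_eq_sum (P : LPCouple) (r : ℕ) {U W : ℝ × ℝ → ℂ} (hU : MemLp U 2 volume)
    (hW : MemLp W 2 volume) : ∫ z, U z * blkX P.reflect r W z =
      ∑ m ∈ Finset.Icc (r - 1) (r + 1), ∫ z, blkX P m U z * blkX P.reflect r W z := by
  have hR := memLp_blkX P.reflect r hW
  have i1 := fun m => integrable_mul_of_memLp (memLp_blkX P m hU) hR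
  rw [← integral_finsetSum _ fun m _ => i1 m, integral_prod_symm_xv (integrable_mul_of_memLp hU hR),
    integral_prod_symm_xv (integrable_finsetSum _ fun m _ => i1 m)]
  refine integral_congr_ae ?_
  filter_upwards [ae_memLp_slice_snd hU, ae_memLp_slice_snd hW] with v h1 h2
  rw [integral_finsetSum]
  · exact P.integral_mul_block_eq_sum r h1 h2
  · exact fun m _ => integrable_mul_of_memLp (P.memLp_block m h1) (P.reflect.memLp_block r h2)

/-- At a fixed time, B^{1/2}_{2,1} pairs with the norm sup_q 2^{-q/2}‖Δ_q ·‖. Only finitely many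
blocks of h are summed; the tail is O(2^{-R}) by smoothness of h in x. -/
theorem IsNice.enorm_integral_initial_le {h : ℝ × ℝ × ℝ → ℂ} (hh : IsNice h) (P : LPCouple) (t : ℝ)
    {U : ℝ × ℝ → ℂ} (hU : MemLp U 2 volume) {X : ℝ≥0∞}
    (hX : ∀ q, eLpNorm (blkX P.reflect q (sl h t)) 2 volume ≤ X * rt q) :
    ‖∫ z, U z * sl h t z‖ₑ ≤ X * (6 * ∑' p, rt p * eLpNorm (blkX P p U) 2 volume) := by
  set Q := P.reflect
  have hW := hh.memLp_sl t
  have hB := (hh.dx.memLp_sl t).2.ne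
  have hUt := hU.2.ne
  have h1 : ∀ R : ℕ, R ≠ 0 → ‖∫ z, U z * sl h t z‖ₑ ≤
      X * (6 * ∑' p, rt p * eLpNorm (blkX P p U) 2 volume) +
      ENNReal.ofReal (3 / 2 ^ R) * (eLpNorm U 2 volume * eLpNorm (sl (Kac.dx h) t) 2 volume) :=
      fun R hR => by
    have hD : MemLp (fun z => sl h t z - lowPassX Q R (sl h t) z) 2 volume :=
      hW.sub (memLp_lowPassX Q R hW)
    have ir : ∀ r ∈ Finset.range R, Integrable fun z => U z * blkX Q r (sl h t) z := fun r _ =>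
      integrable_mul_of_memLp hU (memLp_blkX Q r hW)
    have e : ∫ z, U z * sl h t z = ∑ r ∈ Finset.range R, (∫ z, U z * blkX Q r (sl h t) z) +
        ∫ z, U z * (sl h t z - lowPassX Q R (sl h t) z) := by
      rw [← integral_finsetSum _ ir, ← integral_add (integrable_finsetSum _ ir)
        (integrable_mul_of_memLp hU hD)]
      congr 1; ext z
      rw [lowPassX_eq, ← Finset.mul_sum]; ring
    rw [e]
    refine (enorm_add_le _ _).trans (add_le_add ?_ ?_)
    · refine (enorm_sum_le _ _).trans ?_
      calc _ ≤ ∑ r ∈ Finset.range R, ∑ m ∈ Finset.Icc (r - 1) (r + 1),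
            X * (eLpNorm (blkX P m U) 2 volume * rt r) := by
            refine Finset.sum_le_sum fun r _ => ?_
            rw [integral_mul_blkX_eq_sum P r hU hW]
            refine (enorm_sum_le _ _).trans (Finset.sum_le_sum fun m _ => ?_)
            refine (enorm_integral_mul_le (memLp_blkX P m hU).1 (memLp_blkX Q r hW).1).trans ?_
            calc _ ≤ eLpNorm (blkX P m U) 2 volume * (X * rt r) := by gcongr; exact hX r
              _ = _ := by ring
        _ ≤ _ := by
            simp only [← Finset.mul_sum]
            gcongr
            exact sum_neighbours_le R fun m => eLpNorm (blkX P m U) 2 volume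
    · refine (enorm_integral_mul_le hU.1 hD.1).trans ?_
      calc _ ≤ eLpNorm U 2 volume * (ENNReal.ofReal (3 / 2 ^ R) *
            eLpNorm (sl (Kac.dx h) t) 2 volume) := by
            gcongr; exact hh.eLpNorm_sub_lowPassX_le Q hR t
        _ = _ := by ring
  have h0 : Filter.Tendsto (fun R : ℕ => ENNReal.ofReal (3 / 2 ^ R)) Filter.atTop (nhds 0) := by
    rw [← ENNReal.ofReal_zero]
    refine ENNReal.tendsto_ofReal ?_
    have := (tendsto_pow_atTop_nhds_zero_of_lt_one (show (0 : ℝ) ≤ 1 / 2 by norm_num)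
      (by norm_num)).const_mul 3
    simpa [div_eq_mul_inv] using this
  have h2 := (ENNReal.Tendsto.mul_const (b := eLpNorm U 2 volume * eLpNorm (sl (Kac.dx h) t) 2 volume)
    h0 (Or.inr (ENNReal.mul_ne_top hUt hB))).const_add
    (X * (6 * ∑' p, rt p * eLpNorm (blkX P p U) 2 volume))
  rw [zero_mul, add_zero] at h2
  refine ge_of_tendsto h2 ?_
  filter_upwards [Filter.eventually_ne_atTop 0] with R hR using h1 R hR

/-! ### The dual norms -/

/-- The norm `sup_q 2^{-q/2} ‖Δ_q U‖_{L^p_T L²}`. -/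
noncomputable def dualNorm (Q : LPCouple) (T : ℝ) (p : ℝ≥0∞) (U : ℝ × ℝ × ℝ → ℂ) : ℝ≥0∞ :=
  ⨆ q, normT T p (blkT Q q U) / rt q

theorem normT_le_dualNorm (Q : LPCouple) (T : ℝ) (p : ℝ≥0∞) (U : ℝ × ℝ × ℝ → ℂ) (q : ℕ) :
    normT T p (blkT Q q U) ≤ dualNorm Q T p U * rt q := by
  rw [← ENNReal.div_le_iff (rt_ne_zero q) (rt_ne_top q)]
  exact le_iSup (fun q => normT T p (blkT Q q U) / rt q) q

theorem dualNorm_le_iff {Q : LPCouple} {T : ℝ} {p : ℝ≥0∞} {U : ℝ × ℝ × ℝ → ℂ} {C : ℝ≥0∞} :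
    dualNorm Q T p U ≤ C ↔ ∀ q, normT T p (blkT Q q U) ≤ C * rt q := by
  unfold dualNorm
  rw [iSup_le_iff]
  exact forall_congr' fun q => ENNReal.div_le_iff (rt_ne_zero q) (rt_ne_top q)

theorem ae_sl {T : ℝ} {p : ℝ × ℝ × ℝ → Prop} (h : ∀ᵐ z ∂slab T, p z) :
    ∀ᵐ t ∂timeM T, ∀ᵐ z : ℝ × ℝ, p (t, z) := by
  rw [slab_eq] at h
  exact Measure.ae_ae_of_ae_prod h

theorem ae_blkT_mul_add (Q : LPCouple) (q : ℕ) (c : ℂ) {T : ℝ} {U V W : ℝ × ℝ × ℝ → ℂ}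
    (hU : MemLp U 2 (slab T)) (hV : MemLp V 2 (slab T))
    (hW : W =ᵐ[slab T] fun z => c * U z + V z) :
    ∀ᵐ t ∂timeM T, ∀ᵐ z, sl (blkT Q q W) t z = c * sl (blkT Q q U) t z + sl (blkT Q q V) t z := by
  filter_upwards [ae_memLp_sl hU, ae_memLp_sl hV, ae_sl hW] with t h1 h2 h3
  have h4 : ∀ᵐ z : ℝ × ℝ, ∀ x, sl (blkT Q q W) t (x, z.2) =
      c * sl (blkT Q q U) t (x, z.2) + sl (blkT Q q V) t (x, z.2) := by
    refine Measure.quasiMeasurePreserving_snd.ae (p := fun v => ∀ x, sl (blkT Q q W) t (x, v) =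
      c * sl (blkT Q q U) t (x, v) + sl (blkT Q q V) t (x, v)) ?_
    have h5 : ∀ᵐ v : ℝ, ∀ᵐ x : ℝ, W (t, x, v) = c * U (t, x, v) + V (t, x, v) :=
      Measure.ae_ae_of_ae_prod (Measure.measurePreserving_swap.quasiMeasurePreserving.ae h3)
    filter_upwards [ae_memLp_slice_snd h1, ae_memLp_slice_snd h2, h5] with v h6 h7 h8 x
    have e := Q.block_add q (h6.const_mul c) h7 x
    rw [Q.block_const_mul] at e
    exact (congrFun (Q.block_congr q h8) x).trans e
  filter_upwards [h4] with z hz using hz z.1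

theorem normT_blkT_mul_add_le (Q : LPCouple) (q : ℕ) (c : ℂ) {T : ℝ} {p : ℝ≥0∞} (hp : 1 ≤ p)
    {U V W : ℝ × ℝ × ℝ → ℂ} (hU : MemLp U 2 (slab T)) (hV : MemLp V 2 (slab T))
    (hW : W =ᵐ[slab T] fun z => c * U z + V z) :
    normT T p (blkT Q q W) ≤ ‖c‖ₑ * normT T p (blkT Q q U) + normT T p (blkT Q q V) := by
  have mU := aemeasurable_eLpNorm_sl (memLp_blkT Q q hU).1
  have mV := aemeasurable_eLpNorm_sl (memLp_blkT Q q hV).1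
  have h1 : normT T p (blkT Q q W) ≤ eLpNorm ((fun t => ‖c‖ₑ * eLpNorm (sl (blkT Q q U) t) 2 volume) +
      fun t => eLpNorm (sl (blkT Q q V) t) 2 volume) p (timeM T) := by
    refine eLpNorm_mono_enorm_ae ?_
    filter_upwards [ae_blkT_mul_add Q q c hU hV hW, ae_memLp_sl (memLp_blkT Q q hU),
      ae_memLp_sl (memLp_blkT Q q hV)] with t ht h2 h3
    rw [enorm_eq_self, enorm_eq_self, Pi.add_apply, eLpNorm_congr_ae ht, ← eLpNorm_const_smul]
    exact eLpNorm_add_le (h2.1.const_smul c) h3.1 (by norm_num)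
  refine h1.trans ((eLpNorm_add_le (mU.const_mul _).aestronglyMeasurable mV.aestronglyMeasurable
    hp).trans ?_)
  refine add_le_add ?_ le_rfl
  exact eLpNorm_le_mul_eLpNorm_of_ae_le_mul'' p mU.aestronglyMeasurable
    (Filter.Eventually.of_forall fun t => le_rfl)

theorem dualNorm_mul_add_le (Q : LPCouple) (c : ℂ) {T : ℝ} {p : ℝ≥0∞} (hp : 1 ≤ p)
    {U V W : ℝ × ℝ × ℝ → ℂ} (hU : MemLp U 2 (slab T)) (hV : MemLp V 2 (slab T))
    (hW : W =ᵐ[slab T] fun z => c * U z + V z) :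
    dualNorm Q T p W ≤ ‖c‖ₑ * dualNorm Q T p U + dualNorm Q T p V := by
  rw [dualNorm_le_iff]
  intro q
  refine (normT_blkT_mul_add_le Q q c hp hU hV hW).trans ?_
  rw [add_mul, mul_assoc]
  gcongr <;> exact normT_le_dualNorm _ _ _ _ _

/-- Hölder in time on a bounded interval and 2^{-q/2} ≤ 1. Functionals bounded by the dual norm are
therefore continuous on L² and represented by L² functions. -/
theorem exists_dualNorm_le (Q : LPCouple) (T : ℝ) {p : ℝ≥0∞} (hp2 : p ≤ 2) :
    ∃ C : ℝ≥0∞, C ≠ ⊤ ∧ ∀ U, MemLp U 2 (slab T) → dualNorm Q T p U ≤ C * eLpNorm U 2 (slab T) := by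
  rcases eq_or_ne p 0 with rfl | hp0
  · refine ⟨0, by simp, fun U hU => ?_⟩
    rw [dualNorm_le_iff]; intro q; simp [normT]
  have hexp : 0 ≤ 1 / p.toReal - 1 / (2 : ℝ≥0∞).toReal := by
    have h1 : p.toReal ≤ (2 : ℝ≥0∞).toReal := ENNReal.toReal_mono (by norm_num) hp2
    have h2 : 0 < p.toReal := ENNReal.toReal_pos hp0 (ne_top_of_le_ne_top (by norm_num) hp2)
    rw [sub_nonneg]
    exact one_div_le_one_div_of_le h2 h1
  refine ⟨timeM T univ ^ (1 / p.toReal - 1 / (2 : ℝ≥0∞).toReal),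
    ENNReal.rpow_ne_top_of_nonneg hexp (measure_ne_top _ _), fun U hU => ?_⟩
  rw [dualNorm_le_iff]
  intro q
  have mU := aemeasurable_eLpNorm_sl (memLp_blkT Q q hU).1
  refine (eLpNorm_le_eLpNorm_mul_rpow_measure_univ hp2 mU.aestronglyMeasurable).trans ?_
  rw [mul_comm]
  refine le_trans (mul_le_mul_right ?_ _) (le_mul_of_one_le_right' (one_le_rt q))
  have h1 : eLpNorm (fun t => eLpNorm (sl (blkT Q q U) t) 2 volume) 2 (timeM T) ≤ normT T 2 U :=
    eLpNorm_mono_enorm_ae (by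
      filter_upwards [eLpNorm_sl_blkT_le Q q hU] with t ht
      simpa using ht)
  exact h1.trans (normT_two hU.1).le

/-- The dual norm as a seminorm on `L²`. -/
noncomputable def dualSeminorm (Q : LPCouple) (T : ℝ) (p : ℝ≥0∞) (hp : 1 ≤ p) (hp2 : p ≤ 2) :
    Seminorm ℂ (SlabL2 T) := by
  have hfin : ∀ U : SlabL2 T, dualNorm Q T p U ≠ ⊤ := fun U => by
    obtain ⟨C, hC, hb⟩ := exists_dualNorm_le Q T hp2
    exact ne_top_of_le_ne_top (ENNReal.mul_ne_top hC (Lp.memLp U).2.ne) (hb U (Lp.memLp U))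
  have h0 : dualNorm Q T p (0 : SlabL2 T) = 0 := by
    obtain ⟨C, hC, hb⟩ := exists_dualNorm_le Q T hp2
    have h := hb _ (Lp.memLp (0 : SlabL2 T))
    rw [eLpNorm_congr_ae (Lp.coeFn_zero ℂ 2 (slab T)), eLpNorm_zero, mul_zero] at h
    exact le_antisymm h zero_le
  refine Seminorm.ofSMulLE (fun U => (dualNorm Q T p U).toReal) (by rw [h0]; rfl) (fun U V => ?_)
    (fun c U => ?_)
  · rw [← ENNReal.toReal_add (hfin U) (hfin V)]
    refine ENNReal.toReal_mono (ENNReal.add_ne_top.2 ⟨hfin U, hfin V⟩) ?_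
    have h := dualNorm_mul_add_le Q 1 hp (Lp.memLp U) (Lp.memLp V) (W := (U + V : SlabL2 T)) (by
      filter_upwards [Lp.coeFn_add U V] with z hz
      rw [hz, one_mul]; rfl)
    simpa using h
  · rw [← toReal_enorm, ← ENNReal.toReal_mul]
    refine ENNReal.toReal_mono (ENNReal.mul_ne_top enorm_ne_top (hfin U)) ?_
    have h := dualNorm_mul_add_le Q c hp (Lp.memLp U) (Lp.memLp (0 : SlabL2 T))
      (W := (c • U : SlabL2 T)) (by
      filter_upwards [Lp.coeFn_smul c U, Lp.coeFn_zero ℂ 2 (slab T)] with z hz h2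
      rw [hz, h2]; simp)
    rwa [h0, add_zero] at h

theorem ofReal_dualSeminorm (Q : LPCouple) (T : ℝ) (p : ℝ≥0∞) (hp : 1 ≤ p) (hp2 : p ≤ 2)
    (U : SlabL2 T) : ENNReal.ofReal (dualSeminorm Q T p hp hp2 U) = dualNorm Q T p U := by
  obtain ⟨C, hC, hb⟩ := exists_dualNorm_le Q T hp2
  exact ENNReal.ofReal_toReal
    (ne_top_of_le_ne_top (ENNReal.mul_ne_top hC (Lp.memLp U).2.ne) (hb U (Lp.memLp U)))

end Kac

namespace Kac

open ComplexConjugate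

/-! ### Existence by duality -/

theorem isOscillatorPower_iff {T r : ℝ} {c d : ℝ × ℝ × ℝ → ℂ} : IsOscillatorPower T r c d ↔
    ∀ᵐ z ∂timeX T, ∀ n : ℕ, cfT n d z = ((((n : ℝ) + 1 / 2) ^ r : ℝ) : ℂ) * cfT n c z := by
  rw [timeX_eq]; rfl

theorem IsOscillatorPower.mul_add {T r : ℝ} {c c' c'' d d' d'' : ℝ × ℝ × ℝ → ℂ} (a : ℂ)
    (h : IsOscillatorPower T r c d) (h' : IsOscillatorPower T r c' d')
    (hc : MemLp c 2 (slab T)) (hc' : MemLp c' 2 (slab T)) (hd : MemLp d 2 (slab T))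
    (hd' : MemLp d' 2 (slab T)) (ec : c'' =ᵐ[slab T] fun z => a * c z + c' z)
    (ed : d'' =ᵐ[slab T] fun z => a * d z + d' z) : IsOscillatorPower T r c'' d'' := by
  rw [isOscillatorPower_iff] at h h' ⊢
  have h1 := ae_all_iff.2 fun n => cfT_mul_add_ae n a hc hc' ec
  have h2 := ae_all_iff.2 fun n => cfT_mul_add_ae n a hd hd' ed
  filter_upwards [h, h', h1, h2] with z h3 h4 h5 h6 n
  rw [h5, h6, h3, h4]; ring

theorem isOscillatorPower_zero (T r : ℝ) :
    IsOscillatorPower T r (0 : SlabL2 T) (0 : SlabL2 T) := by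
  rw [isOscillatorPower_iff]
  filter_upwards [ae_velocity (Lp.coeFn_zero ℂ 2 (slab T))] with z hz n
  have h : cfT n (0 : SlabL2 T) z = 0 := by
    rw [cfT, coef_congr n hz]
    simp [coef]
  rw [h, mul_zero]

theorem isNice_zero : IsNice fun _ => 0 := ⟨contDiff_const, HasCompactSupport.zero⟩

theorem coeFn_smul_add {T : ℝ} (c : ℂ) (U V : SlabL2 T) :
    (c • U + V : SlabL2 T) =ᵐ[slab T] fun z => c * U z + V z := by
  filter_upwards [Lp.coeFn_add (c • U) V, Lp.coeFn_smul c U] with z h1 h2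
  rw [h1, Pi.add_apply, h2]; rfl

theorem integral_mul_smul_add {T : ℝ} (c : ℂ) (g : SlabL2 T) (U V : SlabL2 T) :
    ∫ z, g z * (c • U + V : SlabL2 T) z ∂slab T =
      c * ∫ z, g z * U z ∂slab T + ∫ z, g z * V z ∂slab T := by
  rw [← integral_const_mul, ← integral_add
    ((integrable_mul_of_memLp (Lp.memLp g) (Lp.memLp U)).const_mul c)
    (integrable_mul_of_memLp (Lp.memLp g) (Lp.memLp V))]
  refine integral_congr_ae ?_
  filter_upwards [coeFn_smul_add c U V] with z hz
  rw [hz]; ring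

/-- The Hahn-Banach theorem for a functional given by a linear relation. -/
theorem exists_linearMap_of_relation {E : Type*} [AddCommGroup E] [Module ℂ E] {S : Set (E × ℂ)}
    (h0 : (0 : E × ℂ) ∈ S) (h : ∀ (c : ℂ), ∀ x ∈ S, ∀ y ∈ S, c • x + y ∈ S) (p : Seminorm ℂ E)
    (hp : ∀ x ∈ S, ‖x.2‖ ≤ p x.1) :
    ∃ ℓ : E →ₗ[ℂ] ℂ, (∀ x ∈ S, ℓ x.1 = x.2) ∧ ∀ x, ‖ℓ x‖ ≤ p x := by
  let M : Submodule ℂ (E × ℂ) :=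
    { carrier := S
      zero_mem' := h0
      add_mem' := fun {x y} hx hy => by simpa using h 1 x hx y hy
      smul_mem' := fun c x hx => by simpa using h c x hx 0 h0 }
  -- The seminorm bound makes the relation single valued; no separate uniqueness statement for the
  -- adjoint problem is required.
  have hgraph : ∀ x ∈ M, x.1 = 0 → x.2 = 0 := fun x hx h0 => by
    have h := hp x hx
    rw [h0, map_zero] at h
    exact norm_le_zero_iff.1 h
  have hmem := M.mem_graph_toLinearPMap hgraph
  obtain ⟨ℓ, hℓ, hℓp⟩ := Module.Dual.exists_extension_of_le_seminorm M.toLinearPMap.domain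
    M.toLinearPMap.toFun (p := p) fun x => hp _ (hmem x)
  refine ⟨ℓ, fun x hx => ?_, hℓp⟩
  have h1 : x.1 ∈ M.toLinearPMap.domain := ⟨x, hx, rfl⟩
  refine (hℓ ⟨x.1, h1⟩).trans ?_
  have h2 := M.sub_mem (hmem ⟨x.1, h1⟩) hx
  exact sub_eq_zero.1 (hgraph _ h2 (sub_self x.1))

/-- The relation between the data of the adjoint problem and the initial value functional. -/
def IsAdjointDatum (s T : ℝ) (f : ℝ × ℝ × ℝ → ℂ) (g₀ : ℝ × ℝ → ℂ)
    (x : (SlabL2 T × SlabL2 T) × ℂ) : Prop :=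
  ∃ (h : ℝ × ℝ × ℝ → ℂ) (d : SlabL2 T), IsNice h ∧ (∀ z, h (T, z) = 0) ∧
    IsOscillatorPower T (s / 2) x.1.2 d ∧
    (∀ g : SlabL2 T, adjForm s T f g h = ∫ z, g z * (x.1.1 + d : SlabL2 T) z ∂slab T) ∧
    x.2 = ∫ z, g₀ z * sl h 0 z

theorem adjForm_zero_right {s : ℝ} (hs0 : 0 < s) (hs1 : s < 1) {T : ℝ} {f g : ℝ × ℝ × ℝ → ℂ}
    (hf : MemLp f 2 (slab T)) (hg : MemLp g 2 (slab T)) : adjForm s T f g (fun _ => 0) = 0 := by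
  have h := adjForm_mul_add_right hs0 hs1 1 hf hg isNice_zero isNice_zero
  simp only [mul_zero, add_zero, one_mul] at h
  exact left_eq_add.1 h

theorem IsAdjointDatum.smul_add {s : ℝ} (hs0 : 0 < s) (hs1 : s < 1) {T : ℝ}
    {f : ℝ × ℝ × ℝ → ℂ} {g₀ : ℝ × ℝ → ℂ} (hf : MemLp f 2 (slab T)) (hg₀ : MemLp g₀ 2 volume)
    (c : ℂ) {x y : (SlabL2 T × SlabL2 T) × ℂ} (hx : IsAdjointDatum s T f g₀ x)
    (hy : IsAdjointDatum s T f g₀ y) : IsAdjointDatum s T f g₀ (c • x + y) := by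
  obtain ⟨h, d, hh, hT, hd, hB, hL⟩ := hx
  obtain ⟨k, e, hk, kT, he, kB, kL⟩ := hy
  refine ⟨fun z => c * h z + k z, c • d + e, (hh.const_mul c).add hk,
    fun z => by simp [hT, kT], ?_, fun g => ?_, ?_⟩
  · exact hd.mul_add c he (Lp.memLp _) (Lp.memLp _) (Lp.memLp _) (Lp.memLp _)
      (coeFn_smul_add c _ _) (coeFn_smul_add c _ _)
  · rw [adjForm_mul_add_right hs0 hs1 c hf (Lp.memLp g) hh hk, hB g, kB g, ← integral_mul_smul_add]
    have e1 : (c • x + y).1.1 + (c • d + e) = c • (x.1.1 + d) + (y.1.1 + e) := by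
      rw [_root_.smul_add c x.1.1 d]
      exact add_add_add_comm _ _ _ _
    rw [e1]
  · have e1 : (c • x + y).2 = c * x.2 + y.2 := rfl
    rw [e1, hL, kL, ← integral_const_mul, ← integral_add
      ((integrable_mul_of_memLp hg₀ (hh.memLp_sl 0)).const_mul c)
      (integrable_mul_of_memLp hg₀ (hk.memLp_sl 0))]
    congr 1; ext z
    simp only [sl]; ring

theorem isAdjointDatum_zero {s : ℝ} (hs0 : 0 < s) (hs1 : s < 1) {T : ℝ}
    {f : ℝ × ℝ × ℝ → ℂ} {g₀ : ℝ × ℝ → ℂ} (hf : MemLp f 2 (slab T)) :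
    IsAdjointDatum s T f g₀ 0 := by
  refine ⟨fun _ => 0, 0, isNice_zero, fun _ => rfl, isOscillatorPower_zero T _, fun g => ?_, ?_⟩
  · rw [adjForm_zero_right hs0 hs1 hf (Lp.memLp g), eq_comm]
    have e : ((0 : (SlabL2 T × SlabL2 T) × ℂ).1.1 + 0 : SlabL2 T) = 0 := add_zero _
    rw [e]
    refine (integral_congr_ae (g := fun _ => (0 : ℂ)) ?_).trans (by simp)
    filter_upwards [Lp.coeFn_zero ℂ 2 (slab T)] with z hz
    rw [hz]; simp
  · simp [sl]

/-- The constant in the duality estimate. -/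
noncomputable def dualConst (P : LPCouple) (g₀ : ℝ × ℝ → ℂ) : ℝ≥0∞ :=
  600 * ∑' p, rt p * eLpNorm (blkX P p g₀) 2 volume

/-- The adjoint estimate at t = 0 paired with g₀. The constant 600 in `dualConst` is 100 from the
estimate times 6 from the pairing. -/
theorem IsAdjointDatum.enorm_le {s : ℝ} (hs0 : 0 < s) (hs1 : s < 1) (P : LPCouple) {T : ℝ}
    (hT0 : 0 < T) {f : ℝ × ℝ × ℝ → ℂ} {g₀ : ℝ × ℝ → ℂ} (hf : MemLp f 2 (slab T))
    (hsmall : ENNReal.ofReal (6 * momentConst s) *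
      (19 * ∑' p, rt p * normT T ⊤ (blkT P p f)) ≤ ENNReal.ofReal (1 / 2400))
    (hg₀ : MemLp g₀ 2 volume) {x : (SlabL2 T × SlabL2 T) × ℂ} (hx : IsAdjointDatum s T f g₀ x) :
    ‖x.2‖ₑ ≤ dualConst P g₀ * (dualNorm P.reflect T 1 x.1.1 + dualNorm P.reflect T 2 x.1.2) := by
  obtain ⟨h, d, hh, hT, hd, hB, hL⟩ := hx
  -- The identity is given for elements of L² only; it extends to all square integrable
  -- representatives because `adjForm` ignores null sets in g.
  have hB' : ∀ g, MemLp g 2 (slab T) →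
      adjForm s T f g h = ∫ z, g z * (x.1.1 z + d z) ∂slab T := fun g hg => by
    have h1 : adjForm s T f g h = adjForm s T f (hg.toLp g) h := by
      have e := adjForm_mul_add_left hs0 hs1 1 hf (Lp.memLp (hg.toLp g)) (g' := fun _ => 0) (k := g)
        MemLp.zero' (by filter_upwards [hg.coeFn_toLp] with z hz; rw [hz]; ring) hh
      have e0 := adjForm_mul_add_left hs0 hs1 1 hf (g := fun _ => 0) (g' := fun _ => 0)
        (k := fun _ => 0) MemLp.zero' MemLp.zero' (by
          filter_upwards with z; ring) hh
      rw [one_mul] at e e0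
      rw [e, left_eq_add.1 e0, add_zero]
    rw [h1, hB]
    refine integral_congr_ae ?_
    filter_upwards [hg.coeFn_toLp, Lp.coeFn_add x.1.1 d] with z h2 h3
    rw [h2, h3]; rfl
  have hE : ∀ q, eLpNorm (blkX P.reflect q (sl h 0)) 2 volume ≤
      100 * (dualNorm P.reflect T 1 x.1.1 + dualNorm P.reflect T 2 x.1.2) * rt q := fun q =>
    hh.eLpNorm_blkX_le_of_adjForm hs0 hs1 P hT0 hf hsmall hT (Lp.memLp x.1.1) (Lp.memLp x.1.2)
      (Lp.memLp d) hd hB' (normT_le_dualNorm _ _ _ _) (normT_le_dualNorm _ _ _ _) q ⟨le_rfl, hT0.le⟩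
  rw [hL]
  refine (hh.enorm_integral_initial_le P 0 hg₀ hE).trans (le_of_eq ?_)
  rw [dualConst]; ring

theorem dualNorm_zero (Q : LPCouple) (T : ℝ) {r : ℝ≥0∞} (hr : r ≤ 2) :
    dualNorm Q T r (0 : SlabL2 T) = 0 := by
  obtain ⟨C, hC, hb⟩ := exists_dualNorm_le Q T hr
  have h := hb _ (Lp.memLp (0 : SlabL2 T))
  rw [eLpNorm_congr_ae (Lp.coeFn_zero ℂ 2 (slab T)), eLpNorm_zero, mul_zero] at h
  exact le_antisymm h zero_le

theorem exists_eq_integral_of_dualNorm (Q : LPCouple) {T : ℝ} {K : ℝ≥0∞} (hK : K ≠ ⊤)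
    {r : ℝ≥0∞} (hr : r ≤ 2) (L : SlabL2 T →ₗ[ℂ] ℂ) (hL : ∀ a, ‖L a‖ₑ ≤ K * dualNorm Q T r a) :
    ∃ w : SlabL2 T, ∀ a : SlabL2 T, L a = ∫ z, w z * a z ∂slab T := by
  obtain ⟨C, hC, hb⟩ := exists_dualNorm_le Q T hr
  refine exists_eq_integral (L.mkContinuous (K * C).toReal fun a => ?_)
  have h1 := ENNReal.toReal_mono (by have := (Lp.memLp a).2.ne; finiteness)
    ((hL a).trans (mul_le_mul_right (hb a (Lp.memLp a)) K))
  rwa [← mul_assoc, toReal_enorm, ENNReal.toReal_mul, ← Lp.norm_def] at h1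

/-- The Hahn-Banach extension of the initial value functional. -/
theorem exists_functional {s : ℝ} (hs0 : 0 < s) (hs1 : s < 1) (P : LPCouple) {T : ℝ}
    (hT0 : 0 < T) {f : ℝ × ℝ × ℝ → ℂ} {g₀ : ℝ × ℝ → ℂ} (hf : MemLp f 2 (slab T))
    (hsmall : ENNReal.ofReal (6 * momentConst s) *
      (19 * ∑' p, rt p * normT T ⊤ (blkT P p f)) ≤ ENNReal.ofReal (1 / 2400))
    (hg₀ : MemLp g₀ 2 volume) (hK : dualConst P g₀ ≠ ⊤) :
    ∃ ℓ : SlabL2 T × SlabL2 T →ₗ[ℂ] ℂ, (∀ x, IsAdjointDatum s T f g₀ x → ℓ x.1 = x.2) ∧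
      ∀ x, ‖ℓ x‖ₑ ≤ dualConst P g₀ *
        (dualNorm P.reflect T 1 x.1 + dualNorm P.reflect T 2 x.2) := by
  set Q := P.reflect
  set K := dualConst P g₀ with hKdef
  set p : Seminorm ℂ (SlabL2 T × SlabL2 T) := K.toNNReal •
    ((dualSeminorm Q T 1 le_rfl (by norm_num)).comp (LinearMap.fst ℂ (SlabL2 T) (SlabL2 T)) +
      (dualSeminorm Q T 2 (by norm_num) le_rfl).comp (LinearMap.snd ℂ (SlabL2 T) (SlabL2 T))) with hpdef
  have hp : ∀ x, ENNReal.ofReal (p x) = K * (dualNorm Q T 1 x.1 + dualNorm Q T 2 x.2) := fun x => by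
    have e : p x = K.toReal * (dualSeminorm Q T 1 le_rfl (by norm_num) x.1 +
      dualSeminorm Q T 2 (by norm_num) le_rfl x.2) := rfl
    rw [e, ENNReal.ofReal_mul ENNReal.toReal_nonneg, ENNReal.ofReal_toReal hK,
      ENNReal.ofReal_add (apply_nonneg _ _) (apply_nonneg _ _), ofReal_dualSeminorm,
      ofReal_dualSeminorm]
  clear_value p
  obtain ⟨ℓ, hℓ, hℓp⟩ := exists_linearMap_of_relation (S := {x | IsAdjointDatum s T f g₀ x})
    (isAdjointDatum_zero hs0 hs1 hf) (fun c x hx y hy => hx.smul_add hs0 hs1 hf hg₀ c hy) p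
    (fun x hx => by
      have h := hx.enorm_le hs0 hs1 P hT0 hf hsmall hg₀
      rw [← hp, ← ofReal_norm] at h
      exact (ENNReal.ofReal_le_ofReal_iff (apply_nonneg p x.1)).1 h)
  refine ⟨ℓ, hℓ, fun x => ?_⟩
  rw [← hp, ← ofReal_norm]
  exact ENNReal.ofReal_le_ofReal (hℓp x)

/-- The extended functional splits into its two components, represented by w and w'. Suitable data
in the relation then read off the equation and the link between w and w'. -/
theorem exists_dual_solution {s : ℝ} (hs0 : 0 < s) (hs1 : s < 1) (P : LPCouple) {T : ℝ}
    (hT0 : 0 < T) {f : ℝ × ℝ × ℝ → ℂ} {g₀ : ℝ × ℝ → ℂ} (hf : MemLp f 2 (slab T))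
    (hsmall : ENNReal.ofReal (6 * momentConst s) *
      (19 * ∑' p, rt p * normT T ⊤ (blkT P p f)) ≤ ENNReal.ofReal (1 / 2400))
    (hg₀ : MemLp g₀ 2 volume) (hK : dualConst P g₀ ≠ ⊤) :
    ∃ w w' : SlabL2 T,
      (∀ h, IsNice h → (∀ z, h (T, z) = 0) → adjForm s T f w h = ∫ z, g₀ z * sl h 0 z) ∧
      (∀ c d : SlabL2 T, IsOscillatorPower T (s / 2) c d →
        ∫ z, w' z * c z ∂slab T = ∫ z, w z * d z ∂slab T) ∧
      (∀ a : SlabL2 T, ‖∫ z, w z * a z ∂slab T‖ₑ ≤ dualConst P g₀ * dualNorm P.reflect T 1 a) ∧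
      (∀ c : SlabL2 T, ‖∫ z, w' z * c z ∂slab T‖ₑ ≤ dualConst P g₀ * dualNorm P.reflect T 2 c) := by
  obtain ⟨ℓ, hℓM, hℓe⟩ := exists_functional hs0 hs1 P hT0 hf hsmall hg₀ hK
  have hℓ1 : ∀ a : SlabL2 T, ‖ℓ (a, 0)‖ₑ ≤ dualConst P g₀ * dualNorm P.reflect T 1 a := fun a => by
    have h := hℓe (a, 0)
    rwa [dualNorm_zero _ _ le_rfl, add_zero] at h
  have hℓ2 : ∀ c : SlabL2 T, ‖ℓ (0, c)‖ₑ ≤ dualConst P g₀ * dualNorm P.reflect T 2 c := fun c => by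
    have h := hℓe (0, c)
    rwa [dualNorm_zero _ _ (by norm_num), zero_add] at h
  obtain ⟨w, hw⟩ := exists_eq_integral_of_dualNorm P.reflect hK (by norm_num)
    (ℓ ∘ₗ LinearMap.inl ℂ (SlabL2 T) (SlabL2 T)) hℓ1
  obtain ⟨w', hw'⟩ := exists_eq_integral_of_dualNorm P.reflect hK le_rfl
    (ℓ ∘ₗ LinearMap.inr ℂ (SlabL2 T) (SlabL2 T)) hℓ2
  have hw1 : ∀ a : SlabL2 T, ℓ (a, 0) = ∫ z, w z * a z ∂slab T := hw
  have hw2 : ∀ a : SlabL2 T, ℓ (0, a) = ∫ z, w' z * a z ∂slab T := hw'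
  refine ⟨w, w', fun h hh hT => ?_, fun c d hcd => ?_, fun a => ?_, fun c => ?_⟩
  -- Data with c = d = 0, where a is the Riesz representative of the adjoint operator applied to h.
  · obtain ⟨a, ha⟩ := hh.exists_adjForm_eq_integral hs0 hs1 hf
    have h1 := hℓM ((a, 0), ∫ z, g₀ z * sl h 0 z) ⟨h, 0, hh, hT,
      isOscillatorPower_zero T _, fun g => by
        have e : (a + 0 : SlabL2 T) = a := add_zero _
        rw [ha g, e], rfl⟩
    rw [ha w, ← hw1 a]
    exact h1
  -- The datum h = 0 with a = -d: the functional vanishes on (-d, c), which is the dual form of w' =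
  -- ℋ^{s/2}w.
  · have h1 := hℓM ((-d, c), 0) ⟨fun _ => 0, d, isNice_zero, fun _ => rfl, hcd,
      fun g => by
        rw [adjForm_zero_right hs0 hs1 hf (Lp.memLp g), eq_comm]
        have e : (-d + d : SlabL2 T) = 0 := neg_add_cancel _
        rw [e]
        refine (integral_congr_ae (g := fun _ => (0 : ℂ)) ?_).trans (by simp)
        filter_upwards [Lp.coeFn_zero ℂ 2 (slab T)] with z hz
        rw [hz]; simp, by simp [sl]⟩
    have e : ((-d, c) : SlabL2 T × SlabL2 T) = -(d, 0) + (0, c) := by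
      ext1 <;> simp
    have h4 : ℓ (-d, c) = 0 := h1
    rw [e, map_add, map_neg, hw1, hw2] at h4
    exact (neg_add_eq_zero.1 h4).symm
  · rw [← hw1 a]; exact hℓ1 a
  · rw [← hw2 c]; exact hℓ2 c

end Kac

namespace Kac

open ComplexConjugate

/-! ### Recovery of the norms from the dual estimates -/

theorem normT_blkT_le (Q : LPCouple) (q : ℕ) {T : ℝ} (p : ℝ≥0∞) {U : ℝ × ℝ × ℝ → ℂ}
    (hU : MemLp U 2 (slab T)) : normT T p (blkT Q q U) ≤ normT T p U :=
  eLpNorm_mono_enorm_ae (by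
    filter_upwards [eLpNorm_sl_blkT_le Q q hU] with t ht
    simpa using ht)

theorem normT_blkT_blkT_eq_zero (Q : LPCouple) {q r : ℕ} (hqr : q + 2 ≤ r ∨ r + 2 ≤ q) {T : ℝ}
    (p : ℝ≥0∞) {U : ℝ × ℝ × ℝ → ℂ} (hU : MemLp U 2 (slab T)) :
    normT T p (blkT Q q (blkT Q r U)) = 0 := by
  have h1 : (fun t => eLpNorm (sl (blkT Q q (blkT Q r U)) t) 2 volume) =ᵐ[timeM T] fun _ => 0 := by
    filter_upwards [ae_memLp_sl hU] with t ht
    have h2 : ∀ᵐ z : ℝ × ℝ, ∀ x, sl (blkT Q q (blkT Q r U)) t (x, z.2) = 0 := by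
      refine Measure.quasiMeasurePreserving_snd.ae
        (p := fun v => ∀ x, sl (blkT Q q (blkT Q r U)) t (x, v) = 0) ?_
      filter_upwards [ae_memLp_slice_snd ht] with v hv x
      exact Q.block_block_eq_zero hqr hv x
    have h3 : sl (blkT Q q (blkT Q r U)) t =ᵐ[volume] fun _ => 0 := by
      filter_upwards [h2] with z hz using hz z.1
    rw [eLpNorm_congr_ae h3]
    exact eLpNorm_zero
  rw [normT, eLpNorm_congr_ae h1]
  exact eLpNorm_zero

theorem normT_blkT_sum_le (Q : LPCouple) (r : ℕ) {T : ℝ} {p : ℝ≥0∞} (hp : 1 ≤ p)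
    {V : ℕ → ℝ × ℝ × ℝ → ℂ} (hV : ∀ q, MemLp (V q) 2 (slab T)) (c : ℕ → ℂ) (N : ℕ) :
    normT T p (blkT Q r fun z => ∑ q ∈ Finset.range N, c q * V q z) ≤
      ∑ q ∈ Finset.range N, ‖c q‖ₑ * normT T p (blkT Q r (V q)) := by
  induction N with
  | zero =>
    have h : (fun t => eLpNorm (sl (blkT Q r fun _ => 0) t) 2 volume) = fun _ => 0 := by
      ext t
      have : sl (blkT Q r fun _ => 0) t = fun _ => 0 := by
        ext z; simp [sl, blkT, LPCouple.block]
      rw [this]; exact eLpNorm_zero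
    simp only [Finset.range_zero, Finset.sum_empty]
    rw [normT, h]
    exact eLpNorm_zero.le
  | succ n ih =>
    have h1 : MemLp (fun z => ∑ q ∈ Finset.range n, c q * V q z) 2 (slab T) :=
      memLp_finsetSum _ fun q _ => (hV q).const_mul (c q)
    rw [Finset.sum_range_succ]
    refine (normT_blkT_mul_add_le Q r (c n) hp (hV n) h1 (Filter.Eventually.of_forall fun z => ?_)).trans
      ((add_le_add le_rfl ih).trans (add_comm _ _).le)
    beta_reduce
    rw [Finset.sum_range_succ, add_comm]

theorem sum_neighbours_rt_le (N r : ℕ) :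
    ∑ q ∈ Finset.range N, (if q ∈ Finset.Icc (r - 1) (r + 1) then rt q else 0) ≤ 6 * rt r := by
  rw [← Finset.sum_filter]
  have h3 : ((Finset.range N).filter (fun q => q ∈ Finset.Icc (r - 1) (r + 1))).card ≤ 3 := by
    refine (Finset.card_le_card (t := Finset.Icc (r - 1) (r + 1)) fun q hq =>
      (Finset.mem_filter.1 hq).2).trans ?_
    rw [Nat.card_Icc]; omega
  calc _ ≤ ∑ q ∈ (Finset.range N).filter (fun q => q ∈ Finset.Icc (r - 1) (r + 1)), 2 * rt r := by
        refine Finset.sum_le_sum fun q hq => ?_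
        have h := (Finset.mem_filter.1 hq).2
        rw [← rt_two, ← rt_add]
        exact rt_mono (by simp only [Finset.mem_Icc] at h; omega)
    _ ≤ 3 * (2 * rt r) := by
        rw [Finset.sum_const, nsmul_eq_mul]
        gcongr
        exact_mod_cast h3
    _ = _ := by ring

/-- `U` has a near-optimal dual function in `L^p_T L²`, for every level below its norm in
`L^{p'}_T L²`. -/
def HasDual (T : ℝ) (p p' : ℝ≥0∞) (U : ℝ × ℝ × ℝ → ℂ) : Prop :=
  ∀ m, m < normT T p' U → ∃ φ : ℝ × ℝ × ℝ → ℂ, MemLp φ 2 (slab T) ∧ normT T p φ ≤ 1 ∧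
    m.toReal ≤ (∫ z, U z * φ z ∂slab T).re

theorem exists_seq_tendsto_ennreal (b : ℝ≥0∞) : ∃ u : ℕ → ℝ≥0∞, (∀ k, u k < b ∨ u k = 0) ∧
    Filter.Tendsto u Filter.atTop (nhds b) := by
  rcases eq_or_ne b 0 with rfl | hb
  · exact ⟨fun _ => 0, fun _ => Or.inr rfl, tendsto_const_nhds⟩
  · obtain ⟨u, -, h1, h2⟩ := exists_seq_strictMono_tendsto' (pos_iff_ne_zero.2 hb)
    exact ⟨u, fun k => Or.inl (h1 k).2, h2⟩

/-- The functional is tested on Σ_q 2^{q/2} Δ_q φ_q with φ_q nearly optimal for Δ_q w. The pairing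
adds up the weighted norms, while almost orthogonality keeps the sup-type dual norm of this sum
bounded. -/
theorem sum_rt_mul_le_of_dual (P : LPCouple) {T : ℝ} {p p' : ℝ≥0∞} (hp : 1 ≤ p) {w : SlabL2 T}
    {K : ℝ≥0∞}
    (hK : ∀ a : SlabL2 T, ‖∫ z, w z * a z ∂slab T‖ₑ ≤ K * dualNorm P.reflect T p a)
    (hw : ∀ q, HasDual T p p' (blkT P q w)) (N : ℕ) {m : ℕ → ℝ≥0∞}
    (hm : ∀ q, m q < normT T p' (blkT P q w) ∨ m q = 0) :
    ∑ q ∈ Finset.range N, rt q * m q ≤ 6 * K := by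
  set Q := P.reflect
  have hW := Lp.memLp w
  have hex : ∀ q, ∃ φ : ℝ × ℝ × ℝ → ℂ, MemLp φ 2 (slab T) ∧ normT T p φ ≤ 1 ∧
      (m q).toReal ≤ (∫ z, blkT P q w z * φ z ∂slab T).re := fun q => by
    rcases hm q with h | h
    · exact hw q _ h
    · refine ⟨fun _ => 0, MemLp.zero', ?_, by simp [h]⟩
      have e : (fun t => eLpNorm (sl (fun _ => 0) t) 2 volume) = fun _ => 0 := by
        ext t; exact eLpNorm_zero
      rw [normT, e]
      exact eLpNorm_zero.le.trans zero_le
  choose φ hφ hφ1 hφm using hex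
  have hV : ∀ q, MemLp (blkT Q q (φ q)) 2 (slab T) := fun q => memLp_blkT Q q (hφ q)
  set c : ℕ → ℂ := fun q => ((rt q).toReal : ℂ) with hc
  have hce : ∀ q, ‖c q‖ₑ = rt q := fun q => by
    rw [hc, enorm_ofReal, Real.enorm_eq_ofReal ENNReal.toReal_nonneg,
      ENNReal.ofReal_toReal (rt_ne_top q)]
  have hA : MemLp (fun z => ∑ q ∈ Finset.range N, c q * blkT Q q (φ q) z) 2 (slab T) :=
    memLp_finsetSum _ fun q _ => (hV q).const_mul (c q)
  set a : SlabL2 T := hA.toLp _ with ha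
  -- A block r sees at most three terms of the sum, each of size at most 2 · 2^{r/2}.
  have hdual : dualNorm Q T p a ≤ 6 := by
    rw [dualNorm_le_iff]
    intro r
    have h1 : normT T p (blkT Q r a) ≤
        normT T p (blkT Q r fun z => ∑ q ∈ Finset.range N, c q * blkT Q q (φ q) z) := by
      refine (normT_blkT_mul_add_le Q r 1 hp hA (V := fun _ => 0) MemLp.zero' ?_).trans ?_
      · filter_upwards [hA.coeFn_toLp] with z hz
        rw [hz, one_mul, add_zero]
      · have h0 := normT_blkT_sum_le Q r hp (V := fun _ _ => 0) (T := T) (fun _ => MemLp.zero')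
          (fun _ => 0) 0
        simp only [Finset.range_zero, Finset.sum_empty] at h0
        rw [le_antisymm h0 zero_le, enorm_one, one_mul, add_zero]
    refine h1.trans ((normT_blkT_sum_le Q r hp hV c N).trans
      (le_trans (Finset.sum_le_sum fun q _ => ?_) (sum_neighbours_rt_le N r)))
    rw [hce]
    by_cases h : q ∈ Finset.Icc (r - 1) (r + 1)
    · rw [if_pos h]
      refine (mul_le_mul_right ?_ _).trans (mul_one _).le
      exact (normT_blkT_le Q r p (hV q)).trans ((normT_blkT_le Q q p (hφ q)).trans (hφ1 q))
    · rw [if_neg h, normT_blkT_blkT_eq_zero Q (by simp only [Finset.mem_Icc] at h; omega) p (hφ q),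
        mul_zero]
  have hint : ∫ z, w z * a z ∂slab T =
      ∑ q ∈ Finset.range N, c q * ∫ z, blkT P q w z * φ q z ∂slab T := by
    rw [ha, integral_toLp_mul hA]
    have i1 : ∀ q ∈ Finset.range N, Integrable (fun z => c q * (w z * blkT Q q (φ q) z)) (slab T) :=
      fun q _ => (integrable_mul_of_memLp hW (hV q)).const_mul (c q)
    have e1 : ∀ z, w z * ∑ q ∈ Finset.range N, c q * blkT Q q (φ q) z =
        ∑ q ∈ Finset.range N, c q * (w z * blkT Q q (φ q) z) := fun z => by
      rw [Finset.mul_sum]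
      exact Finset.sum_congr rfl fun q _ => by ring
    simp only [e1]
    rw [integral_finsetSum _ i1]
    refine Finset.sum_congr rfl fun q _ => ?_
    rw [integral_const_mul, integral_blkT_mul P q hW (hφ q)]
  have hmt : ∀ q, m q ≠ ⊤ := fun q => by
    rcases hm q with h | h
    · exact h.ne_top
    · rw [h]; simp
  calc ∑ q ∈ Finset.range N, rt q * m q =
        ENNReal.ofReal (∑ q ∈ Finset.range N, (rt q).toReal * (m q).toReal) := by
        rw [ENNReal.ofReal_sum_of_nonneg fun q _ => by positivity]
        refine Finset.sum_congr rfl fun q _ => ?_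
        rw [ENNReal.ofReal_mul ENNReal.toReal_nonneg, ENNReal.ofReal_toReal (rt_ne_top q),
          ENNReal.ofReal_toReal (hmt q)]
    _ ≤ ENNReal.ofReal (∫ z, w z * a z ∂slab T).re := by
        refine ENNReal.ofReal_le_ofReal ?_
        rw [hint, Complex.re_sum]
        refine Finset.sum_le_sum fun q _ => ?_
        rw [hc, Complex.re_ofReal_mul]
        exact mul_le_mul_of_nonneg_left (hφm q) ENNReal.toReal_nonneg
    _ ≤ ‖∫ z, w z * a z ∂slab T‖ₑ := by
        rw [← ofReal_norm]; exact ENNReal.ofReal_le_ofReal (Complex.re_le_norm _)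
    _ ≤ K * 6 := (hK a).trans (mul_le_mul_right hdual K)
    _ = 6 * K := mul_comm _ _

/-- The norms may a priori be infinite or not attained, so they are approached from below before the
bound on partial sums is applied. -/
theorem tsum_rt_mul_normT_le (P : LPCouple) {T : ℝ} {p p' : ℝ≥0∞} (hp : 1 ≤ p) {w : SlabL2 T}
    {K : ℝ≥0∞}
    (hK : ∀ a : SlabL2 T, ‖∫ z, w z * a z ∂slab T‖ₑ ≤ K * dualNorm P.reflect T p a)
    (hw : ∀ q, HasDual T p p' (blkT P q w)) :
    ∑' q, rt q * normT T p' (blkT P q w) ≤ 6 * K := by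
  refine ENNReal.tsum_le_of_sum_range_le fun N => ?_
  choose u hu1 hu2 using fun q => exists_seq_tendsto_ennreal (normT T p' (blkT P q w))
  have h1 : Filter.Tendsto (fun k => ∑ q ∈ Finset.range N, rt q * u q k) Filter.atTop
      (nhds (∑ q ∈ Finset.range N, rt q * normT T p' (blkT P q w))) :=
    tendsto_finsetSum _ fun q _ => ENNReal.Tendsto.const_mul (hu2 q) (Or.inr (rt_ne_top q))
  exact le_of_tendsto' h1 fun k => sum_rt_mul_le_of_dual P hp hK hw N fun q => hu1 q k

theorem dualNorm_le_normT (Q : LPCouple) {T : ℝ} (p : ℝ≥0∞) {U : ℝ × ℝ × ℝ → ℂ}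
    (hU : MemLp U 2 (slab T)) : dualNorm Q T p U ≤ normT T p U := by
  rw [dualNorm_le_iff]
  exact fun q => (normT_blkT_le Q q p hU).trans (le_mul_of_one_le_right' (one_le_rt q))

theorem normT_le_of_dual (Q : LPCouple) {T : ℝ} {p p' : ℝ≥0∞} {w : SlabL2 T} {K : ℝ≥0∞}
    (hK : ∀ a : SlabL2 T, ‖∫ z, w z * a z ∂slab T‖ₑ ≤ K * dualNorm Q T p a)
    (hw : HasDual T p p' w) : normT T p' w ≤ K := by
  refine le_of_forall_lt fun m hm => ?_
  obtain ⟨m', h1, h2⟩ := exists_between hm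
  obtain ⟨φ, hφ, hφ1, hφm⟩ := hw m' h2
  refine h1.trans_le ?_
  have e : normT T p (hφ.toLp φ) = normT T p φ := by
    refine eLpNorm_congr_ae ?_
    filter_upwards [ae_sl hφ.coeFn_toLp] with t ht
    exact eLpNorm_congr_ae ht
  calc m' = ENNReal.ofReal m'.toReal := (ENNReal.ofReal_toReal h2.ne_top).symm
    _ ≤ ENNReal.ofReal (∫ z, w z * (hφ.toLp φ) z ∂slab T).re := by
        rw [integral_toLp_mul hφ]; exact ENNReal.ofReal_le_ofReal hφm
    _ ≤ ‖∫ z, w z * (hφ.toLp φ) z ∂slab T‖ₑ := by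
        rw [← ofReal_norm]; exact ENNReal.ofReal_le_ofReal (Complex.re_le_norm _)
    _ ≤ K * normT T p (hφ.toLp φ) :=
        (hK _).trans (mul_le_mul_right (dualNorm_le_normT Q p (Lp.memLp _)) K)
    _ ≤ K := by rw [e]; exact (mul_le_mul_right hφ1 K).trans (mul_one K).le

/-! ### Near-optimal dual functions in time. -/

/-- The functions `θ(t) conj U` with a nonnegative weight `θ`. -/
theorem exists_dual_of_weight {T : ℝ} {U : ℝ × ℝ × ℝ → ℂ} (hU : MemLp U 2 (slab T)) {p m : ℝ≥0∞}
    (hm : m ≠ ⊤) {Θ : ℝ → ℝ≥0∞} (hΘ : Measurable Θ) (hΘt : ∀ t, Θ t ≠ ⊤)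
    (h2 : ∫⁻ t, (Θ t * eLpNorm (sl U t) 2 volume) ^ 2 ∂timeM T ≠ ⊤)
    (hp : eLpNorm (fun t => Θ t * eLpNorm (sl U t) 2 volume) p (timeM T) ≤ 1)
    (hlow : m ≤ ∫⁻ t, Θ t * eLpNorm (sl U t) 2 volume ^ 2 ∂timeM T) :
    ∃ φ : ℝ × ℝ × ℝ → ℂ, MemLp φ 2 (slab T) ∧ normT T p φ ≤ 1 ∧
      m.toReal ≤ (∫ z, U z * φ z ∂slab T).re := by
  set φ : ℝ × ℝ × ℝ → ℂ := fun z => ((Θ z.1).toReal : ℂ) * conj (U z) with hφ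
  have hmeas : AEStronglyMeasurable φ (slab T) := by
    have h1 : Measurable fun z : ℝ × ℝ × ℝ => ((Θ z.1).toReal : ℂ) :=
      Complex.measurable_ofReal.comp (hΘ.comp measurable_fst).ennreal_toReal
    exact h1.aestronglyMeasurable.mul (memLp_conj hU).1
  have hθ : ∀ t, ‖((Θ t).toReal : ℂ)‖ₑ = Θ t := fun t => by
    rw [enorm_ofReal, Real.enorm_eq_ofReal ENNReal.toReal_nonneg, ENNReal.ofReal_toReal (hΘt t)]
  have hsl : ∀ t, eLpNorm (sl φ t) 2 volume = Θ t * eLpNorm (sl U t) 2 volume := fun t => by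
    have e : sl φ t = ((Θ t).toReal : ℂ) • fun z => conj (sl U t z) := rfl
    rw [e, eLpNorm_const_smul, hθ, eLpNorm_conj]
  have hL2 : MemLp φ 2 (slab T) := by
    refine ⟨hmeas, ?_⟩
    have h3 : eLpNorm φ 2 (slab T) ^ 2 ≠ ⊤ := by
      rw [eLpNorm_slab_sq hmeas]; simp only [hsl]; exact h2
    exact (ENNReal.pow_ne_top_iff (n := 2) |>.1 h3 |>.resolve_right (by norm_num)).lt_top
  refine ⟨φ, hL2, ?_, ?_⟩
  · unfold normT; simp only [hsl]; exact hp
  · have e1 : ∀ z, U z * φ z = ((((Θ z.1).toReal * ‖U z‖ ^ 2 : ℝ)) : ℂ) := fun z => by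
      rw [hφ]
      beta_reduce
      rw [mul_left_comm, Complex.mul_conj, Complex.normSq_eq_norm_sq]
      push_cast; ring
    have hi : Integrable (fun z => (Θ z.1).toReal * ‖U z‖ ^ 2) (slab T) := by
      have h3 := (integrable_mul_of_memLp hU hL2).re
      refine h3.congr (Filter.Eventually.of_forall fun z => ?_)
      beta_reduce
      rw [e1]; exact RCLike.ofReal_re _
    have e2 : (∫ z, U z * φ z ∂slab T).re = ∫ z, (Θ z.1).toReal * ‖U z‖ ^ 2 ∂slab T := by
      simp only [e1]
      rw [integral_complex_ofReal, Complex.ofReal_re]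
    rw [e2, ← ENNReal.ofReal_le_ofReal_iff (integral_nonneg fun z => by positivity),
      ENNReal.ofReal_toReal hm, ofReal_integral_eq_lintegral_ofReal hi
        (Filter.Eventually.of_forall fun z => by positivity)]
    refine hlow.trans (le_of_eq ?_)
    have e3 : ∀ z : ℝ × ℝ × ℝ, ENNReal.ofReal ((Θ z.1).toReal * ‖U z‖ ^ 2) = Θ z.1 * ‖U z‖ₑ ^ 2 :=
      fun z => by
        rw [ENNReal.ofReal_mul ENNReal.toReal_nonneg, ENNReal.ofReal_toReal (hΘt _),
          ENNReal.ofReal_pow (norm_nonneg _), ofReal_norm]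
    simp only [e3]
    rw [slab_eq, lintegral_prod]
    · refine lintegral_congr fun t => ?_
      rw [lintegral_const_mul' _ _ (hΘt t), eLpNorm_two_sq]; rfl
    · have hU' := hU.1
      rw [slab_eq] at hU'
      exact (hΘ.comp measurable_fst).aemeasurable.mul (hU'.enorm.pow_const 2)

/-- The normalized conjugate of U, with constant weight 1/N, attains the norm. -/
theorem hasDual_two {T : ℝ} {U : ℝ × ℝ × ℝ → ℂ} (hU : MemLp U 2 (slab T)) : HasDual T 2 2 U := by
  intro m hm
  set N := normT T 2 U with hN
  have hN0 : N ≠ 0 := (zero_le.trans_lt hm).ne'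
  have hNe : N = eLpNorm U 2 (slab T) := normT_two hU.1
  have hNt : N ≠ ⊤ := by rw [hNe]; exact hU.2.ne
  have hsq : ∫⁻ t, eLpNorm (sl U t) 2 volume ^ 2 ∂timeM T = N ^ 2 := by
    rw [hNe, eLpNorm_slab_sq hU.1]
  have hinv : N⁻¹ ≠ ⊤ := ENNReal.inv_ne_top.2 hN0
  have h1 : ∫⁻ t, (N⁻¹ * eLpNorm (sl U t) 2 volume) ^ 2 ∂timeM T = 1 := by
    simp only [mul_pow]
    rw [lintegral_const_mul' _ _ (by finiteness), hsq, ← mul_pow, ENNReal.inv_mul_cancel hN0 hNt,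
      one_pow]
  refine exists_dual_of_weight hU hm.ne_top (Θ := fun _ => N⁻¹) measurable_const (fun _ => hinv)
    (by rw [h1]; simp) ?_ ?_
  · rw [← sq_le_sq_iff_ennreal, eLpNorm_two_sq]
    simp only [enorm_eq_self]
    rw [h1, one_pow]
  · rw [lintegral_const_mul' _ _ hinv, hsq, sq, ← mul_assoc, ENNReal.inv_mul_cancel hN0 hNt, one_mul]
    exact hm.le

/-- The conjugate of U is normalized at each time and averaged over the set where the spatial norm y
exceeds m. That set has positive measure since m is below the essential supremum, and excluding y =
∞ keeps the weight meaningful. -/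
theorem hasDual_top {T : ℝ} {U : ℝ × ℝ × ℝ → ℂ} (hU : MemLp U 2 (slab T)) : HasDual T 1 ⊤ U := by
  intro m hm
  have hy := aemeasurable_eLpNorm_sl hU.1
  set y := hy.mk with hydef
  have hym : Measurable y := hy.measurable_mk
  have hyy := hy.ae_eq_mk
  set A : Set ℝ := {t | m < y t ∧ y t < ⊤} with hA
  have hAm : MeasurableSet A :=
    (measurableSet_lt measurable_const hym).inter (measurableSet_lt hym measurable_const)
  set μ := timeM T A with hμ
  have hμt : μ ≠ ⊤ := measure_ne_top _ _
  have hμ0 : μ ≠ 0 := by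
    intro h0
    refine absurd hm (not_lt.2 ?_)
    rw [normT, eLpNorm_exponent_top]
    refine essSup_le_of_ae_le _ ?_
    have h1 : ∀ᵐ t ∂timeM T, t ∉ A := measure_eq_zero_iff_ae_notMem.1 h0
    filter_upwards [h1, hyy, ae_memLp_sl hU] with t h2 h3 h4
    rw [enorm_eq_self, h3]
    by_contra h5
    refine h2 ⟨not_le.1 h5, ?_⟩
    rw [hydef, ← h3]; exact h4.2
  set Θ : ℝ → ℝ≥0∞ := A.indicator fun t => (μ * y t)⁻¹ with hΘ
  have hΘm : Measurable Θ := (measurable_const.mul hym).inv.indicator hAm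
  have hy0 : ∀ t ∈ A, y t ≠ 0 := fun t ht => (zero_le.trans_lt ht.1).ne'
  have hΘt : ∀ t, Θ t ≠ ⊤ := fun t => by
    by_cases ht : t ∈ A
    · rw [hΘ, indicator_of_mem ht]
      exact ENNReal.inv_ne_top.2 (mul_ne_zero hμ0 (hy0 t ht))
    · rw [hΘ, indicator_of_notMem ht]; simp
  have hprod : ∀ t, Θ t * y t = A.indicator (fun _ => μ⁻¹) t := fun t => by
    by_cases ht : t ∈ A
    · rw [hΘ, indicator_of_mem ht, indicator_of_mem ht, ENNReal.mul_inv (Or.inl hμ0) (Or.inl hμt),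
        mul_assoc, ENNReal.inv_mul_cancel (hy0 t ht) ht.2.ne, mul_one]
    · rw [hΘ, indicator_of_notMem ht, indicator_of_notMem ht, zero_mul]
  have hprod' : ∀ᵐ t ∂timeM T, Θ t * eLpNorm (sl U t) 2 volume = A.indicator (fun _ => μ⁻¹) t := by
    filter_upwards [hyy] with t ht
    rw [ht]; exact hprod t
  have hμi : μ⁻¹ ≠ ⊤ := ENNReal.inv_ne_top.2 hμ0
  refine exists_dual_of_weight hU hm.ne_top hΘm hΘt ?_ ?_ ?_
  · have h1 : ∫⁻ t, (Θ t * eLpNorm (sl U t) 2 volume) ^ 2 ∂timeM T ≤ ∫⁻ _, μ⁻¹ ^ 2 ∂timeM T := by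
      refine lintegral_mono_ae ?_
      filter_upwards [hprod'] with t ht
      rw [ht]
      gcongr
      exact indicator_le_self _ _ t
    refine ne_top_of_le_ne_top ?_ h1
    rw [lintegral_const]
    have := measure_ne_top (timeM T) univ
    finiteness
  · rw [eLpNorm_one_eq_lintegral_enorm]
    simp only [enorm_eq_self]
    rw [lintegral_congr_ae hprod', lintegral_indicator_const hAm, ENNReal.inv_mul_cancel hμ0 hμt]
  · have h1 : ∫⁻ t, Θ t * eLpNorm (sl U t) 2 volume ^ 2 ∂timeM T =
        ∫⁻ t, A.indicator (fun t => μ⁻¹ * y t) t ∂timeM T := by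
      refine lintegral_congr_ae ?_
      filter_upwards [hprod', hyy] with t h2 h3
      rw [sq, ← mul_assoc, h2, h3]
      by_cases ht : t ∈ A
      · rw [indicator_of_mem ht, indicator_of_mem ht]
      · rw [indicator_of_notMem ht, indicator_of_notMem ht, zero_mul]
    have h2 : ∫⁻ t, A.indicator (fun _ => μ⁻¹ * m) t ∂timeM T = m := by
      rw [lintegral_indicator_const hAm, mul_right_comm, ENNReal.inv_mul_cancel hμ0 hμt, one_mul]
    rw [h1]
    refine h2.symm.le.trans (lintegral_mono fun t => ?_)
    by_cases ht : t ∈ A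
    · rw [indicator_of_mem ht, indicator_of_mem ht]
      exact mul_le_mul_right ht.1.le _
    · rw [indicator_of_notMem ht, indicator_of_notMem ht]

end Kac

namespace Kac

open ComplexConjugate

/-! ### The power of the oscillator -/

theorem exists_tensor {T : ℝ} {ψ : ℝ × ℝ → ℂ} (hψ : MemLp ψ 2 (timeX T)) (n : ℕ) :
    MemLp (fun z : ℝ × ℝ × ℝ => ψ (z.1, z.2.1) * (hermiteFun n z.2.2 : ℂ)) 2 (slab T) := by
  have hmp := measurePreserving_assoc_slab T
  have h1 : AEStronglyMeasurable (fun y : (ℝ × ℝ) × ℝ => ψ y.1 * (hermiteFun n y.2 : ℂ))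
      ((timeX T).prod volume) :=
    hψ.1.comp_fst.mul (memLp_hermiteFun n).1.comp_snd
  have h2 : MemLp (fun y : (ℝ × ℝ) × ℝ => ψ y.1 * (hermiteFun n y.2 : ℂ)) 2
      ((timeX T).prod volume) := by
    rw [memLp_two_iff_sq_lt_top h1, lintegral_sq_prod h1]
    simp only [enorm_mul, mul_pow]
    have h3 : ∀ x, ∫⁻ y, ‖ψ x‖ₑ ^ 2 * ‖(hermiteFun n y : ℂ)‖ₑ ^ 2 =
        ‖ψ x‖ₑ ^ 2 * eLpNorm (fun y => (hermiteFun n y : ℂ)) 2 volume ^ 2 := fun x => by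
      rw [lintegral_const_mul' _ _ (by finiteness), eLpNorm_two_sq]
    have hfin := (memLp_hermiteFun n).2.ne
    simp only [h3]
    rw [lintegral_mul_const' _ _ (by finiteness), ← eLpNorm_two_sq]
    have := hψ.2.ne
    exact (by finiteness : eLpNorm ψ 2 (timeX T) ^ 2 *
      eLpNorm (fun y => (hermiteFun n y : ℂ)) 2 volume ^ 2 ≠ ⊤).lt_top
  have h4 := h2.comp_measurePreserving (hmp.symm MeasurableEquiv.prodAssoc)
  exact h4

theorem cfT_tensor (ψ : ℝ × ℝ → ℂ) (n m : ℕ) (z : ℝ × ℝ) :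
    cfT m (fun z : ℝ × ℝ × ℝ => ψ (z.1, z.2.1) * (hermiteFun n z.2.2 : ℂ)) z =
      ψ z * if m = n then 1 else 0 := by
  rw [← coef_hermiteC m n]
  exact coef_const_mul m (ψ z) (hermiteC n)

theorem integral_mul_tensor {T : ℝ} {U : ℝ × ℝ × ℝ → ℂ} (hU : MemLp U 2 (slab T))
    {ψ : ℝ × ℝ → ℂ} (hψ : MemLp ψ 2 (timeX T)) (n : ℕ) :
    ∫ z, U z * (ψ (z.1, z.2.1) * (hermiteFun n z.2.2 : ℂ)) ∂slab T =
      ∫ z, cfT n U z * ψ z ∂timeX T := by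
  rw [← (hasSum_integral_cfT_mul hU (exists_tensor hψ n)).tsum_eq, tsum_eq_single n fun m hm => by
    simp only [cfT_tensor, if_neg hm]; simp]
  simp only [cfT_tensor, if_true, mul_one]

theorem IsOscillatorPower.congr {T r : ℝ} {c d c' d' : ℝ × ℝ × ℝ → ℂ}
    (h : IsOscillatorPower T r c d) (hc : c' =ᵐ[slab T] c) (hd : d' =ᵐ[slab T] d) :
    IsOscillatorPower T r c' d' := by
  rw [isOscillatorPower_iff] at h ⊢
  filter_upwards [h, ae_velocity hc, ae_velocity hd] with z h1 h2 h3 n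
  have e1 : cfT n c' z = cfT n c z := coef_congr n h2
  have e2 : cfT n d' z = cfT n d z := coef_congr n h3
  rw [e1, e2, h1]

/-- Let D be the defect of the n-th coefficient. Testing with conj(D) ⊗ e_n, an eigenvector of the
oscillator power, gives ∫|D|² = 0. -/
theorem isOscillatorPower_of_dual {T r : ℝ} {w w' : SlabL2 T}
    (h : ∀ c d : SlabL2 T, IsOscillatorPower T r c d →
      ∫ z, w' z * c z ∂slab T = ∫ z, w z * d z ∂slab T) : IsOscillatorPower T r w w' := by
  rw [isOscillatorPower_iff, ae_all_iff]
  intro n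
  set κ : ℂ := ((((n : ℝ) + 1 / 2) ^ r : ℝ) : ℂ) with hκ
  have hw := memLp_cfT n (Lp.memLp w)
  have hw' := memLp_cfT n (Lp.memLp w')
  have hD : MemLp (fun z => cfT n w' z - κ * cfT n w z) 2 (timeX T) := hw'.sub (hw.const_mul κ)
  set D : ℝ × ℝ → ℂ := fun z => cfT n w' z - κ * cfT n w z with hDdef
  have hψ := memLp_conj hD
  have hc := exists_tensor hψ n
  have hd : MemLp (fun z : ℝ × ℝ × ℝ => κ * (conj (D (z.1, z.2.1)) * (hermiteFun n z.2.2 : ℂ))) 2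
      (slab T) := hc.const_mul κ
  have hpow : IsOscillatorPower T r (fun z : ℝ × ℝ × ℝ => conj (D (z.1, z.2.1)) *
      (hermiteFun n z.2.2 : ℂ))
      (fun z => κ * (conj (D (z.1, z.2.1)) * (hermiteFun n z.2.2 : ℂ))) := by
    rw [isOscillatorPower_iff]
    refine Filter.Eventually.of_forall fun z m => ?_
    have e : cfT m (fun z : ℝ × ℝ × ℝ => κ * (conj (D (z.1, z.2.1)) *
        (hermiteFun n z.2.2 : ℂ))) z = κ * cfT m (fun z : ℝ × ℝ × ℝ => conj (D (z.1, z.2.1)) *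
        (hermiteFun n z.2.2 : ℂ)) z :=
      coef_const_mul m κ fun v => conj (D z) * (hermiteFun n v : ℂ)
    rw [e, cfT_tensor (fun z => conj (D z)) n m z]
    by_cases hmn : m = n
    · rw [hmn]
    · rw [if_neg hmn]; simp
  have h1 := h (hc.toLp _) (hd.toLp _) (hpow.congr hc.coeFn_toLp hd.coeFn_toLp)
  rw [integral_toLp_mul hc, integral_toLp_mul hd, integral_mul_tensor (Lp.memLp w') hψ n] at h1
  have e2 : ∫ z, w z * (κ * (conj (D (z.1, z.2.1)) * (hermiteFun n z.2.2 : ℂ))) ∂slab T =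
      κ * ∫ z, cfT n w z * conj (D z) ∂timeX T := by
    rw [← integral_mul_tensor (Lp.memLp w) hψ n, ← integral_const_mul]
    congr 1; ext z; ring
  rw [e2] at h1
  have h2 : ∫ z, conj (D z) * D z ∂timeX T = 0 := by
    have i1 := integrable_mul_of_memLp hw' hψ
    have i2 := (integrable_mul_of_memLp hw hψ).const_mul κ
    have e : ∀ z, conj (D z) * D z = cfT n w' z * conj (D z) - κ * (cfT n w z * conj (D z)) :=
      fun z => by rw [hDdef]; ring
    simp only [e]
    rw [integral_sub i1 i2, h1, integral_const_mul, sub_self]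
  have h3 : (eLpNorm D 2 (timeX T)).toReal ^ 2 = 0 := by
    rw [toReal_eLpNorm_sq hD, h2]; rfl
  have h4 : eLpNorm D 2 (timeX T) = 0 := by
    rcases (ENNReal.toReal_eq_zero_iff _).1 (pow_eq_zero_iff two_ne_zero |>.1 h3) with h | h
    · exact h
    · exact absurd h hD.2.ne
  rw [eLpNorm_eq_zero_iff hD.1 two_ne_zero] at h4
  filter_upwards [h4] with z hz
  exact sub_eq_zero.1 hz

/-! ### From the forms to the weak formulation -/

/-- Besides the interchange, it supplies the measurability and integrability of the limit, so the
pairings in the weak formulation are genuine integrals. -/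
theorem integral_eq_tsum_of_hasSum {ι α : Type*} [Countable ι] [MeasurableSpace α] {ν : Measure α}
    {F : ι → α → ℂ} {G : α → ℂ} (hF : ∀ i, AEStronglyMeasurable (F i) ν)
    (hfin : ∑' i, ∫⁻ z, ‖F i z‖ₑ ∂ν ≠ ⊤) (hs : ∀ᵐ z ∂ν, HasSum (fun i => F i z) (G z)) :
    Integrable G ν ∧ ∫ z, G z ∂ν = ∑' i, ∫ z, F i z ∂ν := by
  have hG : AEStronglyMeasurable G ν := by
    refine aestronglyMeasurable_of_tendsto_ae (u := (Filter.atTop : Filter (Finset ι)))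
      (f := fun s z => ∑ i ∈ s, F i z) (fun s => ?_) ?_
    · exact Finset.aestronglyMeasurable_fun_sum s fun i _ => hF i
    · filter_upwards [hs] with z hz using hz
  have e : G =ᵐ[ν] fun z => ∑' i, F i z := by
    filter_upwards [hs] with z hz using hz.tsum_eq.symm
  refine ⟨⟨hG, ?_⟩, ?_⟩
  · rw [HasFiniteIntegral]
    refine lt_of_le_of_lt ?_ hfin.lt_top
    rw [← lintegral_tsum fun i => (hF i).enorm]
    refine lintegral_mono_ae ?_
    filter_upwards [e] with z hz
    rw [hz]; exact enorm_tsum_le_tsum_enorm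
  · rw [integral_congr_ae e]
    exact integral_tsum (f := F) hF hfin

theorem lamForm_eq_integral {s : ℝ} (hs0 : 0 < s) (hs1 : s < 1) {T : ℝ} {g h : ℝ × ℝ × ℝ → ℂ}
    (hg : MemLp g 2 (slab T)) (hh : IsNice h) :
    ∫ t in Icc 0 T, ∫ x : ℝ, linKacPairing s (fun v => g (t, x, v)) (fun v => h (t, x, v)) =
      lamForm s T g h := by
  have h1 := integral_eq_tsum_of_hasSum (ν := timeX T)
    (F := fun n z => (lam s n : ℂ) * (cfT n g z * cfT n h z))
    (G := fun z => linKacPairing s (fun v => g (z.1, z.2, v)) (fun v => h (z.1, z.2, v)))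
    (fun n => ((memLp_cfT n hg).1.mul (memLp_cfT n (hh.memLp_slab T)).1).const_mul _)
    (hh.tsum_lam_lintegral_ne_top hs0 hs1 hg) (by
      filter_upwards [ae_memLp_velocity hg] with z hz
      exact hasSum_linKacPairing hs0 hs1 hz (hh.slice_vel z.1 z.2).1 (hh.slice_vel z.1 z.2).2)
  have h2 := h1.2
  rw [timeX, integral_prod _ h1.1] at h2
  refine h2.trans (tsum_congr fun n => ?_)
  rw [integral_const_mul]; rfl

theorem alphaForm_eq_integral {s : ℝ} (hs0 : 0 < s) (hs1 : s < 1) {T : ℝ}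
    {f g h : ℝ × ℝ × ℝ → ℂ} (hf : MemLp f 2 (slab T)) (hg : MemLp g 2 (slab T)) (hh : IsNice h) :
    ∫ t in Icc 0 T, ∫ x : ℝ, gammaPairing s (fun v => f (t, x, v)) (fun v => g (t, x, v))
      (fun v => h (t, x, v)) = alphaForm s T f g h := by
  obtain ⟨C, hC, hb⟩ := hh.exists_tsum_alpha_lintegral_le hs0 hs1 T
  have h1 := integral_eq_tsum_of_hasSum (ν := timeX T)
    (F := fun (p : ℕ × ℕ) z => (alpha s p.1 p.2 : ℂ) *
      (cfT p.1 f z * cfT p.2 g z * cfT (p.1 + p.2) h z))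
    (G := fun z => gammaPairing s (fun v => f (z.1, z.2, v)) (fun v => g (z.1, z.2, v))
      (fun v => h (z.1, z.2, v)))
    (fun p => (hh.integrable_cfT_mul p.1 p.2 (p.1 + p.2) hf hg).1.const_mul _)
    (ne_top_of_le_ne_top (ENNReal.mul_ne_top hC (ENNReal.mul_ne_top hf.2.ne hg.2.ne))
      (hb f g hf hg)) (by
      filter_upwards [ae_memLp_velocity hf, ae_memLp_velocity hg] with z hz hz'
      exact hasSum_gammaPairing hs0 hs1 hz hz' (hh.slice_vel z.1 z.2).1 (hh.slice_vel z.1 z.2).2)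
  have h2 := h1.2
  rw [timeX, integral_prod _ h1.1] at h2
  refine h2.trans (tsum_congr fun p => ?_)
  rw [integral_const_mul]; rfl

/-- Multiplication by `e^t`. -/
noncomputable def expMul (U : ℝ × ℝ × ℝ → ℂ) (z : ℝ × ℝ × ℝ) : ℂ := (Real.exp z.1 : ℂ) * U z

theorem IsNice.expMul {h : ℝ × ℝ × ℝ → ℂ} (hh : IsNice h) : IsNice (expMul h) := by
  refine hh.mul_left ?_
  exact Complex.ofRealCLM.contDiff.comp (Real.contDiff_exp.comp contDiff_fst)

theorem cfT_expMul (n : ℕ) (U : ℝ × ℝ × ℝ → ℂ) (z : ℝ × ℝ) :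
    cfT n (expMul U) z = (Real.exp z.1 : ℂ) * cfT n U z :=
  coef_const_mul n (Real.exp z.1 : ℂ) fun v => U (z.1, z.2, v)

theorem blkT_expMul (P : LPCouple) (q : ℕ) (U : ℝ × ℝ × ℝ → ℂ) :
    blkT P q (expMul U) = expMul (blkT P q U) :=
  funext fun z => P.block_const_mul q (Real.exp z.1 : ℂ) (fun y => U (z.1, y, z.2.2)) z.2.1

theorem aestronglyMeasurable_expMul {T : ℝ} {U : ℝ × ℝ × ℝ → ℂ}
    (hU : AEStronglyMeasurable U (slab T)) : AEStronglyMeasurable (expMul U) (slab T) := by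
  have h1 : Continuous fun z : ℝ × ℝ × ℝ => (Real.exp z.1 : ℂ) := by fun_prop
  exact h1.aestronglyMeasurable.mul hU

theorem normT_expMul_le {T : ℝ} (p : ℝ≥0∞) {U : ℝ × ℝ × ℝ → ℂ}
    (hU : AEStronglyMeasurable U (slab T)) :
    normT T p (expMul U) ≤ ENNReal.ofReal (Real.exp T) * normT T p U := by
  refine eLpNorm_le_mul_eLpNorm_of_ae_le_mul'' p (aemeasurable_eLpNorm_sl hU).aestronglyMeasurable ?_
  have hmem : ∀ᵐ t ∂timeM T, t ∈ Icc 0 T := ae_restrict_mem measurableSet_Icc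
  filter_upwards [hmem] with t ht
  have e : sl (expMul U) t = (Real.exp t : ℂ) • sl U t := rfl
  rw [enorm_eq_self, enorm_eq_self, e, eLpNorm_const_smul, enorm_ofReal,
    Real.enorm_eq_ofReal (Real.exp_pos t).le]
  gcongr
  exact ht.2

theorem memLp_expMul {T : ℝ} {U : ℝ × ℝ × ℝ → ℂ} (hU : MemLp U 2 (slab T)) :
    MemLp (expMul U) 2 (slab T) := by
  have h1 := aestronglyMeasurable_expMul hU.1
  refine ⟨h1, ?_⟩
  rw [← normT_two h1]
  refine (normT_expMul_le 2 hU.1).trans_lt ?_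
  rw [normT_two hU.1]
  exact ENNReal.mul_lt_top ENNReal.ofReal_lt_top hU.2

theorem IsOscillatorPower.expMul {T r : ℝ} {c d : ℝ × ℝ × ℝ → ℂ}
    (h : IsOscillatorPower T r c d) : IsOscillatorPower T r (expMul c) (expMul d) := by
  rw [isOscillatorPower_iff] at h ⊢
  filter_upwards [h] with z hz n
  rw [cfT_expMul, cfT_expMul, hz]; ring

theorem IsNice.transport_expMul {h : ℝ × ℝ × ℝ → ℂ} (hh : IsNice h) (z : ℝ × ℝ × ℝ) :
    Kac.transport (Kac.expMul h) z =
      -((Real.exp z.1 : ℂ) * (Kac.dt h z + (z.2.2 : ℂ) * Kac.dx h z)) := by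
  have h1 : Kac.dt (Kac.expMul h) z =
      (Real.exp z.1 : ℂ) * h z + (Real.exp z.1 : ℂ) * Kac.dt h z :=
    ((Real.hasDerivAt_exp z.1).ofReal_comp.mul
      (hh.hasDerivAt_time z.1 z.2.1 z.2.2).differentiableAt.hasDerivAt).deriv
  have h2 : Kac.dx (Kac.expMul h) z = (Real.exp z.1 : ℂ) * Kac.dx h z :=
    ((hh.hasDerivAt_pos z.1 z.2.1 z.2.2).differentiableAt.hasDerivAt.const_mul
      (Real.exp z.1 : ℂ)).deriv
  unfold Kac.transport
  rw [h1, h2, Kac.expMul]; ring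

theorem lamForm_expMul (s T : ℝ) (g h : ℝ × ℝ × ℝ → ℂ) :
    lamForm s T g (expMul h) = lamForm s T (expMul g) h := by
  refine tsum_congr fun n => ?_
  congr 2; ext z
  rw [cfT_expMul, cfT_expMul]; ring

theorem alphaForm_expMul (s T : ℝ) (f g h : ℝ × ℝ × ℝ → ℂ) :
    alphaForm s T f g (expMul h) = alphaForm s T f (expMul g) h := by
  refine tsum_congr fun p => ?_
  congr 2; ext z
  rw [cfT_expMul, cfT_expMul]; ring

/-- The identity for w is used with the test function e^t k. The zeroth-order term of the adjoint
operator cancels against the derivative of e^t, and the exponential passes to w in the remaining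
terms. At t = 0 it equals 1, so the initial term is unchanged. -/
theorem isWeakSolution_expMul {s : ℝ} (hs0 : 0 < s) (hs1 : s < 1) {T : ℝ}
    {f w : ℝ × ℝ × ℝ → ℂ} {g₀ : ℝ × ℝ → ℂ} (hf : MemLp f 2 (slab T)) (hw : MemLp w 2 (slab T))
    (hg₀ : MemLp g₀ 2 volume)
    (h : ∀ h, IsNice h → (∀ z, h (T, z) = 0) → adjForm s T f w h = ∫ z, g₀ z * sl h 0 z) :
    IsWeakSolution s T f g₀ (expMul w) := by
  intro k hk
  have hn : IsNice k := ⟨hk.1, hk.2.1⟩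
  have hg := memLp_expMul hw
  have hkT : ∀ z, k (T, z) = 0 := fun z => by
    by_contra h0
    have h1 := hk.2.2 (subset_tsupport k (Function.mem_support.2 h0))
    exact lt_irrefl _ (show T < T from h1)
  have h1 := h (expMul k) hn.expMul fun z => by rw [expMul, hkT, mul_zero]
  rw [lamForm_eq_integral hs0 hs1 hg hn, alphaForm_eq_integral hs0 hs1 hf hg hn]
  have hD : IsNice fun z => dt k z + (z.2.2 : ℂ) * dx k z := hn.dt.add hn.dx.vel_mul
  have e1 : ∫ t in Icc 0 T, ∫ x : ℝ, ∫ v : ℝ, expMul w (t, x, v) *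
      (deriv (fun τ : ℝ => k (τ, x, v)) t + (v : ℂ) * deriv (fun y : ℝ => k (t, y, v)) x) =
      ∫ z, expMul w z * (dt k z + (z.2.2 : ℂ) * dx k z) ∂slab T := by
    have hi := integrable_mul_of_memLp hg (hD.memLp_slab T)
    rw [integral_slab hi]
    refine integral_congr_ae ?_
    have h2 : ∀ᵐ t ∂timeM T, Integrable fun z : ℝ × ℝ => expMul w (t, z) *
        (dt k (t, z) + (z.2 : ℂ) * dx k (t, z)) := by
      rw [slab_eq] at hi
      exact hi.prod_right_ae
    filter_upwards [h2] with t ht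
    exact (integral_prod _ ht).symm
  have e2 : ∫ x : ℝ, ∫ v : ℝ, g₀ (x, v) * k (0, x, v) = ∫ z, g₀ z * sl (expMul k) 0 z := by
    have hi := integrable_mul_of_memLp hg₀ (hn.memLp_sl 0)
    have e3 : sl (expMul k) 0 = sl k 0 := by ext z; simp [sl, expMul]
    rw [e3]
    exact (integral_prod _ hi).symm
  have e4 : ∫ z, w z * transport (expMul k) z ∂slab T =
      -∫ z, expMul w z * (dt k z + (z.2.2 : ℂ) * dx k z) ∂slab T := by
    rw [← integral_neg]
    congr 1; ext z
    rw [hn.transport_expMul, expMul]; ring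
  have h5 : ∫ z, w z * transport (expMul k) z ∂slab T + lamForm s T w (expMul k) -
      alphaForm s T f w (expMul k) = ∫ z, g₀ z * sl (expMul k) 0 z := h1
  rw [e4, lamForm_expMul, alphaForm_expMul] at h5
  rw [e1, e2, ← h5]; ring

/-! ### Besov norms -/

theorem two_rpow_eq_rt (n : ℕ) :
    (2 : ℝ≥0∞) ^ (((n : ℝ) - 1) * (1 / 2)) = (2 : ℝ≥0∞) ^ (-(1 / 2) : ℝ) * rt n := by
  rw [rt_eq, ← ENNReal.rpow_add _ _ two_ne_zero (by norm_num)]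
  congr 1; ring

theorem besovNormTV_eq (P : LPCouple) {T : ℝ} (p : ℝ≥0∞) {U : ℝ × ℝ × ℝ → ℂ}
    (hU : AEStronglyMeasurable U (slab T)) : besovNormTV P T p 2 (1 / 2) 2 U =
      (2 : ℝ≥0∞) ^ (-(1 / 2) : ℝ) * ∑' n, rt n * normT T p (blkT P n U) := by
  rw [besovNormTV, ← ENNReal.tsum_mul_left]
  refine tsum_congr fun n => ?_
  rw [two_rpow_eq_rt, mul_assoc, ← normTVX_eq (aestronglyMeasurable_blkT P n hU)]
  rfl

theorem besovNormV_eq (P : LPCouple) {U : ℝ × ℝ → ℂ} (hU : AEStronglyMeasurable U volume) :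
    besovNormV P 2 (1 / 2) 2 U =
      (2 : ℝ≥0∞) ^ (-(1 / 2) : ℝ) * ∑' n, rt n * eLpNorm (blkX P n U) 2 volume := by
  rw [besovNormV, ← ENNReal.tsum_mul_left]
  refine tsum_congr fun n => ?_
  rw [two_rpow_eq_rt, mul_assoc, ← normVX_eq (aestronglyMeasurable_blkX P n hU)]
  rfl

theorem memLp_slab_of_memTVX_top {T : ℝ} {f : ℝ × ℝ × ℝ → ℂ} (hf : MemTVX T ⊤ 2 2 f) :
    MemLp f 2 (slab T) := by
  refine ⟨hf.1, ?_⟩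
  have h1 := hf.2
  rw [normTVX_eq hf.1] at h1
  rw [← normT_two hf.1]
  refine (eLpNorm_le_eLpNorm_mul_rpow_measure_univ le_top
    (aemeasurable_eLpNorm_sl hf.1).aestronglyMeasurable).trans_lt ?_
  refine ENNReal.mul_lt_top h1 (ENNReal.rpow_lt_top_of_nonneg (by simp) (measure_ne_top _ _))

/-- Each of the two norms is at most e^T · 6 · 600 = 3600 e^T times the norm of g₀, whence 7200. -/
theorem exists_solution {s : ℝ} (hs0 : 0 < s) (hs1 : s < 1) (P : LPCouple) {T : ℝ} (hT : 0 < T)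
    {g₀ : ℝ × ℝ → ℂ} (hg₀ : MemBesovV P g₀) {f : ℝ × ℝ × ℝ → ℂ} (hf : MemBesovTV P T ⊤ f)
    (hsmall : ENNReal.ofReal (6 * momentConst s) *
      (19 * ∑' p, rt p * normT T ⊤ (blkT P p f)) ≤ ENNReal.ofReal (1 / 2400)) :
    ∃ g : ℝ × ℝ × ℝ → ℂ, MemTVX T ⊤ 2 2 g ∧ IsWeakSolution s T f g₀ g ∧ MemBesovTV P T ⊤ g ∧
      ∃ Hg : ℝ × ℝ × ℝ → ℂ, IsOscillatorPower T (s / 2) g Hg ∧ MemBesovTV P T 2 Hg ∧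
        besovNormTV P T ⊤ 2 (1 / 2) 2 g + besovNormTV P T 2 2 (1 / 2) 2 Hg ≤
          ENNReal.ofReal (7200 * Real.exp T) * besovNormV P 2 (1 / 2) 2 g₀ := by
  have hf2 := memLp_slab_of_memTVX_top hf.1
  have hg2 : MemLp g₀ 2 volume := ⟨hg₀.1.1, by rw [← normVX_eq hg₀.1.1]; exact hg₀.1.2⟩
  set κ : ℝ≥0∞ := (2 : ℝ≥0∞) ^ (-(1 / 2) : ℝ) with hκ
  have hκ0 : κ ≠ 0 := (ENNReal.rpow_pos (by norm_num) (by norm_num)).ne'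
  have hκt : κ ≠ ⊤ := ENNReal.rpow_ne_top_of_ne_zero (by norm_num) (by norm_num)
  set G := ∑' n, rt n * eLpNorm (blkX P n g₀) 2 volume with hG
  have hGb : besovNormV P 2 (1 / 2) 2 g₀ = κ * G := besovNormV_eq P hg₀.1.1
  have hGt : G ≠ ⊤ := by
    have h1 := hg₀.2
    rw [hGb] at h1
    intro h2
    rw [h2, ENNReal.mul_top hκ0] at h1
    exact lt_irrefl _ h1
  have hKt : dualConst P g₀ ≠ ⊤ := ENNReal.mul_ne_top (by norm_num) hGt
  obtain ⟨w, w', h1, h2, h3, h4⟩ := exists_dual_solution hs0 hs1 P hT hf2 hsmall hg2 hKt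
  have hw := Lp.memLp w
  have hw' := Lp.memLp w'
  have hsum : ∀ (p p' : ℝ≥0∞) (hp : 1 ≤ p) (U : SlabL2 T),
      (∀ a : SlabL2 T, ‖∫ z, U z * a z ∂slab T‖ₑ ≤ dualConst P g₀ * dualNorm P.reflect T p a) →
      (∀ q, HasDual T p p' (blkT P q U)) → besovNormTV P T p' 2 (1 / 2) 2 (expMul U) ≤
        ENNReal.ofReal (Real.exp T) * (3600 * (κ * G)) := fun p p' hp U hU hd => by
    have h5 := tsum_rt_mul_normT_le P hp hU hd
    rw [besovNormTV_eq P p' (aestronglyMeasurable_expMul (Lp.memLp U).1)]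
    calc _ ≤ κ * ∑' n, ENNReal.ofReal (Real.exp T) * (rt n * normT T p' (blkT P n U)) := by
          refine mul_le_mul_right (ENNReal.tsum_le_tsum fun n => ?_) _
          rw [blkT_expMul, mul_left_comm]
          exact mul_le_mul_right (normT_expMul_le p' (memLp_blkT P n (Lp.memLp U)).1) _
      _ ≤ κ * (ENNReal.ofReal (Real.exp T) * (6 * dualConst P g₀)) := by
          rw [ENNReal.tsum_mul_left]; gcongr
      _ = _ := by rw [dualConst, ← hG]; ring
  have hb1 := hsum 1 ⊤ le_rfl w h3 fun q => hasDual_top (memLp_blkT P q hw)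
  have hb2 := hsum 2 2 (by norm_num) w' h4 fun q => hasDual_two (memLp_blkT P q hw')
  have hfin : ENNReal.ofReal (Real.exp T) * (3600 * (κ * G)) < ⊤ := by finiteness
  have hg : MemTVX T ⊤ 2 2 (expMul w) := by
    have h5 := aestronglyMeasurable_expMul hw.1
    refine ⟨h5, ?_⟩
    rw [normTVX_eq h5]
    refine (normT_expMul_le ⊤ hw.1).trans_lt ?_
    exact ENNReal.mul_lt_top ENNReal.ofReal_lt_top
      ((normT_le_of_dual P.reflect h3 (hasDual_top hw)).trans_lt hKt.lt_top)
  have hHg : MemTVX T 2 2 2 (expMul w') := by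
    have h5 := memLp_expMul hw'
    refine ⟨h5.1, ?_⟩
    rw [normTVX_eq h5.1, normT_two h5.1]
    exact h5.2
  refine ⟨expMul w, hg, isWeakSolution_expMul hs0 hs1 hf2 hw hg2 h1, ⟨hg, hb1.trans_lt hfin⟩,
    expMul w', (isOscillatorPower_of_dual h2).expMul, ⟨hHg, hb2.trans_lt hfin⟩, ?_⟩
  refine (add_le_add hb1 hb2).trans (le_of_eq ?_)
  rw [hGb, mul_comm (7200 : ℝ), ENNReal.ofReal_mul (Real.exp_pos T).le, ENNReal.ofReal_ofNat]
  ring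

/-- Translates smallness of the Besov norm into smallness of the weighted sum; the factor 2
generously covers the 2^{1/2} from indexing blocks by n = q + 1. -/
theorem hsmall_of_le {s ε : ℝ} (hm : 6 * momentConst s * (19 * (2 * ε)) ≤ 1 / 2400)
    (P : LPCouple) {T : ℝ} {f : ℝ × ℝ × ℝ → ℂ} (hf : MemBesovTV P T ⊤ f)
    (h : besovNormTV P T ⊤ 2 (1 / 2) 2 f ≤ ENNReal.ofReal ε) :
    ENNReal.ofReal (6 * momentConst s) *
      (19 * ∑' p, rt p * normT T ⊤ (blkT P p f)) ≤ ENNReal.ofReal (1 / 2400) := by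
  rw [besovNormTV_eq P ⊤ hf.1.1] at h
  set F := ∑' p, rt p * normT T ⊤ (blkT P p f)
  have h1 : F ≤ 2 * ENNReal.ofReal ε := by
    have h2 : (1 : ℝ≥0∞) ≤ 2 * (2 : ℝ≥0∞) ^ (-(1 / 2) : ℝ) := by
      nth_rewrite 1 [← ENNReal.rpow_one 2]
      rw [← ENNReal.rpow_add _ _ two_ne_zero (by norm_num)]
      exact ENNReal.one_le_rpow (by norm_num) (by norm_num)
    calc F = 1 * F := (one_mul F).symm
      _ ≤ 2 * (2 : ℝ≥0∞) ^ (-(1 / 2) : ℝ) * F := by gcongr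
      _ = 2 * ((2 : ℝ≥0∞) ^ (-(1 / 2) : ℝ) * F) := mul_assoc _ _ _
      _ ≤ _ := by gcongr
  have hmc : 0 ≤ 6 * momentConst s := by have := momentConst_nonneg s; positivity
  calc _ ≤ ENNReal.ofReal (6 * momentConst s) * (19 * (2 * ENNReal.ofReal ε)) := by gcongr
    _ = ENNReal.ofReal (6 * momentConst s * (19 * (2 * ε))) := by
        rw [ENNReal.ofReal_mul (p := 6 * momentConst s) hmc,
          ENNReal.ofReal_mul (p := 19) (by norm_num), ENNReal.ofReal_mul (p := 2) (by norm_num),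
          ENNReal.ofReal_ofNat, ENNReal.ofReal_ofNat]
    _ ≤ _ := ENNReal.ofReal_le_ofReal hm

end Kac

theorem theorem3p2 (s : ℝ) (hs0 : 0 < s) (hs1 : s < 1) (P : Kac.LPCouple) :
    ∃ ε₀ : ℝ, 0 < ε₀ ∧ ∃ c₀ : ℝ, 1 < c₀ ∧
      ∀ (T : ℝ), 0 < T →
      ∀ (g₀ : ℝ × ℝ → ℂ), Kac.MemBesovV P g₀ →
      ∀ (f : ℝ × ℝ × ℝ → ℂ), Kac.MemBesovTV P T ⊤ f →
        Kac.besovNormTV P T ⊤ 2 (1 / 2) 2 f ≤ ENNReal.ofReal ε₀ →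
        ∃ g : ℝ × ℝ × ℝ → ℂ,
          Kac.MemTVX T ⊤ 2 2 g ∧
          Kac.IsWeakSolution s T f g₀ g ∧
          Kac.MemBesovTV P T ⊤ g ∧
          ∃ Hg : ℝ × ℝ × ℝ → ℂ,
            Kac.IsOscillatorPower T (s / 2) g Hg ∧
            Kac.MemBesovTV P T 2 Hg ∧
            Kac.besovNormTV P T ⊤ 2 (1 / 2) 2 g + Kac.besovNormTV P T 2 2 (1 / 2) 2 Hg
              ≤ ENNReal.ofReal (c₀ * Real.exp T) * Kac.besovNormV P 2 (1 / 2) 2 g₀ := by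
  have hm := Kac.momentConst_nonneg s
  -- 6 · 19 · 2 · 2400 = 547200; adding 1 to the moment constant avoids a division by zero.
  refine ⟨1 / (547200 * (Kac.momentConst s + 1)), by positivity, 7200, by norm_num,
    fun T hT g₀ hg₀ f hf hsmall => Kac.exists_solution hs0 hs1 P hT hg₀ hf
      (Kac.hsmall_of_le ?_ P hf hsmall)⟩
  have h1 : 6 * Kac.momentConst s * (19 * (2 * (1 / (547200 * (Kac.momentConst s + 1))))) =
      Kac.momentConst s / (Kac.momentConst s + 1) / 2400 := by
    field_simp
    ring
  rw [h1]
  gcongr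
  rw [div_le_one (by positivity)]
  linarith
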